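/- Let $p$ be a prime, let $B$ be a definite quaternion algebra over $\mathbb{Q}$ and $R\subset B$ a $\mathbb{Z}$-order, with a splitting $\iota\colon B\otimes_{\mathbb{Q}}\mathbb{Q}_p\cong M_2(\mathbb{Q}_p)$ such that $\iota(R\otimes\mathbb{Z}_p)=M_2(\mathbb{Z}_p)$ (for instance an Eichler order of level prime to $p$, where $p$ does not divide the discriminant of $B$). Let $\Gamma\subset \mathrm{GL}_2(\mathbb{Q}_p)$ be the image under $\iota$ of the group of elements of reduced norm $1$ in $R[1/p]^\times$. Let $k\ge 0$ be even. Let $\mathcal{P}_k\subset\mathbb{Q}_p[x]$ be the polynomials of degree at most $k$, with the right action $(P\cdot_k g)(x)=\det(g)^{-k/2}(cx+d)^kP\big(\tfrac{ax+b}{cx+d}\big)$ for $g=\begin{pmatrix}a&b\\c&d\end{pmatrix}$, and let $V_k=\mathrm{Hom}_{\mathbb{Q}_p}(\mathcal{P}_k,\mathbb{Q}_p)$ with the induced left action. For a field $E\supseteq\mathbb{Q}_p$ put $V_{k,E}=V_k\otimes E=\mathrm{Hom}_{\mathbb{Q}_p}(\mathcal{P}_k,E)$, and let $C_h(\Gamma,V_{k,E})$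 be the space of $\Gamma$-equivariant harmonic cocycles on the Bruhat–Tits tree of $\mathrm{GL}_2(\mathbb{Q}_p)$, that is, of functions $c$ from the oriented edges to $V_{k,E}$ with $c(\gamma e)=\gamma c(e)$ for $\gamma\in\Gamma$, $c(\overline e)=-c(e)$, and $\sum_{s(e)=v}c(e)=0$ for every vertex $v$. For a vertex $v$ let $\psi_E\colon C_h(\Gamma,V_{k,E})\to H^1(\Gamma,V_{k,E})$ be the map induced by $c\mapsto\big(\gamma\mapsto\sum_{e\colon v\to\gamma v}c(e)\big)$, the sum being over the edges of the path from $v$ to $\gamma v$. Let $K\subset\mathbb{C}_p$ be the unramified quadratic extension of $\mathbb{Q}_p$, and let $E$ be $K$ or $\mathbb{C}_p$. Let $e\mapsto U_e$ be the $\mathrm{GL}_2(\mathbb{Q}_p)$-equivariant bijection from oriented edges to compact open balls in $\mathbb{P}^1(\mathbb{Q}_p)$ that sends the edge from $[\mathbb{Z}_p\oplus p\mathbb{Z}_p]$ to $[\mathbb{Z}_p^2]$ to $\mathbb{Z}_p$. For $c\in C_h(\Gamma,V_{k,E})$ let $\mu_c$ be the Amice-Vélu–Vishik measure of $c$: the unique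 continuous $E$-linear form on the space of $E$-valued functions on $\mathbb{P}^1(\mathbb{Q}_p)$ that are locally analytic except possibly for a pole of order at most $k$ at $\infty$, such that $\int_{U_e}P\,d\mu_c=c(e)(P)$ for all edges $e$ and $P\in\mathcal{P}_k$, and such that for some $C\ge0$ one has, for all $e$: $\big|\int_{U_e}x^n\,d\mu_c\big|\le C\rho^{-n+k/2}$ for all integers $n\le k$ if $\infty\in U_e\not\ni 0$, where $\rho=\sup_{u\in U_e}|1/u|$; and $\big|\int_{U_e}(x-a)^n\,d\mu_c\big|\le C\rho^{n-k/2}$ for all $a\in U_e$ and $n\ge 0$ if $\infty\notin U_e$, where $\rho$ is the diameter of $U_e$. Let $\log_p$ be the branch of the $p$-adic logarithm on $E^\times$ with $\log_p(p)=0$. For $\tau_1,\tau_2\in E\setminus\mathbb{Q}_p$ and $P\in\mathcal{P}_k$ put $$\int_{\tau_1}^{\tau_2}\omega_c(P)=\int_{\mathbb{P}^1(\mathbb{Q}_p)}P(x)\log_p\Big(\frac{x-\tau_2}{x-\tau_1}\Big)\,d\mu_c(x)\in E .$$ For $\tau\in E\setminus\mathbb{Q}_p$ Teitelbaum's cocycle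 of $c$ is $\lambda^{\tau}_{\mathrm{Tei}}(c)(\gamma)(P)=\int_\tau^{\gamma\tau}\omega_c(P)$. For $c\in C_h(\Gamma,V_k)$ and $\tau\in K\setminus\mathbb{Q}_p$ its trace version is $\lambda^{\tau}(c)(\gamma)(P)=\tfrac12\mathrm{Tr}_{K/\mathbb{Q}_p}\big(\int_\tau^{\gamma\tau}\omega_c(P)\big)\in\mathbb{Q}_p$. Then the measures $\mu_c$ exist and are unique, the integrands above lie in the space on which they are defined, and: 1. Let $\sigma$ be the nontrivial element of $\mathrm{Gal}(K/\mathbb{Q}_p)$, $c\in C_h(\Gamma,V_k)$ and $\tau\in K\setminus\mathbb{Q}_p$. Then $\lambda^\tau(c)=\tfrac12\big(\lambda^\tau_{\mathrm{Tei}}(c)+\lambda^{\tau^\sigma}_{\mathrm{Tei}}(c)\big)$, and $\lambda^\tau_{\mathrm{Tei}}(c)$, $\lambda^{\tau^\sigma}_{\mathrm{Tei}}(c)$ are $1$-cocycles with values in $V_{k,K}$ that differ by a coboundary defined over $K$. 2. Over $E=\mathbb{Q}_p$ and $E=\mathbb{C}_p$ the map $\psi_E$ is well defined, independent of $v$, and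 an isomorphism. The functions $\lambda^\tau(c)$ and (over $\mathbb{C}_p$) $\lambda^\tau_{\mathrm{Tei}}(c)$ are $1$-cocycles, and they induce linear maps $\lambda\colon C_h(\Gamma,V_k)\to H^1(\Gamma,V_k)$ and $\lambda_{\mathrm{Tei}}\colon C_h(\Gamma,V_{k,\mathbb{C}_p})\to H^1(\Gamma,V_{k,\mathbb{C}_p})$ that do not depend on $\tau\in K\setminus\mathbb{Q}_p$, respectively $\tau\in\mathbb{C}_p\setminus\mathbb{Q}_p$. Thus the operators $\mathcal{L}=\lambda\circ\psi_{\mathbb{Q}_p}^{-1}$ on $H^1(\Gamma,V_k)$ and $\mathcal{L}_{\mathrm{Tei}}=\lambda_{\mathrm{Tei}}\circ\psi_{\mathbb{C}_p}^{-1}$ (Teitelbaum's $\mathcal{L}$-operator) on $H^1(\Gamma,V_{k,\mathbb{C}_p})$ are defined. 3. The canonical map $\mathbb{C}_p\otimes_{\mathbb{Q}_p}H^1(\Gamma,V_k)\to H^1(\Gamma,V_{k,\mathbb{C}_p})$ is an isomorphism, and it carries $\mathrm{id}_{\mathbb{C}_p}\otimes\mathcal{L}$ to $\mathcal{L}_{\mathrm{Tei}}$.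 Hence Teitelbaum's $\mathcal{L}$-operator is defined over $\mathbb{Q}_p$. -/

import Mathlib

open scoped Pointwise Matrix
noncomputable section
namespace LOperator
variable (p : ℕ) [Fact p.Prime]

/-- `ℤ_p`-lattices in `ℚ_p²`. -/
abbrev Lattice : Type :=
  {L : Submodule ℤ_[p] (Fin 2 → ℚ_[p]) // Submodule.IsLattice ℚ_[p] L}

variable {p}

/-- `ℚ_pˣ` acts on lattices by homotheties. -/
instance : MulAction ℚ_[p]ˣ (Lattice p) where
  smul a L := ⟨a • L.1, have := L.2; inferInstance⟩
  one_smul L := Subtype.ext (one_smul _ L.1)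
  mul_smul a b L := Subtype.ext (mul_smul a b L.1)

lemma Lattice.coe_smul (a : ℚ_[p]ˣ) (L : Lattice p) : (a • L).1 = a • L.1 := rfl

/-- `GL₂(ℚ_p)` acts on lattices by `g L = {g v | v ∈ L}` (column vectors). -/
instance : SMul (GL (Fin 2) ℚ_[p]) (Lattice p) where
  smul g L := ⟨L.1.map ((Matrix.mulVecLin g.1).restrictScalars ℤ_[p]), by
    have := L.2
    refine ⟨L.2.fg.map _, ?_⟩
    have h := congrArg (Submodule.map (Matrix.mulVecLin g.1)) L.2.span_eq_top
    rw [Submodule.map_span, Submodule.map_top] at h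
    have h2 : LinearMap.range (Matrix.mulVecLin g.1) = ⊤ := by
      rw [LinearMap.range_eq_top]
      intro v
      refine ⟨Matrix.mulVec (g⁻¹).1 v, ?_⟩
      rw [Matrix.mulVecLin_apply, Matrix.mulVec_mulVec, ← Units.val_mul, mul_inv_cancel]
      simp
    rw [h2] at h
    simpa using h⟩

lemma Lattice.coe_gl_smul (g : GL (Fin 2) ℚ_[p]) (L : Lattice p) :
    (g • L).1 = L.1.map ((Matrix.mulVecLin g.1).restrictScalars ℤ_[p]) := rfl

instance : MulAction (GL (Fin 2) ℚ_[p]) (Lattice p) where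
  one_smul L := by
    apply Subtype.ext
    rw [Lattice.coe_gl_smul]
    ext v
    simp
  mul_smul g h L := by
    apply Subtype.ext
    simp only [Lattice.coe_gl_smul]
    rw [← Submodule.map_comp]
    congr 1
    ext v : 1
    simp

lemma Lattice.gl_smul_comm (g : GL (Fin 2) ℚ_[p]) (a : ℚ_[p]ˣ) (L : Lattice p) :
    g • a • L = a • g • L := by
  apply Subtype.ext
  simp only [Lattice.coe_gl_smul, Lattice.coe_smul]
  ext v
  constructor
  · rintro ⟨_, ⟨w, hw, rfl⟩, rfl⟩
    exact ⟨_, ⟨w, hw, rfl⟩, by simp⟩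
  · rintro ⟨_, ⟨w, hw, rfl⟩, rfl⟩
    exact ⟨_, ⟨w, hw, rfl⟩, by simp⟩

variable (p) in
/-- `p` as a unit of `ℚ_p`. -/
def pUnit : ℚ_[p]ˣ := Units.mk0 (p : ℚ_[p]) (by exact_mod_cast (Fact.out : p.Prime).ne_zero)

variable (p) in
/-- Vertices of the Bruhat-Tits tree: homothety classes of lattices in `ℚ_p²`. -/
abbrev Vertex : Type := MulAction.orbitRel.Quotient ℚ_[p]ˣ (Lattice p)

/-- The homothety class `[L]`. -/
abbrev Lattice.cls (L : Lattice p) : Vertex p := Quotient.mk _ L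

lemma Lattice.cls_eq {L M : Lattice p} : L.cls = M.cls ↔ ∃ a : ℚ_[p]ˣ, a • M = L := by
  rw [Quotient.eq]; rfl

/-- `L` and `L'` satisfy `pL ⊊ L' ⊊ L`. -/
def Lattice.Adj (L L' : Lattice p) : Prop := (pUnit p • L).1 < L'.1 ∧ L'.1 < L.1

lemma Lattice.smul_le_of_norm_le_one (L : Lattice p) (a : ℚ_[p]ˣ) (ha : ‖(a : ℚ_[p])‖ ≤ 1) :
    (a • L).1 ≤ L.1 := by
  intro v hv
  obtain ⟨w, hw, rfl⟩ := (Submodule.mem_smul_pointwise_iff_exists _ _ _).1 hv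
  exact L.1.smul_mem (⟨(a : ℚ_[p]), ha⟩ : ℤ_[p]) hw

lemma Lattice.smul_lt_smul (a : ℚ_[p]ˣ) {L M : Lattice p} (h : L.1 < M.1) :
    (a • L).1 < (a • M).1 := by
  have key : ∀ (a : ℚ_[p]ˣ) {L M : Lattice p}, L.1 ≤ M.1 → (a • L).1 ≤ (a • M).1 := by
    intro a L M h v hv
    obtain ⟨w, hw, rfl⟩ := (Submodule.mem_smul_pointwise_iff_exists _ _ _).1 hv
    exact (Submodule.mem_smul_pointwise_iff_exists _ _ _).2 ⟨w, h hw, rfl⟩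
  refine lt_of_le_not_ge (key a h.le) fun h' => h.not_ge ?_
  have := key a⁻¹ h'
  rwa [inv_smul_smul, inv_smul_smul] at this

lemma Lattice.gl_smul_lt (g : GL (Fin 2) ℚ_[p]) {L M : Lattice p} (h : L.1 < M.1) :
    (g • L).1 < (g • M).1 := by
  have key : ∀ (g : GL (Fin 2) ℚ_[p]) {L M : Lattice p}, L.1 ≤ M.1 → (g • L).1 ≤ (g • M).1 :=
    fun g L M h => Submodule.map_mono h
  refine lt_of_le_not_ge (key g h.le) fun h' => h.not_ge ?_
  have := key g⁻¹ h'
  rwa [inv_smul_smul, inv_smul_smul] at this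

lemma Lattice.Adj.not_homothetic {L L' : Lattice p} (h : L.Adj L') : L.cls ≠ L'.cls := by
  intro e
  obtain ⟨a, rfl⟩ := Lattice.cls_eq.1 e.symm
  by_cases ha : ‖(a : ℚ_[p])‖ < 1
  · refine h.1.not_ge ?_
    have h1 : a • L = (a * (pUnit p)⁻¹) • pUnit p • L := by rw [smul_smul]; simp
    rw [h1]
    refine Lattice.smul_le_of_norm_le_one _ _ ?_
    have h2 : ‖(a : ℚ_[p])‖ ≤ (p : ℝ) ^ (-1 : ℤ) := by
      rw [Padic.norm_le_pow_iff_norm_lt_pow_add_one]; simpa using ha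
    have hp : (0 : ℝ) < p := by exact_mod_cast (Fact.out : p.Prime).pos
    simp only [pUnit, Units.val_mul, Units.val_inv_eq_inv_val, Units.val_mk0, norm_mul, norm_inv,
      Padic.norm_p, inv_inv]
    rw [zpow_neg_one] at h2
    calc _ ≤ (p : ℝ)⁻¹ * p := by gcongr
      _ = 1 := inv_mul_cancel₀ hp.ne'
  · refine h.2.not_ge ?_
    have h1 : L = a⁻¹ • a • L := by simp
    conv_lhs => rw [h1]
    refine Lattice.smul_le_of_norm_le_one _ _ ?_
    push Not at ha
    simpa using inv_le_one_of_one_le₀ ha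

variable (p) in
/-- The Bruhat-Tits tree of `GL₂(ℚ_p)`. Its (oriented) edges are the darts of this graph, with
source `e.fst`, target `e.snd` and opposite edge `e.symm`. -/
def tree : SimpleGraph (Vertex p) where
  Adj v w := ∃ L L' : Lattice p, L.cls = v ∧ L'.cls = w ∧ L.Adj L'
  symm := ⟨by
    rintro v w ⟨L, L', rfl, rfl, h1, h2⟩
    exact ⟨L', pUnit p • L, rfl, Lattice.cls_eq.2 ⟨_, rfl⟩, Lattice.smul_lt_smul _ h2, h1⟩⟩
  loopless := ⟨by
    rintro v ⟨L, L', h1, h2, h⟩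
    exact h.not_homothetic (h1.trans h2.symm)⟩

variable (p) in
/-- Oriented edges of the tree. -/
abbrev Edge : Type := (tree p).Dart

instance : SMul (GL (Fin 2) ℚ_[p]) (Vertex p) where
  smul g := Quotient.map (g • ·) (by
    rintro L M ⟨a, h⟩
    exact ⟨a, by rw [← h]; exact (Lattice.gl_smul_comm g a M).symm⟩)

lemma Lattice.gl_smul_cls (g : GL (Fin 2) ℚ_[p]) (L : Lattice p) : g • L.cls = (g • L).cls := rfl

lemma tree_adj_smul (g : GL (Fin 2) ℚ_[p]) {v w : Vertex p} (h : (tree p).Adj v w) :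
    (tree p).Adj (g • v) (g • w) := by
  obtain ⟨L, L', rfl, rfl, h1, h2⟩ := h
  refine ⟨g • L, g • L', rfl, rfl, ?_, Lattice.gl_smul_lt g h2⟩
  rw [← Lattice.gl_smul_comm]
  exact Lattice.gl_smul_lt g h1

instance : SMul (GL (Fin 2) ℚ_[p]) (Edge p) where
  smul g e := ⟨(g • e.fst, g • e.snd), tree_adj_smul g e.adj⟩

/-- The tree is locally finite. -/
lemma finite_edges_from (v : Vertex p) : {e : Edge p | e.fst = v}.Finite := by
  induction v using Quotient.inductionOn with | h L
  have hfin : {M : Submodule ℤ_[p] (Fin 2 → ℚ_[p]) | (pUnit p • L).1 ≤ M ∧ M ≤ L.1}.Finite := by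
    set I : Ideal ℤ_[p] := IsLocalRing.maximalIdeal ℤ_[p] with hI
    have : Finite (ℤ_[p] ⧸ I) := Finite.of_equiv _ (PadicInt.residueField (p := p)).symm.toEquiv
    have : Module.Finite ℤ_[p] L.1 := Module.Finite.iff_fg.2 L.2.fg
    have : Finite (L.1 ⧸ (I • (⊤ : Submodule ℤ_[p] L.1))) := by
      have : Finite (L.1 ⧸ (⊤ : Submodule ℤ_[p] L.1)) := inferInstance
      exact Submodule.finite_quotient_smul I Module.Finite.fg_top
    have : Finite (Submodule ℤ_[p] (L.1 ⧸ (I • (⊤ : Submodule ℤ_[p] L.1)))) :=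
      Finite.of_injective (SetLike.coe : _ → Set (L.1 ⧸ (I • (⊤ : Submodule ℤ_[p] L.1)))) SetLike.coe_injective
    have : Finite (Set.Ici (I • (⊤ : Submodule ℤ_[p] L.1))) :=
      Finite.of_equiv _ (Submodule.comapMkQRelIso _).toEquiv
    have hf : (Set.Ici (I • (⊤ : Submodule ℤ_[p] L.1))).Finite := Set.toFinite _
    refine (hf.image (Submodule.map L.1.subtype)).subset ?_
    rintro M ⟨h1, h2⟩
    refine ⟨M.comap L.1.subtype, ?_, by simpa using h2⟩
    rw [Set.mem_Ici, Submodule.smul_le]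
    intro r hr n _
    rw [hI, PadicInt.maximalIdeal_eq_span_p, Ideal.mem_span_singleton'] at hr
    obtain ⟨s, rfl⟩ := hr
    rw [mul_smul]
    refine Submodule.smul_mem _ s ?_
    refine h1 ((Submodule.mem_smul_pointwise_iff_exists _ _ _).2 ⟨n.1, n.2, ?_⟩)
    ext i
    simp [pUnit, Units.smul_def, Algebra.smul_def]
  have hfin2 : {M : Lattice p | (pUnit p • L).1 ≤ M.1 ∧ M.1 ≤ L.1}.Finite :=
    hfin.preimage Subtype.val_injective.injOn
  have hfin3 := hfin2.image Lattice.cls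
  refine Set.Finite.of_finite_image (f := fun e : Edge p => e.snd) (hfin3.subset ?_) ?_
  · rintro _ ⟨e, he, rfl⟩
    obtain ⟨M, M', hM, hM', h⟩ := e.adj
    have hML : L.cls = M.cls := by rw [hM]; exact he.symm
    obtain ⟨a, rfl⟩ := Lattice.cls_eq.1 hML
    refine ⟨a • M', ⟨?_, (Lattice.smul_lt_smul a h.2).le⟩, ?_⟩
    · rw [smul_comm]
      exact (Lattice.smul_lt_smul a h.1).le
    · exact (Lattice.cls_eq.2 ⟨a, rfl⟩).trans hM'
  · rintro e he f hf h
    exact SimpleGraph.Dart.ext _ _ (Prod.ext (he.trans hf.symm) h)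

variable (p) in
/-- The lattice `ℤ_p²`. -/
def latticeZero : Lattice p := ⟨Submodule.span ℤ_[p] (Set.range (Pi.basisFun ℚ_[p] (Fin 2))), by
  refine ⟨Submodule.fg_span (Set.finite_range _), ?_⟩
  rw [Submodule.span_span_of_tower]
  exact (Pi.basisFun ℚ_[p] (Fin 2)).span_eq⟩


variable (p) in
/-- The vertex `v₀ = [ℤ_p²]`. -/
def v0 : Vertex p := (latticeZero p).cls

variable (p) in
/-- The matrix with rows `(0, 1)` and `(p, 0)`. -/
def w0 : GL (Fin 2) ℚ_[p] :=
  Matrix.GeneralLinearGroup.mkOfDetNeZero !![0, 1; (p : ℚ_[p]), 0] (by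
    simpa [Matrix.det_fin_two] using (Fact.out : p.Prime).ne_zero)

open scoped Classical in
/-- The compact open ball `U_e ⊆ ℙ¹(ℚ_p) = ℚ_p ∪ {∞}` attached to an oriented edge: the
`GL₂(ℚ_p)`-equivariant assignment sending the edge `e₀` from `w₀ v₀` to `v₀` to `ℤ_p`. -/
def ball (e : Edge p) : Set (OnePoint ℚ_[p]) :=
  {x | ∃ g : GL (Fin 2) ℚ_[p], g • w0 p • v0 p = e.fst ∧ g • v0 p = e.snd ∧
    ∃ z : ℤ_[p], x = g • (((z : ℚ_[p]) : OnePoint ℚ_[p]))}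

/-- The points of `U_e` in `ℚ_p`. -/
def finBall (e : Edge p) : Set ℚ_[p] := {x | (x : OnePoint ℚ_[p]) ∈ ball e}

open scoped Classical in
/-- `ρ = sup |1/u|` over `u ∈ U_e` if `∞ ∈ U_e`, and `ρ` is the diameter of `U_e` otherwise. -/
def radius (e : Edge p) : ℝ :=
  if OnePoint.infty ∈ ball e then sSup ((fun u : ℚ_[p] => ‖u⁻¹‖) '' finBall e)
  else Metric.diam (finBall e)

/-! ### The coefficients `V_k` -/

variable (p) in
/-- Polynomials over `ℚ_p` of degree at most `k`. -/
abbrev Pk (k : ℕ) : Type := Polynomial.degreeLE ℚ_[p] (k : WithBot ℕ)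

open Polynomial in
/-- `(P ·_k g)(x) = det(g)^{-k/2} (c x + d)^k P((a x + b)/(c x + d))`, as a polynomial. -/
def polyActAux (k : ℕ) (g : GL (Fin 2) ℚ_[p]) (P : ℚ_[p][X]) : ℚ_[p][X] :=
  C ((g.det⁻¹ : ℚ_[p]ˣ) ^ (k / 2) : ℚ_[p]) *
    ∑ i ∈ Finset.range (k + 1), C (P.coeff i) * (C (g 0 0) * X + C (g 0 1)) ^ i *
      (C (g 1 0) * X + C (g 1 1)) ^ (k - i)

lemma eval_polyActAux (k : ℕ) (g : GL (Fin 2) ℚ_[p]) (P : Pk p k) (x : ℚ_[p])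
    (hx : g 1 0 * x + g 1 1 ≠ 0) :
    (polyActAux k g P.1).eval x = ((g.det⁻¹ : ℚ_[p]ˣ) ^ (k / 2) : ℚ_[p]) *
      ((g 1 0 * x + g 1 1) ^ k * P.1.eval ((g 0 0 * x + g 0 1) / (g 1 0 * x + g 1 1))) := by
  have hP : P.1.natDegree < k + 1 :=
    Nat.lt_succ_of_le (Polynomial.natDegree_le_of_degree_le (Polynomial.mem_degreeLE.1 P.2))
  rw [Polynomial.eval_eq_sum_range' hP]
  simp only [polyActAux, Polynomial.eval_mul, Polynomial.eval_C, Polynomial.eval_finsetSum,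
    Polynomial.eval_pow, Polynomial.eval_add, Polynomial.eval_X, Finset.mul_sum]
  refine Finset.sum_congr rfl fun i hi => ?_
  have hi' : i ≤ k := Nat.lt_succ_iff.1 (Finset.mem_range.1 hi)
  have hpow : (g 1 0 * x + g 1 1) ^ k = (g 1 0 * x + g 1 1) ^ (k - i) * (g 1 0 * x + g 1 1) ^ i := by
    rw [← pow_add, Nat.sub_add_cancel hi']
  have hi0 : (g 1 0 * x + g 1 1) ^ i ≠ 0 := pow_ne_zero _ hx
  rw [hpow, div_pow]
  generalize (g 1 0 * x + g 1 1) ^ i = s at hi0 ⊢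
  field_simp

/-- The right action of `g` on `P_k`. -/
def polyAct (k : ℕ) (g : GL (Fin 2) ℚ_[p]) : Pk p k →ₗ[ℚ_[p]] Pk p k where
  toFun P := ⟨polyActAux k g P.1, by
    rw [Polynomial.mem_degreeLE]
    refine Polynomial.degree_le_of_natDegree_le ?_
    refine (Polynomial.natDegree_C_mul_le _ _).trans ?_
    refine Polynomial.natDegree_sum_le_of_forall_le _ _ fun i hi => ?_
    have hi' : i ≤ k := Nat.lt_succ_iff.1 (Finset.mem_range.1 hi)
    have h1 : ∀ s t : ℚ_[p], (Polynomial.C s * Polynomial.X + Polynomial.C t).natDegree ≤ 1 :=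
      fun s t => Polynomial.natDegree_linear_le
    calc _ ≤ 0 + i * 1 + (k - i) * 1 := by
          refine Polynomial.natDegree_mul_le_of_le (Polynomial.natDegree_mul_le_of_le ?_ ?_) ?_
          · exact (Polynomial.natDegree_C _).le
          · exact Polynomial.natDegree_pow_le_of_le _ (h1 _ _)
          · exact Polynomial.natDegree_pow_le_of_le _ (h1 _ _)
      _ ≤ k := by omega⟩
  map_add' P Q := Subtype.ext (by
    simp only [polyActAux, Submodule.coe_add, Polynomial.coeff_add, Polynomial.C_add, add_mul,
      Finset.sum_add_distrib, mul_add])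
  map_smul' r P := Subtype.ext (by
    simp only [polyActAux, Submodule.coe_smul, Polynomial.smul_eq_C_mul,
      Polynomial.coeff_C_mul, Polynomial.C_mul, RingHom.id_apply, Finset.mul_sum]
    exact Finset.sum_congr rfl fun i _ => by ring)

lemma finite_denom_zero (g : GL (Fin 2) ℚ_[p]) : {x : ℚ_[p] | g 1 0 * x + g 1 1 = 0}.Finite := by
  refine Set.Subsingleton.finite fun x hx y hy => ?_
  simp only [Set.mem_ofPred_eq] at hx hy
  by_contra hxy
  have h1 : g 1 0 * (x - y) = 0 := by linear_combination hx - hy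
  have h2 : g 1 0 = 0 := (mul_eq_zero.1 h1).resolve_right (sub_ne_zero.2 hxy)
  have h3 : g 1 1 = 0 := by simpa [h2] using hx
  have := g.det_ne_zero
  rw [Matrix.det_fin_two] at this
  exact this (by rw [h2, h3]; ring)

lemma polyAct_one (k : ℕ) : polyAct (p := p) k 1 = LinearMap.id := by
  ext1 P
  refine Subtype.ext (Polynomial.funext fun x => ?_)
  refine (eval_polyActAux k 1 P x (by simp)).trans ?_
  simp

lemma polyAct_mul (k : ℕ) (g h : GL (Fin 2) ℚ_[p]) :
    polyAct k (g * h) = polyAct k h ∘ₗ polyAct k g := by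
  ext1 P
  refine Subtype.ext (Polynomial.eq_of_infinite_eval_eq _ _ ?_)
  refine ((finite_denom_zero h).union (finite_denom_zero (g * h))).infinite_compl.mono ?_
  intro x hx
  simp only [Set.mem_compl_iff, Set.mem_union, Set.mem_ofPred_eq, not_or] at hx
  obtain ⟨hx1, hx2⟩ := hx
  simp only [Set.mem_ofPred_eq]
  have e10 : (g * h) 1 0 = g 1 0 * h 0 0 + g 1 1 * h 1 0 := by
    simp [Matrix.mul_apply, Fin.sum_univ_two]
  have e11 : (g * h) 1 1 = g 1 0 * h 0 1 + g 1 1 * h 1 1 := by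
    simp [Matrix.mul_apply, Fin.sum_univ_two]
  have e00 : (g * h) 0 0 = g 0 0 * h 0 0 + g 0 1 * h 1 0 := by
    simp [Matrix.mul_apply, Fin.sum_univ_two]
  have e01 : (g * h) 0 1 = g 0 0 * h 0 1 + g 0 1 * h 1 1 := by
    simp [Matrix.mul_apply, Fin.sum_univ_two]
  have key : (g * h) 1 0 * x + (g * h) 1 1 =
      (g 1 0 * ((h 0 0 * x + h 0 1) / (h 1 0 * x + h 1 1)) + g 1 1) * (h 1 0 * x + h 1 1) := by
    rw [e10, e11]; field_simp; ring
  have key0 : (g * h) 0 0 * x + (g * h) 0 1 =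
      (g 0 0 * ((h 0 0 * x + h 0 1) / (h 1 0 * x + h 1 1)) + g 0 1) * (h 1 0 * x + h 1 1) := by
    rw [e00, e01]; field_simp; ring
  have hx3 : g 1 0 * ((h 0 0 * x + h 0 1) / (h 1 0 * x + h 1 1)) + g 1 1 ≠ 0 := by
    intro h0
    rw [h0, zero_mul] at key
    exact hx2 key
  refine (eval_polyActAux k (g * h) P x hx2).trans ?_
  refine Eq.trans ?_ (eval_polyActAux k h (polyAct k g P) x hx1).symm
  refine Eq.trans ?_ (congrArg (fun t => _ * (_ * t)) (eval_polyActAux k g P _ hx3).symm)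
  rw [key, key0, mul_div_mul_right _ _ hx1, map_mul, mul_inv, Units.val_mul, mul_pow, mul_pow]
  generalize Polynomial.eval _ P.1 = t
  ring

variable (p) in
/-- `V_k ⊗ E`: the `ℚ_p`-linear maps `P_k → E`. -/
abbrev Vk (k : ℕ) (E : Type) [Field E] [Algebra ℚ_[p] E] : Type := Pk p k →ₗ[ℚ_[p]] E

/-- The left action on `V_k ⊗ E`, `(g φ)(P) = φ(P ·_k g)`. -/
def vkRep (k : ℕ) (E : Type) [Field E] [Algebra ℚ_[p] E] :
    Representation E (GL (Fin 2) ℚ_[p]) (Vk p k E) where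
  toFun g :=
    { toFun := fun φ => φ ∘ₗ polyAct k g
      map_add' := fun _ _ => rfl
      map_smul' := fun _ _ => rfl }
  map_one' := by
    refine LinearMap.ext fun φ => ?_
    change φ ∘ₗ polyAct k 1 = φ
    rw [polyAct_one, LinearMap.comp_id]
  map_mul' g h := by
    refine LinearMap.ext fun φ => ?_
    change φ ∘ₗ polyAct k (g * h) = (φ ∘ₗ polyAct k h) ∘ₗ polyAct k g
    rw [polyAct_mul, LinearMap.comp_assoc]

variable (Γ : Subgroup (GL (Fin 2) ℚ_[p])) (k : ℕ) (E : Type)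

/-- `V_k ⊗ E` as a representation of `Γ`. -/
abbrev vkRepOn (Γ : Subgroup (GL (Fin 2) ℚ_[p])) (k : ℕ) (E : Type) [Field E] [Algebra ℚ_[p] E] : Rep E Γ := Rep.of ((vkRep k E).comp Γ.subtype)

/-- The space `C_h(Γ, V_k ⊗ E)` of `Γ`-invariant harmonic cocycles on the tree. -/
def harmonic [Field E] [Algebra ℚ_[p] E] : Submodule E (Edge p → Vk p k E) where
  carrier := {c | (∀ e, c e.symm = -c e) ∧
    (∀ v : Vertex p, ∑ᶠ e ∈ {e : Edge p | e.fst = v}, c e = 0) ∧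
    ∀ γ ∈ Γ, ∀ e, vkRep k E γ (c (γ⁻¹ • e)) = c e}
  zero_mem' := ⟨by simp, by simp, by simp⟩
  add_mem' := by
    rintro c c' ⟨h1, h2, h3⟩ ⟨h1', h2', h3'⟩
    refine ⟨fun e => ?_, fun v => ?_, fun γ hγ e => ?_⟩
    · simp [h1, h1', add_comm]
    · have := finsum_mem_add_distrib (f := c) (g := c') (finite_edges_from v)
      rw [h2, h2', add_zero] at this
      exact this
    · simp [h3 γ hγ, h3' γ hγ]
  smul_mem' := by
    rintro r c ⟨h1, h2, h3⟩
    refine ⟨fun e => ?_, fun v => ?_, fun γ hγ e => ?_⟩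
    · simp [h1]
    · have : r • ∑ᶠ e ∈ {e : Edge p | e.fst = v}, c e =
          ∑ᶠ e ∈ {e : Edge p | e.fst = v}, r • c e := smul_finsum_mem (finite_edges_from v)
      rw [h2, smul_zero] at this
      exact this.symm
    · simp [h3 γ hγ]

variable {k E}

/-- The sum of `c` over the edges of the path from `v` to `w`. -/
def pathSum {V : Type} [AddCommGroup V] (c : Edge p → V) (v w : Vertex p) : V :=
  open scoped Classical in
  if h : ∃ q : (tree p).Walk v w, q.IsPath then (h.choose.darts.map c).sum else 0

section Integration

variable [NormedField E] [NormedAlgebra ℚ_[p] E]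

variable (p k E) in
/-- `A_k^loc ⊗ E`: functions on `ℚ_p` that are locally analytic, and at `∞` are locally analytic
up to a pole of order at most `k`. -/
def locAn : Submodule E (ℚ_[p] → E) where
  carrier := {f | (∀ a, AnalyticAt ℚ_[p] f a) ∧ ∃ g : ℚ_[p] → E, AnalyticAt ℚ_[p] g 0 ∧
    ∃ r : ℝ, ∀ x, r < ‖x‖ → f x = x ^ k • g x⁻¹}
  zero_mem' := ⟨fun _ => analyticAt_const, 0, analyticAt_const, 0, by simp⟩
  add_mem' := by
    rintro f f' ⟨h1, g, hg, r, hr⟩ ⟨h1', g', hg', r', hr'⟩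
    refine ⟨fun a => (h1 a).add (h1' a), g + g', hg.add hg', max r r', fun x hx => ?_⟩
    rw [max_lt_iff] at hx
    simp [hr x hx.1, hr' x hx.2]
  smul_mem' := by
    rintro t f ⟨h1, g, hg, r, hr⟩
    refine ⟨fun a => analyticAt_const.mul (h1 a), fun x => t * g x, analyticAt_const.mul hg, r,
      fun x hx => ?_⟩
    simp [hr x hx]

/-- Continuity of a linear form on `A_k^loc ⊗ E`, which is the locally convex limit of the Banach
spaces of (finite families of) power series converging on balls. -/
def IsCont (μ : locAn p k E →ₗ[E] E) : Prop :=
  (∀ e : Edge p, OnePoint.infty ∉ ball e → ∀ a ∈ finBall e, ∃ C : ℝ,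
    ∀ (f : locAn p k E) (b : ℕ → E) (M : ℝ),
      (∀ x ∈ finBall e, HasSum (fun i => (x - a) ^ i • b i) (f.1 x)) →
      (∀ x ∉ finBall e, f.1 x = 0) → (∀ i, ‖b i‖ * radius e ^ i ≤ M) → ‖μ f‖ ≤ C * M) ∧
  (∀ e : Edge p, OnePoint.infty ∈ ball e → 0 ∉ finBall e → ∃ C : ℝ,
    ∀ (f : locAn p k E) (b : ℕ → E) (M : ℝ),
      (∀ x ∈ finBall e, HasSum (fun i : ℕ => x ^ ((k : ℤ) - i) • b i) (f.1 x)) →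
      (∀ x ∉ finBall e, f.1 x = 0) → (∀ i, ‖b i‖ * radius e ^ i ≤ M) → ‖μ f‖ ≤ C * M)

/-- `μ` is the measure `μ_c` on `A_k^loc ⊗ E` attached to `c` (theorem of Amice-Vélu and Vishik). -/
structure IsMeasureOf (c : Edge p → Vk p k E) (μ : locAn p k E →ₗ[E] E) : Prop where
  cont : IsCont μ
  /-- `∫_{U_e} P dμ = c(e)(P)` for `P ∈ P_k` -/
  integral_poly : ∀ (e : Edge p) (P : Pk p k) (f : locAn p k E),
    f.1 = (finBall e).indicator (fun x => algebraMap ℚ_[p] E (P.1.eval x)) → μ f = c e P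
  growth : ∃ C : ℝ, 0 ≤ C ∧
    (∀ e : Edge p, OnePoint.infty ∈ ball e → 0 ∉ finBall e → ∀ n : ℤ, n ≤ k →
      ∀ f : locAn p k E, f.1 = (finBall e).indicator (fun x => algebraMap ℚ_[p] E (x ^ n)) →
        ‖μ f‖ ≤ C * radius e ^ (-n + (k / 2 : ℕ) : ℤ)) ∧
    (∀ e : Edge p, OnePoint.infty ∉ ball e → ∀ a ∈ finBall e, ∀ n : ℕ,
      ∀ f : locAn p k E, f.1 = (finBall e).indicator (fun x => algebraMap ℚ_[p] E ((x - a) ^ n)) →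
        ‖μ f‖ ≤ C * radius e ^ (n - (k / 2 : ℕ) : ℤ))

open scoped Classical in
/-- The measure `μ_c` (unique for harmonic `Γ`-invariant `c`). -/
def measureOf (c : Edge p → Vk p k E) : locAn p k E →ₗ[E] E :=
  if h : ∃ μ, IsMeasureOf c μ then h.choose else 0

open scoped Classical in
/-- `∫_{ℙ¹(ℚ_p)} f dμ_c` for `f ∈ A_k^loc ⊗ E`. -/
def integral (c : Edge p → Vk p k E) (f : ℚ_[p] → E) : E :=
  if h : f ∈ locAn p k E then measureOf c ⟨f, h⟩ else 0

variable (p) in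
open scoped Classical in
/-- The branch of the `p`-adic logarithm with `log_p(p) = 0`: if `z ^ n = p ^ m * u` with `n ≥ 1`
and `|u - 1| < 1`, then `log_p(z) = (1/n) ∑_{i ≥ 1} (-1)^(i-1) (u - 1)^i / i`. -/
def logp (z : E) : E :=
  if h : ∃ t : ℕ × ℤ × E, 0 < t.1 ∧ z ^ t.1 = (p : E) ^ t.2.1 * t.2.2 ∧ ‖t.2.2 - 1‖ < 1 then
    (h.choose.1 : E)⁻¹ * ∑' i : ℕ, (-1) ^ i * (h.choose.2.2 - 1) ^ (i + 1) / ((i + 1 : ℕ) : E)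
  else 0

variable (p E) in
/-- The `E`-points `E \ ℚ_p` of the `p`-adic upper half plane. -/
def Hp : Set E := (Set.range (algebraMap ℚ_[p] E))ᶜ

/-- The fractional linear action. -/
def moebius (g : GL (Fin 2) ℚ_[p]) (τ : E) : E :=
  (algebraMap ℚ_[p] E (g 0 0) * τ + algebraMap ℚ_[p] E (g 0 1)) /
    (algebraMap ℚ_[p] E (g 1 0) * τ + algebraMap ℚ_[p] E (g 1 1))

/-- The integrand `x ↦ P(x) log_p((x - τ₂)/(x - τ₁))`. -/
def logIntegrand (τ₁ τ₂ : E) (P : Pk p k) (x : ℚ_[p]) : E :=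
  algebraMap ℚ_[p] E (P.1.eval x) *
    logp p ((algebraMap ℚ_[p] E x - τ₂) / (algebraMap ℚ_[p] E x - τ₁))

/-- The line integral `∫_{τ₁}^{τ₂} ω_c(P)`. -/
def lineIntegral (c : Edge p → Vk p k E) (τ₁ τ₂ : E) (P : Pk p k) : E :=
  integral c (logIntegrand τ₁ τ₂ P)

variable {Γ} in
/-- Teitelbaum's cocycle at the base point `τ`: `γ, P ↦ ∫_τ^{γτ} ω_c(P)`. -/
def teitelbaumCocycle (c : Edge p → Vk p k E) (τ : E) (γ : Γ) (P : Pk p k) : E :=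
  lineIntegral c τ (moebius γ.1 τ) P

variable (k E) in
/-- The measures `μ_c` exist and are unique, and the integrands of the line integrals are in
`A_k^loc ⊗ E`. -/
def IntegralsDefined : Prop :=
  (∀ c ∈ harmonic Γ k E, ∃! μ, IsMeasureOf c μ) ∧
  ∀ τ₁ ∈ Hp p E, ∀ τ₂ ∈ Hp p E, ∀ P : Pk p k, logIntegrand τ₁ τ₂ P ∈ locAn p k E

end Integration

/-- The function `f : Γ → (P_k → E)` is a 1-cocycle with values in `V_k ⊗ E` and has class `h`. -/
def HasClass [Field E] [Algebra ℚ_[p] E] (f : Γ → Pk p k → E)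
    (h : groupCohomology.H1 (vkRepOn Γ k E)) : Prop :=
  ∃ z : groupCohomology.cocycles₁ (vkRepOn Γ k E),
    (∀ γ P, (z.1 γ : Vk p k E) P = f γ P) ∧ groupCohomology.H1π (vkRepOn Γ k E) z = h

/-- `ψ` is the map induced by `c ↦ (γ ↦ ∑_{e : v → γv} c(e))`, for every vertex `v`. -/
def IsPsi [Field E] [Algebra ℚ_[p] E]
    (ψ : harmonic Γ k E →ₗ[E] groupCohomology.H1 (vkRepOn Γ k E)) : Prop :=
  ∀ (v : Vertex p) (c : harmonic Γ k E),
    HasClass Γ (fun γ P => pathSum c.1 v (γ.1 • v) P) (ψ c)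

/-- `lam` is the map induced by `c ↦ (γ, P ↦ ∫_τ^{γτ} ω_c(P))`, for every `τ ∈ E \ ℚ_p`. -/
def IsTeitelbaumLambda [NormedField E] [NormedAlgebra ℚ_[p] E]
    (lam : harmonic Γ k E →ₗ[E] groupCohomology.H1 (vkRepOn Γ k E)) : Prop :=
  ∀ τ ∈ Hp p E, ∀ c : harmonic Γ k E, HasClass Γ (teitelbaumCocycle c.1 τ) (lam c)

/-- Extension of scalars of a `V_k`-valued function on the edges. -/
def extend (E : Type) [Field E] [Algebra ℚ_[p] E] (c : Edge p → Vk p k ℚ_[p]) :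
    Edge p → Vk p k E :=
  fun e => Algebra.linearMap ℚ_[p] E ∘ₗ c e

variable {Γ} in
/-- The averaged cocycle `γ, P ↦ ½ Tr_{K/ℚ_p} ∫_τ^{γτ} ω_c(P)`. -/
def traceCocycle (K : Type) [NormedField K] [NormedAlgebra ℚ_[p] K] (c : Edge p → Vk p k ℚ_[p])
    (τ : K) (γ : Γ) (P : Pk p k) : ℚ_[p] :=
  (1 / 2) * Algebra.trace ℚ_[p] K (teitelbaumCocycle (extend K c) τ γ P)

/-- `lam` is the map induced by `c ↦ (γ, P ↦ ½ Tr_{K/ℚ_p} ∫_τ^{γτ} ω_c(P))`, for every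
`τ ∈ K \ ℚ_p`. -/
def IsTraceLambda (K : Type) [NormedField K] [NormedAlgebra ℚ_[p] K]
    (lam : harmonic Γ k ℚ_[p] →ₗ[ℚ_[p]] groupCohomology.H1 (vkRepOn Γ k ℚ_[p])) : Prop :=
  ∀ τ ∈ Hp p K, ∀ c : harmonic Γ k ℚ_[p], HasClass Γ (traceCocycle K c.1 τ) (lam c)

/-- `j : E ⊗ H¹(Γ, V_k) → H¹(Γ, V_k ⊗ E)` is the canonical map. -/
def IsScalarExtension [Field E] [Algebra ℚ_[p] E]
    (j : TensorProduct ℚ_[p] E (groupCohomology.H1 (vkRepOn Γ k ℚ_[p])) →ₗ[E]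
      groupCohomology.H1 (vkRepOn Γ k E)) : Prop :=
  ∀ z : groupCohomology.cocycles₁ (vkRepOn Γ k ℚ_[p]),
    HasClass Γ (fun γ P => algebraMap ℚ_[p] E ((z.1 γ : Vk p k ℚ_[p]) P))
      (j (TensorProduct.tmul ℚ_[p] 1 (groupCohomology.H1π (vkRepOn Γ k ℚ_[p]) z)))

/-! ### The group `Γ` -/

open scoped Quaternion in
/-- The elements of reduced norm `1` of `R[1/p]ˣ`, for a subring `R` of a quaternion algebra. -/
def normOneUnits (p : ℕ) {a b : ℚ} (R : Subring ℍ[ℚ, a, b]) : Subgroup ℍ[ℚ, a, b]ˣ where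
  carrier := {u | (∃ n : ℕ, (p : ℍ[ℚ, a, b]) ^ n * u ∈ R) ∧
    (∃ n : ℕ, (p : ℍ[ℚ, a, b]) ^ n * (u⁻¹ : ℍ[ℚ, a, b]ˣ) ∈ R) ∧
    (u : ℍ[ℚ, a, b]) * star (u : ℍ[ℚ, a, b]) = 1}
  one_mem' := ⟨⟨0, by simp⟩, ⟨0, by simp⟩, by simp⟩
  mul_mem' := by
    have key : ∀ x y : ℍ[ℚ, a, b], (∃ n : ℕ, (p : ℍ[ℚ, a, b]) ^ n * x ∈ R) →
        (∃ n : ℕ, (p : ℍ[ℚ, a, b]) ^ n * y ∈ R) →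
        ∃ n : ℕ, (p : ℍ[ℚ, a, b]) ^ n * (x * y) ∈ R := by
      rintro x y ⟨n, hn⟩ ⟨m, hm⟩
      refine ⟨n + m, ?_⟩
      have h : (p : ℍ[ℚ, a, b]) ^ (n + m) * (x * y) =
          ((p : ℍ[ℚ, a, b]) ^ n * x) * ((p : ℍ[ℚ, a, b]) ^ m * y) := by
        have hc : (p : ℍ[ℚ, a, b]) ^ m * x = x * (p : ℍ[ℚ, a, b]) ^ m :=
          ((Nat.cast_commute p x).pow_left m).eq
        rw [pow_add, mul_assoc, mul_assoc, ← mul_assoc _ x y, hc, mul_assoc x]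
      rw [h]
      exact R.mul_mem hn hm
    rintro u v ⟨h1, h2, h3⟩ ⟨h1', h2', h3'⟩
    refine ⟨by simpa using key _ _ h1 h1', by simpa using key _ _ h2' h2, ?_⟩
    rw [Units.val_mul, star_mul, mul_assoc, ← mul_assoc (v : ℍ[ℚ, a, b]), h3', one_mul, h3]
  inv_mem' := by
    rintro u ⟨h1, h2, h3⟩
    refine ⟨h2, by simpa using h1, ?_⟩
    have h4 : ((u⁻¹ : ℍ[ℚ, a, b]ˣ) : ℍ[ℚ, a, b]) = star (u : ℍ[ℚ, a, b]) :=
      Units.inv_eq_of_mul_eq_one_right h3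
    rw [h4, star_star, ← h4, Units.inv_mul]

open scoped Quaternion in
/-- The group `Γ ⊆ GL₂(ℚ_p)`: the image of the norm one units of `R[1/p]` under `ι`. -/
def arithGroup {a b : ℚ} (R : Subring ℍ[ℚ, a, b])
    (ι : ℍ[ℚ, a, b] →ₐ[ℚ] Matrix (Fin 2) (Fin 2) ℚ_[p]) : Subgroup (GL (Fin 2) ℚ_[p]) :=
  (normOneUnits p R).map (Units.map (ι : ℍ[ℚ, a, b] →* Matrix (Fin 2) (Fin 2) ℚ_[p]))

end LOperator
end

noncomputable section
namespace LOperator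
variable {p : ℕ} [Fact p.Prime]
open Filter Topology

/-! ### Matrices -/

/-- The invertible matrix with rows `(a, b)` and `(c, d)`. -/
def mat (a b c d : ℚ_[p]) (h : a * d - b * c ≠ 0) : GL (Fin 2) ℚ_[p] :=
  Matrix.GeneralLinearGroup.mkOfDetNeZero !![a, b; c, d] (by rwa [Matrix.det_fin_two_of])

section mat
variable (a b c d : ℚ_[p]) (h : a * d - b * c ≠ 0)
@[simp] lemma mat_00 : mat a b c d h 0 0 = a := rfl
@[simp] lemma mat_01 : mat a b c d h 0 1 = b := rfl
@[simp] lemma mat_10 : mat a b c d h 1 0 = c := rfl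
@[simp] lemma mat_11 : mat a b c d h 1 1 = d := rfl
end mat

lemma gl_ext {g h : GL (Fin 2) ℚ_[p]} (h00 : g 0 0 = h 0 0) (h01 : g 0 1 = h 0 1)
    (h10 : g 1 0 = h 1 0) (h11 : g 1 1 = h 1 1) : g = h := by
  refine Matrix.GeneralLinearGroup.ext fun i j => ?_
  fin_cases i <;> fin_cases j <;> assumption

lemma mul_00 (g h : GL (Fin 2) ℚ_[p]) : (g * h) 0 0 = g 0 0 * h 0 0 + g 0 1 * h 1 0 := by
  simp [Matrix.mul_apply, Fin.sum_univ_two]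
lemma mul_01 (g h : GL (Fin 2) ℚ_[p]) : (g * h) 0 1 = g 0 0 * h 0 1 + g 0 1 * h 1 1 := by
  simp [Matrix.mul_apply, Fin.sum_univ_two]
lemma mul_10 (g h : GL (Fin 2) ℚ_[p]) : (g * h) 1 0 = g 1 0 * h 0 0 + g 1 1 * h 1 0 := by
  simp [Matrix.mul_apply, Fin.sum_univ_two]
lemma mul_11 (g h : GL (Fin 2) ℚ_[p]) : (g * h) 1 1 = g 1 0 * h 0 1 + g 1 1 * h 1 1 := by
  simp [Matrix.mul_apply, Fin.sum_univ_two]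

/-- The determinant, as an element of `ℚ_p`. -/
def gdet (g : GL (Fin 2) ℚ_[p]) : ℚ_[p] := g 0 0 * g 1 1 - g 0 1 * g 1 0

lemma gdet_eq (g : GL (Fin 2) ℚ_[p]) : ((g.det : ℚ_[p]ˣ) : ℚ_[p]) = gdet g := by
  rw [Matrix.GeneralLinearGroup.val_det_apply, Matrix.det_fin_two, gdet]

lemma gdet_ne_zero (g : GL (Fin 2) ℚ_[p]) : gdet g ≠ 0 := by
  rw [← gdet_eq]; exact Units.ne_zero _

lemma gdet_mul (g h : GL (Fin 2) ℚ_[p]) : gdet (g * h) = gdet g * gdet h := by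
  rw [← gdet_eq, ← gdet_eq, ← gdet_eq, map_mul, Units.val_mul]

lemma gl_inv (g : GL (Fin 2) ℚ_[p]) : g⁻¹ = mat (g 1 1 / gdet g) (-g 0 1 / gdet g)
    (-g 1 0 / gdet g) (g 0 0 / gdet g) (by
      have := gdet_ne_zero g
      have h2 : g 1 1 / gdet g * (g 0 0 / gdet g) - -g 0 1 / gdet g * (-g 1 0 / gdet g) =
        (gdet g)⁻¹ := by field_simp; rw [gdet]; ring
      rw [h2]; exact inv_ne_zero this) := by
  rw [inv_eq_iff_mul_eq_one]
  have := gdet_ne_zero g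
  apply gl_ext
  · rw [mul_00]; simp only [mat_00, mat_10, Units.val_one, Matrix.one_apply_eq]
    field_simp; rw [gdet]; ring
  · rw [mul_01]; simp; field_simp; ring
  · rw [mul_10]; simp; field_simp; ring
  · rw [mul_11]; simp only [mat_01, mat_11, Units.val_one, Matrix.one_apply_eq]
    field_simp; rw [gdet]; ring

lemma p_ne_zero : (p : ℚ_[p]) ≠ 0 := by exact_mod_cast (Fact.out : p.Prime).ne_zero
lemma one_lt_p : (1 : ℝ) < p := by exact_mod_cast (Fact.out : p.Prime).one_lt
lemma p_pos : (0 : ℝ) < p := zero_lt_one.trans one_lt_p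

lemma norm_lt_one_iff (x : ℚ_[p]) : ‖x‖ < 1 ↔ ‖x / p‖ ≤ 1 := by
  have h := Padic.norm_le_pow_iff_norm_lt_pow_add_one x (-1)
  rw [zpow_neg_one, neg_add_cancel, zpow_zero] at h
  rw [← h, norm_div, Padic.norm_p, div_le_one (inv_pos.2 p_pos)]

lemma norm_lt_iff (x y : ℚ_[p]) (hy : y ≠ 0) : ‖x‖ < ‖y‖ ↔ ‖x / p‖ ≤ ‖y‖ := by
  have hy' : 0 < ‖y‖ := norm_pos_iff.2 hy
  rw [← div_lt_one hy', ← norm_div, norm_lt_one_iff, ← div_le_one hy', ← norm_div, div_right_comm]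

section ultra
variable {M : Type*} [SeminormedAddCommGroup M] [IsUltrametricDist M] {x y : M} {r : ℝ}
lemma norm_sub_le_max (x y : M) : ‖x - y‖ ≤ max ‖x‖ ‖y‖ := by
  simpa [sub_eq_add_neg] using IsUltrametricDist.norm_add_le_max x (-y)
lemma norm_add_le_of (hx : ‖x‖ ≤ r) (hy : ‖y‖ ≤ r) : ‖x + y‖ ≤ r :=
  (IsUltrametricDist.norm_add_le_max x y).trans (max_le hx hy)
lemma norm_sub_le_of (hx : ‖x‖ ≤ r) (hy : ‖y‖ ≤ r) : ‖x - y‖ ≤ r :=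
  (norm_sub_le_max x y).trans (max_le hx hy)
lemma norm_add_lt_of (hx : ‖x‖ < r) (hy : ‖y‖ < r) : ‖x + y‖ < r :=
  (IsUltrametricDist.norm_add_le_max x y).trans_lt (max_lt hx hy)
lemma norm_sub_lt_of (hx : ‖x‖ < r) (hy : ‖y‖ < r) : ‖x - y‖ < r :=
  (norm_sub_le_max x y).trans_lt (max_lt hx hy)
lemma norm_add_eq_left (h : ‖y‖ < ‖x‖) : ‖x + y‖ = ‖x‖ := by
  rw [IsUltrametricDist.norm_add_eq_max_of_norm_ne_norm h.ne', max_eq_left h.le]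
lemma norm_sub_eq_left (h : ‖y‖ < ‖x‖) : ‖x - y‖ = ‖x‖ := by
  rw [sub_eq_add_neg]; exact norm_add_eq_left (by rwa [norm_neg])
end ultra

/-! ### Stabilizers -/

/-- A homothety times an element of the Iwahori subgroup of matrices that are upper triangular
modulo `p`. -/
def Iw (u : GL (Fin 2) ℚ_[p]) : Prop :=
  ‖u 0 0‖ = ‖u 1 1‖ ∧ ‖u 0 1‖ ≤ ‖u 1 1‖ ∧ ‖u 1 0‖ < ‖u 1 1‖

/-- A homothety times an element of `GL₂(ℤ_p)`. -/
def Maxl (u : GL (Fin 2) ℚ_[p]) : Prop :=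
  ∃ a : ℚ_[p]ˣ, (∀ i j, ‖u i j‖ ≤ ‖(a : ℚ_[p])‖) ∧ ‖gdet u‖ = ‖(a : ℚ_[p])‖ ^ 2

lemma Iw.ne_zero {u : GL (Fin 2) ℚ_[p]} (h : Iw u) : u 1 1 ≠ 0 :=
  norm_pos_iff.1 ((norm_nonneg _).trans_lt h.2.2)

lemma Iw.norm_gdet {u : GL (Fin 2) ℚ_[p]} (h : Iw u) : ‖gdet u‖ = ‖u 1 1‖ ^ 2 := by
  have h0 : 0 < ‖u 1 1‖ := norm_pos_iff.2 h.ne_zero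
  have : ‖u 0 1 * u 1 0‖ < ‖u 0 0 * u 1 1‖ := by
    rw [norm_mul, norm_mul, h.1]
    exact mul_lt_mul' h.2.1 h.2.2 (norm_nonneg _) h0
  rw [gdet, norm_sub_eq_left this, norm_mul, h.1, sq]

lemma Iw.maxl {u : GL (Fin 2) ℚ_[p]} (h : Iw u) : Maxl u := by
  refine ⟨Units.mk0 _ h.ne_zero, ?_, h.norm_gdet⟩
  intro i j
  fin_cases i <;> fin_cases j
  exacts [h.1.le, h.2.1, h.2.2.le, le_rfl]

/-! ### Lattices -/

lemma mem_latticeZero (v : Fin 2 → ℚ_[p]) : v ∈ (latticeZero p).1 ↔ ‖v 0‖ ≤ 1 ∧ ‖v 1‖ ≤ 1 := by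
  constructor
  · intro h
    have hle : (latticeZero p).1 ≤
        (Submodule.pi Set.univ fun _ : Fin 2 => LinearMap.range (Algebra.linearMap ℤ_[p] ℚ_[p])) := by
      refine Submodule.span_le.2 ?_
      rintro _ ⟨i, rfl⟩ j _
      rw [Pi.basisFun_apply]
      by_cases hij : j = i
      · subst hij; exact ⟨1, by simp⟩
      · exact ⟨0, by simp [hij]⟩
    have := hle h
    obtain ⟨x, hx⟩ := this 0 trivial
    obtain ⟨y, hy⟩ := this 1 trivial
    rw [← hx, ← hy]
    exact ⟨x.2, y.2⟩
  · rintro ⟨h0, h1⟩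
    obtain ⟨x, hx⟩ : ∃ x : ℤ_[p], (x : ℚ_[p]) = v 0 := ⟨⟨v 0, h0⟩, rfl⟩
    obtain ⟨y, hy⟩ : ∃ y : ℤ_[p], (y : ℚ_[p]) = v 1 := ⟨⟨v 1, h1⟩, rfl⟩
    have : v = x • Pi.basisFun ℚ_[p] (Fin 2) 0 + y • Pi.basisFun ℚ_[p] (Fin 2) 1 := by
      ext i
      fin_cases i <;> simp [Algebra.smul_def, ← hx, ← hy]
    rw [this]
    exact add_mem (Submodule.smul_mem _ _ (Submodule.subset_span ⟨0, rfl⟩))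
      (Submodule.smul_mem _ _ (Submodule.subset_span ⟨1, rfl⟩))

lemma mem_smul_latticeZero (g : GL (Fin 2) ℚ_[p]) (v : Fin 2 → ℚ_[p]) :
    v ∈ (g • latticeZero p).1 ↔ ‖g 1 1 * v 0 - g 0 1 * v 1‖ ≤ ‖gdet g‖ ∧
      ‖g 0 0 * v 1 - g 1 0 * v 0‖ ≤ ‖gdet g‖ := by
  have hd := gdet_ne_zero g
  have hd' : 0 < ‖gdet g‖ := norm_pos_iff.2 hd
  rw [Lattice.coe_gl_smul]
  constructor
  · rintro ⟨w, hw, rfl⟩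
    rw [SetLike.mem_coe, mem_latticeZero] at hw
    have e0 : ((Matrix.mulVecLin g.1).restrictScalars ℤ_[p]) w 0 = g 0 0 * w 0 + g 0 1 * w 1 := by
      simp [Matrix.mulVec, dotProduct, Fin.sum_univ_two]
    have e1 : ((Matrix.mulVecLin g.1).restrictScalars ℤ_[p]) w 1 = g 1 0 * w 0 + g 1 1 * w 1 := by
      simp [Matrix.mulVec, dotProduct, Fin.sum_univ_two]
    rw [e0, e1]
    constructor
    · rw [show g 1 1 * (g 0 0 * w 0 + g 0 1 * w 1) - g 0 1 * (g 1 0 * w 0 + g 1 1 * w 1) =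
        gdet g * w 0 by rw [gdet]; ring, norm_mul]
      exact mul_le_of_le_one_right hd'.le hw.1
    · rw [show g 0 0 * (g 1 0 * w 0 + g 1 1 * w 1) - g 1 0 * (g 0 0 * w 0 + g 0 1 * w 1) =
        gdet g * w 1 by rw [gdet]; ring, norm_mul]
      exact mul_le_of_le_one_right hd'.le hw.2
  · rintro ⟨h0, h1⟩
    refine ⟨![(g 1 1 * v 0 - g 0 1 * v 1) / gdet g, (g 0 0 * v 1 - g 1 0 * v 0) / gdet g], ?_, ?_⟩
    · rw [SetLike.mem_coe, mem_latticeZero]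
      simp only [Matrix.cons_val_zero, Matrix.cons_val_one, norm_div]
      exact ⟨(div_le_one hd').2 h0, (div_le_one hd').2 h1⟩
    · ext i
      fin_cases i
      · simp [Matrix.mulVec, dotProduct, Fin.sum_univ_two]
        field_simp
        rw [gdet]
        ring
      · simp [Matrix.mulVec, dotProduct, Fin.sum_univ_two]
        field_simp
        rw [gdet]
        ring

/-- The scalar matrix `a`. -/
def scal (a : ℚ_[p]) (ha : a ≠ 0) : GL (Fin 2) ℚ_[p] := mat a 0 0 a (by simpa using ha)

lemma scal_smul (a : ℚ_[p]ˣ) (L : Lattice p) : scal (a : ℚ_[p]) a.ne_zero • L = a • L := by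
  apply Subtype.ext
  rw [Lattice.coe_gl_smul, Lattice.coe_smul]
  ext v
  refine Submodule.mem_map.trans (Iff.trans ?_ (Submodule.mem_smul_pointwise_iff_exists _ _ _).symm)
  have : ∀ w : Fin 2 → ℚ_[p],
      ((Matrix.mulVecLin (scal (a : ℚ_[p]) a.ne_zero).1).restrictScalars ℤ_[p]) w = a • w := by
    intro w
    ext i
    fin_cases i <;>
      simp [Matrix.mulVec, dotProduct, Fin.sum_univ_two, scal, Units.smul_def]
  simp only [this]

instance : MulAction (GL (Fin 2) ℚ_[p]) (Vertex p) where
  one_smul v := by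
    induction v using Quotient.inductionOn with | h L
    exact congrArg Lattice.cls (one_smul _ L)
  mul_smul g h v := by
    induction v using Quotient.inductionOn with | h L
    exact congrArg Lattice.cls (mul_smul g h L)

instance : MulAction (GL (Fin 2) ℚ_[p]) (Edge p) where
  one_smul _ := SimpleGraph.Dart.ext _ _ (Prod.ext (one_smul _ _) (one_smul _ _))
  mul_smul _ _ _ := SimpleGraph.Dart.ext _ _ (Prod.ext (mul_smul _ _ _) (mul_smul _ _ _))

@[simp] lemma smul_fst (g : GL (Fin 2) ℚ_[p]) (e : Edge p) : (g • e).fst = g • e.fst := rfl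
@[simp] lemma smul_snd (g : GL (Fin 2) ℚ_[p]) (e : Edge p) : (g • e).snd = g • e.snd := rfl
@[simp] lemma smul_symm (g : GL (Fin 2) ℚ_[p]) (e : Edge p) : g • e.symm = (g • e).symm := rfl

lemma edge_ext {e f : Edge p} (h1 : e.fst = f.fst) (h2 : e.snd = f.snd) : e = f :=
  SimpleGraph.Dart.ext _ _ (Prod.ext h1 h2)

lemma smul_v0_eq_iff (g : GL (Fin 2) ℚ_[p]) : g • v0 p = v0 p ↔ Maxl g := by
  have hd' : 0 < ‖gdet g‖ := norm_pos_iff.2 (gdet_ne_zero g)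
  constructor
  · intro h
    obtain ⟨a, ha⟩ := Lattice.cls_eq.1 h
    have ha0 : 0 < ‖(a : ℚ_[p])‖ := norm_pos_iff.2 a.ne_zero
    have hm : ∀ v : Fin 2 → ℚ_[p], v ∈ (g • latticeZero p).1 ↔ ‖v 0‖ ≤ ‖(a:ℚ_[p])‖ ∧ ‖v 1‖ ≤ ‖(a:ℚ_[p])‖ := by
      intro v
      rw [show g • latticeZero p = _ from ha.symm, ← scal_smul, mem_smul_latticeZero]
      simp only [scal, mat_00, mat_01, mat_10, mat_11, gdet, zero_mul, sub_zero, norm_mul]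
      rw [mul_le_mul_iff_right₀ ha0, mul_le_mul_iff_right₀ ha0]
    have h0 := (hm ![g 0 0, g 1 0]).1 (by
      rw [mem_smul_latticeZero]
      simp only [Matrix.cons_val_zero, Matrix.cons_val_one]
      rw [mul_comm (g 0 0) (g 1 0), sub_self, norm_zero, mul_comm (g 1 1)]
      exact ⟨le_rfl, norm_nonneg _⟩)
    have h1 := (hm ![g 0 1, g 1 1]).1 (by
      rw [mem_smul_latticeZero]
      simp only [Matrix.cons_val_zero, Matrix.cons_val_one]
      rw [mul_comm (g 0 1) (g 1 1), sub_self, norm_zero, mul_comm (g 1 0)]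
      exact ⟨norm_nonneg _, le_rfl⟩)
    simp only [Matrix.cons_val_zero, Matrix.cons_val_one] at h0 h1
    have h2 := (mem_smul_latticeZero g _).1 ((hm ![(a : ℚ_[p]), 0]).2 (by simp))
    have h3 := (mem_smul_latticeZero g _).1 ((hm ![0, (a : ℚ_[p])]).2 (by simp))
    simp only [Matrix.cons_val_zero, Matrix.cons_val_one, mul_zero, sub_zero, zero_sub, norm_neg,
      norm_mul] at h2 h3
    refine ⟨a, ?_, le_antisymm ?_ ?_⟩
    · intro i j
      fin_cases i <;> fin_cases j
      exacts [h0.1, h1.1, h0.2, h1.2]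
    · refine norm_sub_le_of ?_ ?_ <;> rw [norm_mul, sq]
      · exact mul_le_mul h0.1 h1.2 (norm_nonneg _) ha0.le
      · exact mul_le_mul h1.1 h0.2 (norm_nonneg _) ha0.le
    · have h4 : ‖gdet g * (a : ℚ_[p]) ^ 2‖ ≤ ‖gdet g‖ * ‖gdet g‖ := by
        rw [show gdet g * (a : ℚ_[p]) ^ 2 = (g 1 1 * a) * (g 0 0 * a) - (g 0 1 * a) * (g 1 0 * a) by
          rw [gdet]; ring]
        refine norm_sub_le_of ?_ ?_ <;> rw [norm_mul, norm_mul, norm_mul]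
        · exact mul_le_mul h2.1 h3.2 (by positivity) hd'.le
        · exact mul_le_mul h3.1 h2.2 (by positivity) hd'.le
      rw [norm_mul, norm_pow] at h4
      exact le_of_mul_le_mul_left h4 hd'
  · rintro ⟨a, h, hdet⟩
    have ha0 : 0 < ‖(a : ℚ_[p])‖ := norm_pos_iff.2 a.ne_zero
    refine Lattice.cls_eq.2 ⟨a, Subtype.ext ?_⟩
    ext v
    rw [← scal_smul, mem_smul_latticeZero, mem_smul_latticeZero]
    simp only [scal, mat_00, mat_01, mat_10, mat_11, zero_mul, sub_zero]
    rw [show gdet (mat (a : ℚ_[p]) 0 0 a _) = a * a by simp [gdet], norm_mul, norm_mul,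
      norm_mul, mul_le_mul_iff_right₀ ha0, mul_le_mul_iff_right₀ ha0, hdet]
    constructor
    · rintro ⟨h0, h1⟩
      constructor <;> refine norm_sub_le_of ?_ ?_ <;> rw [norm_mul, sq]
      · exact mul_le_mul (h _ _) h0 (norm_nonneg _) ha0.le
      · exact mul_le_mul (h _ _) h1 (norm_nonneg _) ha0.le
      · exact mul_le_mul (h _ _) h1 (norm_nonneg _) ha0.le
      · exact mul_le_mul (h _ _) h0 (norm_nonneg _) ha0.le
    · rintro ⟨h0, h1⟩
      rw [← hdet] at h0 h1
      have key : ∀ x y s t : ℚ_[p], ‖x‖ ≤ ‖gdet g‖ → ‖y‖ ≤ ‖gdet g‖ → ‖s‖ ≤ ‖(a : ℚ_[p])‖ →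
          ‖t‖ ≤ ‖(a : ℚ_[p])‖ → ‖(s * x + t * y) / gdet g‖ ≤ ‖(a : ℚ_[p])‖ := by
        intro x y s t hx hy hs ht
        rw [norm_div, div_le_iff₀ hd']
        refine norm_add_le_of ?_ ?_ <;> rw [norm_mul]
        · exact mul_le_mul hs hx (norm_nonneg _) ha0.le
        · exact mul_le_mul ht hy (norm_nonneg _) ha0.le
      have hd := gdet_ne_zero g
      constructor
      · have := key _ _ _ _ h0 h1 (h 0 0) (h 0 1)
        rwa [show (g 0 0 * (g 1 1 * v 0 - g 0 1 * v 1) + g 0 1 * (g 0 0 * v 1 - g 1 0 * v 0)) / gdet g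
          = v 0 by rw [div_eq_iff hd, gdet]; ring] at this
      · have := key _ _ _ _ h0 h1 (h 1 0) (h 1 1)
        rwa [show (g 1 0 * (g 1 1 * v 0 - g 0 1 * v 1) + g 1 1 * (g 0 0 * v 1 - g 1 0 * v 0)) / gdet g
          = v 1 by rw [div_eq_iff hd, gdet]; ring] at this

lemma w0_eq : w0 p = mat 0 1 p 0 (by simpa using p_ne_zero) := rfl

lemma mem_unit_smul_latticeZero (a : ℚ_[p]ˣ) (v : Fin 2 → ℚ_[p]) :
    v ∈ (a • latticeZero p).1 ↔ ‖v 0‖ ≤ ‖(a : ℚ_[p])‖ ∧ ‖v 1‖ ≤ ‖(a : ℚ_[p])‖ := by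
  have ha0 : 0 < ‖(a : ℚ_[p])‖ := norm_pos_iff.2 a.ne_zero
  rw [← scal_smul, mem_smul_latticeZero]
  simp only [scal, mat_00, mat_01, mat_10, mat_11, gdet, zero_mul, sub_zero, norm_mul]
  rw [mul_le_mul_iff_right₀ ha0, mul_le_mul_iff_right₀ ha0]

/-- The matrix with rows `(p, x)` and `(0, 1)`. -/
def hm (x : ℚ_[p]) : GL (Fin 2) ℚ_[p] := mat p x 0 1 (by simpa using p_ne_zero)

lemma mem_w0_smul (v : Fin 2 → ℚ_[p]) :
    v ∈ (w0 p • latticeZero p).1 ↔ ‖v 0‖ ≤ 1 ∧ ‖v 1‖ ≤ (p : ℝ)⁻¹ := by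
  rw [mem_smul_latticeZero]
  simp only [w0_eq, mat_00, mat_01, mat_10, mat_11, gdet, zero_mul, zero_sub, one_mul, norm_neg,
    norm_mul, Padic.norm_p]
  rw [and_comm, mul_le_iff_le_one_right (inv_pos.2 p_pos)]

lemma mem_hm_smul (x : ℚ_[p]) (v : Fin 2 → ℚ_[p]) :
    v ∈ (hm x • latticeZero p).1 ↔ ‖v 0 - x * v 1‖ ≤ (p : ℝ)⁻¹ ∧ ‖v 1‖ ≤ 1 := by
  rw [mem_smul_latticeZero]
  simp only [hm, mat_00, mat_01, mat_10, mat_11, gdet, zero_mul, mul_zero, sub_zero, one_mul, mul_one,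
    norm_mul, Padic.norm_p]
  rw [mul_le_iff_le_one_right (inv_pos.2 p_pos)]

lemma norm_lt_one_iff' (x : ℚ_[p]) : ‖x‖ < 1 ↔ ‖x‖ ≤ (p : ℝ)⁻¹ := by
  have h := Padic.norm_le_pow_iff_norm_lt_pow_add_one x (-1)
  rw [zpow_neg_one, neg_add_cancel, zpow_zero] at h
  exact h.symm

lemma v0_adj_w0 : (tree p).Adj (v0 p) (w0 p • v0 p) := by
  have hp : (p : ℝ)⁻¹ < 1 := inv_lt_one_of_one_lt₀ one_lt_p
  refine ⟨latticeZero p, w0 p • latticeZero p, rfl, rfl, ?_, ?_⟩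
  · refine SetLike.lt_iff_le_and_exists.2 ⟨fun v hv => ?_, ![1, 0], ?_, ?_⟩
    · rw [mem_unit_smul_latticeZero] at hv
      simp only [pUnit, Units.val_mk0, Padic.norm_p] at hv
      rw [mem_w0_smul]
      exact ⟨hv.1.trans hp.le, hv.2⟩
    · rw [mem_w0_smul]; simp
    · rw [mem_unit_smul_latticeZero]
      simp only [pUnit, Units.val_mk0, Padic.norm_p]
      simp only [Matrix.cons_val_zero, norm_one]
      exact fun h => hp.not_ge h.1
  · refine SetLike.lt_iff_le_and_exists.2 ⟨fun v hv => ?_, ![0, 1], ?_, ?_⟩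
    · rw [mem_w0_smul] at hv
      rw [mem_latticeZero]
      exact ⟨hv.1, hv.2.trans hp.le⟩
    · rw [mem_latticeZero]; simp
    · rw [mem_w0_smul]
      exact fun h => hp.not_ge (by simpa using h.2)

variable (p) in
/-- The edge `e₀` from `w₀ v₀` to `v₀`. -/
def e0 : Edge p := ⟨(w0 p • v0 p, v0 p), v0_adj_w0.symm⟩

lemma w0_sq : w0 p * w0 p = scal (p : ℚ_[p]) p_ne_zero := by
  rw [w0_eq]
  apply gl_ext
  · rw [mul_00]; simp [scal]
  · rw [mul_01]; simp [scal]
  · rw [mul_10]; simp [scal]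
  · rw [mul_11]; simp [scal]

lemma Iw_scal (a : ℚ_[p]) (ha : a ≠ 0) : Iw (scal a ha) := by
  refine ⟨rfl, ?_, ?_⟩ <;> simp [scal, ha]

lemma w0_conj (u : GL (Fin 2) ℚ_[p]) : ∃ h, (w0 p)⁻¹ * u * w0 p =
    mat (u 1 1) (u 1 0 / p) (p * u 0 1) (u 0 0) h := by
  have h : u 1 1 * u 0 0 - u 1 0 / p * (p * u 0 1) ≠ 0 := by
    have hp := p_ne_zero (p := p)
    have := gdet_ne_zero u
    rw [gdet] at this
    intro h
    apply this
    rw [← h]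
    field_simp
  refine ⟨h, ?_⟩
  rw [mul_assoc, inv_mul_eq_iff_eq_mul]
  have hp := p_ne_zero (p := p)
  apply gl_ext
  · rw [mul_00, mul_00]; simp [w0_eq]; ring
  · rw [mul_01, mul_01]; simp [w0_eq]
  · rw [mul_10, mul_10]; simp [w0_eq]; ring
  · rw [mul_11, mul_11]; simp [w0_eq]; field_simp

lemma norm_p_mul_lt {x : ℚ_[p]} {r : ℝ} (hr : 0 < r) (h : ‖x‖ ≤ r) : ‖p * x‖ < r := by
  rw [norm_mul, Padic.norm_p]
  have hp : (p : ℝ)⁻¹ < 1 := inv_lt_one_of_one_lt₀ one_lt_p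
  calc _ ≤ (p : ℝ)⁻¹ * r := by gcongr
    _ < 1 * r := by gcongr
    _ = r := one_mul r

lemma Iw.conj_w0 {u : GL (Fin 2) ℚ_[p]} (hu : Iw u) : Iw ((w0 p)⁻¹ * u * w0 p) := by
  obtain ⟨h, e⟩ := w0_conj u
  rw [e]
  refine ⟨hu.1.symm, ?_, ?_⟩
  · simp only [mat_01, mat_11]
    rw [hu.1]
    exact (norm_lt_iff _ _ hu.ne_zero).1 hu.2.2
  · simp only [mat_10, mat_11]
    rw [hu.1]
    exact norm_p_mul_lt (norm_pos_iff.2 hu.ne_zero) hu.2.1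

lemma smul_w0_v0_eq_iff (g : GL (Fin 2) ℚ_[p]) :
    g • w0 p • v0 p = w0 p • v0 p ↔ Maxl ((w0 p)⁻¹ * g * w0 p) := by
  rw [← smul_v0_eq_iff, mul_smul, mul_smul, inv_smul_eq_iff]

lemma Iw_of_maxl {g : GL (Fin 2) ℚ_[p]} (h : Maxl g) (h' : Maxl ((w0 p)⁻¹ * g * w0 p)) : Iw g := by
  obtain ⟨a, ha, hd⟩ := h
  obtain ⟨b, hb, hd'⟩ := h'
  obtain ⟨h, e⟩ := w0_conj g
  rw [e] at hb hd'
  have hp := p_ne_zero (p := p)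
  have ha0 : 0 < ‖(a : ℚ_[p])‖ := norm_pos_iff.2 a.ne_zero
  have hde : gdet (mat (g 1 1) (g 1 0 / p) (p * g 0 1) (g 0 0) h) = gdet g := by
    simp [gdet]; field_simp
  rw [hde, hd] at hd'
  have hab : ‖(a : ℚ_[p])‖ = ‖(b : ℚ_[p])‖ :=
    (pow_left_inj₀ (norm_nonneg _) (norm_nonneg _) two_ne_zero).1 hd'
  have h10 : ‖g 1 0‖ < ‖(a : ℚ_[p])‖ := by
    rw [norm_lt_iff _ _ a.ne_zero, hab]
    exact hb 0 1
  have hlt : ‖g 0 1 * g 1 0‖ < ‖(a : ℚ_[p])‖ ^ 2 := by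
    rw [norm_mul, sq]
    exact (mul_le_mul_of_nonneg_right (ha 0 1) (norm_nonneg _)).trans_lt
      (mul_lt_mul_of_pos_left h10 ha0)
  have h1 : ‖g 0 0‖ * ‖g 1 1‖ = ‖(a : ℚ_[p])‖ ^ 2 := by
    rw [← norm_mul, show g 0 0 * g 1 1 = gdet g + g 0 1 * g 1 0 by rw [gdet]; ring,
      norm_add_eq_left (by rwa [hd]), hd]
  have h00 : ‖g 0 0‖ = ‖(a : ℚ_[p])‖ := by
    refine le_antisymm (ha 0 0) (not_lt.1 fun hlt => h1.not_lt ?_)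
    rw [sq]
    exact (mul_le_mul_of_nonneg_left (ha 1 1) (norm_nonneg _)).trans_lt
      (mul_lt_mul_of_pos_right hlt ha0)
  have h11 : ‖g 1 1‖ = ‖(a : ℚ_[p])‖ := by
    rw [h00, sq] at h1
    exact mul_left_cancel₀ ha0.ne' h1
  exact ⟨h00.trans h11.symm, (ha 0 1).trans h11.ge, h10.trans_le h11.ge⟩

lemma smul_e0_eq_iff (g : GL (Fin 2) ℚ_[p]) : g • e0 p = e0 p ↔ Iw g := by
  constructor
  · intro h
    exact Iw_of_maxl ((smul_v0_eq_iff g).1 (congrArg (fun e : Edge p => e.snd) h))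
      ((smul_w0_v0_eq_iff g).1 (congrArg (fun e : Edge p => e.fst) h))
  · intro h
    exact edge_ext ((smul_w0_v0_eq_iff g).2 h.conj_w0.maxl) ((smul_v0_eq_iff g).2 h.maxl)

lemma smul_e0_eq_smul_iff (g h : GL (Fin 2) ℚ_[p]) : g • e0 p = h • e0 p ↔ Iw (h⁻¹ * g) := by
  rw [← smul_e0_eq_iff, mul_smul, inv_smul_eq_iff]

lemma w0_smul_e0 : w0 p • e0 p = (e0 p).symm := by
  refine edge_ext ?_ rfl
  change w0 p • w0 p • v0 p = v0 p
  rw [← mul_smul, w0_sq, smul_v0_eq_iff]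
  exact (Iw_scal _ _).maxl

/-! ### Neighbours -/

lemma exists_digit {x : ℚ_[p]} (hx : ‖x‖ ≤ 1) : ∃ j : Fin p, ‖x - (j : ℕ)‖ < 1 := by
  obtain ⟨n, hn, h⟩ := PadicInt.exists_mem_range (⟨x, hx⟩ : ℤ_[p])
  refine ⟨⟨n, hn⟩, ?_⟩
  have := (PadicInt.mem_nonunits).1 ((IsLocalRing.mem_maximalIdeal _).1 h)
  exact this

lemma digit_unique {i j : Fin p} (h : ‖((i : ℕ) : ℚ_[p]) - (j : ℕ)‖ < 1) : i = j := by
  have h1 : ‖(((i : ℕ) - (j : ℕ) : ℤ) : ℚ_[p])‖ < 1 := by push_cast; exact h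
  rw [Padic.norm_intCast_lt_one_iff] at h1
  have h3 : (i : ℤ) = j := by
    have hi := i.2
    have hj := j.2
    have := Int.eq_zero_of_abs_lt_dvd h1 (by rw [abs_lt]; omega)
    omega
  exact Fin.ext (by exact_mod_cast h3)

/-- Translates of `e₀` to the edges with source `v₀`. -/
def nb : Option (Fin p) → GL (Fin 2) ℚ_[p]
  | none => w0 p
  | some j => hm (j : ℕ)

lemma hm_smul_fst (x : ℚ_[p]) (hx : ‖x‖ ≤ 1) : hm x • w0 p • v0 p = v0 p := by
  rw [← mul_smul, smul_v0_eq_iff]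
  have hp := p_ne_zero (p := p)
  refine ⟨Units.mk0 (p : ℚ_[p]) hp, ?_, ?_⟩
  · intro i j
    have hp1 : (p : ℝ)⁻¹ ≤ 1 := inv_le_one_of_one_le₀ one_lt_p.le
    have hp0 : 0 < (p : ℝ)⁻¹ := inv_pos.2 p_pos
    fin_cases i <;> fin_cases j
    · change ‖(hm x * w0 p) 0 0‖ ≤ _
      rw [mul_00]; simpa [hm, w0_eq, Padic.norm_p, hp0] using hx
    · change ‖(hm x * w0 p) 0 1‖ ≤ _
      rw [mul_01]; simp [hm, w0_eq]
    · change ‖(hm x * w0 p) 1 0‖ ≤ _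
      rw [mul_10]; simp [hm, w0_eq]
    · change ‖(hm x * w0 p) 1 1‖ ≤ _
      rw [mul_11]; simp [hm, w0_eq]
  · rw [gdet_mul]
    simp [gdet, hm, w0_eq, sq]

lemma nb_fst (i : Option (Fin p)) : (nb i • e0 p).fst = v0 p := by
  cases i with
  | none => exact congrArg (fun e : Edge p => e.fst) w0_smul_e0
  | some j => exact hm_smul_fst _ (IsUltrametricDist.norm_natCast_le_one _ _)

lemma lattice_nb {L : Submodule ℤ_[p] (Fin 2 → ℚ_[p])} (h1 : (pUnit p • latticeZero p).1 < L)
    (h2 : L < (latticeZero p).1) : ∃ i : Option (Fin p), (nb i • latticeZero p).1 = L := by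
  have hp := p_ne_zero (p := p)
  have hsm : ∀ v : Fin 2 → ℚ_[p], v ∈ L → ∀ a : ℚ_[p], ‖a‖ ≤ 1 → a • v ∈ L :=
    fun v hv a ha => L.smul_mem (⟨a, ha⟩ : ℤ_[p]) hv
  have hpL : ∀ v : Fin 2 → ℚ_[p], ‖v 0‖ < 1 → ‖v 1‖ < 1 → v ∈ L := by
    intro v hv0 hv1
    refine h1.le ((mem_unit_smul_latticeZero _ _).2 ?_)
    simp only [pUnit, Units.val_mk0, Padic.norm_p]
    exact ⟨(norm_lt_one_iff' _).1 hv0, (norm_lt_one_iff' _).1 hv1⟩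
  have hint : ∀ v ∈ L, ‖v 0‖ ≤ 1 ∧ ‖v 1‖ ≤ 1 := fun v hv => (mem_latticeZero v).1 (h2.le hv)
  have htop : ![1, 0] ∈ L → ![0, 1] ∈ L → False := by
    intro ha hb
    refine h2.not_ge fun v hv => ?_
    rw [mem_latticeZero] at hv
    have : v = v 0 • ![1, 0] + v 1 • ![0, 1] := by
      ext i; fin_cases i <;> simp
    rw [this]
    exact L.add_mem (hsm _ ha _ hv.1) (hsm _ hb _ hv.2)
  obtain ⟨v, hv, hv'⟩ := SetLike.exists_of_lt h1
  obtain ⟨hv0, hv1⟩ := hint v hv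
  rcases hv1.lt_or_eq with hlt | heq
  · have h0 : ‖v 0‖ = 1 := by
      refine le_antisymm hv0 (not_lt.1 fun h => hv' ((mem_unit_smul_latticeZero _ _).2 ?_))
      simp only [pUnit, Units.val_mk0, Padic.norm_p]
      exact ⟨(norm_lt_one_iff' _).1 h, (norm_lt_one_iff' _).1 hlt⟩
    have hne : v 0 ≠ 0 := norm_pos_iff.1 (by rw [h0]; exact one_pos)
    have h10 : ![1, 0] ∈ L := by
      have : ![1, 0] = (v 0)⁻¹ • v - ![0, (v 0)⁻¹ * v 1] := by
        ext i; fin_cases i <;> simp [hne]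
      rw [this]
      refine L.sub_mem (hsm _ hv _ (by rw [norm_inv, h0, inv_one])) (hpL _ (by simp) ?_)
      simpa [h0] using hlt
    refine ⟨none, le_antisymm (fun y hy => ?_) fun y hy => ?_⟩
    · obtain ⟨hy0, hy1⟩ := (mem_w0_smul y).1 hy
      have : y = y 0 • ![1, 0] + ![0, y 1] := by
        ext i; fin_cases i <;> simp
      rw [this]
      exact L.add_mem (hsm _ h10 _ hy0) (hpL _ (by simp) (by simpa [norm_lt_one_iff'] using hy1))
    · refine (mem_w0_smul y).2 ⟨(hint y hy).1, (norm_lt_one_iff' _).1 ?_⟩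
      refine lt_of_le_of_ne (hint y hy).2 fun h => htop h10 ?_
      have hne : y 1 ≠ 0 := norm_pos_iff.1 (by rw [h]; exact one_pos)
      have : ![0, 1] = (y 1)⁻¹ • (y - y 0 • ![1, 0]) := by
        ext i; fin_cases i <;> simp [hne, Matrix.vecHead, Matrix.vecTail]
      rw [this]
      exact hsm _ (L.sub_mem hy (hsm _ h10 _ (hint y hy).1)) _ (by rw [norm_inv, h, inv_one])
  · have hne : v 1 ≠ 0 := norm_pos_iff.1 (by rw [heq]; exact one_pos)
    obtain ⟨j, hj⟩ := exists_digit (x := v 0 / v 1) (by rw [norm_div, heq, div_one]; exact hv0)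
    have hj1 : ‖((j : ℕ) : ℚ_[p])‖ ≤ 1 := IsUltrametricDist.norm_natCast_le_one _ _
    have hjL : ![((j : ℕ) : ℚ_[p]), 1] ∈ L := by
      have : ![((j : ℕ) : ℚ_[p]), 1] = (v 1)⁻¹ • v - ![v 0 / v 1 - (j : ℕ), 0] := by
        ext i; fin_cases i
        · simp; ring
        · simp [hne]
      rw [this]
      exact L.sub_mem (hsm _ hv _ (by rw [norm_inv, heq, inv_one])) (hpL _ hj (by simp))
    refine ⟨some j, le_antisymm (fun y hy => ?_) fun y hy => ?_⟩
    · obtain ⟨hy0, hy1⟩ := (mem_hm_smul _ y).1 hy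
      have : y = y 1 • ![((j : ℕ) : ℚ_[p]), 1] + ![y 0 - (j : ℕ) * y 1, 0] := by
        ext i; fin_cases i
        · simp; ring
        · simp
      rw [this]
      exact L.add_mem (hsm _ hjL _ hy1) (hpL _ (by simpa [norm_lt_one_iff'] using hy0) (by simp))
    · refine (mem_hm_smul _ y).2 ⟨(norm_lt_one_iff' _).1 ?_, (hint y hy).2⟩
      have hle : ‖y 0 - (j : ℕ) * y 1‖ ≤ 1 := by
        refine norm_sub_le_of (hint y hy).1 ?_
        rw [norm_mul]
        exact mul_le_one₀ hj1 (norm_nonneg _) (hint y hy).2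
      refine lt_of_le_of_ne hle fun h => ?_
      have hne : y 0 - (j : ℕ) * y 1 ≠ 0 := norm_pos_iff.1 (by rw [h]; exact one_pos)
      have h10 : ![1, 0] ∈ L := by
        have : ![1, 0] = (y 0 - (j : ℕ) * y 1)⁻¹ • (y - y 1 • ![((j : ℕ) : ℚ_[p]), 1]) := by
          ext i; fin_cases i
          · simp [Matrix.vecHead, mul_comm (y 1), inv_mul_cancel₀ hne]
          · simp [Matrix.vecHead, Matrix.vecTail]
        rw [this]
        exact hsm _ (L.sub_mem hy (hsm _ hjL _ (hint y hy).2)) _ (by rw [norm_inv, h, inv_one])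
      refine htop h10 ?_
      have : ![0, 1] = ![((j : ℕ) : ℚ_[p]), 1] - ((j : ℕ) : ℚ_[p]) • ![1, 0] := by
        ext i; fin_cases i <;> simp
      rw [this]
      exact L.sub_mem hjL (hsm _ h10 _ hj1)

lemma exists_nb {e : Edge p} (he : e.fst = v0 p) : ∃ i : Option (Fin p), e = nb i • e0 p := by
  obtain ⟨M, M', hM, hM', h⟩ := e.adj
  obtain ⟨a, ha⟩ := Lattice.cls_eq.1 ((show (latticeZero p).cls = M.cls by rw [hM]; exact he.symm))
  obtain ⟨i, hi⟩ := lattice_nb (L := (a • M').1) (by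
      rw [← ha, smul_comm]
      exact Lattice.smul_lt_smul a h.1) (by rw [← ha]; exact Lattice.smul_lt_smul a h.2)
  refine ⟨i, edge_ext (he.trans (nb_fst i).symm) ?_⟩
  rw [smul_snd]
  change e.snd = (nb i • latticeZero p).cls
  rw [show nb i • latticeZero p = a • M' from Subtype.ext hi]
  exact hM'.symm.trans (Lattice.cls_eq.2 ⟨a, rfl⟩).symm

lemma hm_inv_mul (x y : ℚ_[p]) : (hm x)⁻¹ * hm y = mat 1 ((y - x) / (p : ℚ_[p])) 0 1 (by simp) := by
  have hp := p_ne_zero (p := p)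
  rw [inv_mul_eq_iff_eq_mul]
  apply gl_ext
  · rw [mul_00]; simp [hm]
  · rw [mul_01]; simp [hm]; field_simp; ring
  · rw [mul_10]; simp [hm]
  · rw [mul_11]; simp [hm]

lemma nb_injective : Function.Injective (fun i : Option (Fin p) => nb i • e0 p) := by
  have hp := p_ne_zero (p := p)
  have key : ∀ j : Fin p, nb (none : Option (Fin p)) • e0 p ≠ nb (some j) • e0 p := by
    intro j h
    have h2 := (smul_e0_eq_smul_iff _ _).1 h.symm
    have e : ∀ h', (nb (none : Option (Fin p)))⁻¹ * nb (some j) = mat 0 ((p : ℚ_[p])⁻¹) p (j : ℕ) h' := by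
      intro h'
      rw [inv_mul_eq_iff_eq_mul]
      apply gl_ext
      · rw [mul_00]; simp [nb, hm, w0_eq]
      · rw [mul_01]; simp [nb, hm, w0_eq]
      · rw [mul_10]; simp [nb, hm, w0_eq]
      · rw [mul_11]; simp [nb, hm, w0_eq, hp]
    rw [e (by simp [hp])] at h2
    have := h2.1
    rw [mat_00, mat_11, norm_zero] at this
    exact h2.ne_zero (norm_eq_zero.1 (by rw [mat_11, ← this]))
  intro i j h
  cases i with
  | none => cases j with
    | none => rfl
    | some j => exact (key j h).elim
  | some i => cases j with
    | none => exact (key i h.symm).elim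
    | some j =>
      have h2 := (smul_e0_eq_smul_iff _ _).1 h
      change Iw ((hm _)⁻¹ * hm _) at h2
      rw [hm_inv_mul] at h2
      have := h2.2.1
      simp only [mat_01, mat_11, norm_one] at this
      rw [← norm_lt_one_iff] at this
      rw [digit_unique this]

lemma exists_smul_latticeZero (L : Lattice p) : ∃ g : GL (Fin 2) ℚ_[p], g • latticeZero p = L := by
  obtain ⟨L, hL⟩ := L
  let b : Module.Basis (Fin 2) ℤ_[p] L :=
    Module.finBasisOfFinrankEq ℤ_[p] L (Submodule.IsLattice.finrank_of_pi ℚ_[p] L)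
  let B := Module.Basis.extendOfIsLattice ℚ_[p] b
  have hdet : ((Pi.basisFun ℚ_[p] (Fin 2)).toMatrix B).det ≠ 0 := by
    have := (Pi.basisFun ℚ_[p] (Fin 2)).invertibleToMatrix B
    exact ((Matrix.isUnit_iff_isUnit_det _).1 (isUnit_of_invertible _)).ne_zero
  refine ⟨Matrix.GeneralLinearGroup.mkOfDetNeZero _ hdet, Subtype.ext ?_⟩
  rw [Lattice.coe_gl_smul, latticeZero]
  simp only
  rw [Submodule.map_span, ← Set.range_comp]
  have h : ∀ i, ((Matrix.mulVecLin (Matrix.GeneralLinearGroup.mkOfDetNeZero _ hdet).1).restrictScalars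
      ℤ_[p]) (Pi.basisFun ℚ_[p] (Fin 2) i) = (b i : Fin 2 → ℚ_[p]) := by
    intro i
    rw [← Module.Basis.extendOfIsLattice_apply ℚ_[p] b i]
    ext j
    simp only [LinearMap.coe_restrictScalars, Matrix.mulVecLin_apply, Pi.basisFun_apply,
      Matrix.mulVec_single_one]
    rfl
  have h2 : (⇑((Matrix.mulVecLin (Matrix.GeneralLinearGroup.mkOfDetNeZero _ hdet).1).restrictScalars
      ℤ_[p]) ∘ ⇑(Pi.basisFun ℚ_[p] (Fin 2))) = L.subtype ∘ b := funext h
  rw [h2, Set.range_comp, ← Submodule.map_span, b.span_eq, Submodule.map_top, Submodule.range_subtype]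

lemma exists_smul_v0 (v : Vertex p) : ∃ g : GL (Fin 2) ℚ_[p], g • v0 p = v := by
  induction v using Quotient.inductionOn with | h L
  obtain ⟨g, rfl⟩ := exists_smul_latticeZero L
  exact ⟨g, rfl⟩

lemma exists_nb_smul {e : Edge p} {g : GL (Fin 2) ℚ_[p]} (he : e.fst = g • v0 p) :
    ∃ i : Option (Fin p), e = (g * nb i) • e0 p := by
  obtain ⟨i, hi⟩ := exists_nb (e := g⁻¹ • e) (by rw [smul_fst, he, inv_smul_smul])
  exact ⟨i, by rw [mul_smul, ← hi, smul_inv_smul]⟩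

lemma exists_smul_e0 (e : Edge p) : ∃ g : GL (Fin 2) ℚ_[p], g • e0 p = e := by
  obtain ⟨g, hg⟩ := exists_smul_v0 e.fst
  obtain ⟨i, hi⟩ := exists_nb_smul hg.symm
  exact ⟨_, hi.symm⟩

lemma nb_smul_fst (g : GL (Fin 2) ℚ_[p]) (i : Option (Fin p)) :
    ((g * nb i) • e0 p).fst = g • v0 p := by
  rw [mul_smul, smul_fst, nb_fst]

lemma smul_w0_e0 (g : GL (Fin 2) ℚ_[p]) : (g * w0 p) • e0 p = (g • e0 p).symm := by
  rw [mul_smul, w0_smul_e0, smul_symm]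

lemma finsum_edges {M : Type*} [AddCommMonoid M] (g : GL (Fin 2) ℚ_[p]) (f : Edge p → M) :
    ∑ᶠ e ∈ {e : Edge p | e.fst = g • v0 p}, f e =
      f (g • e0 p).symm + ∑ j : Fin p, f ((g * hm (j : ℕ)) • e0 p) := by
  have hset : {e : Edge p | e.fst = g • v0 p} =
      Set.range (fun i : Option (Fin p) => (g * nb i) • e0 p) := by
    ext e
    constructor
    · intro h
      obtain ⟨i, hi⟩ := exists_nb_smul h
      exact ⟨i, hi.symm⟩
    · rintro ⟨i, rfl⟩
      exact nb_smul_fst g i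
  have hinj : Function.Injective (fun i : Option (Fin p) => (g * nb i) • e0 p) := by
    intro i j h
    simp only [mul_smul] at h
    exact nb_injective (smul_left_cancel g h)
  rw [hset, finsum_mem_range hinj, finsum_eq_sum_of_fintype, Fintype.sum_option]
  rw [← smul_w0_e0]
  rfl

/-! ### Generation of `GL₂(ℚ_p)` and connectedness of the tree -/

/-- The matrix that exchanges the two coordinates. -/
def sw : GL (Fin 2) ℚ_[p] := mat 0 1 1 0 (by simp)

lemma sw_sq : (sw : GL (Fin 2) ℚ_[p]) * sw = 1 := by
  apply gl_ext
  · rw [mul_00]; simp [sw]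
  · rw [mul_01]; simp [sw]
  · rw [mul_10]; simp [sw]
  · rw [mul_11]; simp [sw]

/-- The matrix with rows `(p ^ m, x)` and `(0, 1)`. -/
def aff (m : ℤ) (x : ℚ_[p]) : GL (Fin 2) ℚ_[p] :=
  mat ((p : ℚ_[p]) ^ m) x 0 1 (by simpa using zpow_ne_zero m p_ne_zero)

lemma aff_mul_aff (m n : ℤ) (x y : ℚ_[p]) : aff m x * aff n y = aff (m + n) ((p : ℚ_[p]) ^ m * y + x) := by
  have hp := p_ne_zero (p := p)
  apply gl_ext
  · rw [mul_00]; simp [aff, zpow_add₀ hp]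
  · rw [mul_01]; simp [aff]
  · rw [mul_10]; simp [aff]
  · rw [mul_11]; simp [aff]

lemma hm_eq_aff (x : ℚ_[p]) : hm x = aff 1 x := by
  apply gl_ext <;> simp [aff, hm]

lemma aff_zero_zero : (aff 0 0 : GL (Fin 2) ℚ_[p]) = 1 := by
  apply gl_ext <;> simp [aff]

lemma exists_zpow_norm {x : ℚ_[p]} (hx : x ≠ 0) : ∃ m : ℤ, ‖x‖ = ‖(p : ℚ_[p]) ^ m‖ := by
  refine ⟨x.valuation, ?_⟩
  rw [Padic.norm_p_zpow, Padic.norm_eq_zpow_neg_valuation hx]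

lemma Iw_of_norm {a b c d : ℚ_[p]} (h) (h1 : ‖a‖ = ‖d‖) (h2 : ‖b‖ ≤ ‖d‖) (h3 : ‖c‖ < ‖d‖) :
    Iw (mat a b c d h) := ⟨h1, h2, h3⟩

lemma Maxl_iff_exists {g : GL (Fin 2) ℚ_[p]} (hg : Maxl g) :
    Iw g ∨ ∃ u u', Iw u ∧ Iw u' ∧ g = u * sw * u' := by
  obtain ⟨a, ha, hd⟩ := hg
  have ha0 : 0 < ‖(a : ℚ_[p])‖ := norm_pos_iff.2 a.ne_zero
  rcases (ha 1 0).lt_or_eq with hlt | heq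
  · left
    have hlt' : ‖g 0 1 * g 1 0‖ < ‖(a : ℚ_[p])‖ ^ 2 := by
      rw [norm_mul, sq]
      exact (mul_le_mul_of_nonneg_right (ha 0 1) (norm_nonneg _)).trans_lt
        (mul_lt_mul_of_pos_left hlt ha0)
    have h1 : ‖g 0 0‖ * ‖g 1 1‖ = ‖(a : ℚ_[p])‖ ^ 2 := by
      rw [← norm_mul, show g 0 0 * g 1 1 = gdet g + g 0 1 * g 1 0 by rw [gdet]; ring,
        norm_add_eq_left (by rwa [hd]), hd]
    have h00 : ‖g 0 0‖ = ‖(a : ℚ_[p])‖ := by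
      refine le_antisymm (ha 0 0) (not_lt.1 fun hlt => h1.not_lt ?_)
      rw [sq]
      exact (mul_le_mul_of_nonneg_left (ha 1 1) (norm_nonneg _)).trans_lt
        (mul_lt_mul_of_pos_right hlt ha0)
    have h11 : ‖g 1 1‖ = ‖(a : ℚ_[p])‖ := by
      rw [h00, sq] at h1
      exact mul_left_cancel₀ ha0.ne' h1
    exact ⟨h00.trans h11.symm, (ha 0 1).trans h11.ge, hlt.trans_le h11.ge⟩
  · right
    have hc : g 1 0 ≠ 0 := norm_pos_iff.1 (by rw [heq]; exact ha0)
    refine ⟨mat (-gdet g / g 1 0) (g 0 0) 0 (g 1 0) ?_, mat 1 (g 1 1 / g 1 0) 0 1 (by simp),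
      Iw_of_norm _ ?_ ?_ ?_, Iw_of_norm _ rfl ?_ (by simp), ?_⟩
    · simpa [hc] using gdet_ne_zero g
    · rw [norm_div, norm_neg, hd, heq, sq, mul_div_cancel_right₀ _ ha0.ne']
    · rw [heq]; exact ha 0 0
    · rw [norm_zero, heq]; exact ha0
    · rw [norm_div, heq, norm_one, div_le_one ha0]
      exact ha 1 1
    · apply gl_ext
      · rw [mul_00, mul_00, mul_01]; simp [sw]
      · rw [mul_01, mul_00, mul_01]; simp [sw]; field_simp; rw [gdet]; ring
      · rw [mul_10, mul_10, mul_11]; simp [sw]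
      · rw [mul_11, mul_10, mul_11]; simp [sw]; field_simp

lemma Maxl.mul {g h : GL (Fin 2) ℚ_[p]} (hg : Maxl g) (hh : Maxl h) : Maxl (g * h) := by
  rw [← smul_v0_eq_iff] at *
  rw [mul_smul, hh, hg]

lemma Maxl.inv {g : GL (Fin 2) ℚ_[p]} (hg : Maxl g) : Maxl g⁻¹ := by
  rw [← smul_v0_eq_iff] at *
  rw [inv_smul_eq_iff, hg]

lemma Maxl_one : Maxl (1 : GL (Fin 2) ℚ_[p]) := by
  rw [← smul_v0_eq_iff, one_smul]

lemma Maxl_sw : Maxl (sw : GL (Fin 2) ℚ_[p]) := by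
  refine ⟨1, fun i j => ?_, by simp [sw, gdet]⟩
  fin_cases i <;> fin_cases j <;> simp [sw]

/-- The diagonal matrix with entries `1` and `p ^ n`. -/
def dg (n : ℕ) : GL (Fin 2) ℚ_[p] := mat 1 0 0 ((p : ℚ_[p]) ^ n) (by simpa using pow_ne_zero n p_ne_zero)

lemma dg_succ (n : ℕ) : (dg (n + 1) : GL (Fin 2) ℚ_[p]) = dg n * (w0 p * sw) := by
  apply gl_ext
  · rw [mul_00, mul_00]; simp [dg, sw, w0_eq]
  · rw [mul_01, mul_01]; simp [dg, sw, w0_eq]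
  · rw [mul_10, mul_10]; simp [dg, sw, w0_eq]
  · rw [mul_11, mul_11]; simp [dg, sw, w0_eq, pow_succ]

lemma cartan_aux (g : GL (Fin 2) ℚ_[p]) (h0 : g 0 0 ≠ 0) (h : ∀ i j, ‖g i j‖ ≤ ‖g 0 0‖) :
    ∃ k k' : GL (Fin 2) ℚ_[p], ∃ n : ℕ, Maxl k ∧ Maxl k' ∧ g = k * dg n * k' := by
  have hp := p_ne_zero (p := p)
  have ha0 : 0 < ‖g 0 0‖ := norm_pos_iff.2 h0
  have hd := gdet_ne_zero g
  obtain ⟨m, hm⟩ := exists_zpow_norm (div_ne_zero hd (mul_ne_zero h0 h0))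
  have hle : ‖gdet g / (g 0 0 * g 0 0)‖ ≤ 1 := by
    rw [norm_div, div_le_one (by rw [norm_mul]; positivity)]
    refine norm_sub_le_of ?_ ?_ <;> rw [norm_mul, norm_mul]
    · exact mul_le_mul le_rfl (h 1 1) (norm_nonneg _) ha0.le
    · exact mul_le_mul (h 0 1) (h 1 0) (norm_nonneg _) ha0.le
  obtain ⟨n, rfl⟩ : ∃ n : ℕ, m = n := by
    refine ⟨m.toNat, (Int.toNat_of_nonneg ?_).symm⟩
    rw [hm, Padic.norm_p_zpow] at hle
    by_contra hneg
    exact (one_lt_zpow₀ one_lt_p (n := -m) (by omega)).not_ge hle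
  rw [zpow_natCast] at hm
  have hpn : (p : ℚ_[p]) ^ n ≠ 0 := pow_ne_zero n hp
  have hδ : ‖gdet g / (g 0 0 * (p : ℚ_[p]) ^ n)‖ = ‖g 0 0‖ := by
    have : gdet g / (g 0 0 * (p : ℚ_[p]) ^ n) =
      (gdet g / (g 0 0 * g 0 0)) / (p : ℚ_[p]) ^ n * g 0 0 := by field_simp
    rw [this, norm_mul, norm_div, hm, div_self (norm_ne_zero_iff.2 hpn), one_mul]
  refine ⟨mat 1 0 (g 1 0 / g 0 0) 1 (by simp), mat (g 0 0) (g 0 1) 0 (gdet g / (g 0 0 * (p : ℚ_[p]) ^ n))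
    (by simp [h0, hd, hp]), n, ⟨1, ?_, by simp [gdet]⟩, Iw.maxl (Iw_of_norm _ hδ.symm ?_ ?_), ?_⟩
  · intro i j
    fin_cases i <;> fin_cases j
    · simp
    · simp
    · simpa using div_le_one_of_le₀ (h 1 0) (norm_nonneg _)
    · simp
  · rw [hδ]; exact h 0 1
  · rw [hδ, norm_zero]; exact ha0
  · apply gl_ext
    · rw [mul_00, mul_00, mul_01]; simp [dg]
    · rw [mul_01, mul_00, mul_01]; simp [dg]
    · rw [mul_10, mul_10, mul_11]; simp [dg, h0]
    · rw [mul_11, mul_10, mul_11]; simp [dg]; field_simp; rw [gdet]; ring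

/-- The Cartan decomposition. -/
lemma cartan (g : GL (Fin 2) ℚ_[p]) :
    ∃ k k' : GL (Fin 2) ℚ_[p], ∃ n : ℕ, Maxl k ∧ Maxl k' ∧ g = k * dg n * k' := by
  obtain ⟨⟨i, j⟩, -, hij⟩ := Finset.exists_max_image (Finset.univ : Finset (Fin 2 × Fin 2))
    (fun x => ‖g x.1 x.2‖) ⟨(0, 0), Finset.mem_univ _⟩
  have hmax : ∀ a b, ‖g a b‖ ≤ ‖g i j‖ := fun a b => hij (a, b) (Finset.mem_univ _)
  have key : ∀ s t : GL (Fin 2) ℚ_[p], Maxl s → Maxl t → s * s = 1 → t * t = 1 →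
      (∀ a b, ∃ a' b', (s * g * t) a b = g a' b') → (s * g * t) 0 0 = g i j →
      ∃ k k' : GL (Fin 2) ℚ_[p], ∃ n : ℕ, Maxl k ∧ Maxl k' ∧ g = k * dg n * k' := by
    intro s t hs ht hss htt hst h00
    have hle : ∀ a b, ‖(s * g * t) a b‖ ≤ ‖(s * g * t) 0 0‖ := by
      intro a b
      obtain ⟨a', b', h⟩ := hst a b
      rw [h, h00]; exact hmax _ _
    obtain ⟨k, k', n, hk, hk', h⟩ := cartan_aux (s * g * t) (fun h0 => by
      rw [h0, norm_zero] at hle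
      have hz : ∀ a b, (s * g * t) a b = 0 := fun a b => norm_le_zero_iff.1 (hle a b)
      exact gdet_ne_zero (s * g * t) (by rw [gdet, hz, hz 0 1, zero_mul, zero_mul, sub_zero])) hle
    refine ⟨s * k, k' * t, n, hs.mul hk, hk'.mul ht, ?_⟩
    rw [show s * k * dg n * (k' * t) = s * (k * dg n * k') * t by group, ← h,
      show s * (s * g * t) * t = (s * s) * g * (t * t) by group, hss, htt, one_mul, mul_one]
  have e : ∀ (h : GL (Fin 2) ℚ_[p]) (b : Fin 2), (h * sw : GL (Fin 2) ℚ_[p]) 0 b = h 0 (1 - b) ∧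
      (h * sw : GL (Fin 2) ℚ_[p]) 1 b = h 1 (1 - b) ∧
      (sw * h : GL (Fin 2) ℚ_[p]) 0 b = h 1 b ∧ (sw * h : GL (Fin 2) ℚ_[p]) 1 b = h 0 b := by
    intro h b
    fin_cases b
    · exact ⟨by simp [mul_00, sw], by simp [mul_10, sw], by simp [mul_00, sw], by simp [mul_10, sw]⟩
    · exact ⟨by simp [mul_01, sw], by simp [mul_11, sw], by simp [mul_01, sw], by simp [mul_11, sw]⟩
  fin_cases i <;> fin_cases j
  · exact key 1 1 Maxl_one Maxl_one (one_mul 1) (one_mul 1) (fun a b => ⟨a, b, by simp⟩) (by simp)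
  · refine key 1 sw Maxl_one Maxl_sw (one_mul 1) sw_sq (fun a b => ?_) ?_
    · rw [one_mul]
      fin_cases a
      exacts [⟨_, _, (e g b).1⟩, ⟨_, _, (e g b).2.1⟩]
    · rw [one_mul, (e g 0).1]; rfl
  · refine key sw 1 Maxl_sw Maxl_one sw_sq (one_mul 1) (fun a b => ?_) ?_
    · rw [mul_one]
      fin_cases a
      exacts [⟨_, _, (e g b).2.2.1⟩, ⟨_, _, (e g b).2.2.2⟩]
    · rw [mul_one, (e g 0).2.2.1]; rfl
  · refine key sw sw Maxl_sw Maxl_sw sw_sq sw_sq (fun a b => ?_) ?_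
    · fin_cases a
      exacts [⟨_, _, (e _ b).1.trans (e g _).2.2.1⟩, ⟨_, _, (e _ b).2.1.trans (e g _).2.2.2⟩]
    · rw [(e _ 0).1, (e g _).2.2.1]; rfl

lemma gl_eq_top {S : Subgroup (GL (Fin 2) ℚ_[p])} (hI : ∀ u, Iw u → u ∈ S) (hs : sw ∈ S)
    (hw : w0 p ∈ S) (g : GL (Fin 2) ℚ_[p]) : g ∈ S := by
  have hM : ∀ u, Maxl u → u ∈ S := by
    intro u hu
    rcases Maxl_iff_exists hu with h | ⟨v, v', hv, hv', rfl⟩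
    · exact hI u h
    · exact S.mul_mem (S.mul_mem (hI v hv) hs) (hI v' hv')
  have hd : ∀ n, dg n ∈ S := by
    intro n
    induction n with
    | zero => convert S.one_mem; apply gl_ext <;> simp [dg]
    | succ n ih => rw [dg_succ]; exact S.mul_mem ih (S.mul_mem hw hs)
  obtain ⟨k, k', n, hk, hk', rfl⟩ := cartan g
  exact S.mul_mem (S.mul_mem (hM k hk) (hd n)) (hM k' hk')

lemma reachable_smul (g : GL (Fin 2) ℚ_[p]) {v w : Vertex p} (h : (tree p).Reachable v w) :
    (tree p).Reachable (g • v) (g • w) := by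
  obtain ⟨q⟩ := h
  induction q with
  | nil => exact SimpleGraph.Reachable.refl _
  | cons h _ ih => exact (tree_adj_smul g h).reachable.trans ih

lemma reachable_v0 (v : Vertex p) : (tree p).Reachable (v0 p) v := by
  obtain ⟨g, rfl⟩ := exists_smul_v0 v
  let S : Subgroup (GL (Fin 2) ℚ_[p]) :=
    { carrier := {g | (tree p).Reachable (v0 p) (g • v0 p)}
      one_mem' := by rw [Set.mem_ofPred_eq, one_smul]
      mul_mem' := fun {g h} hg hh => by
        rw [Set.mem_ofPred_eq, mul_smul]
        exact SimpleGraph.Reachable.trans hg (reachable_smul g hh)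
      inv_mem' := fun {g} hg => by
        have := reachable_smul g⁻¹ hg
        rw [inv_smul_smul] at this
        exact this.symm }
  refine gl_eq_top (S := S) (fun u hu => ?_) ?_ ?_ g
  · change (tree p).Reachable (v0 p) (u • v0 p)
    rw [(smul_v0_eq_iff u).2 hu.maxl]
  · change (tree p).Reachable (v0 p) (sw • v0 p)
    rw [(smul_v0_eq_iff _).2 Maxl_sw]
  · exact v0_adj_w0.reachable

lemma reachable (v w : Vertex p) : (tree p).Reachable v w :=
  (reachable_v0 v).symm.trans (reachable_v0 w)

/-! ### Balls -/

lemma mem_ball_smul (g : GL (Fin 2) ℚ_[p]) (e : Edge p) (x : OnePoint ℚ_[p]) :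
    letI := Classical.decEq ℚ_[p]
    x ∈ ball (g • e) ↔ g⁻¹ • x ∈ ball e := by
  classical
  constructor
  · rintro ⟨h, h1, h2, z, rfl⟩
    refine ⟨g⁻¹ * h, ?_, ?_, z, ?_⟩
    · rw [mul_smul, h1, smul_fst, inv_smul_smul]
    · rw [mul_smul, h2, smul_snd, inv_smul_smul]
    · rw [mul_smul]
  · rintro ⟨h, h1, h2, z, hz⟩
    refine ⟨g * h, ?_, ?_, z, ?_⟩
    · rw [mul_smul, h1, smul_fst]
    · rw [mul_smul, h2, smul_snd]
    · rw [mul_smul, ← hz, smul_inv_smul]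

lemma ball_e0 (x : OnePoint ℚ_[p]) : x ∈ ball (e0 p) ↔ ∃ z : ℚ_[p], ‖z‖ ≤ 1 ∧ x = z := by
  classical
  constructor
  · rintro ⟨u, h1, h2, z, rfl⟩
    have hu : Iw u := by
      rw [← smul_e0_eq_iff]
      exact edge_ext h1 h2
    have hz : ‖(z : ℚ_[p])‖ ≤ 1 := z.2
    have hlt : ‖u 1 0 * z‖ < ‖u 1 1‖ := by
      rw [norm_mul]
      exact (mul_le_of_le_one_right (norm_nonneg _) hz).trans_lt hu.2.2
    have hden : ‖u 1 0 * z + u 1 1‖ = ‖u 1 1‖ := by rw [add_comm, norm_add_eq_left hlt]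
    have hne : u 1 0 * z + u 1 1 ≠ 0 := norm_pos_iff.1 (by rw [hden]; exact norm_pos_iff.2 hu.ne_zero)
    refine ⟨(u 0 0 * z + u 0 1) / (u 1 0 * z + u 1 1), ?_, ?_⟩
    · rw [norm_div, hden, div_le_one (norm_pos_iff.2 hu.ne_zero)]
      refine norm_add_le_of ?_ hu.2.1
      rw [norm_mul, hu.1]
      exact mul_le_of_le_one_right (norm_nonneg _) hz
    · rw [OnePoint.smul_some_eq_ite, if_neg hne]
  · rintro ⟨z, hz, rfl⟩
    exact ⟨1, one_smul _ _, one_smul _ _, ⟨z, hz⟩, (one_smul _ _).symm⟩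

/-- The vector `(x, y)` lies over a point of `g • ℤ_p`. -/
def InCone (g : GL (Fin 2) ℚ_[p]) (x y : ℚ_[p]) : Prop :=
  ‖g 1 1 * x - g 0 1 * y‖ ≤ ‖g 0 0 * y - g 1 0 * x‖

lemma coe_mem_ball (g : GL (Fin 2) ℚ_[p]) (x : ℚ_[p]) :
    (x : OnePoint ℚ_[p]) ∈ ball (g • e0 p) ↔ InCone g x 1 := by
  classical
  have hd := gdet_ne_zero g
  have e1 : g⁻¹ 1 0 * x + g⁻¹ 1 1 = (g 0 0 * 1 - g 1 0 * x) / gdet g := by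
    rw [gl_inv]; simp only [mat_10, mat_11]; ring
  have e2 : g⁻¹ 0 0 * x + g⁻¹ 0 1 = (g 1 1 * x - g 0 1 * 1) / gdet g := by
    rw [gl_inv]; simp only [mat_00, mat_01]; ring
  rw [mem_ball_smul, ball_e0, InCone]
  by_cases h1 : g 0 0 * 1 - g 1 0 * x = 0
  · rw [OnePoint.smul_some_eq_ite, if_pos (by rw [e1, h1, zero_div]), h1, norm_zero, norm_le_zero_iff]
    constructor
    · rintro ⟨z, -, hz⟩
      exact (OnePoint.infty_ne_coe z hz).elim
    · intro h2
      exact (hd (by rw [gdet]; linear_combination (g 1 1) * h1 + g 1 0 * h2)).elim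
  · rw [OnePoint.smul_some_eq_ite, if_neg (by rw [e1]; exact div_ne_zero h1 hd), e1, e2,
      div_div_div_cancel_right₀ hd]
    constructor
    · rintro ⟨z, hz, hz'⟩
      rw [← OnePoint.coe_injective hz', norm_div, div_le_one (norm_pos_iff.2 h1)] at hz
      exact hz
    · intro h
      exact ⟨_, by rwa [norm_div, div_le_one (norm_pos_iff.2 h1)], rfl⟩

lemma infty_mem_ball (g : GL (Fin 2) ℚ_[p]) :
    OnePoint.infty ∈ ball (g • e0 p) ↔ ‖g 1 1‖ ≤ ‖g 1 0‖ := by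
  classical
  have hd := gdet_ne_zero g
  have e1 : g⁻¹ 1 0 = -g 1 0 / gdet g := by rw [gl_inv, mat_10]
  have e2 : g⁻¹ 0 0 = g 1 1 / gdet g := by rw [gl_inv, mat_00]
  rw [mem_ball_smul, ball_e0]
  by_cases h1 : g 1 0 = 0
  · rw [OnePoint.smul_infty_eq_ite, if_pos (by rw [e1, h1, neg_zero, zero_div])]
    rw [h1, norm_zero, norm_le_zero_iff]
    constructor
    · rintro ⟨z, -, hz⟩
      exact (OnePoint.infty_ne_coe z hz).elim
    · intro h2
      exact (hd (by rw [gdet, h1, h2]; ring)).elim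
  · have h3 : -g 1 0 ≠ 0 := neg_ne_zero.2 h1
    rw [OnePoint.smul_infty_eq_ite, if_neg (by rw [e1]; exact div_ne_zero h3 hd), e1, e2,
      div_div_div_cancel_right₀ hd]
    have h2 : ‖g 1 1 / -g 1 0‖ ≤ 1 ↔ ‖g 1 1‖ ≤ ‖g 1 0‖ := by
      rw [norm_div, norm_neg, div_le_one (norm_pos_iff.2 h1)]
    rw [← h2]
    constructor
    · rintro ⟨z, hz, hz'⟩
      rwa [← OnePoint.coe_injective hz'] at hz
    · intro h
      exact ⟨_, h, rfl⟩

/-! ### The tree is acyclic -/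

lemma ball_hm_lt {j : ℕ} : ball ((hm (j : ℚ_[p])) • e0 p) ⊂ ball (e0 p) := by
  have hp := p_ne_zero (p := p)
  have hj : ‖(j : ℚ_[p])‖ ≤ 1 := IsUltrametricDist.norm_natCast_le_one _ _
  have hc : ∀ x : ℚ_[p], (x : OnePoint ℚ_[p]) ∈ ball ((hm (j : ℚ_[p])) • e0 p) ↔ ‖x - j‖ < 1 := by
    intro x
    rw [coe_mem_ball, InCone, norm_lt_one_iff']
    simp [hm, Padic.norm_p]
  refine (Set.ssubset_iff_of_subset ?_).2 ?_
  · intro x hx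
    rw [ball_e0]
    induction x using OnePoint.rec with
    | infty =>
      rw [infty_mem_ball] at hx
      simp [hm] at hx
      exact absurd hx (by norm_num)
    | coe x =>
      rw [hc] at hx
      refine ⟨x, ?_, rfl⟩
      have := norm_add_le_of hx.le hj
      rwa [sub_add_cancel] at this
  · refine ⟨((j + 1 : ℚ_[p]) : OnePoint ℚ_[p]), (ball_e0 _).2 ⟨_, norm_add_le_of hj (by simp), rfl⟩, ?_⟩
    rw [hc]
    simp

lemma ball_smul_lt {e f : Edge p} (g : GL (Fin 2) ℚ_[p]) (h : ball e ⊂ ball f) :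
    ball (g • e) ⊂ ball (g • f) := by
  classical
  refine (Set.ssubset_iff_of_subset ?_).2 ?_
  · intro x hx
    rw [mem_ball_smul] at *
    exact h.subset hx
  · obtain ⟨x, hx, hx'⟩ := Set.exists_of_ssubset h
    refine ⟨g • x, ?_, ?_⟩
    · rw [mem_ball_smul, inv_smul_smul]; exact hx
    · rw [mem_ball_smul, inv_smul_smul]; exact hx'

lemma ball_lt_of_next {e f : Edge p} (h : f.fst = e.snd) (hne : f ≠ e.symm) : ball f ⊂ ball e := by
  obtain ⟨g, rfl⟩ := exists_smul_e0 e
  obtain ⟨i, rfl⟩ := exists_nb_smul h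
  cases i with
  | none => exact (hne (smul_w0_e0 g)).elim
  | some j =>
    rw [mul_smul]
    exact ball_smul_lt g ball_hm_lt

lemma exists_last_dart {v w : Vertex p} (q : (tree p).Walk v w) (d : Edge p) (hd : d.snd = v)
    (hn : (d.edge :: q.edges).Nodup) (hq : ¬ q.Nil) :
    ∃ l ∈ q.darts, l.snd = w ∧ ball l ⊂ ball d := by
  induction q generalizing d with
  | nil => exact (hq SimpleGraph.Walk.Nil.nil).elim
  | @cons u v w h q ih =>
    let d' : Edge p := ⟨(u, v), h⟩
    have hlt : ball d' ⊂ ball d := by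
      refine ball_lt_of_next hd.symm fun h' => ?_
      have h1 : d'.edge = d.edge := by rw [h', SimpleGraph.Dart.edge_symm]
      rw [SimpleGraph.Walk.edges_cons, List.nodup_cons] at hn
      exact hn.1 (by rw [← h1]; exact List.mem_cons_self)
    by_cases hnil : q.Nil
    · obtain rfl : v = w := hnil.eq
      exact ⟨d', by simp [d'], rfl, hlt⟩
    · obtain ⟨l, hl, hl', hl2⟩ := ih d' rfl (by
        rw [SimpleGraph.Walk.edges_cons, List.nodup_cons] at hn
        exact hn.2) hnil
      exact ⟨l, by rw [SimpleGraph.Walk.darts_cons]; exact List.mem_cons_of_mem _ hl, hl',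
        hl2.trans hlt⟩

lemma tree_acyclic : (tree p).IsAcyclic := by
  intro v c hc
  cases c with
  | nil => exact hc.not_nil SimpleGraph.Walk.Nil.nil
  | @cons _ u _ h q =>
    let d : Edge p := ⟨(v, u), h⟩
    have hn : (d.edge :: q.edges).Nodup := hc.isTrail.edges_nodup
    have hq : ¬ q.Nil := fun hq => h.ne hq.eq.symm
    obtain ⟨l, hl, hl', hl2⟩ := exists_last_dart q d rfl hn hq
    refine (hl2.trans (ball_lt_of_next (e := l) (f := d) hl'.symm fun h' => ?_)).ne rfl
    rw [List.nodup_cons] at hn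
    refine hn.1 ?_
    rw [h', SimpleGraph.Dart.edge_symm]
    exact List.mem_map_of_mem hl

/-! ### Path sums -/

section pathSum
variable {V : Type} [AddCommGroup V] {c : Edge p → V}

lemma exists_path (v w : Vertex p) : ∃ q : (tree p).Walk v w, q.IsPath := by
  classical
  obtain ⟨q⟩ := reachable v w
  exact ⟨q.bypass, q.bypass_isPath⟩

lemma path_unique {v w : Vertex p} {q q' : (tree p).Walk v w} (h : q.IsPath) (h' : q'.IsPath) :
    q = q' :=
  congrArg Subtype.val ((tree_acyclic.subsingleton_path v w).elim ⟨q, h⟩ ⟨q', h'⟩)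

lemma pathSum_eq {v w : Vertex p} (q : (tree p).Walk v w) (hq : q.IsPath) :
    pathSum c v w = (q.darts.map c).sum := by
  have h : ∃ q : (tree p).Walk v w, q.IsPath := ⟨q, hq⟩
  rw [pathSum, dif_pos h, path_unique h.choose_spec hq]

lemma pathSum_self (v : Vertex p) : pathSum c v v = 0 := by
  rw [pathSum_eq SimpleGraph.Walk.nil SimpleGraph.Walk.IsPath.nil]; rfl

lemma pathSum_edge (hc : ∀ e, c e.symm = -c e) (v : Vertex p) (e : Edge p) :
    pathSum c v e.snd = pathSum c v e.fst + c e := by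
  classical
  obtain ⟨q, hq⟩ := exists_path v e.fst
  by_cases h : e.snd ∈ q.support
  · have h1 := hq.takeUntil h
    have h2 := hq.dropUntil h
    have h3 : (SimpleGraph.Walk.cons e.adj.symm SimpleGraph.Walk.nil).IsPath := by
      simp [e.adj.ne.symm]
    have h4 := path_unique h2 h3
    have h5 : q.darts = (q.takeUntil _ h).darts ++ [e.symm] := by
      conv_lhs => rw [← q.take_spec h, SimpleGraph.Walk.darts_append, h4]
      rfl
    rw [pathSum_eq q hq, pathSum_eq _ h1, h5]
    simp [hc]
  · have h1 : (q.concat e.adj).IsPath := hq.concat h e.adj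
    rw [pathSum_eq q hq, pathSum_eq _ h1]
    simp

lemma pathSum_of_potential (f : Vertex p → V) (hf : ∀ e : Edge p, c e = f e.snd - f e.fst)
    (v w : Vertex p) : pathSum c v w = f w - f v := by
  have key : ∀ {v w : Vertex p} (q : (tree p).Walk v w), (q.darts.map c).sum = f w - f v := by
    intro v w q
    induction q with
    | nil => simp
    | cons h q ih =>
      rw [SimpleGraph.Walk.darts_cons, List.map_cons, List.sum_cons, ih, hf]
      abel
  obtain ⟨q, hq⟩ := exists_path v w
  rw [pathSum_eq q hq, key]

lemma pathSum_trans (hc : ∀ e, c e.symm = -c e) (u v w : Vertex p) :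
    pathSum c u w = pathSum c u v + pathSum c v w := by
  rw [pathSum_of_potential (c := c) (pathSum c u) (fun e => by
    rw [pathSum_edge hc, add_sub_cancel_left]) v w, add_sub_cancel]

end pathSum

/-! ### Normal forms of balls -/

lemma coe_mem_ball_aff (m : ℤ) (a x : ℚ_[p]) :
    (x : OnePoint ℚ_[p]) ∈ ball (aff m a • e0 p) ↔ ‖x - a‖ ≤ (p : ℝ) ^ (-m) := by
  rw [coe_mem_ball, InCone, ← Padic.norm_p_zpow]
  simp [aff]

lemma infty_notMem_ball_aff (m : ℤ) (a : ℚ_[p]) : OnePoint.infty ∉ ball (aff m a • e0 p) := by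
  rw [infty_mem_ball]
  simp [aff]

lemma finBall_aff (m : ℤ) (a : ℚ_[p]) :
    finBall (aff m a • e0 p) = Metric.closedBall a ((p : ℝ) ^ (-m)) := by
  ext x
  rw [finBall, Set.mem_ofPred_eq, coe_mem_ball_aff, Metric.mem_closedBall, dist_eq_norm]

lemma radius_aff (m : ℤ) (a : ℚ_[p]) : radius (aff m a • e0 p) = (p : ℝ) ^ (-m) := by
  have hpos : (0 : ℝ) < (p : ℝ) ^ (-m) := zpow_pos p_pos _
  rw [radius, if_neg (infty_notMem_ball_aff m a), finBall_aff]
  refine le_antisymm (Metric.diam_le_of_forall_dist_le hpos.le ?_) ?_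
  · intro x hx y hy
    rw [Metric.mem_closedBall] at hx hy
    rw [dist_comm] at hy
    exact (dist_triangle_max x a y).trans (max_le hx hy)
  · have := Metric.dist_le_diam_of_mem (s := Metric.closedBall a ((p : ℝ) ^ (-m)))
      Metric.isBounded_closedBall (x := a + (p : ℚ_[p]) ^ m) (y := a)
      (by rw [Metric.mem_closedBall, dist_eq_norm, add_sub_cancel_left, Padic.norm_p_zpow])
      (Metric.mem_closedBall_self hpos.le)
    rwa [dist_eq_norm, add_sub_cancel_left, Padic.norm_p_zpow] at this

lemma exists_aff {e : Edge p} (h : OnePoint.infty ∉ ball e) {a : ℚ_[p]} (ha : a ∈ finBall e) :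
    ∃ m : ℤ, e = aff m a • e0 p := by
  have hp := p_ne_zero (p := p)
  obtain ⟨g, rfl⟩ := exists_smul_e0 e
  rw [infty_mem_ball, not_le] at h
  have ha' : InCone g a 1 := (coe_mem_ball g a).1 ha
  rw [InCone, mul_one, mul_one] at ha'
  have hd : g 1 1 ≠ 0 := norm_pos_iff.1 ((norm_nonneg _).trans_lt h)
  have h0 : g 0 0 - g 1 0 * a ≠ 0 := by
    intro h0
    rw [h0, norm_zero, norm_le_zero_iff] at ha'
    exact gdet_ne_zero g (by rw [gdet]; linear_combination (g 1 1) * h0 + g 1 0 * ha')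
  obtain ⟨m, hm⟩ := exists_zpow_norm (div_ne_zero h0 hd)
  have hpm : (p : ℚ_[p]) ^ m ≠ 0 := zpow_ne_zero m hp
  refine ⟨m, (smul_e0_eq_smul_iff _ _).2 ?_⟩
  have hdet : ((g 0 0 - g 1 0 * a) / (p : ℚ_[p]) ^ m) * g 1 1 -
      ((g 0 1 - a * g 1 1) / (p : ℚ_[p]) ^ m) * g 1 0 ≠ 0 := by
    rw [show ((g 0 0 - g 1 0 * a) / (p : ℚ_[p]) ^ m) * g 1 1 -
      ((g 0 1 - a * g 1 1) / (p : ℚ_[p]) ^ m) * g 1 0 = gdet g / (p : ℚ_[p]) ^ m by rw [gdet]; ring]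
    exact div_ne_zero (gdet_ne_zero g) hpm
  have e : (aff m a)⁻¹ * g = mat ((g 0 0 - g 1 0 * a) / (p : ℚ_[p]) ^ m)
      ((g 0 1 - a * g 1 1) / (p : ℚ_[p]) ^ m) (g 1 0) (g 1 1) hdet := by
    rw [inv_mul_eq_iff_eq_mul]
    apply gl_ext
    · rw [mul_00]; simp [aff]; field_simp; ring
    · rw [mul_01]; simp [aff]; field_simp; ring
    · rw [mul_10]; simp [aff]
    · rw [mul_11]; simp [aff]
  have h1 : ‖(g 0 0 - g 1 0 * a) / (p : ℚ_[p]) ^ m‖ = ‖g 1 1‖ := by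
    rw [norm_div, ← hm, norm_div, div_div_cancel₀ (norm_ne_zero_iff.2 h0)]
  rw [e]
  refine ⟨h1, ?_, h⟩
  simp only [mat_01, mat_11]
  rw [← h1, norm_div, norm_div]
  gcongr
  rwa [norm_sub_rev, mul_comm a]

variable (p) in
/-- The matrix with rows `(0, 1)` and `(p ^ m, 0)`. -/
def iaff (m : ℤ) : GL (Fin 2) ℚ_[p] :=
  mat 0 1 ((p : ℚ_[p]) ^ m) 0 (by simpa using zpow_ne_zero m p_ne_zero)

lemma coe_mem_ball_iaff (m : ℤ) (x : ℚ_[p]) :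
    (x : OnePoint ℚ_[p]) ∈ ball (iaff p m • e0 p) ↔ (p : ℝ) ^ m ≤ ‖x‖ := by
  have hpos : (0 : ℝ) < (p : ℝ) ^ m := zpow_pos p_pos _
  rw [coe_mem_ball, InCone]
  simp only [iaff, mat_00, mat_01, mat_10, mat_11]
  simp only [zero_mul, mul_one, zero_sub, norm_neg, norm_one,
    norm_mul, Padic.norm_p_zpow, zpow_neg]
  rw [le_inv_mul_iff₀ hpos, mul_one]

lemma infty_mem_ball_iaff (m : ℤ) : OnePoint.infty ∈ ball (iaff p m • e0 p) := by
  rw [infty_mem_ball]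
  simpa [iaff] using zpow_nonneg p_pos.le m

lemma finBall_iaff (m : ℤ) :
    finBall (iaff p m • e0 p) = {x | (p : ℝ) ^ m ≤ ‖x‖} := by
  ext x
  rw [finBall, Set.mem_ofPred_eq, coe_mem_ball_iaff]
  rfl

lemma zero_notMem_iaff (m : ℤ) : (0 : ℚ_[p]) ∉ finBall (iaff p m • e0 p) := by
  rw [finBall_iaff, Set.mem_ofPred_eq, norm_zero, not_le]
  exact zpow_pos p_pos _

lemma radius_iaff (m : ℤ) : radius (iaff p m • e0 p) = (p : ℝ) ^ (-m) := by
  have hpos : (0 : ℝ) < (p : ℝ) ^ m := zpow_pos p_pos _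
  rw [radius, if_pos (infty_mem_ball_iaff m), finBall_iaff]
  refine IsGreatest.csSup_eq ⟨⟨(p : ℚ_[p]) ^ (-m), ?_, ?_⟩, ?_⟩
  · rw [Set.mem_ofPred_eq, Padic.norm_p_zpow, neg_neg]
  · simp only
    rw [norm_inv, Padic.norm_p_zpow, neg_neg, zpow_neg]
  · rintro _ ⟨x, hx, rfl⟩
    simp only
    rw [norm_inv, zpow_neg]
    exact inv_anti₀ hpos hx

lemma exists_iaff {e : Edge p} (h : OnePoint.infty ∈ ball e) (h0 : (0 : ℚ_[p]) ∉ finBall e) :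
    ∃ m : ℤ, e = iaff p m • e0 p := by
  have hp := p_ne_zero (p := p)
  obtain ⟨g, rfl⟩ := exists_smul_e0 e
  rw [infty_mem_ball] at h
  have h0' : ¬ InCone g 0 1 := fun h' => h0 ((coe_mem_ball g 0).2 h')
  rw [InCone, mul_zero, mul_zero, mul_one, mul_one, zero_sub, sub_zero, norm_neg, not_le] at h0'
  have hc : g 1 0 ≠ 0 := by
    intro hc
    rw [hc, norm_zero, norm_le_zero_iff] at h
    exact gdet_ne_zero g (by rw [gdet, hc, h]; ring)
  have hb : g 0 1 ≠ 0 := norm_pos_iff.1 ((norm_nonneg _).trans_lt h0')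
  obtain ⟨m, hm⟩ := exists_zpow_norm (div_ne_zero hc hb)
  have hpm : (p : ℚ_[p]) ^ m ≠ 0 := zpow_ne_zero m hp
  refine ⟨m, (smul_e0_eq_smul_iff _ _).2 ?_⟩
  have hdet : (g 1 0 / (p : ℚ_[p]) ^ m) * g 0 1 - (g 1 1 / (p : ℚ_[p]) ^ m) * g 0 0 ≠ 0 := by
    rw [show (g 1 0 / (p : ℚ_[p]) ^ m) * g 0 1 - (g 1 1 / (p : ℚ_[p]) ^ m) * g 0 0 =
      - (gdet g / (p : ℚ_[p]) ^ m) by rw [gdet]; ring]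
    exact neg_ne_zero.2 (div_ne_zero (gdet_ne_zero g) hpm)
  have e : (iaff p m)⁻¹ * g = mat (g 1 0 / (p : ℚ_[p]) ^ m)
      (g 1 1 / (p : ℚ_[p]) ^ m) (g 0 0) (g 0 1) hdet := by
    rw [inv_mul_eq_iff_eq_mul]
    apply gl_ext
    · rw [mul_00]; simp [iaff]
    · rw [mul_01]; simp [iaff]
    · rw [mul_10]; simp [iaff]; field_simp
    · rw [mul_11]; simp [iaff]; field_simp
  have h1 : ‖g 1 0 / (p : ℚ_[p]) ^ m‖ = ‖g 0 1‖ := by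
    rw [norm_div, ← hm, norm_div, div_div_cancel₀ (norm_ne_zero_iff.2 hc)]
  rw [e]
  refine ⟨h1, ?_, h0'⟩
  simp only [mat_01, mat_11]
  rw [← h1, norm_div, norm_div]
  gcongr

/-! ### Power series on `ℤ_p` -/

section ultraSums
variable {M : Type*} [NormedAddCommGroup M] [IsUltrametricDist M]

lemma hasSum_norm_le {ι : Type*} {f : ι → M} {a : M} {C : ℝ} (h : HasSum f a) (hC : 0 ≤ C)
    (hf : ∀ i, ‖f i‖ ≤ C) : ‖a‖ ≤ C := by
  refine le_of_tendsto h.norm (Eventually.of_forall fun s => ?_)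
  exact IsUltrametricDist.norm_sum_le_of_forall_le_of_nonneg hC fun i _ => hf i

lemma summable_of_tendsto_zero [CompleteSpace M] {f : ℕ → M} (h : Tendsto f atTop (𝓝 0)) :
    Summable f :=
  NonarchimedeanAddGroup.summable_of_tendsto_cofinite_zero (by rwa [Nat.cofinite_eq_atTop])

lemma summable_double [CompleteSpace M] {f : ℕ × ℕ → M} {g : ℕ → ℝ} (hg : Tendsto g atTop (𝓝 0))
    (hfg : ∀ n i, ‖f (n, i)‖ ≤ g n) (hf : ∀ n, Tendsto (fun i => f (n, i)) atTop (𝓝 0)) :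
    Summable f := by
  refine NonarchimedeanAddGroup.summable_of_tendsto_cofinite_zero ?_
  rw [Metric.tendsto_nhds]
  intro ε hε
  obtain ⟨N, hN⟩ := eventually_atTop.1 (hg.eventually (gt_mem_nhds hε))
  have hfin : ∀ n, {i | ε ≤ ‖f (n, i)‖}.Finite := by
    intro n
    have := (hf n).eventually (Metric.ball_mem_nhds 0 hε)
    rw [← Nat.cofinite_eq_atTop, eventually_cofinite] at this
    refine this.subset fun i hi => ?_
    simpa using hi
  rw [eventually_cofinite]
  refine ((Finset.range N).finite_toSet.biUnion fun n _ => (hfin n).image (Prod.mk n)).subset ?_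
  rintro ⟨n, i⟩ h
  simp only [Set.mem_ofPred_eq, dist_zero_right, not_lt] at h
  refine Set.mem_biUnion (x := n) ?_ ⟨i, h, rfl⟩
  rw [Finset.mem_coe, Finset.mem_range]
  by_contra hn
  exact (h.trans (hfg n i)).not_gt (hN n (not_lt.1 hn))

end ultraSums

section HasExp
variable {E : Type*} [NormedField E] [NormedAlgebra ℚ_[p] E]

/-- `F` is given on `ℤ_p` by the power series with coefficients `b`. -/
def HasExp (F : ℚ_[p] → E) (b : ℕ → E) : Prop :=
  ∀ z : ℚ_[p], ‖z‖ ≤ 1 → HasSum (fun n => z ^ n • b n) (F z)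

variable {F G : ℚ_[p] → E} {b b' : ℕ → E}

lemma HasExp.tendsto (h : HasExp F b) : Tendsto b atTop (𝓝 0) := by
  have := (h 1 (by simp)).summable.tendsto_atTop_zero
  simpa using this

lemma exists_norm_le_of_tendsto {M : Type*} [SeminormedAddCommGroup M] {b : ℕ → M}
    (h : Tendsto b atTop (𝓝 0)) : ∃ C, 0 ≤ C ∧ ∀ n, ‖b n‖ ≤ C := by
  obtain ⟨C, hC⟩ := h.norm.bddAbove_range
  exact ⟨C, (norm_nonneg _).trans (hC ⟨0, rfl⟩), fun n => hC ⟨n, rfl⟩⟩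

/-- The formal series with given coefficients. -/
def seriesOf (b : ℕ → E) : FormalMultilinearSeries ℚ_[p] ℚ_[p] E :=
  fun n => ContinuousMultilinearMap.mkPiRing ℚ_[p] (Fin n) (b n)

lemma seriesOf_coeff (b : ℕ → E) (n : ℕ) : (seriesOf (p := p) b).coeff n = b n := by
  rw [FormalMultilinearSeries.coeff, seriesOf, ContinuousMultilinearMap.mkPiRing_apply]
  simp

lemma HasExp.hasFPowerSeriesAt (h : HasExp F b) : HasFPowerSeriesAt F (seriesOf b) 0 := by
  rw [hasFPowerSeriesAt_iff]
  filter_upwards [Metric.closedBall_mem_nhds (0 : ℚ_[p]) one_pos] with z hz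
  simp only [seriesOf_coeff, zero_add]
  exact h z (by simpa using hz)

lemma HasExp.unique (h : HasExp F b) (h' : HasExp F b') : b = b' := by
  have := h.hasFPowerSeriesAt.eq_formalMultilinearSeries h'.hasFPowerSeriesAt
  funext n
  rw [← seriesOf_coeff (p := p) b, this, seriesOf_coeff]

lemma HasExp.congr (h : HasExp F b) (hFG : ∀ z, ‖z‖ ≤ 1 → F z = G z) : HasExp G b :=
  fun z hz => by rw [← hFG z hz]; exact h z hz

lemma HasExp.add (h : HasExp F b) (h' : HasExp G b') : HasExp (F + G) (b + b') := fun z hz => by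
  simpa [smul_add] using (h z hz).add (h' z hz)

lemma HasExp.const_mul (h : HasExp F b) (t : E) : HasExp (fun z => t * F z) (fun n => t * b n) :=
  fun z hz => by simpa [mul_smul_comm] using (h z hz).mul_left t

lemma hasExp_zero : HasExp (0 : ℚ_[p] → E) 0 := fun z _ => by simpa using hasSum_zero

lemma analyticAt_of_hasExp {f : ℚ_[p] → E} {a : ℚ_[p]} {m : ℤ}
    (h : HasExp (fun z => f (a + (p : ℚ_[p]) ^ m * z)) b) : AnalyticAt ℚ_[p] f a := by
  have h1 := h.hasFPowerSeriesAt.analyticAt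
  have hp : (p : ℚ_[p]) ^ m ≠ 0 := zpow_ne_zero m p_ne_zero
  have h2 : AnalyticAt ℚ_[p] (fun x : ℚ_[p] => (x - a) / (p : ℚ_[p]) ^ m) a :=
    (analyticAt_id.sub analyticAt_const).div analyticAt_const hp
  have h3 := AnalyticAt.comp (f := fun x : ℚ_[p] => (x - a) / (p : ℚ_[p]) ^ m) (x := a)
    (by simpa using h1) h2
  refine h3.congr (Eventually.of_forall fun x => ?_)
  simp only [Function.comp]
  rw [mul_div_cancel₀ _ hp, add_sub_cancel]

lemma exists_hasExp_of_analyticAt {f : ℚ_[p] → E} {a : ℚ_[p]} (h : AnalyticAt ℚ_[p] f a) :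
    ∃ m : ℕ, ∃ b, HasExp (fun z => f (a + (p : ℚ_[p]) ^ m * z)) b := by
  obtain ⟨q, hq⟩ := h
  rw [hasFPowerSeriesAt_iff, Metric.eventually_nhds_iff] at hq
  obtain ⟨r, hr, hq⟩ := hq
  obtain ⟨m, hm⟩ := exists_pow_lt_of_lt_one hr (inv_lt_one_of_one_lt₀ (one_lt_p (p := p)))
  refine ⟨m, fun n => ((p : ℚ_[p]) ^ m) ^ n • q.coeff n, fun z hz => ?_⟩
  have := @hq ((p : ℚ_[p]) ^ m * z) (by
    rw [dist_zero_right, norm_mul, norm_pow, Padic.norm_p]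
    exact (mul_le_of_le_one_right (by positivity) hz).trans_lt hm)
  have e : (fun n => z ^ n • ((p : ℚ_[p]) ^ m) ^ n • q.coeff n) =
      fun n => ((p : ℚ_[p]) ^ m * z) ^ n • q.coeff n := by
    funext n
    rw [mul_pow, mul_smul, smul_comm]
  change HasSum (fun n => z ^ n • ((p : ℚ_[p]) ^ m) ^ n • q.coeff n) _
  rw [e]
  exact this

variable [CompleteSpace E] [IsUltrametricDist E]

lemma hasExp_tsum (h : Tendsto b atTop (𝓝 0)) : HasExp (fun z : ℚ_[p] => ∑' n, z ^ n • b n) b := by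
  intro z hz
  refine (summable_of_tendsto_zero ?_).hasSum
  refine squeeze_zero_norm (fun n => ?_) (tendsto_norm_zero.comp h)
  rw [norm_smul, norm_pow]
  exact mul_le_of_le_one_left (norm_nonneg _) (pow_le_one₀ (norm_nonneg _) hz)

/-- Substitution of power series with integral coefficients. -/
lemma hasExp_subst {A : ℕ → ℕ → ℚ_[p]} {φ : ℕ → ℚ_[p] → ℚ_[p]} (hA : ∀ n, HasExp (φ n) (A n))
    (hA1 : ∀ n i, ‖A n i‖ ≤ 1) (hb : Tendsto b atTop (𝓝 0))
    (hF : ∀ z, ‖z‖ ≤ 1 → HasSum (fun n => φ n z • b n) (F z)) :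
    HasExp F (fun i => ∑' n, A n i • b n) := by
  intro z hz
  have hs : Summable (fun x : ℕ × ℕ => (z ^ x.2 * A x.1 x.2) • b x.1) := by
    refine summable_double (tendsto_norm_zero.comp hb) (fun n i => ?_) (fun n => ?_)
    · rw [norm_smul, norm_mul, norm_pow]
      refine mul_le_of_le_one_left (norm_nonneg _) (mul_le_one₀ ?_ (norm_nonneg _) (hA1 n i))
      exact pow_le_one₀ (norm_nonneg _) hz
    · have := ((hA n z hz).summable.tendsto_atTop_zero).smul_const (b n)
      simpa using this
  have h1 : ∀ n, HasSum (fun i => (z ^ i * A n i) • b n) (φ n z • b n) := fun n => by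
    have := (hA n z hz).smul_const (b n)
    simpa using this
  have h2 := hs.hasSum.prod_fiberwise h1
  have h3 : F z = ∑' x : ℕ × ℕ, (z ^ x.2 * A x.1 x.2) • b x.1 := (hF z hz).unique h2
  have h4 : HasSum (fun x : ℕ × ℕ => (z ^ x.1 * A x.2 x.1) • b x.2) (F z) := by
    rw [h3]
    exact (Equiv.prodComm ℕ ℕ).hasSum_iff.2 hs.hasSum
  have h5 : ∀ i, Summable (fun n => A n i • b n) := fun i => by
    refine summable_of_tendsto_zero (squeeze_zero_norm (fun n => ?_) (tendsto_norm_zero.comp hb))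
    rw [norm_smul]
    exact mul_le_of_le_one_left (norm_nonneg _) (hA1 n i)
  refine h4.prod_fiberwise fun i => ?_
  have := (h5 i).hasSum.const_smul (z ^ i)
  simpa [mul_smul] using this

end HasExp

/-! ### Power series with integral coefficients -/

/-- `φ` is given on `ℤ_p` by a power series with coefficients in `ℤ_p`. -/
def IntExp (φ : ℚ_[p] → ℚ_[p]) : Prop := ∃ A : ℕ → ℚ_[p], (∀ i, ‖A i‖ ≤ 1) ∧ HasExp φ A

instance : NonarchimedeanRing ℚ_[p] where
  is_nonarchimedean := NonarchimedeanAddGroup.is_nonarchimedean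

lemma IntExp.mul {φ ψ : ℚ_[p] → ℚ_[p]} (hφ : IntExp φ) (hψ : IntExp ψ) : IntExp (φ * ψ) := by
  obtain ⟨A, hA, hφ⟩ := hφ
  obtain ⟨B, hB, hψ⟩ := hψ
  refine ⟨fun n => ∑ kl ∈ Finset.HasAntidiagonal.antidiagonal n, A kl.1 * B kl.2, fun n => ?_, fun z hz => ?_⟩
  · refine IsUltrametricDist.norm_sum_le_of_forall_le_of_nonneg zero_le_one fun kl _ => ?_
    rw [norm_mul]
    exact mul_le_one₀ (hA _) (norm_nonneg _) (hB _)
  · have h := (hφ z hz).mul_of_nonarchimedean (hψ z hz)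
    have h1 := (Finset.HasAntidiagonal.sigmaAntidiagonalEquivProd (A := ℕ)).hasSum_iff.2 h
    have h2 := h1.sigma (fun n => hasSum_fintype _)
    refine (congrArg (fun f => HasSum f _) (funext fun n => ?_)).mp h2
    simp only [Function.comp_apply, Finset.HasAntidiagonal.sigmaAntidiagonalEquivProd_apply]
    rw [Finset.univ_eq_attach, Finset.sum_attach (Finset.HasAntidiagonal.antidiagonal n)
      (fun kl => z ^ kl.1 • A kl.1 * z ^ kl.2 • B kl.2), Finset.smul_sum]
    refine Finset.sum_congr rfl fun kl hkl => ?_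
    rw [← Finset.HasAntidiagonal.mem_antidiagonal.1 hkl, pow_add]
    simp only [smul_eq_mul]
    ring

lemma intExp_linear {a b : ℚ_[p]} (ha : ‖a‖ ≤ 1) (hb : ‖b‖ ≤ 1) : IntExp (fun z : ℚ_[p] => a * z + b) := by
  refine ⟨fun n => if n = 0 then b else if n = 1 then a else 0, fun n => ?_, fun z _ => ?_⟩
  · dsimp only; split_ifs <;> simp [ha, hb]
  · have : a * z + b = ∑ n ∈ Finset.range 2,
        z ^ n • (if n = 0 then b else if n = 1 then a else 0) := by
      simp [Finset.sum_range_succ]; ring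
    change HasSum (fun n => z ^ n • (if n = 0 then b else if n = 1 then a else 0)) (a * z + b)
    rw [this]
    refine hasSum_sum_of_ne_finset_zero fun n hn => ?_
    rw [Finset.mem_range, not_lt] at hn
    rw [if_neg (by omega), if_neg (by omega), smul_zero]

lemma intExp_inv {c : ℚ_[p]} (hc : ‖c‖ < 1) : IntExp (fun z : ℚ_[p] => (c * z + 1)⁻¹) := by
  refine ⟨fun n => (-c) ^ n, fun n => ?_, fun z hz => ?_⟩
  · rw [norm_pow, norm_neg]
    exact pow_le_one₀ (norm_nonneg _) hc.le
  · have hlt : ‖-c * z‖ < 1 := by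
      rw [norm_mul, norm_neg]
      exact (mul_le_of_le_one_right (norm_nonneg _) hz).trans_lt hc
    have := hasSum_geometric_of_norm_lt_one hlt
    have e : (c * z + 1)⁻¹ = (1 - -c * z)⁻¹ := by congr 1; ring
    have e2 : (fun n => z ^ n • (-c) ^ n) = fun n => (-c * z) ^ n := by
      funext n; rw [smul_eq_mul, ← mul_pow, mul_comm]
    change HasSum (fun n => z ^ n • (-c) ^ n) ((c * z + 1)⁻¹)
    rw [e, e2]
    exact this

lemma intExp_one : IntExp (fun _ : ℚ_[p] => (1 : ℚ_[p])) := by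
  have := intExp_linear (p := p) (a := 0) (b := 1) (by simp) (by simp)
  refine (congrArg IntExp (funext fun z => ?_)).mp this
  simp

lemma IntExp.pow {φ : ℚ_[p] → ℚ_[p]} (hφ : IntExp φ) (n : ℕ) : IntExp (φ ^ n) := by
  induction n with
  | zero => rw [pow_zero]; exact intExp_one
  | succ n ih => rw [pow_succ]; exact ih.mul hφ

lemma intExp_zpow {c : ℚ_[p]} (hc : ‖c‖ < 1) (n : ℤ) : IntExp (fun z : ℚ_[p] => (c * z + 1) ^ n) := by
  cases n with
  | ofNat n =>
    refine (congrArg IntExp (funext fun z => ?_)).mp ((intExp_linear hc.le (b := 1) (by simp)).pow n)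
    simp
  | negSucc n =>
    have := (intExp_inv hc).pow (n + 1)
    refine (congrArg IntExp ?_).mp this
    funext z
    simp [zpow_negSucc]

/-! ### The `p`-adic logarithm -/

section Log
variable {E : Type} [NormedField E] [NormedAlgebra ℚ_[p] E]

lemma norm_natCast_inv_le {n : ℕ} (hn : n ≠ 0) : ‖((n : ℚ_[p]))⁻¹‖ ≤ n := by
  rw [norm_inv]
  have h1 : ‖(n : ℚ_[p])‖ = ((p : ℝ) ^ padicValNat p n)⁻¹ := by
    have := Padic.eq_padicNorm (p := p) (n : ℚ)
    rw [padicNorm.eq_zpow_of_nonzero (by exact_mod_cast hn), padicValRat.of_nat] at this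
    simpa using this
  rw [h1, inv_inv]
  exact_mod_cast Nat.le_of_dvd (Nat.pos_of_ne_zero hn) pow_padicValNat_dvd

lemma algebraMap_natCast' (n : ℕ) : algebraMap ℚ_[p] E (n : ℚ_[p]) = n := map_natCast _ n

include p in
lemma norm_natCast_inv_le' {n : ℕ} (hn : n ≠ 0) : ‖((n : E))⁻¹‖ ≤ n := by
  rw [← algebraMap_natCast' (p := p), ← map_inv₀, norm_algebraMap']
  exact norm_natCast_inv_le hn

include p in
lemma natCast_ne_zero' {n : ℕ} (hn : n ≠ 0) : (n : E) ≠ 0 := by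
  rw [← algebraMap_natCast' (p := p), Ne, FaithfulSMul.algebraMap_eq_zero_iff]
  exact_mod_cast hn

variable (p E) in
lemma norm_p_cast : ‖(p : E)‖ = (p : ℝ)⁻¹ := by
  rw [← algebraMap_natCast' (p := p), norm_algebraMap', Padic.norm_p]

variable (E) in
/-- The Taylor series of the logarithm at `1`. -/
def log1 (u : E) : E := ∑' i : ℕ, (-1) ^ i * (u - 1) ^ (i + 1) / ((i + 1 : ℕ) : E)

lemma norm_choose_le (n j : ℕ) : ‖((p ^ n).choose (j + 1) : ℚ_[p])‖ ≤ (j + 1 : ℕ) * ((p : ℝ)⁻¹) ^ n := by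
  obtain ⟨q, hq⟩ : ∃ q, p ^ n = q + 1 :=
    ⟨p ^ n - 1, (Nat.sub_add_cancel (Nat.one_le_pow _ _ (Fact.out : p.Prime).pos)).symm⟩
  have h := Nat.add_one_mul_choose_eq q j
  have h2 : ((p ^ n).choose (j + 1) : ℚ_[p]) =
      (((j + 1 : ℕ) : ℚ_[p]))⁻¹ * ((p : ℚ_[p]) ^ n * (q.choose j : ℚ_[p])) := by
    have h3 : ((j + 1 : ℕ) : ℚ_[p]) ≠ 0 := by exact_mod_cast j.succ_ne_zero
    rw [eq_inv_mul_iff_mul_eq₀ h3, mul_comm]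
    have := congrArg (Nat.cast (R := ℚ_[p])) h
    push_cast at this ⊢
    rw [hq, ← this, ← Nat.cast_pow, hq]
    push_cast
    rfl
  rw [h2, norm_mul, norm_mul, norm_pow, Padic.norm_p]
  refine mul_le_mul (norm_natCast_inv_le j.succ_ne_zero) ?_ (by positivity) (by positivity)
  exact mul_le_of_le_one_right (by positivity) (IsUltrametricDist.norm_natCast_le_one ℚ_[p] _)

lemma tendsto_choose (j : ℕ) :
    Tendsto (fun n => ((p ^ n - 1).choose j : ℚ_[p])) atTop (𝓝 ((-1) ^ j)) := by
  induction j with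
  | zero => simp
  | succ j ih =>
    have h0 : Tendsto (fun n => ((p ^ n).choose (j + 1) : ℚ_[p])) atTop (𝓝 0) := by
      refine squeeze_zero_norm (norm_choose_le · j) ?_
      have := (tendsto_pow_atTop_nhds_zero_of_lt_one (r := (p : ℝ)⁻¹) (by positivity)
        (inv_lt_one_of_one_lt₀ one_lt_p)).const_mul ((j + 1 : ℕ) : ℝ)
      simpa using this
    have := h0.sub ih
    rw [zero_sub, ← neg_one_mul, ← pow_succ'] at this
    refine this.congr fun n => ?_
    have h1 : p ^ n = (p ^ n - 1) + 1 :=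
      (Nat.sub_add_cancel (Nat.one_le_pow _ _ (Fact.out : p.Prime).pos)).symm
    have h2 := Nat.choose_succ_succ (p ^ n - 1) j
    rw [Nat.succ_eq_add_one, ← h1] at h2
    rw [h2]
    push_cast
    ring

lemma tendsto_mul_pow_zero {r : ℝ} (h0 : 0 ≤ r) (h1 : r < 1) :
    Tendsto (fun i : ℕ => ((i + 1 : ℕ) : ℝ) * r ^ (i + 1)) atTop (𝓝 0) :=
  (tendsto_self_mul_const_pow_of_lt_one h0 h1).comp (tendsto_add_atTop_nat 1)

lemma tendsto_log1 [CompleteSpace E] {u : E} (hu : ‖u - 1‖ < 1) :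
    Tendsto (fun n : ℕ => (u ^ p ^ n - 1) / (p : E) ^ n) atTop (𝓝 (log1 E u)) := by
  set x := u - 1 with hx
  have hux : u = x + 1 := by rw [hx]; ring
  have key : ∀ n : ℕ, (u ^ p ^ n - 1) / (p : E) ^ n =
      ∑' i : ℕ, ((p ^ n - 1).choose i : E) * x ^ (i + 1) / ((i + 1 : ℕ) : E) := by
    intro n
    obtain ⟨q, hq⟩ : ∃ q, p ^ n = q + 1 :=
      ⟨p ^ n - 1, (Nat.sub_add_cancel (Nat.one_le_pow _ _ (Fact.out : p.Prime).pos)).symm⟩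
    have hpn : (p : E) ^ n ≠ 0 := pow_ne_zero _ (natCast_ne_zero' (p := p) (Fact.out : p.Prime).ne_zero)
    rw [tsum_eq_sum (s := Finset.range (p ^ n)), hux, add_pow, hq, Finset.sum_range_succ',
      eq_comm, eq_div_iff hpn]
    · simp only [one_pow, mul_one, pow_zero, Nat.choose_zero_right, Nat.cast_one,
        add_sub_cancel_right, Finset.sum_mul]
      refine Finset.sum_congr rfl fun i _ => ?_
      have h := Nat.add_one_mul_choose_eq q i
      rw [← hq] at h
      have := congrArg (Nat.cast (R := E)) h
      have h3 : ((i + 1 : ℕ) : E) ≠ 0 := natCast_ne_zero' (p := p) i.succ_ne_zero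
      rw [← hq, div_mul_eq_mul_div, div_eq_iff h3]
      push_cast at this ⊢
      rw [show q = p ^ n - 1 by omega] at this
      linear_combination x ^ (i + 1) * this
    · intro i hi
      rw [Finset.mem_range, not_lt] at hi
      rw [Nat.choose_eq_zero_of_lt, Nat.cast_zero, zero_mul, zero_div]
      have := Nat.one_le_pow n _ (Fact.out : p.Prime).pos
      omega
  simp only [key]
  refine tendsto_tsum_of_dominated_convergence
    (bound := fun i : ℕ => ((i + 1 : ℕ) : ℝ) * ‖x‖ ^ (i + 1)) ?_ (fun i => ?_) ?_
  · have := (summable_pow_mul_geometric_of_norm_lt_one 1 (r := ‖x‖) (by simpa using hu))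
    have := (summable_nat_add_iff 1).2 this
    simpa using this
  · refine ((?_ : Tendsto _ atTop (𝓝 ((-1 : E) ^ i))).mul_const _).div_const _
    have := ((algebraMapCLM ℚ_[p] E).continuous.tendsto _).comp (tendsto_choose (p := p) i)
    simpa [Function.comp_def] using this
  · refine Eventually.of_forall fun n i => ?_
    rw [div_eq_mul_inv, norm_mul, norm_mul, norm_pow, mul_comm]
    refine mul_le_mul (norm_natCast_inv_le' (p := p) i.succ_ne_zero) ?_ (by positivity) (by positivity)
    refine mul_le_of_le_one_left (by positivity) ?_
    rw [← algebraMap_natCast' (p := p), norm_algebraMap']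
    exact IsUltrametricDist.norm_natCast_le_one ℚ_[p] _

variable [CompleteSpace E] [IsUltrametricDist E]

lemma norm_eq_one_of_sub {u : E} (hu : ‖u - 1‖ < 1) : ‖u‖ = 1 := by
  have h := norm_add_eq_left (x := (1 : E)) (y := u - 1) (by simpa using hu)
  simpa using h

lemma norm_mul_sub_one {u v : E} (hu : ‖u - 1‖ < 1) (hv : ‖v - 1‖ < 1) : ‖u * v - 1‖ < 1 := by
  rw [show u * v - 1 = (u - 1) * v + (v - 1) by ring]
  refine norm_add_lt_of ?_ hv
  rwa [norm_mul, norm_eq_one_of_sub hv, mul_one]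

lemma norm_pow_sub_one {u : E} (hu : ‖u - 1‖ < 1) (n : ℕ) : ‖u ^ n - 1‖ < 1 := by
  induction n with
  | zero => simp
  | succ n ih => rw [pow_succ]; exact norm_mul_sub_one ih hu

include p in
lemma log1_mul {u v : E} (hu : ‖u - 1‖ < 1) (hv : ‖v - 1‖ < 1) :
    log1 E (u * v) = log1 E u + log1 E v := by
  have hp0 : Tendsto (fun n => (p : E) ^ n) atTop (𝓝 0) :=
    tendsto_pow_atTop_nhds_zero_of_norm_lt_one (by
      rw [norm_p_cast p E]; exact inv_lt_one_of_one_lt₀ one_lt_p)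
  have hv1 : Tendsto (fun n => v ^ p ^ n) atTop (𝓝 1) := by
    have := ((tendsto_log1 (p := p) hv).mul hp0).add_const 1
    rw [mul_zero, zero_add] at this
    refine this.congr fun n => ?_
    have hpn : (p : E) ^ n ≠ 0 := pow_ne_zero _ (natCast_ne_zero' (p := p) (Fact.out : p.Prime).ne_zero)
    rw [div_mul_cancel₀ _ hpn, sub_add_cancel]
  have h := ((tendsto_log1 (p := p) hu).mul hv1).add (tendsto_log1 (p := p) hv)
  rw [mul_one] at h
  refine tendsto_nhds_unique (tendsto_log1 (p := p) (norm_mul_sub_one hu hv)) (h.congr fun n => ?_)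
  rw [mul_pow]
  ring

include p in
lemma log1_pow {u : E} (hu : ‖u - 1‖ < 1) (n : ℕ) : log1 E (u ^ n) = n * log1 E u := by
  induction n with
  | zero => simp [log1]
  | succ n ih =>
    rw [pow_succ, log1_mul (p := p) (norm_pow_sub_one hu n) hu, ih]
    push_cast; ring

variable (p) in
/-- `z ^ n = p ^ m u` with `u` close to `1`. -/
def IsLogRep (z : E) (t : ℕ × ℤ × E) : Prop :=
  0 < t.1 ∧ z ^ t.1 = (p : E) ^ t.2.1 * t.2.2 ∧ ‖t.2.2 - 1‖ < 1

lemma logp_eq {z : E} {t : ℕ × ℤ × E} (h : IsLogRep p z t) :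
    logp p z = (t.1 : E)⁻¹ * log1 E t.2.2 := by
  have hex : ∃ t : ℕ × ℤ × E, 0 < t.1 ∧ z ^ t.1 = (p : E) ^ t.2.1 * t.2.2 ∧ ‖t.2.2 - 1‖ < 1 :=
    ⟨t, h⟩
  rw [logp, dif_pos hex]
  change (hex.choose.1 : E)⁻¹ * log1 E hex.choose.2.2 = _
  obtain ⟨h1', h2', h3'⟩ := hex.choose_spec
  obtain ⟨h1, h2, h3⟩ := h
  generalize hex.choose = t' at *
  obtain ⟨n, m, u⟩ := t
  obtain ⟨n', m', u'⟩ := t'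
  dsimp only at *
  have hpE : (p : E) ≠ 0 := natCast_ne_zero' (p := p) (Fact.out : p.Prime).ne_zero
  have e : (p : E) ^ (m * n') * u ^ n' = (p : E) ^ (m' * n) * u' ^ n := by
    rw [zpow_mul, zpow_mul, zpow_natCast, zpow_natCast, ← mul_pow, ← mul_pow, ← h2, ← h2',
      ← pow_mul, ← pow_mul, mul_comm]
  have e2 : m * n' = m' * n := by
    have := congrArg norm e
    rw [norm_mul, norm_mul, norm_pow, norm_pow, norm_eq_one_of_sub h3, norm_eq_one_of_sub h3',
      one_pow, one_pow, mul_one, mul_one, norm_zpow, norm_zpow, norm_p_cast p E] at this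
    refine zpow_right_injective₀ (by positivity [p_pos (p := p)]) ?_ this
    exact (inv_lt_one_of_one_lt₀ one_lt_p).ne
  rw [e2] at e
  have e3 := mul_left_cancel₀ (zpow_ne_zero _ hpE) e
  have e4 := congrArg (log1 E) e3
  rw [log1_pow (p := p) h3, log1_pow (p := p) h3'] at e4
  have hn : (n : E) ≠ 0 := natCast_ne_zero' (p := p) h1.ne'
  have hn' : (n' : E) ≠ 0 := natCast_ne_zero' (p := p) h1'.ne'
  field_simp
  linear_combination -e4

variable (p E) in
/-- Every nonzero element has a logarithm. -/
def HasLog : Prop := ∀ z : E, z ≠ 0 → ∃ t, IsLogRep p z t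

lemma logp_of_norm_sub_lt {u : E} (hu : ‖u - 1‖ < 1) : logp p u = log1 E u := by
  rw [logp_eq (t := (1, 0, u)) ⟨by simp, by simp, hu⟩]
  simp

lemma logp_mul (hE : HasLog p E) {z w : E} (hz : z ≠ 0) (hw : w ≠ 0) :
    logp p (z * w) = logp p z + logp p w := by
  obtain ⟨⟨n, m, u⟩, h1, h2, h3⟩ := hE z hz
  obtain ⟨⟨n', m', u'⟩, h1', h2', h3'⟩ := hE w hw
  rw [logp_eq (z := z) ⟨h1, h2, h3⟩, logp_eq (z := w) ⟨h1', h2', h3'⟩]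
  dsimp only at *
  have hpE : (p : E) ≠ 0 := natCast_ne_zero' (p := p) (Fact.out : p.Prime).ne_zero
  rw [logp_eq (t := (n * n', m * n' + m' * n, u ^ n' * u' ^ n)) ⟨Nat.mul_pos h1 h1', ?_,
    norm_mul_sub_one (norm_pow_sub_one h3 _) (norm_pow_sub_one h3' _)⟩]
  · dsimp only
    rw [log1_mul (p := p) (norm_pow_sub_one h3 _) (norm_pow_sub_one h3' _), log1_pow (p := p) h3,
      log1_pow (p := p) h3']
    have hn : (n : E) ≠ 0 := natCast_ne_zero' (p := p) h1.ne'
    have hn' : (n' : E) ≠ 0 := natCast_ne_zero' (p := p) h1'.ne'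
    push_cast
    field_simp
  · dsimp only
    rw [mul_pow, pow_mul, h2, mul_comm n, pow_mul w, h2', mul_pow, mul_pow, zpow_add₀ hpE,
      zpow_mul, zpow_mul, zpow_natCast, zpow_natCast]
    ring

lemma logp_one : logp p (1 : E) = 0 := by
  rw [logp_of_norm_sub_lt (by simp)]; simp [log1]

lemma logp_div (hE : HasLog p E) {z w : E} (hz : z ≠ 0) (hw : w ≠ 0) :
    logp p (z / w) = logp p z - logp p w := by
  have := logp_mul hE (div_ne_zero hz hw) hw
  rw [div_mul_cancel₀ _ hw] at this
  rw [this, add_sub_cancel_right]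

lemma hasExp_log1 {y : E} (hy : ‖y‖ < 1) :
    ∃ b, HasExp (fun z : ℚ_[p] => log1 E (1 + z • y)) b := by
  refine ⟨fun n => if n = 0 then 0 else -((-y) ^ n / (n : E)), fun z hz => ?_⟩
  have hsum : HasSum (fun n : ℕ => (-1) ^ n * (z • y) ^ (n + 1) / ((n + 1 : ℕ) : E))
      (log1 E (1 + z • y)) := by
    rw [log1, add_sub_cancel_left]
    refine (summable_of_tendsto_zero (squeeze_zero_norm (fun i => ?_)
      (tendsto_mul_pow_zero (norm_nonneg y) hy))).hasSum
    rw [div_eq_mul_inv, norm_mul, norm_mul, norm_pow, norm_pow, norm_neg, norm_one, one_pow, one_mul,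
      mul_comm]
    refine mul_le_mul (norm_natCast_inv_le' (p := p) i.succ_ne_zero) ?_ (by positivity) (by positivity)
    rw [norm_smul]
    exact pow_le_pow_left₀ (by positivity) (mul_le_of_le_one_left (norm_nonneg _) hz) _
  rw [← hasSum_nat_add_iff' 1]
  simp only [Finset.range_one, Finset.sum_singleton, if_true, smul_zero, sub_zero]
  refine (congrArg (fun f => HasSum f _) (funext fun n => ?_)).mp hsum
  rw [if_neg n.succ_ne_zero, Algebra.smul_def, Algebra.smul_def, mul_pow, neg_pow y, map_pow]
  ring

/-- The logarithm of a linear form is analytic away from its zero. -/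
lemma analyticAt_logp_linear (hE : HasLog p E) {s t : E} {a : ℚ_[p]}
    (h : algebraMap ℚ_[p] E a * s + t ≠ 0) :
    AnalyticAt ℚ_[p] (fun x : ℚ_[p] => logp p (algebraMap ℚ_[p] E x * s + t)) a := by
  set d := algebraMap ℚ_[p] E a * s + t with hd
  obtain ⟨m, hm⟩ : ∃ m : ℕ, ‖(p : E) ^ m * s / d‖ < 1 := by
    have hp0 : Tendsto (fun n => (p : E) ^ n * s / d) atTop (𝓝 (0 * s / d)) :=
      ((tendsto_pow_atTop_nhds_zero_of_norm_lt_one (by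
        rw [norm_p_cast p E]; exact inv_lt_one_of_one_lt₀ one_lt_p)).mul_const s).div_const d
    rw [zero_mul, zero_div] at hp0
    have := (tendsto_norm_zero.comp hp0).eventually (gt_mem_nhds one_pos)
    exact this.exists
  obtain ⟨b, hb⟩ := hasExp_log1 (p := p) hm
  have h1 : AnalyticAt ℚ_[p] (fun x : ℚ_[p] => log1 E (1 + ((x - a) / (p : ℚ_[p]) ^ (m : ℤ)) •
      ((p : E) ^ m * s / d))) a := by
    have hpm : (p : ℚ_[p]) ^ (m : ℤ) ≠ 0 := zpow_ne_zero _ p_ne_zero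
    refine analyticAt_of_hasExp (m := m) (b := b) (hb.congr fun z _ => ?_)
    rw [add_sub_cancel_left, mul_div_cancel_left₀ _ hpm]
  refine (analyticAt_const.add h1 : AnalyticAt ℚ_[p] (fun x => logp p d + _) a).congr ?_
  have hev : ∀ᶠ x in 𝓝 a, ‖(x - a) / (p : ℚ_[p]) ^ (m : ℤ)‖ ≤ 1 := by
    have hpm : 0 < ‖(p : ℚ_[p]) ^ (m : ℤ)‖ := norm_pos_iff.2 (zpow_ne_zero _ p_ne_zero)
    filter_upwards [Metric.closedBall_mem_nhds a hpm] with x hx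
    rw [norm_div, div_le_one hpm, ← dist_eq_norm]
    exact hx
  filter_upwards [hev] with x hx
  set z := (x - a) / (p : ℚ_[p]) ^ (m : ℤ) with hz
  have hlt : ‖(1 + z • ((p : E) ^ m * s / d)) - 1‖ < 1 := by
    rw [add_sub_cancel_left, norm_smul]
    exact (mul_le_of_le_one_left (norm_nonneg _) hx).trans_lt hm
  have hne : (1 + z • ((p : E) ^ m * s / d)) ≠ 0 := by
    rw [← norm_ne_zero_iff, norm_eq_one_of_sub hlt]; exact one_ne_zero
  change logp p d + log1 E (1 + z • ((p : E) ^ m * s / d)) = _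
  rw [← logp_of_norm_sub_lt (p := p) hlt, ← logp_mul hE h hne]
  congr 1
  have hpE : (p : E) ≠ 0 := natCast_ne_zero' (p := p) (Fact.out : p.Prime).ne_zero
  rw [Algebra.smul_def, hz, map_div₀, zpow_natCast, map_pow, algebraMap_natCast', map_sub]
  field_simp
  rw [hd]; ring

omit [CompleteSpace E] [IsUltrametricDist E] in
lemma hp_sub_ne {τ : E} (hτ : τ ∈ Hp p E) (x : ℚ_[p]) : algebraMap ℚ_[p] E x - τ ≠ 0 :=
  fun h => hτ ⟨x, sub_eq_zero.1 h⟩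

omit [CompleteSpace E] [IsUltrametricDist E] in
lemma analyticAt_polynomial (P : Polynomial ℚ_[p]) (a : ℚ_[p]) :
    AnalyticAt ℚ_[p] (fun x => algebraMap ℚ_[p] E (P.eval x)) a := by
  have h1 : AnalyticAt ℚ_[p] (fun x => P.eval x) a := by
    simp only [Polynomial.eval_eq_sum_range]
    exact Finset.analyticAt_fun_sum _ fun i _ => analyticAt_const.mul (analyticAt_id.pow i)
  exact ((algebraMapCLM ℚ_[p] E).analyticAt _).comp h1

/-- The integrand of the line integral in the coordinate `1 / x`, divided by the pole. -/
def logPole {k : ℕ} (τ₁ τ₂ : E) (P : Pk p k) (w : ℚ_[p]) : E :=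
  algebraMap ℚ_[p] E (((P.1.reflect k).eval w)) *
    (logp p (algebraMap ℚ_[p] E w * (-τ₂) + 1) - logp p (algebraMap ℚ_[p] E w * (-τ₁) + 1))

lemma analyticAt_logPole (hE : HasLog p E) {k : ℕ} (τ₁ τ₂ : E) (P : Pk p k) :
    AnalyticAt ℚ_[p] (logPole τ₁ τ₂ P) 0 :=
  (analyticAt_polynomial _ 0).mul ((analyticAt_logp_linear hE (by simp)).sub
    (analyticAt_logp_linear hE (by simp)))

lemma logPole_zero {k : ℕ} (τ₁ τ₂ : E) (P : Pk p k) : logPole τ₁ τ₂ P 0 = 0 := by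
  simp [logPole]

lemma logIntegrand_eq_logPole (hE : HasLog p E) {k : ℕ} {τ₁ τ₂ : E} (h1 : τ₁ ∈ Hp p E)
    (h2 : τ₂ ∈ Hp p E) (P : Pk p k) {x : ℚ_[p]} (hx0 : x ≠ 0) :
    logIntegrand τ₁ τ₂ P x = x ^ k • logPole τ₁ τ₂ P x⁻¹ := by
  have hx1 : algebraMap ℚ_[p] E x ≠ 0 := by simpa using hx0
  have hne : ∀ τ ∈ Hp p E, algebraMap ℚ_[p] E x⁻¹ * (-τ) + 1 ≠ 0 := by
    intro τ hτ h
    refine hp_sub_ne hτ x ?_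
    have : algebraMap ℚ_[p] E x * (algebraMap ℚ_[p] E x⁻¹ * (-τ) + 1) = 0 := by rw [h, mul_zero]
    rw [map_inv₀] at this
    field_simp at this
    linear_combination this
  have e : ∀ τ : E, algebraMap ℚ_[p] E x - τ =
      algebraMap ℚ_[p] E x * (algebraMap ℚ_[p] E x⁻¹ * (-τ) + 1) := by
    intro τ; rw [map_inv₀]; field_simp; ring
  rw [logIntegrand, e τ₁, e τ₂, mul_div_mul_left _ _ hx1, logp_div hE (hne _ h2) (hne _ h1),
    Algebra.smul_def, logPole, ← mul_assoc, ← map_mul]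
  congr 2
  have hdeg : P.1.natDegree ≤ k :=
    Polynomial.natDegree_le_of_degree_le (Polynomial.mem_degreeLE.1 P.2)
  let _ := invertibleOfNonzero hx0
  have := Polynomial.eval₂_reflect_mul_pow (RingHom.id ℚ_[p]) x k P.1 hdeg
  rw [invOf_eq_inv] at this
  rw [mul_comm]
  exact this.symm

lemma logIntegrand_mem (hE : HasLog p E) {k : ℕ} {τ₁ τ₂ : E} (h1 : τ₁ ∈ Hp p E)
    (h2 : τ₂ ∈ Hp p E) (P : Pk p k) : logIntegrand τ₁ τ₂ P ∈ locAn p k E := by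
  refine ⟨fun a => ?_, logPole τ₁ τ₂ P, analyticAt_logPole hE τ₁ τ₂ P, 0, fun x hx =>
    logIntegrand_eq_logPole hE h1 h2 P (norm_pos_iff.1 hx)⟩
  have ha : ∀ τ ∈ Hp p E, AnalyticAt ℚ_[p]
      (fun x : ℚ_[p] => logp p (algebraMap ℚ_[p] E x * 1 + -τ)) a := fun τ hτ => by
    refine analyticAt_logp_linear hE ?_
    rw [mul_one, ← sub_eq_add_neg]
    exact hp_sub_ne hτ a
  refine ((analyticAt_polynomial P.1 a).mul ((ha _ h2).sub (ha _ h1))).congr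
    (Eventually.of_forall fun x => ?_)
  rw [logIntegrand, logp_div hE (hp_sub_ne h2 x) (hp_sub_ne h1 x)]
  simp [sub_eq_add_neg]

end Log

/-! ### Existence of logarithms -/

lemma hasLog_of_finiteDimensional {K : Type} [NormedField K] [NormedAlgebra ℚ_[p] K]
    [FiniteDimensional ℚ_[p] K] : HasLog p K := by
  intro z hz
  have : ProperSpace K := FiniteDimensional.proper ℚ_[p] K
  have hpK : (p : K) ≠ 0 := natCast_ne_zero' (p := p) (Fact.out : p.Prime).ne_zero
  have hpn := norm_p_cast p K
  have hy : ∀ n : ℕ, ∃ m : ℤ, (p : ℝ)⁻¹ < ‖z ^ n * (p : K) ^ m‖ ∧ ‖z ^ n * (p : K) ^ m‖ ≤ 1 := by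
    intro n
    obtain ⟨m, hm1, hm2⟩ := exists_mem_Ioc_zpow (norm_pos_iff.2 (pow_ne_zero n hz))
      (one_lt_p (p := p))
    refine ⟨m + 1, ?_, ?_⟩
    · rw [norm_mul, norm_zpow, hpn, inv_zpow, zpow_add₀ p_pos.ne', zpow_one, mul_inv, ← mul_assoc]
      have h0 : (0 : ℝ) < (p : ℝ) ^ m := zpow_pos p_pos m
      have : 1 < ‖z ^ n‖ * ((p : ℝ) ^ m)⁻¹ := by
        rwa [← div_eq_mul_inv, one_lt_div h0]
      have hp' : (0 : ℝ) < (p : ℝ)⁻¹ := inv_pos.2 p_pos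
      nlinarith
    · rw [norm_mul, norm_zpow, hpn, inv_zpow, ← div_eq_mul_inv]
      exact div_le_one_of_le₀ hm2 (by positivity)
  choose m hm1 hm2 using hy
  set y : ℕ → K := fun n => z ^ n * (p : K) ^ m n with hyd
  obtain ⟨a, -, φ, hφ, hlim⟩ := (isCompact_closedBall (0 : K) 1).tendsto_subseq
    (x := y) (fun n => mem_closedBall_zero_iff.2 (hm2 n))
  have hc := hlim.cauchySeq
  rw [Metric.cauchySeq_iff'] at hc
  obtain ⟨N, hN⟩ := hc (p : ℝ)⁻¹ (inv_pos.2 p_pos)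
  have h1 := hN (N + 1) N.le_succ
  have hlt : φ N < φ (N + 1) := hφ N.lt_succ_self
  have hyN : y (φ N) ≠ 0 := by
    intro h
    have := hm1 (φ N)
    change _ < ‖y (φ N)‖ at this
    rw [h, norm_zero] at this
    exact (inv_pos.2 (p_pos (p := p))).not_gt this
  refine ⟨(φ (N + 1) - φ N, m (φ N) - m (φ (N + 1)), y (φ (N + 1)) / y (φ N)), Nat.sub_pos_of_lt hlt,
    ?_, ?_⟩
  · dsimp only
    rw [hyd]
    dsimp only
    rw [pow_sub₀ z hz hlt.le, zpow_sub₀ hpK]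
    have := pow_ne_zero (φ N) hz
    have := zpow_ne_zero (m (φ N)) hpK
    have := zpow_ne_zero (m (φ (N + 1))) hpK
    field_simp
  · dsimp only
    rw [div_sub_one hyN, norm_div, div_lt_one (norm_pos_iff.2 hyN), ← dist_eq_norm]
    exact h1.trans (hm1 (φ N))

lemma hasLog_padicComplex : HasLog p ℂ_[p] := by
  intro z hz
  obtain ⟨w, hw⟩ : ∃ w : PadicAlgCl p, ‖z - (w : ℂ_[p])‖ < ‖z‖ := by
    have hd := (UniformSpace.Completion.denseRange_coe (α := PadicAlgCl p))
    obtain ⟨w, hw⟩ := Metric.denseRange_iff.1 hd z ‖z‖ (norm_pos_iff.2 hz)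
    exact ⟨w, by rwa [dist_eq_norm] at hw⟩
  have hnw : ‖(w : ℂ_[p])‖ = ‖z‖ := by
    have := norm_sub_eq_left hw
    rwa [sub_sub_cancel] at this
  have hw0 : (w : ℂ_[p]) ≠ 0 := by
    rw [← norm_ne_zero_iff, hnw, norm_ne_zero_iff]; exact hz
  have : FiniteDimensional ℚ_[p] (IntermediateField.adjoin ℚ_[p] {w}) :=
    IntermediateField.adjoin.finiteDimensional (Algebra.IsIntegral.isIntegral w)
  obtain ⟨⟨n, m, u⟩, h1, h2, h3⟩ := hasLog_of_finiteDimensional (p := p)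
    (K := IntermediateField.adjoin ℚ_[p] {w})
    ⟨w, IntermediateField.mem_adjoin_simple_self ℚ_[p] w⟩ (by
      intro h
      refine hw0 ?_
      have := congrArg (fun t : IntermediateField.adjoin ℚ_[p] {w} => ((t : PadicAlgCl p) : ℂ_[p])) h
      simpa using this)
  dsimp only at h1 h2 h3
  have h2' := congrArg ((algebraMap (PadicAlgCl p) ℂ_[p]).comp
    (algebraMap (IntermediateField.adjoin ℚ_[p] {w}) (PadicAlgCl p))) h2
  rw [map_pow, map_mul, map_zpow₀, map_natCast] at h2'
  have h3' : ‖(((u : PadicAlgCl p) : ℂ_[p])) - 1‖ < 1 := by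
    have e : (((u : PadicAlgCl p) : ℂ_[p])) - 1 = (((u - 1 : IntermediateField.adjoin ℚ_[p] {w}) :
      PadicAlgCl p) : ℂ_[p]) := by
      rw [PadicComplex.coe_eq, PadicComplex.coe_eq]; simp
    rw [e, PadicComplex.norm_extends]
    exact h3
  have hzw : ‖z / w - 1‖ < 1 := by
    rw [div_sub_one hw0, norm_div, div_lt_one (norm_pos_iff.2 hw0), hnw]
    exact hw
  refine ⟨(n, m, ((u : PadicAlgCl p) : ℂ_[p]) * (z / w) ^ n), h1, ?_,
    norm_mul_sub_one h3' (norm_pow_sub_one hzw n)⟩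
  dsimp only
  have h4 : (w : ℂ_[p]) ^ n = (p : ℂ_[p]) ^ m * ((u : PadicAlgCl p) : ℂ_[p]) := by
    exact h2'
  rw [← mul_assoc, ← h4, ← mul_pow, mul_div_cancel₀ _ hw0]

/-! ### Polynomials and local moments -/

/-- The monomial `x ^ i` in `P_k` (zero if `i > k`). -/
def mono (k i : ℕ) : Pk p k := ⟨if i ≤ k then Polynomial.X ^ i else 0, by
  split_ifs with h
  · rw [Polynomial.mem_degreeLE]
    exact (Polynomial.degree_X_pow_le i).trans (by exact_mod_cast h)
  · exact zero_mem _⟩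

lemma mono_val {k i : ℕ} (h : i ≤ k) : (mono k i : Pk p k).1 = Polynomial.X ^ i := if_pos h

lemma natDegree_le (k : ℕ) (P : Pk p k) : P.1.natDegree ≤ k :=
  Polynomial.natDegree_le_of_degree_le (Polynomial.mem_degreeLE.1 P.2)

lemma eq_sum_mono {k : ℕ} (P : Pk p k) :
    P = ∑ i ∈ Finset.range (k + 1), P.1.coeff i • mono k i := by
  refine Subtype.ext ?_
  rw [Submodule.coe_sum]
  conv_lhs => rw [P.1.as_sum_range_C_mul_X_pow' (Nat.lt_succ_of_le (natDegree_le k P))]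
  refine Finset.sum_congr rfl fun i hi => ?_
  rw [Submodule.coe_smul, mono_val (Nat.lt_succ_iff.1 (Finset.mem_range.1 hi)),
    Polynomial.smul_eq_C_mul]

/-- The automorphy factor of `u` at `0`. -/
def wt (k : ℕ) (u : GL (Fin 2) ℚ_[p]) : ℚ_[p] := (gdet u)⁻¹ ^ (k / 2) * u 1 1 ^ k

/-- The normalized transform of the monomial `x ^ m` under `u`. -/
def phi (k : ℕ) (u : GL (Fin 2) ℚ_[p]) (m : ℕ) (z : ℚ_[p]) : ℚ_[p] :=
  (u 0 0 / u 1 1 * z + u 0 1 / u 1 1) ^ m * (u 1 0 / u 1 1 * z + 1) ^ ((k : ℤ) - m)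

/-- The semigroup of elements contracting `ℤ_p`. -/
structure Sig (u : GL (Fin 2) ℚ_[p]) : Prop where
  h00 : ‖u 0 0‖ ≤ ‖u 1 1‖
  h01 : ‖u 0 1‖ ≤ ‖u 1 1‖
  h10 : ‖u 1 0‖ < ‖u 1 1‖

section Sig
variable {u : GL (Fin 2) ℚ_[p]}

lemma Iw.sig (h : Iw u) : Sig u := ⟨h.1.le, h.2.1, h.2.2⟩

lemma sig_aff {m : ℤ} (hm : 0 ≤ m) {a : ℚ_[p]} (ha : ‖a‖ ≤ 1) : Sig (aff m a) := by
  refine ⟨?_, by simpa [aff] using ha, by simp [aff]⟩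
  have : ‖(p : ℚ_[p]) ^ m‖ ≤ 1 := by
    rw [Padic.norm_p_zpow]
    exact zpow_le_one_of_nonpos₀ one_lt_p.le (by omega)
  simpa [aff] using this

lemma sig_hm {a : ℚ_[p]} (ha : ‖a‖ ≤ 1) : Sig (hm a) := by
  rw [hm_eq_aff]; exact sig_aff zero_le_one ha

lemma Sig.ne_zero (h : Sig u) : u 1 1 ≠ 0 := norm_pos_iff.1 ((norm_nonneg _).trans_lt h.h10)

lemma Sig.norm_c (h : Sig u) : ‖u 1 0 / u 1 1‖ < 1 := by
  rw [norm_div, div_lt_one (norm_pos_iff.2 h.ne_zero)]; exact h.h10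

lemma Sig.norm_a (h : Sig u) : ‖u 0 0 / u 1 1‖ ≤ 1 := by
  rw [norm_div, div_le_one (norm_pos_iff.2 h.ne_zero)]; exact h.h00

lemma Sig.norm_b (h : Sig u) : ‖u 0 1 / u 1 1‖ ≤ 1 := by
  rw [norm_div, div_le_one (norm_pos_iff.2 h.ne_zero)]; exact h.h01

lemma Sig.norm_den (h : Sig u) {z : ℚ_[p]} (hz : ‖z‖ ≤ 1) : ‖u 1 0 / u 1 1 * z + 1‖ = 1 := by
  rw [add_comm, norm_add_eq_left, norm_one]
  rw [norm_one, norm_mul]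
  exact (mul_le_of_le_one_right (norm_nonneg _) hz).trans_lt h.norm_c

lemma Sig.den_ne_zero (h : Sig u) {z : ℚ_[p]} (hz : ‖z‖ ≤ 1) : u 1 0 / u 1 1 * z + 1 ≠ 0 := by
  rw [← norm_ne_zero_iff, h.norm_den hz]; exact one_ne_zero

lemma Sig.exists_exp (h : Sig u) (k m : ℕ) :
    ∃ A : ℕ → ℚ_[p], (∀ i, ‖A i‖ ≤ 1) ∧ HasExp (phi k u m) A :=
  ((intExp_linear h.norm_a h.norm_b).pow m).mul (intExp_zpow h.norm_c _)

/-- The Taylor coefficients of `phi`. -/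
def Sig.coef (h : Sig u) (k m : ℕ) : ℕ → ℚ_[p] := (h.exists_exp k m).choose

lemma Sig.coef_norm (h : Sig u) (k m n : ℕ) : ‖h.coef k m n‖ ≤ 1 := (h.exists_exp k m).choose_spec.1 n

lemma Sig.hasExp (h : Sig u) (k m : ℕ) : HasExp (phi k u m) (h.coef k m) :=
  (h.exists_exp k m).choose_spec.2

lemma HasExp.comp_mul {E : Type*} [NormedField E] [NormedAlgebra ℚ_[p] E] {F : ℚ_[p] → E}
    {b : ℕ → E} (h : HasExp F b) {s : ℚ_[p]} (hs : ‖s‖ ≤ 1) :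
    HasExp (fun z => F (s * z)) (fun n => s ^ n • b n) := by
  intro z hz
  have h1 := h (s * z) (by rw [norm_mul]; exact mul_le_one₀ hs (norm_nonneg _) hz)
  refine (congrArg (fun f => HasSum f _) (funext fun n => ?_)).mp h1
  rw [smul_smul, mul_pow, mul_comm]

lemma Sig.coef_norm_of_c (h : Sig u) (hc : u 1 0 = 0) (k m n : ℕ) :
    ‖h.coef k m n‖ ≤ ‖u 0 0 / u 1 1‖ ^ n := by
  obtain ⟨B, hB, hψ⟩ := (intExp_linear (a := (1 : ℚ_[p])) (by simp) h.norm_b).pow m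
  have h1 : HasExp (phi k u m) (fun n => (u 0 0 / u 1 1) ^ n • B n) := by
    refine (hψ.comp_mul h.norm_a).congr fun z _ => ?_
    simp [phi, hc]
  rw [(h.hasExp k m).unique h1, norm_smul, norm_pow]
  exact mul_le_of_le_one_right (by positivity) (hB n)

lemma hasExp_eval (P : Polynomial ℚ_[p]) : HasExp (fun z => P.eval z) P.coeff := by
  intro z _
  have h : P.eval z = ∑ n ∈ Finset.range (P.natDegree + 1), z ^ n • P.coeff n := by
    rw [Polynomial.eval_eq_sum_range]
    exact Finset.sum_congr rfl fun i _ => by rw [smul_eq_mul, mul_comm]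
  change HasSum (fun n => z ^ n • P.coeff n) (P.eval z)
  rw [h]
  refine hasSum_sum_of_ne_finset_zero fun n hn => ?_
  rw [Finset.mem_range, not_lt] at hn
  rw [Polynomial.coeff_eq_zero_of_natDegree_lt (by omega), smul_zero]

lemma Sig.polyAct_mono (h : Sig u) {k m : ℕ} (hm : m ≤ k) (n : ℕ) :
    (polyAct k u (mono k m)).1.coeff n = wt k u * h.coef k m n := by
  have h1 : HasExp (fun z => (polyAct k u (mono k m)).1.eval z)
      (fun n => wt k u * h.coef k m n) := by
    refine ((h.hasExp k m).const_mul (wt k u)).congr fun z hz => ?_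
    have hd := h.den_ne_zero hz
    have h11 := h.ne_zero
    have e : u 1 0 * z + u 1 1 = u 1 1 * (u 1 0 / u 1 1 * z + 1) := by field_simp
    have hne : u 1 0 * z + u 1 1 ≠ 0 := by rw [e]; exact mul_ne_zero h11 hd
    refine Eq.trans ?_ (eval_polyActAux k u (mono k m) z hne).symm
    have e2 : (u 0 0 * z + u 0 1) / (u 1 0 * z + u 1 1) =
        (u 0 0 / u 1 1 * z + u 0 1 / u 1 1) / (u 1 0 / u 1 1 * z + 1) := by
      rw [e, div_eq_div_iff (mul_ne_zero h11 hd) hd]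
      field_simp
    rw [e2, e, mono_val hm, Polynomial.eval_pow, Polynomial.eval_X, Units.val_inv_eq_inv_val,
      gdet_eq, wt, phi, zpow_sub₀ hd, zpow_natCast, zpow_natCast, div_pow, mul_pow]
    ring
  exact congrFun ((hasExp_eval _).unique h1) n

lemma Sig.coef_eq_zero (h : Sig u) {k m n : ℕ} (hm : m ≤ k) (hn : k < n) : h.coef k m n = 0 := by
  have := h.polyAct_mono hm n
  rw [Polynomial.coeff_eq_zero_of_natDegree_lt ((natDegree_le k _).trans_lt hn), eq_comm,
    mul_eq_zero] at this
  refine this.resolve_left ?_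
  exact mul_ne_zero (pow_ne_zero _ (inv_ne_zero (gdet_ne_zero u))) (pow_ne_zero _ h.ne_zero)

lemma Iw.norm_wt {k : ℕ} (hk : Even k) (h : Iw u) : ‖wt k u‖ = 1 := by
  obtain ⟨r, rfl⟩ := hk
  have h0 : ‖u 1 1‖ ≠ 0 := norm_ne_zero_iff.2 h.ne_zero
  rw [wt, norm_mul, norm_pow, norm_pow, norm_inv, h.norm_gdet, show (r + r) / 2 = r by omega,
    ← two_mul, pow_mul, ← mul_pow, inv_mul_cancel₀ (pow_ne_zero _ h0), one_pow]

lemma norm_wt_aff (k : ℕ) (m : ℤ) (a : ℚ_[p]) :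
    ‖wt k (aff m a)‖ = ((p : ℝ) ^ m) ^ (k / 2) := by
  simp [wt, gdet, aff, Padic.norm_p]

end Sig

/-! ### Homogeneous functions -/

section Sections
variable {E : Type} [NormedField E] [NormedAlgebra ℚ_[p] E] {k : ℕ}
  {F G : ℚ_[p] → ℚ_[p] → E} {g u : GL (Fin 2) ℚ_[p]} {b : ℕ → E}

/-- Homogeneity of degree `k`. -/
def Homog (k : ℕ) (F : ℚ_[p] → ℚ_[p] → E) : Prop :=
  ∀ s : ℚ_[p], s ≠ 0 → ∀ x y, F (s * x) (s * y) = s ^ k • F x y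

/-- The restriction of `F` to `g ℤ_p`, in the coordinate given by `g`. -/
def res (k : ℕ) (F : ℚ_[p] → ℚ_[p] → E) (g : GL (Fin 2) ℚ_[p]) (z : ℚ_[p]) : E :=
  ((gdet g)⁻¹ ^ (k / 2)) • F (g 0 0 * z + g 0 1) (g 1 0 * z + g 1 1)

lemma res_mul (hF : Homog k F) (h : Sig u) {z : ℚ_[p]} (hz : ‖z‖ ≤ 1) :
    res k F (g * u) z = (wt k u * (u 1 0 / u 1 1 * z + 1) ^ k) •
      res k F g ((u 0 0 / u 1 1 * z + u 0 1 / u 1 1) / (u 1 0 / u 1 1 * z + 1)) := by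
  have hd := h.den_ne_zero hz
  have h11 := h.ne_zero
  set d := u 1 0 / u 1 1 * z + 1 with hdd
  set w := (u 0 0 / u 1 1 * z + u 0 1 / u 1 1) / d with hw
  have e1 : (g * u) 0 0 * z + (g * u) 0 1 = (u 1 1 * d) * (g 0 0 * w + g 0 1) := by
    have : (u 1 1 * d) * (g 0 0 * w + g 0 1) = g 0 0 * (u 1 1 * (w * d)) + g 0 1 * (u 1 1 * d) := by
      ring
    rw [this, hw, div_mul_cancel₀ _ hd, hdd, mul_00, mul_01]
    field_simp
    ring
  have e2 : (g * u) 1 0 * z + (g * u) 1 1 = (u 1 1 * d) * (g 1 0 * w + g 1 1) := by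
    have : (u 1 1 * d) * (g 1 0 * w + g 1 1) = g 1 0 * (u 1 1 * (w * d)) + g 1 1 * (u 1 1 * d) := by
      ring
    rw [this, hw, div_mul_cancel₀ _ hd, hdd, mul_10, mul_11]
    field_simp
    ring
  rw [res, e1, e2, hF _ (mul_ne_zero h11 hd), res, smul_smul, smul_smul, gdet_mul, wt]
  congr 1
  rw [mul_inv, mul_pow, mul_pow]
  ring

variable [CompleteSpace E] [IsUltrametricDist E]

lemma transfer (hF : Homog k F) (h : Sig u) (hb : HasExp (res k F g) b) :
    HasExp (res k F (g * u)) (fun n => wt k u • ∑' m, h.coef k m n • b m) := by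
  have h1 : HasExp (fun z => (u 1 0 / u 1 1 * z + 1) ^ k •
      res k F g ((u 0 0 / u 1 1 * z + u 0 1 / u 1 1) / (u 1 0 / u 1 1 * z + 1)))
      (fun n => ∑' m, h.coef k m n • b m) := by
    refine hasExp_subst (fun m => h.hasExp k m) (fun m n => h.coef_norm k m n) hb.tendsto ?_
    intro z hz
    have hd := h.den_ne_zero hz
    set w := (u 0 0 / u 1 1 * z + u 0 1 / u 1 1) / (u 1 0 / u 1 1 * z + 1) with hw
    have hw1 : ‖w‖ ≤ 1 := by
      rw [hw, norm_div, h.norm_den hz, div_one]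
      refine norm_add_le_of ?_ h.norm_b
      rw [norm_mul]
      exact mul_le_one₀ h.norm_a (norm_nonneg _) hz
    have := (hb w hw1).const_smul ((u 1 0 / u 1 1 * z + 1) ^ k)
    refine (congrArg (fun f => HasSum f _) (funext fun n => ?_)).mp this
    rw [smul_smul, phi, hw, div_pow, zpow_sub₀ hd, zpow_natCast, zpow_natCast]
    congr 1
    ring
  intro z hz
  have h2 := (h1 z hz).const_smul (wt k u)
  rw [smul_smul, ← res_mul hF h hz] at h2
  refine (congrArg (fun f => HasSum f _) (funext fun n => ?_)).mp h2
  rw [smul_comm]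

lemma transfer_tail (h : Sig u) {t q : ℝ} (ht0 : 0 ≤ t) (hq0 : 0 ≤ q) (hbt : Tendsto b atTop (𝓝 0))
    (ht : ∀ n, k < n → ‖b n‖ ≤ t) {n : ℕ} (hn : k < n) (hq : ∀ m, ‖h.coef k m n‖ ≤ q) :
    ‖wt k u • ∑' m, h.coef k m n • b m‖ ≤ ‖wt k u‖ * (q * t) := by
  rw [norm_smul]
  refine mul_le_mul_of_nonneg_left ?_ (norm_nonneg _)
  have hs : Summable (fun m => h.coef k m n • b m) := by
    refine summable_of_tendsto_zero (squeeze_zero_norm (fun m => ?_) (tendsto_norm_zero.comp hbt))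
    rw [norm_smul]
    exact mul_le_of_le_one_left (norm_nonneg _) (h.coef_norm k m n)
  refine hasSum_norm_le hs.hasSum (mul_nonneg hq0 ht0) fun m => ?_
  by_cases hm : m ≤ k
  · rw [h.coef_eq_zero hm hn, zero_smul, norm_zero]
    exact mul_nonneg hq0 ht0
  · rw [norm_smul]
    exact mul_le_mul (hq m) (ht m (not_le.1 hm)) (norm_nonneg _) hq0

/-- The moments of `c` on `g ℤ_p`. -/
def mom (c : Edge p → Vk p k E) (g : GL (Fin 2) ℚ_[p]) (i : ℕ) : E :=
  c (g • e0 p) (polyAct k g⁻¹ (mono k i))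

omit [CompleteSpace E] [IsUltrametricDist E] in
lemma mom_mul (c : Edge p → Vk p k E) (h : Sig u) {m : ℕ} (hm : m ≤ k) :
    c ((g * u) • e0 p) (polyAct k g⁻¹ (mono k m)) =
      ∑ i ∈ Finset.range (k + 1), (wt k u * h.coef k m i) • mom c (g * u) i := by
  have e : polyAct k g⁻¹ (mono k m) = polyAct k (g * u)⁻¹ (polyAct k u (mono k m)) := by
    rw [← LinearMap.comp_apply, ← polyAct_mul]
    congr 2
    group
  rw [e, eq_sum_mono (polyAct k u (mono k m)), map_sum, map_sum]
  refine Finset.sum_congr rfl fun i _ => ?_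
  rw [map_smul, map_smul, h.polyAct_mono hm, mom]

lemma transfer_main (c : Edge p → Vk p k E) (h : Sig u) {t C : ℝ} (ht0 : 0 ≤ t) (hC0 : 0 ≤ C)
    (hbt : Tendsto b atTop (𝓝 0)) (ht : ∀ n, k < n → ‖b n‖ ≤ t)
    (hC : ∀ i, ‖mom c (g * u) i‖ ≤ C) :
    ‖∑ i ∈ Finset.range (k + 1), (wt k u • ∑' m, h.coef k m i • b m) * mom c (g * u) i -
      ∑ m ∈ Finset.range (k + 1), b m * c ((g * u) • e0 p) (polyAct k g⁻¹ (mono k m))‖ ≤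
      ‖wt k u‖ * (t * C) := by
  have hs : ∀ i, Summable (fun m => h.coef k m i • b m) := fun i => by
    refine summable_of_tendsto_zero (squeeze_zero_norm (fun m => ?_) (tendsto_norm_zero.comp hbt))
    rw [norm_smul]
    exact mul_le_of_le_one_left (norm_nonneg _) (h.coef_norm k m i)
  have e1 : ∑ m ∈ Finset.range (k + 1), b m * c ((g * u) • e0 p) (polyAct k g⁻¹ (mono k m)) =
      ∑ i ∈ Finset.range (k + 1), (wt k u • ∑ m ∈ Finset.range (k + 1), h.coef k m i • b m) *
        mom c (g * u) i := by
    calc _ = ∑ m ∈ Finset.range (k + 1), ∑ i ∈ Finset.range (k + 1),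
          b m * (wt k u * h.coef k m i) • mom c (g * u) i := by
          refine Finset.sum_congr rfl fun m hm => ?_
          rw [mom_mul c h (Nat.lt_succ_iff.1 (Finset.mem_range.1 hm)), Finset.mul_sum]
      _ = _ := by
          rw [Finset.sum_comm]
          refine Finset.sum_congr rfl fun i _ => ?_
          rw [Finset.smul_sum, Finset.sum_mul]
          refine Finset.sum_congr rfl fun m _ => ?_
          rw [smul_smul, smul_mul_assoc, mul_smul_comm]
  rw [e1, ← Finset.sum_sub_distrib]
  refine IsUltrametricDist.norm_sum_le_of_forall_le_of_nonneg
    (mul_nonneg (norm_nonneg _) (mul_nonneg ht0 hC0)) fun i _ => ?_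
  rw [← sub_mul, ← smul_sub, norm_mul, norm_smul, mul_assoc]
  refine mul_le_mul_of_nonneg_left (mul_le_mul ?_ (hC i) (norm_nonneg _) ht0) (norm_nonneg _)
  rw [← (hs i).sum_add_tsum_nat_add (k + 1), add_sub_cancel_left]
  refine hasSum_norm_le ((summable_nat_add_iff (k + 1)).2 (hs i)).hasSum ht0 fun m => ?_
  rw [norm_smul]
  exact (mul_le_of_le_one_left (norm_nonneg _) (h.coef_norm k _ i)).trans (ht _ (by omega))

end Sections

/-! ### Riemann sums -/

section Riemann
variable {E : Type} [NormedField E] [NormedAlgebra ℚ_[p] E] {k : ℕ}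
  {F G : ℚ_[p] → ℚ_[p] → E} {g u : GL (Fin 2) ℚ_[p]} {b : ℕ → E}

open scoped Classical in
/-- The Taylor coefficients of `f`, if `f` is given on `ℤ_p` by a power series. -/
def coefs (f : ℚ_[p] → E) : ℕ → E := if h : ∃ b, HasExp f b then h.choose else 0

lemma HasExp.coefs_eq {f : ℚ_[p] → E} (h : HasExp f b) : coefs f = b := by
  have hex : ∃ b, HasExp f b := ⟨b, h⟩
  rw [coefs, dif_pos hex]
  exact hex.choose_spec.unique h

/-- The approximation to the integral of `F` over `g ℤ_p` given by a Taylor polynomial. -/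
def taylorSum (c : Edge p → Vk p k E) (F : ℚ_[p] → ℚ_[p] → E) (g : GL (Fin 2) ℚ_[p]) : E :=
  ∑ i ∈ Finset.range (k + 1), coefs (res k F g) i * mom c g i

/-- The Riemann sum for the integral of `F` over `g ℤ_p` and its balls of level `s`. -/
def riemann (c : Edge p → Vk p k E) (F : ℚ_[p] → ℚ_[p] → E) : ℕ → GL (Fin 2) ℚ_[p] → E
  | 0, g => taylorSum c F g
  | s + 1, g => ∑ j : Fin p, riemann c F s (g * hm ((j : ℕ) : ℚ_[p]))

/-- `F` is analytic on the balls of level `m` of `g ℤ_p`, with Taylor coefficients of order `> k`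
bounded by `t`. -/
def AnBd (k : ℕ) (F : ℚ_[p] → ℚ_[p] → E) (t : ℝ) : ℕ → GL (Fin 2) ℚ_[p] → Prop
  | 0, g => ∃ b, HasExp (res k F g) b ∧ ∀ n, k < n → ‖b n‖ ≤ t
  | m + 1, g => ∀ j : Fin p, AnBd k F t m (g * hm ((j : ℕ) : ℚ_[p]))

lemma AnBd.mono {t t' : ℝ} (htt : t ≤ t') : ∀ {m : ℕ} {g}, AnBd k F t m g → AnBd k F t' m g
  | 0, _, ⟨b, hb, ht⟩ => ⟨b, hb, fun n hn => (ht n hn).trans htt⟩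
  | _ + 1, _, h => fun j => AnBd.mono htt (h j)

/-- `c` is harmonic with moments bounded by `C`. -/
structure IsBdd (c : Edge p → Vk p k E) (C : ℝ) : Prop where
  nonneg : 0 ≤ C
  symm : ∀ e, c e.symm = -c e
  sum : ∀ g : GL (Fin 2) ℚ_[p], c (g • e0 p) = ∑ j : Fin p, c ((g * hm ((j : ℕ) : ℚ_[p])) • e0 p)
  bound : ∀ g i, ‖mom c g i‖ ≤ C

variable (p) in
/-- The contraction factor. -/
def ratio (k : ℕ) : ℝ := (p : ℝ) ^ (k / 2) * (p : ℝ)⁻¹ ^ (k + 1)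

variable (p) in
lemma ratio_nonneg (k : ℕ) : 0 ≤ ratio p k := by
  have := p_pos (p := p)
  unfold ratio; positivity

variable (p) in
lemma ratio_lt_one (k : ℕ) : ratio p k < 1 := by
  have hp := p_pos (p := p)
  rw [ratio, inv_pow, ← div_eq_mul_inv, div_lt_one (by positivity)]
  exact pow_lt_pow_right₀ one_lt_p (by omega)

lemma norm_natCast_le (j : ℕ) : ‖(j : ℚ_[p])‖ ≤ 1 := IsUltrametricDist.norm_natCast_le_one _ _

lemma norm_wt_hm (k : ℕ) (a : ℚ_[p]) : ‖wt k (hm a)‖ = (p : ℝ) ^ (k / 2) := by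
  rw [hm_eq_aff, norm_wt_aff, zpow_one]

lemma coef_hm_norm {a : ℚ_[p]} (ha : ‖a‖ ≤ 1) {n : ℕ} (hn : k < n) (m : ℕ) :
    ‖(sig_hm ha).coef k m n‖ ≤ (p : ℝ)⁻¹ ^ (k + 1) := by
  refine ((sig_hm ha).coef_norm_of_c (by simp [hm]) k m n).trans ?_
  have : ‖(hm a) 0 0 / (hm a) 1 1‖ = (p : ℝ)⁻¹ := by simp [hm, Padic.norm_p]
  rw [this]
  exact pow_le_pow_of_le_one (inv_nonneg.2 p_pos.le) (inv_le_one_of_one_le₀ one_lt_p.le) hn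

lemma exists_perm (h : Iw u) : ∃ σ : Equiv.Perm (Fin p), ∀ j : Fin p,
    ∃ v, Iw v ∧ u * hm ((j : ℕ) : ℚ_[p]) = hm ((σ j : ℕ) : ℚ_[p]) * v := by
  have key : ∀ j : Fin p, ∃ i : Fin p, (u * hm ((j : ℕ) : ℚ_[p])) • e0 p = hm ((i : ℕ) : ℚ_[p]) • e0 p := by
    intro j
    have hv : u • v0 p = v0 p := (smul_v0_eq_iff u).2 h.maxl
    obtain ⟨i, hi⟩ := exists_nb (e := (u * nb (some j)) • e0 p) (by rw [nb_smul_fst, hv])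
    cases i with
    | some i => exact ⟨i, hi⟩
    | none =>
      exfalso
      have h1 : (u * nb (some j)) • e0 p = (u * nb (none : Option (Fin p))) • e0 p := by
        rw [hi]
        change w0 p • e0 p = (u * w0 p) • e0 p
        rw [smul_w0_e0, w0_smul_e0, (smul_e0_eq_iff u).2 h]
      rw [mul_smul, mul_smul] at h1
      have := nb_injective (smul_left_cancel u h1)
      simp at this
  choose σ hσ using key
  have hinj : Function.Injective σ := by
    intro i j hij
    have h1 : (u * hm ((i : ℕ) : ℚ_[p])) • e0 p = (u * hm ((j : ℕ) : ℚ_[p])) • e0 p := by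
      rw [hσ, hσ, hij]
    rw [mul_smul, mul_smul] at h1
    have := nb_injective (a₁ := some i) (a₂ := some j) (smul_left_cancel u h1)
    simpa using this
  refine ⟨Equiv.ofBijective σ (Finite.injective_iff_bijective.1 hinj), fun j => ?_⟩
  refine ⟨(hm ((σ j : ℕ) : ℚ_[p]))⁻¹ * (u * hm ((j : ℕ) : ℚ_[p])), ?_, ?_⟩
  · exact (smul_e0_eq_smul_iff _ _).1 (hσ j)
  · rw [Equiv.ofBijective_apply, mul_inv_cancel_left]

variable [CompleteSpace E] [IsUltrametricDist E] {c : Edge p → Vk p k E} {C t : ℝ}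

lemma AnBd.step (hF : Homog k F) (ht0 : 0 ≤ t) :
    ∀ {m : ℕ} {g}, AnBd k F t m g → AnBd k F (ratio p k * t) (m + 1) g
  | 0, g, ⟨b, hb, ht⟩ => fun j => by
    refine ⟨_, transfer hF (sig_hm (norm_natCast_le j)) hb, fun n hn => ?_⟩
    refine (transfer_tail (sig_hm (norm_natCast_le j)) ht0 (q := (p : ℝ)⁻¹ ^ (k + 1)) ?_ hb.tendsto
      ht hn (coef_hm_norm (norm_natCast_le j) hn)).trans ?_
    · exact pow_nonneg (inv_nonneg.2 p_pos.le) _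
    · rw [norm_wt_hm, ratio, mul_assoc]
  | _ + 1, _, h => fun j => AnBd.step hF ht0 (h j)

lemma AnBd.steps (hF : Homog k F) (ht0 : 0 ≤ t) {m : ℕ} (h : AnBd k F t m g) (s : ℕ) :
    AnBd k F (ratio p k ^ s * t) (m + s) g := by
  induction s with
  | zero => simpa using h
  | succ s ih =>
    have := ih.step hF (mul_nonneg (pow_nonneg (ratio_nonneg p k) s) ht0)
    rwa [pow_succ', mul_assoc]

lemma AnBd.of_iw (hk : Even k) (hF : Homog k F) (ht0 : 0 ≤ t) :
    ∀ {m : ℕ} {g u}, Iw u → AnBd k F t m g → AnBd k F t m (g * u)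
  | 0, g, u, hu, ⟨b, hb, ht⟩ => by
    refine ⟨_, transfer hF hu.sig hb, fun n hn => ?_⟩
    refine (transfer_tail hu.sig ht0 (q := 1) zero_le_one hb.tendsto ht hn
      (fun m => hu.sig.coef_norm k m n)).trans ?_
    rw [hu.norm_wt hk, one_mul, one_mul]
  | m + 1, g, u, hu, h => fun j => by
    obtain ⟨σ, hσ⟩ := exists_perm hu
    obtain ⟨v, hv, e⟩ := hσ j
    rw [mul_assoc, e, ← mul_assoc]
    exact AnBd.of_iw hk hF ht0 hv (h (σ j))

lemma taylorSum_norm_le (hc : IsBdd c C) (hb : HasExp (res k F g) b) {B : ℝ} (hB0 : 0 ≤ B)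
    (hB : ∀ n, ‖b n‖ ≤ B) : ‖taylorSum c F g‖ ≤ B * C := by
  rw [taylorSum, hb.coefs_eq]
  refine IsUltrametricDist.norm_sum_le_of_forall_le_of_nonneg (mul_nonneg hB0 hc.nonneg) fun i _ => ?_
  rw [norm_mul]
  exact mul_le_mul (hB i) (hc.bound g i) (norm_nonneg _) hB0

lemma riemann_step (hc : IsBdd c C) (hF : Homog k F) (ht0 : 0 ≤ t) :
    ∀ {m : ℕ} {g}, AnBd k F t m g →
      ‖riemann c F (m + 1) g - riemann c F m g‖ ≤ (p : ℝ) ^ (k / 2) * (t * C)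
  | 0, g, ⟨b, hb, ht⟩ => by
    have e : taylorSum c F g = ∑ j : Fin p, ∑ m ∈ Finset.range (k + 1),
        b m * c ((g * hm ((j : ℕ) : ℚ_[p])) • e0 p) (polyAct k g⁻¹ (LOperator.mono k m)) := by
      rw [taylorSum, hb.coefs_eq, Finset.sum_comm]
      refine Finset.sum_congr rfl fun m _ => ?_
      rw [mom, hc.sum, LinearMap.sum_apply, Finset.mul_sum]
    change ‖∑ j : Fin p, taylorSum c F (g * hm ((j : ℕ) : ℚ_[p])) - taylorSum c F g‖ ≤ _
    rw [e, ← Finset.sum_sub_distrib]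
    refine IsUltrametricDist.norm_sum_le_of_forall_le_of_nonneg ?_ fun j _ => ?_
    · exact mul_nonneg (pow_nonneg p_pos.le _) (mul_nonneg ht0 hc.nonneg)
    · have hs := sig_hm (norm_natCast_le (p := p) j)
      rw [taylorSum, (transfer hF hs hb).coefs_eq]
      refine (transfer_main c hs ht0 hc.nonneg hb.tendsto ht (hc.bound _)).trans ?_
      rw [norm_wt_hm]
  | m + 1, g, h => by
    change ‖∑ j : Fin p, riemann c F (m + 1) (g * hm ((j : ℕ) : ℚ_[p])) -
      ∑ j : Fin p, riemann c F m (g * hm ((j : ℕ) : ℚ_[p]))‖ ≤ _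
    rw [← Finset.sum_sub_distrib]
    refine IsUltrametricDist.norm_sum_le_of_forall_le_of_nonneg ?_ fun j _ =>
      riemann_step hc hF ht0 (h j)
    exact mul_nonneg (pow_nonneg p_pos.le _) (mul_nonneg ht0 hc.nonneg)

lemma riemann_iw (hk : Even k) (hc : IsBdd c C) (hF : Homog k F) (ht0 : 0 ≤ t) :
    ∀ {m : ℕ} {g u}, Iw u → AnBd k F t m g →
      ‖riemann c F m (g * u) - riemann c F m g‖ ≤ t * C
  | 0, g, u, hu, ⟨b, hb, ht⟩ => by
    change ‖taylorSum c F (g * u) - taylorSum c F g‖ ≤ _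
    have e : taylorSum c F g = ∑ m ∈ Finset.range (k + 1),
        b m * c ((g * u) • e0 p) (polyAct k g⁻¹ (LOperator.mono k m)) := by
      rw [taylorSum, hb.coefs_eq]
      refine Finset.sum_congr rfl fun m _ => ?_
      rw [mom, mul_smul, (smul_e0_eq_iff u).2 hu]
    rw [e, taylorSum, (transfer hF hu.sig hb).coefs_eq]
    refine (transfer_main c hu.sig ht0 hc.nonneg hb.tendsto ht (hc.bound _)).trans ?_
    rw [hu.norm_wt hk, one_mul]
  | m + 1, g, u, hu, h => by
    obtain ⟨σ, hσ⟩ := exists_perm hu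
    change ‖∑ j : Fin p, riemann c F m (g * u * hm ((j : ℕ) : ℚ_[p])) -
      ∑ j : Fin p, riemann c F m (g * hm ((j : ℕ) : ℚ_[p]))‖ ≤ _
    rw [← Equiv.sum_comp σ (fun j : Fin p => riemann c F m (g * hm ((j : ℕ) : ℚ_[p]))),
      ← Finset.sum_sub_distrib]
    refine IsUltrametricDist.norm_sum_le_of_forall_le_of_nonneg (mul_nonneg ht0 hc.nonneg)
      fun j _ => ?_
    obtain ⟨v, hv, e⟩ := hσ j
    rw [mul_assoc, e, ← mul_assoc]
    exact riemann_iw hk hc hF ht0 hv (h (σ j))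

/-- The integral of `F` over `g ℤ_p`. -/
def coneInt (c : Edge p → Vk p k E) (F : ℚ_[p] → ℚ_[p] → E) (g : GL (Fin 2) ℚ_[p]) : E :=
  limUnder atTop (fun s => riemann c F s g)

lemma riemann_dist (hc : IsBdd c C) (hF : Homog k F) (ht0 : 0 ≤ t) {m : ℕ} (h : AnBd k F t m g)
    (s : ℕ) : ‖riemann c F (s + 1 + m) g - riemann c F (s + m) g‖ ≤
      ((p : ℝ) ^ (k / 2) * (t * C)) * ratio p k ^ s := by
  have := riemann_step hc hF (mul_nonneg (pow_nonneg (ratio_nonneg p k) s) ht0) (h.steps hF ht0 s)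
  rw [show s + 1 + m = m + s + 1 by omega, add_comm s m]
  refine this.trans (le_of_eq (by ring))

lemma coneInt_tendsto (hc : IsBdd c C) (hF : Homog k F) (ht0 : 0 ≤ t) {m : ℕ} (h : AnBd k F t m g) :
    Tendsto (fun s => riemann c F s g) atTop (𝓝 (coneInt c F g)) := by
  have hcs : CauchySeq (fun s => riemann c F (s + m) g) := by
    refine cauchySeq_of_le_geometric (ratio p k) ((p : ℝ) ^ (k / 2) * (t * C)) (ratio_lt_one p k)
      fun s => ?_
    rw [dist_comm, dist_eq_norm]
    exact riemann_dist hc hF ht0 h s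
  obtain ⟨a, ha⟩ := cauchySeq_tendsto_of_complete hcs
  replace ha := (tendsto_add_atTop_iff_nat (f := fun s => riemann c F s g) m).1 ha
  exact tendsto_nhds_limUnder ⟨a, ha⟩

lemma coneInt_sub_norm (hc : IsBdd c C) (hF : Homog k F) (ht0 : 0 ≤ t) {m : ℕ}
    (h : AnBd k F t m g) :
    ‖coneInt c F g - riemann c F m g‖ ≤ (p : ℝ) ^ (k / 2) * (t * C) := by
  have h1 := (tendsto_add_atTop_iff_nat m).2 (coneInt_tendsto hc hF ht0 h)
  have h0 : 0 ≤ (p : ℝ) ^ (k / 2) * (t * C) :=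
    mul_nonneg (pow_nonneg p_pos.le _) (mul_nonneg ht0 hc.nonneg)
  refine le_of_tendsto ((h1.sub_const (riemann c F m g)).norm) (Eventually.of_forall fun s => ?_)
  induction s with
  | zero => simpa using h0
  | succ s ih =>
    have := riemann_dist hc hF ht0 h s
    have h2 : ((p : ℝ) ^ (k / 2) * (t * C)) * ratio p k ^ s ≤ (p : ℝ) ^ (k / 2) * (t * C) :=
      mul_le_of_le_one_right h0 (pow_le_one₀ (ratio_nonneg p k) (ratio_lt_one p k).le)
    have := norm_add_le_of (this.trans h2) ih
    rwa [sub_add_sub_cancel] at this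

/-- `F` is homogeneous and locally analytic. -/
structure IsLA (k : ℕ) (F : ℚ_[p] → ℚ_[p] → E) : Prop where
  homog : Homog k F
  an : ∀ g, ∃ m t, 0 ≤ t ∧ AnBd k F t m g

lemma coneInt_iw (hk : Even k) (hc : IsBdd c C) (hF : IsLA k F) (hu : Iw u) :
    coneInt c F (g * u) = coneInt c F g := by
  obtain ⟨m, t, ht0, h⟩ := hF.an g
  have h1 := coneInt_tendsto hc hF.homog ht0 h
  have h2 := coneInt_tendsto hc hF.homog ht0 (h.of_iw hk hF.homog ht0 hu)
  have h3 : Tendsto (fun s => riemann c F (s + m) (g * u) - riemann c F (s + m) g) atTop (𝓝 0) := by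
    refine squeeze_zero_norm (a := fun s => ratio p k ^ s * (t * C)) (fun s => ?_) ?_
    · have := riemann_iw hk hc hF.homog (mul_nonneg (pow_nonneg (ratio_nonneg p k) s) ht0) hu
        (h.steps hF.homog ht0 s)
      rw [add_comm s m, ← mul_assoc]
      exact this
    · have := (tendsto_pow_atTop_nhds_zero_of_lt_one (ratio_nonneg p k) (ratio_lt_one p k)).mul_const
        (t * C)
      rwa [zero_mul] at this
  have h4 := ((tendsto_add_atTop_iff_nat m).2 h2).sub ((tendsto_add_atTop_iff_nat m).2 h1)
  exact sub_eq_zero.1 (tendsto_nhds_unique h4 h3)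

lemma coneInt_subdivide (hc : IsBdd c C) (hF : IsLA k F) (g : GL (Fin 2) ℚ_[p]) :
    coneInt c F g = ∑ j : Fin p, coneInt c F (g * hm ((j : ℕ) : ℚ_[p])) := by
  have h1 : Tendsto (fun s => riemann c F (s + 1) g) atTop
      (𝓝 (∑ j : Fin p, coneInt c F (g * hm ((j : ℕ) : ℚ_[p])))) := by
    refine tendsto_finsetSum _ fun j _ => ?_
    obtain ⟨m, t, ht0, h⟩ := hF.an (g * hm ((j : ℕ) : ℚ_[p]))
    exact coneInt_tendsto hc hF.homog ht0 h
  obtain ⟨m, t, ht0, h⟩ := hF.an g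
  exact tendsto_nhds_unique
    ((tendsto_add_atTop_iff_nat 1).2 (coneInt_tendsto hc hF.homog ht0 h)) h1

/-- The integral of `F` over `U_e`. -/
def edgeInt (c : Edge p → Vk p k E) (F : ℚ_[p] → ℚ_[p] → E) (e : Edge p) : E :=
  coneInt c F (exists_smul_e0 e).choose

lemma edgeInt_smul (hk : Even k) (hc : IsBdd c C) (hF : IsLA k F) (g : GL (Fin 2) ℚ_[p]) :
    edgeInt c F (g • e0 p) = coneInt c F g := by
  have h := (exists_smul_e0 (g • e0 p)).choose_spec
  have h2 := (smul_e0_eq_smul_iff _ _).1 h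
  rw [edgeInt, ← coneInt_iw hk hc hF h2 (g := g), mul_inv_cancel_left]

/-- The integral of `F` over `ℙ¹(ℚ_p)`. -/
def totalInt (c : Edge p → Vk p k E) (F : ℚ_[p] → ℚ_[p] → E) : E :=
  coneInt c F 1 + coneInt c F (w0 p)

lemma totalInt_eq (hk : Even k) (hc : IsBdd c C) (hF : IsLA k F) (g : GL (Fin 2) ℚ_[p]) :
    totalInt c F = coneInt c F g + coneInt c F (g * w0 p) := by
  set S : Vertex p → E := fun v => ∑ᶠ e ∈ {e : Edge p | e.fst = v}, edgeInt c F e with hS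
  have h1 : ∀ g : GL (Fin 2) ℚ_[p], S (g • v0 p) = coneInt c F g + coneInt c F (g * w0 p) := by
    intro g
    rw [hS]
    dsimp only
    rw [finsum_edges, ← smul_w0_e0, edgeInt_smul hk hc hF, coneInt_subdivide hc hF g, add_comm]
    simp only [edgeInt_smul hk hc hF]
  have hw : ∀ g : GL (Fin 2) ℚ_[p], S ((g * w0 p) • v0 p) = S (g • v0 p) := by
    intro g
    rw [h1, h1, mul_assoc, w0_sq, coneInt_iw hk hc hF (Iw_scal _ _), add_comm]
  let H : Subgroup (GL (Fin 2) ℚ_[p]) :=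
    { carrier := {u | ∀ g : GL (Fin 2) ℚ_[p], S ((g * u) • v0 p) = S (g • v0 p)}
      one_mem' := fun g => by rw [mul_one]
      mul_mem' := fun {u v} hu hv g => by rw [← mul_assoc, hv, hu]
      inv_mem' := fun {u} hu g => by rw [← hu (g * u⁻¹), inv_mul_cancel_right] }
  have hmx : ∀ u, Maxl u → u ∈ H := fun u hu g => by
    rw [mul_smul, (smul_v0_eq_iff u).2 hu]
  have := gl_eq_top (S := H) (fun u hu => hmx u hu.maxl) (hmx _ Maxl_sw) hw g 1
  rw [one_mul, h1, h1, one_mul] at this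
  rw [totalInt, this]

lemma coneInt_of_hasExp (hc : IsBdd c C) (hF : Homog k F) (hb : HasExp (res k F g) b) {t : ℝ}
    (ht0 : 0 ≤ t) (ht : ∀ n, k < n → ‖b n‖ ≤ t) :
    ‖coneInt c F g - ∑ i ∈ Finset.range (k + 1), b i * mom c g i‖ ≤ (p : ℝ) ^ (k / 2) * (t * C) := by
  have := coneInt_sub_norm hc hF ht0 (m := 0) (g := g) ⟨b, hb, ht⟩
  change ‖coneInt c F g - taylorSum c F g‖ ≤ _ at this
  rwa [taylorSum, hb.coefs_eq] at this

lemma coneInt_eq_zero (hc : IsBdd c C) (hF : Homog k F) (h : ∀ z, ‖z‖ ≤ 1 → res k F g z = 0) :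
    coneInt c F g = 0 := by
  have hb : HasExp (res k F g) 0 := hasExp_zero.congr fun z hz => (h z hz).symm
  have := coneInt_of_hasExp hc hF hb le_rfl (fun n _ => by simp)
  simpa using this

end Riemann

/-! ### Functions on `ℙ¹(ℚ_p)` as homogeneous functions -/

section Ext
variable {E : Type} [NormedField E] [NormedAlgebra ℚ_[p] E] {k : ℕ}

lemma pole_unique {g g' : ℚ_[p] → E} (hg : ContinuousAt g 0) (hg' : ContinuousAt g' 0) {r : ℝ}
    (h : ∀ x : ℚ_[p], r < ‖x‖ → x ^ k • g x⁻¹ = x ^ k • g' x⁻¹) : g 0 = g' 0 := by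
  have hev : ∀ᶠ w : ℚ_[p] in 𝓝[≠] 0, g w = g' w := by
    have h0 : 0 < (|r| + 1)⁻¹ := inv_pos.2 (by positivity)
    filter_upwards [self_mem_nhdsWithin, mem_nhdsWithin_of_mem_nhds (Metric.ball_mem_nhds 0 h0)]
      with w hw hw1
    have hw0 : w ≠ 0 := hw
    rw [mem_ball_zero_iff] at hw1
    have h2 : r < ‖w⁻¹‖ := by
      rw [norm_inv]
      have := (lt_inv_comm₀ (norm_pos_iff.2 hw0) (by positivity)).1 hw1
      exact (le_abs_self r).trans_lt ((lt_add_one _).trans this)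
    have h3 := h w⁻¹ h2
    rw [inv_inv] at h3
    exact smul_right_injective E (pow_ne_zero k (inv_ne_zero hw0)) h3
  exact tendsto_nhds_unique ((hg.tendsto.mono_left nhdsWithin_le_nhds).congr' hev)
    (hg'.tendsto.mono_left nhdsWithin_le_nhds)

/-- The leading coefficient of `f` at `∞`. -/
def leading (f : locAn p k E) : E := f.2.2.choose 0

lemma leading_eq {f : locAn p k E} {g : ℚ_[p] → E} (hg : ContinuousAt g 0) {r : ℝ}
    (h : ∀ x, r < ‖x‖ → f.1 x = x ^ k • g x⁻¹) : leading f = g 0 := by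
  obtain ⟨h1, r', h2⟩ := f.2.2.choose_spec
  refine pole_unique (k := k) (r := max r r') h1.continuousAt hg fun x hx => ?_
  rw [max_lt_iff] at hx
  rw [← h x hx.1, ← h2 x hx.2]

lemma leading_spec (f : locAn p k E) : ∃ g : ℚ_[p] → E, AnalyticAt ℚ_[p] g 0 ∧ g 0 = leading f ∧
    ∃ r : ℝ, ∀ x, r < ‖x‖ → f.1 x = x ^ k • g x⁻¹ :=
  ⟨_, f.2.2.choose_spec.1, rfl, f.2.2.choose_spec.2⟩

lemma leading_lin (t : E) (f f' : locAn p k E) :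
    leading (t • f + f') = t * leading f + leading f' := by
  obtain ⟨g, hg, e, r, h⟩ := leading_spec f
  obtain ⟨g', hg', e', r', h'⟩ := leading_spec f'
  rw [← e, ← e']
  refine leading_eq (g := fun x => t * g x + g' x) (r := max r r') ?_ fun x hx => ?_
  · exact (continuousAt_const.mul hg.continuousAt).add hg'.continuousAt
  · rw [max_lt_iff] at hx
    change t * f.1 x + f'.1 x = _
    rw [h x hx.1, h' x hx.2, smul_add, mul_smul_comm]

open scoped Classical in
/-- The homogeneous function of degree `k` attached to `f`. -/
def ext (f : locAn p k E) (x y : ℚ_[p]) : E :=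
  if y = 0 then x ^ k • leading f else y ^ k • f.1 (x / y)

lemma ext_of_ne (f : locAn p k E) (x : ℚ_[p]) {y : ℚ_[p]} (hy : y ≠ 0) :
    ext f x y = y ^ k • f.1 (x / y) := if_neg hy

lemma ext_zero (f : locAn p k E) (x : ℚ_[p]) : ext f x 0 = x ^ k • leading f := if_pos rfl

lemma ext_lin (t : E) (f f' : locAn p k E) :
    ext (t • f + f') = fun x y => t * ext f x y + ext f' x y := by
  funext x y
  by_cases hy : y = 0
  · subst hy
    rw [ext_zero, ext_zero, ext_zero, leading_lin, smul_add, mul_smul_comm]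
  · rw [ext_of_ne _ _ hy, ext_of_ne _ _ hy, ext_of_ne _ _ hy, mul_smul_comm, ← smul_add]
    rfl

lemma homog_ext (f : locAn p k E) : Homog k (ext f) := by
  intro s hs x y
  by_cases hy : y = 0
  · subst hy
    rw [mul_zero, ext_zero, ext_zero, mul_pow, mul_smul]
  · rw [ext_of_ne _ _ hy, ext_of_ne _ _ (mul_ne_zero hs hy), mul_pow, mul_smul,
      mul_div_mul_left _ _ hs]

lemma gl_vec_ne_zero (g : GL (Fin 2) ℚ_[p]) (z : ℚ_[p]) (h : g 1 0 * z + g 1 1 = 0) :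
    g 0 0 * z + g 0 1 ≠ 0 := by
  intro h'
  refine gdet_ne_zero g ?_
  rw [gdet]
  linear_combination g 0 0 * h - g 1 0 * h'

lemma analyticAt_res_ext (f : locAn p k E) (g : GL (Fin 2) ℚ_[p]) (z : ℚ_[p]) :
    AnalyticAt ℚ_[p] (res k (ext f) g) z := by
  have hx : AnalyticAt ℚ_[p] (fun z => g 0 0 * z + g 0 1) z :=
    (analyticAt_const.mul analyticAt_id).add analyticAt_const
  have hy : AnalyticAt ℚ_[p] (fun z => g 1 0 * z + g 1 1) z :=
    (analyticAt_const.mul analyticAt_id).add analyticAt_const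
  suffices AnalyticAt ℚ_[p] (fun z => ext f (g 0 0 * z + g 0 1) (g 1 0 * z + g 1 1)) z from
    (analyticAt_const (𝕜 := ℚ_[p]) (v := ((gdet g)⁻¹ ^ (k / 2) : ℚ_[p]))).smul this
  by_cases h0 : g 1 0 * z + g 1 1 = 0
  · have h1 := gl_vec_ne_zero g z h0
    obtain ⟨G, hG, e, r, h⟩ := leading_spec f
    have hq : AnalyticAt ℚ_[p] (fun z => (g 1 0 * z + g 1 1) / (g 0 0 * z + g 0 1)) z :=
      hy.div hx h1
    have hq0 : (g 1 0 * z + g 1 1) / (g 0 0 * z + g 0 1) = 0 := by rw [h0, zero_div]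
    have h2 : AnalyticAt ℚ_[p] (fun z => (g 0 0 * z + g 0 1) ^ k •
        G ((g 1 0 * z + g 1 1) / (g 0 0 * z + g 0 1))) z := by
      refine (hx.pow k).smul (AnalyticAt.fun_comp (g := G) ?_ hq)
      rwa [hq0]
    refine h2.congr ?_
    have hlim := hq.continuousAt.tendsto
    rw [hq0] at hlim
    have hpos : 0 < (|r| + 1)⁻¹ := inv_pos.2 (by positivity)
    filter_upwards [hlim.eventually (Metric.ball_mem_nhds 0 hpos), hx.continuousAt.eventually_ne h1]
      with w hw hw1
    rw [dist_zero_right] at hw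
    by_cases hyw : g 1 0 * w + g 1 1 = 0
    · rw [hyw, zero_div, ext_zero, e]
    · rw [ext_of_ne _ _ hyw, h, smul_smul, ← mul_pow, inv_div, mul_div_cancel₀ _ hyw]
      rw [← inv_div, norm_inv]
      have := (lt_inv_comm₀ (norm_pos_iff.2 (div_ne_zero hyw hw1)) (by positivity)).1 hw
      exact (le_abs_self r).trans_lt ((lt_add_one _).trans this)
  · have h2 : AnalyticAt ℚ_[p] (fun z => (g 1 0 * z + g 1 1) ^ k •
        f.1 ((g 0 0 * z + g 0 1) / (g 1 0 * z + g 1 1))) z :=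
      (hy.pow k).smul (AnalyticAt.fun_comp (f.2.1 _) (hx.div hy h0))
    refine h2.congr ?_
    filter_upwards [hy.continuousAt.eventually_ne h0] with w hw
    rw [ext_of_ne _ _ hw]

variable [CompleteSpace E] [IsUltrametricDist E] {F G : ℚ_[p] → ℚ_[p] → E}

lemma res_aff (hF : Homog k F) (g : GL (Fin 2) ℚ_[p]) {m : ℤ} (hm : 0 ≤ m) {a z : ℚ_[p]}
    (ha : ‖a‖ ≤ 1) (hz : ‖z‖ ≤ 1) :
    res k F (g * aff m a) z = wt k (aff m a : GL (Fin 2) ℚ_[p]) • res k F g (a + (p : ℚ_[p]) ^ m * z) := by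
  rw [res_mul hF (sig_aff hm ha) hz]
  simp [aff, add_comm]

omit [CompleteSpace E] [IsUltrametricDist E] in
lemma anBd_of_hasExp : ∀ (m : ℕ) (g : GL (Fin 2) ℚ_[p]),
    (∀ a : ℚ_[p], ‖a‖ ≤ 1 → ∃ b, HasExp (res k F (g * aff m a)) b) → ∃ t, 0 ≤ t ∧ AnBd k F t m g
  | 0, g, h => by
    obtain ⟨b, hb⟩ := h 0 (by simp)
    rw [Nat.cast_zero, aff_zero_zero, mul_one] at hb
    obtain ⟨t, ht0, ht⟩ := exists_norm_le_of_tendsto hb.tendsto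
    exact ⟨t, ht0, b, hb, fun n _ => ht n⟩
  | m + 1, g, h => by
    have : ∀ j : Fin p, ∃ t, 0 ≤ t ∧ AnBd k F t m (g * hm ((j : ℕ) : ℚ_[p])) := fun j => by
      refine anBd_of_hasExp m _ fun a ha => ?_
      rw [mul_assoc, hm_eq_aff, aff_mul_aff, add_comm (1 : ℤ)]
      refine h _ (norm_add_le_of ?_ (norm_natCast_le _))
      rw [zpow_one, norm_mul]
      exact mul_le_one₀ (norm_natCast_le _) (norm_nonneg _) ha
    choose t ht0 ht using this
    refine ⟨∑ j, t j, Finset.sum_nonneg fun j _ => ht0 j, fun j => (ht j).mono ?_⟩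
    exact Finset.single_le_sum (fun j _ => ht0 j) (Finset.mem_univ j)

lemma isLA_of_analyticAt (hF : Homog k F) (h : ∀ g z, AnalyticAt ℚ_[p] (res k F g) z) :
    IsLA k F := by
  refine ⟨hF, fun g => ?_⟩
  have h1 : ∀ a : ℚ_[p], ∃ m : ℕ, ‖a‖ ≤ 1 → ∃ b, HasExp (res k F (g * aff m a)) b := by
    intro a
    obtain ⟨m, b, hb⟩ := exists_hasExp_of_analyticAt (h g a)
    refine ⟨m, fun ha => ⟨fun i => wt k (aff m a : GL (Fin 2) ℚ_[p]) • b i, fun z hz => ?_⟩⟩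
    rw [res_aff hF g (by positivity) ha hz, zpow_natCast]
    have := (hb z hz).const_smul (wt k (aff m a : GL (Fin 2) ℚ_[p]))
    refine (congrArg (fun f => HasSum f _) (funext fun i => ?_)).mp this
    rw [smul_comm]
  choose m hm using h1
  obtain ⟨T, hT, hcov⟩ := (isCompact_closedBall (0 : ℚ_[p]) 1).elim_nhds_subcover
    (fun a => Metric.closedBall a ((p : ℝ) ^ (-(m a : ℤ))))
    (fun a _ => Metric.closedBall_mem_nhds a (zpow_pos p_pos _))
  set N := T.sup m with hN
  obtain ⟨t, ht0, ht⟩ := anBd_of_hasExp (k := k) (F := F) N g (fun a ha => by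
    obtain ⟨z, hz, haz⟩ := Set.mem_iUnion₂.1 (hcov (mem_closedBall_zero_iff.2 ha))
    obtain ⟨b, hb⟩ := hm z (mem_closedBall_zero_iff.1 (hT z hz))
    have hle : m z ≤ N := Finset.le_sup hz
    have hpm : (p : ℚ_[p]) ^ (m z : ℤ) ≠ 0 := zpow_ne_zero _ p_ne_zero
    have e : aff N a = aff (m z) z * aff ((N : ℤ) - m z) ((a - z) / (p : ℚ_[p]) ^ (m z : ℤ)) := by
      rw [aff_mul_aff, mul_div_cancel₀ _ hpm, add_sub_cancel, sub_add_cancel]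
    have hs : Sig (aff ((N : ℤ) - m z) ((a - z) / (p : ℚ_[p]) ^ (m z : ℤ))) := by
      refine sig_aff (by omega) ?_
      rw [norm_div, div_le_one (norm_pos_iff.2 hpm), Padic.norm_p_zpow, ← dist_eq_norm]
      exact haz
    rw [e, ← mul_assoc]
    exact ⟨_, transfer hF hs hb⟩)
  exact ⟨N, t, ht0, ht⟩

lemma isLA_ext (f : locAn p k E) : IsLA k (ext f) :=
  isLA_of_analyticAt (homog_ext f) (analyticAt_res_ext f)

/-! ### Linearity and equivariance of the integral -/

variable {c : Edge p → Vk p k E} {C : ℝ}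

omit [CompleteSpace E] [IsUltrametricDist E] in
lemma riemann_lin (t : E) {s s' : ℝ} : ∀ {m : ℕ} {g}, AnBd k F s m g → AnBd k G s' m g →
    riemann c (fun x y => t * F x y + G x y) m g = t * riemann c F m g + riemann c G m g
  | 0, g, ⟨b, hb, _⟩, ⟨b', hb', _⟩ => by
    have : HasExp (res k (fun x y => t * F x y + G x y) g) (fun n => t * b n + b' n) := by
      refine ((hb.const_mul t).add hb').congr fun z _ => ?_
      simp [res]
    change taylorSum c _ g = t * taylorSum c _ g + taylorSum c _ g
    rw [taylorSum, taylorSum, taylorSum, this.coefs_eq, hb.coefs_eq, hb'.coefs_eq, Finset.mul_sum,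
      ← Finset.sum_add_distrib]
    exact Finset.sum_congr rfl fun i _ => by ring
  | m + 1, g, h, h' => by
    change ∑ j : Fin p, riemann c _ m _ = t * ∑ j : Fin p, riemann c F m _ + ∑ j : Fin p, riemann c G m _
    rw [Finset.mul_sum, ← Finset.sum_add_distrib]
    exact Finset.sum_congr rfl fun j _ => riemann_lin t (h j) (h' j)

lemma coneInt_lin (hc : IsBdd c C) (hF : IsLA k F) (hG : IsLA k G) (t : E) (g : GL (Fin 2) ℚ_[p]) :
    coneInt c (fun x y => t * F x y + G x y) g = t * coneInt c F g + coneInt c G g := by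
  obtain ⟨m, s, hs0, h⟩ := hF.an g
  obtain ⟨m', s', hs0', h'⟩ := hG.an g
  have h1 := ((coneInt_tendsto hc hF.homog hs0 h).const_mul t).add
    (coneInt_tendsto hc hG.homog hs0' h')
  refine Tendsto.limUnder_eq ((tendsto_add_atTop_iff_nat (m + m')).1 ?_)
  refine ((tendsto_add_atTop_iff_nat (m + m')).2 h1).congr fun i => ?_
  have e1 := h.steps hF.homog hs0 (m' + i)
  have e2 := h'.steps hG.homog hs0' (m + i)
  rw [show m + (m' + i) = i + (m + m') by omega] at e1
  rw [show m' + (m + i) = i + (m + m') by omega] at e2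
  exact (riemann_lin t e1 e2).symm

lemma totalInt_lin (hc : IsBdd c C) (hF : IsLA k F) (hG : IsLA k G) (t : E) :
    totalInt c (fun x y => t * F x y + G x y) = t * totalInt c F + totalInt c G := by
  rw [totalInt, coneInt_lin hc hF hG, coneInt_lin hc hF hG, totalInt, totalInt]
  ring

lemma totalInt_congr (h : ∀ x y, x ≠ 0 ∨ y ≠ 0 → F x y = G x y) : totalInt c F = totalInt c G := by
  have hr : res k F = res k G := by
    funext g z
    rw [res, res, h]
    by_cases h0 : g 1 0 * z + g 1 1 = 0
    · exact Or.inl (gl_vec_ne_zero g z h0)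
    · exact Or.inr h0
  have hs : ∀ s g, riemann c F s g = riemann c G s g := by
    intro s
    induction s with
    | zero => intro g; change taylorSum c F g = taylorSum c G g; rw [taylorSum, taylorSum, hr]
    | succ s ih => intro g; exact Finset.sum_congr rfl fun j _ => ih _
  simp only [totalInt, coneInt, hs]

lemma totalInt_comp (hk : Even k) (hc : IsBdd c C) (hF : IsLA k F) {γ : GL (Fin 2) ℚ_[p]}
    (hγ : gdet γ = 1) (hcγ : ∀ g i, mom c (γ * g) i = mom c g i) :
    totalInt c (fun x y => F (γ 0 0 * x + γ 0 1 * y) (γ 1 0 * x + γ 1 1 * y)) = totalInt c F := by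
  have hr : ∀ g, res k (fun x y => F (γ 0 0 * x + γ 0 1 * y) (γ 1 0 * x + γ 1 1 * y)) g =
      res k F (γ * g) := by
    intro g
    funext z
    rw [res, res, gdet_mul, hγ, one_mul, mul_00, mul_01, mul_10, mul_11]
    congr 2 <;> ring
  have hs : ∀ s g, riemann c (fun x y => F (γ 0 0 * x + γ 0 1 * y) (γ 1 0 * x + γ 1 1 * y)) s g =
      riemann c F s (γ * g) := by
    intro s
    induction s with
    | zero =>
      intro g
      change taylorSum c _ g = taylorSum c F (γ * g)
      rw [taylorSum, taylorSum, hr]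
      simp only [hcγ]
    | succ s ih =>
      intro g
      refine Finset.sum_congr rfl fun j _ => ?_
      rw [ih, mul_assoc]
  rw [totalInt_eq hk hc hF γ]
  simp only [totalInt, coneInt, hs, mul_one]

/-! ### The measure -/

/-- The integral of `f` against the measure of `c`. -/
def theMeasure (hc : IsBdd c C) : locAn p k E →ₗ[E] E where
  toFun f := totalInt c (ext f)
  map_add' f f' := by
    have := totalInt_lin hc (isLA_ext f) (isLA_ext f') 1
    rw [← ext_lin, one_smul, one_mul] at this
    exact this
  map_smul' t f := by
    have h0 : ∀ f : locAn p k E, totalInt c (ext f) = 0 → totalInt c (ext (t • f + 0)) =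
      t * totalInt c (ext f) + totalInt c (ext (0 : locAn p k E)) := fun _ _ => by
      rw [ext_lin, totalInt_lin hc (isLA_ext _) (isLA_ext _)]
    have h1 := totalInt_lin hc (isLA_ext f) (isLA_ext 0) t
    have h2 := totalInt_lin hc (isLA_ext (0 : locAn p k E)) (isLA_ext 0) 1
    rw [← ext_lin, add_zero] at h1
    rw [← ext_lin, one_smul, add_zero, one_mul, eq_comm, add_eq_right] at h2
    rw [h1, h2, add_zero]
    rfl

lemma theMeasure_apply (hc : IsBdd c C) (f : locAn p k E) :
    theMeasure hc f = totalInt c (ext f) := rfl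

lemma coneInt_norm_le (hc : IsBdd c C) (hF : Homog k F) {g : GL (Fin 2) ℚ_[p]} {b : ℕ → E}
    (hb : HasExp (res k F g) b) {B : ℝ} (hB0 : 0 ≤ B) (hB : ∀ n, ‖b n‖ ≤ B) :
    ‖coneInt c F g‖ ≤ (p : ℝ) ^ (k / 2) * (B * C) := by
  have h1 := coneInt_of_hasExp hc hF hb hB0 (fun n _ => hB n)
  have h2 := taylorSum_norm_le hc hb hB0 hB
  rw [taylorSum, hb.coefs_eq] at h2
  have h3 : B * C ≤ (p : ℝ) ^ (k / 2) * (B * C) :=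
    le_mul_of_one_le_left (mul_nonneg hB0 hc.nonneg) (one_le_pow₀ one_lt_p.le)
  have := norm_add_le_of h1 (h2.trans h3)
  rwa [sub_add_cancel] at this

lemma totalInt_of_support (hk : Even k) (hc : IsBdd c C) (hF : IsLA k F) {g : GL (Fin 2) ℚ_[p]}
    (h : ∀ z, ‖z‖ ≤ 1 → F (g 0 0 + g 0 1 * (p * z)) (g 1 0 + g 1 1 * (p * z)) = 0) :
    totalInt c F = coneInt c F g := by
  rw [totalInt_eq hk hc hF g, coneInt_eq_zero hc hF.homog (g := g * w0 p), add_zero]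
  intro z hz
  rw [res, mul_00, mul_01, mul_10, mul_11, w0_eq]
  simp only [mat_00, mat_01, mat_10, mat_11, mul_zero, mul_one, zero_add, add_zero]
  have e1 : g 0 1 * p * z + g 0 0 = g 0 0 + g 0 1 * (p * z) := by ring
  have e2 : g 1 1 * p * z + g 1 0 = g 1 0 + g 1 1 * (p * z) := by ring
  rw [e1, e2, h z hz, smul_zero]

omit [CompleteSpace E] [IsUltrametricDist E] in
lemma leading_eq_zero {f : locAn p k E} {r : ℝ} (h : ∀ x, r < ‖x‖ → f.1 x = 0) : leading f = 0 :=
  leading_eq (g := 0) continuousAt_const fun x hx => by rw [h x hx]; simp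

lemma theMeasure_aff (hk : Even k) (hc : IsBdd c C) {f : locAn p k E} {m : ℤ} {a : ℚ_[p]}
    (hf : ∀ x ∉ finBall (aff m a • e0 p), f.1 x = 0) {b : ℕ → E}
    (hb : HasExp (fun z => f.1 (a + (p : ℚ_[p]) ^ m * z)) b) {B : ℝ} (hB0 : 0 ≤ B)
    (hB : ∀ n, ‖b n‖ ≤ B) :
    ‖theMeasure hc f‖ ≤ (p : ℝ) ^ (k / 2) * C * (((p : ℝ) ^ m) ^ (k / 2) * B) := by
  have hp0 : (p : ℚ_[p]) ^ m ≠ 0 := zpow_ne_zero _ p_ne_zero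
  rw [theMeasure_apply, totalInt_of_support hk hc (isLA_ext f) (g := aff m a)]
  · have h1 : HasExp (res k (ext f) (aff m a)) (fun n => ((p : ℚ_[p]) ^ m)⁻¹ ^ (k / 2) • b n) := by
      intro z hz
      have e : res k (ext f) (aff m a) z = ((p : ℚ_[p]) ^ m)⁻¹ ^ (k / 2) •
          f.1 (a + (p : ℚ_[p]) ^ m * z) := by
        rw [res, ext_of_ne _ _ (by simp [aff])]
        simp [aff, gdet, add_comm]
      rw [e]
      have := (hb z hz).const_smul (((p : ℚ_[p]) ^ m)⁻¹ ^ (k / 2))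
      simp only [smul_comm _ (z ^ _)] at this
      exact this
    have hn : ∀ n, ‖((p : ℚ_[p]) ^ m)⁻¹ ^ (k / 2) • b n‖ ≤ ((p : ℝ) ^ m) ^ (k / 2) * B := by
      intro n
      rw [norm_smul, norm_pow, norm_inv, norm_zpow, Padic.norm_p, inv_zpow, inv_inv]
      exact mul_le_mul_of_nonneg_left (hB n) (pow_nonneg (zpow_nonneg p_pos.le _) _)
    refine (coneInt_norm_le hc (homog_ext f) h1 ?_ hn).trans (le_of_eq (by ring))
    exact mul_nonneg (pow_nonneg (zpow_nonneg p_pos.le _) _) hB0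
  · intro z hz
    have hlarge : ∀ x : ℚ_[p], (p : ℝ) ^ (-m) < ‖x - a‖ → f.1 x = 0 := fun x hx => by
      refine hf x ?_
      rw [finBall_aff, Metric.mem_closedBall, dist_eq_norm, not_le]
      exact hx
    by_cases hz0 : z = 0
    · subst hz0
      simp only [aff, mat_10, mat_11, mul_zero, add_zero, ext_zero]
      rw [leading_eq_zero (r := (p : ℝ) ^ (-m) + ‖a‖), smul_zero]
      intro x hx
      refine hlarge x ?_
      have := norm_sub_norm_le x a
      linarith
    · have hpz : (p : ℚ_[p]) * z ≠ 0 := mul_ne_zero p_ne_zero hz0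
      simp only [aff, mat_10, mat_11, mat_00, mat_01, one_mul, zero_add]
      rw [ext_of_ne _ _ hpz, hlarge, smul_zero]
      have e : ((p : ℚ_[p]) ^ m + a * (p * z)) / (p * z) - a = (p : ℚ_[p]) ^ m / (p * z) := by
        rw [add_div, mul_div_cancel_right₀ _ hpz, add_sub_cancel_right]
      rw [e, norm_div, Padic.norm_p_zpow, lt_div_iff₀ (norm_pos_iff.2 hpz)]
      refine mul_lt_of_lt_one_right (zpow_pos p_pos _) ?_
      exact norm_p_mul_lt one_pos hz

lemma theMeasure_iaff (hk : Even k) (hc : IsBdd c C) {f : locAn p k E} {m : ℤ}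
    (hf : ∀ x ∉ finBall (iaff p m • e0 p), f.1 x = 0) {b : ℕ → E} {G : ℚ_[p] → E}
    (hb : HasExp G b) (hG : ∀ z, z ≠ 0 → ‖z‖ ≤ 1 → G z = ((p : ℚ_[p]) ^ m * z) ^ k •
      f.1 ((p : ℚ_[p]) ^ m * z)⁻¹) {B : ℝ} (hB0 : 0 ≤ B) (hB : ∀ n, ‖b n‖ ≤ B) :
    ‖theMeasure hc f‖ ≤ (p : ℝ) ^ (k / 2) * C * (((p : ℝ) ^ m) ^ (k / 2) * B) := by
  have hp0 : (p : ℚ_[p]) ^ m ≠ 0 := zpow_ne_zero _ p_ne_zero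
  rw [theMeasure_apply, totalInt_of_support hk hc (isLA_ext f) (g := iaff p m)]
  · have hlead : leading f = G 0 := by
      have hcont : ContinuousAt G 0 := hb.hasFPowerSeriesAt.analyticAt.continuousAt
      have h0 : ((p : ℚ_[p]) ^ m)⁻¹ * 0 = 0 := mul_zero _
      rw [← h0]
      refine leading_eq (g := fun w => G (((p : ℚ_[p]) ^ m)⁻¹ * w)) (r := (p : ℝ) ^ m) ?_
        fun x hx => ?_
      · refine ContinuousAt.comp (g := G) ?_ (continuousAt_const.mul continuousAt_id)
        simpa using hcont
      · have hx0 : x ≠ 0 := norm_pos_iff.1 ((zpow_pos p_pos m).trans hx)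
        rw [hG _ (mul_ne_zero (inv_ne_zero hp0) (inv_ne_zero hx0)), mul_inv_cancel_left₀ hp0,
          inv_inv, smul_smul, ← mul_pow, mul_inv_cancel₀ hx0, one_pow, one_smul]
        rw [norm_mul, norm_inv, norm_inv, Padic.norm_p_zpow, ← mul_inv, zpow_neg]
        refine inv_le_one_of_one_le₀ ?_
        rw [← div_eq_inv_mul, one_le_div (zpow_pos p_pos m)]
        exact hx.le
    have h1 : HasExp (res k (ext f) (iaff p m)) (fun n => (-(p : ℚ_[p]) ^ m)⁻¹ ^ (k / 2) • b n) := by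
      intro z hz
      have e : res k (ext f) (iaff p m) z = (-(p : ℚ_[p]) ^ m)⁻¹ ^ (k / 2) • G z := by
        have e1 : gdet (iaff p m) = -(p : ℚ_[p]) ^ m := by simp [iaff, gdet]
        rw [res, e1]
        congr 1
        simp only [iaff, mat_00, mat_01, mat_10, mat_11, zero_mul, zero_add, add_zero]
        by_cases hz0 : z = 0
        · rw [hz0, mul_zero, ext_zero, one_pow, one_smul, hlead]
        · rw [ext_of_ne _ _ (mul_ne_zero hp0 hz0), hG z hz0 hz, one_div]
      rw [e]
      have := (hb z hz).const_smul ((-(p : ℚ_[p]) ^ m)⁻¹ ^ (k / 2))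
      simp only [smul_comm _ (z ^ _)] at this
      exact this
    have hn : ∀ n, ‖(-(p : ℚ_[p]) ^ m)⁻¹ ^ (k / 2) • b n‖ ≤ ((p : ℝ) ^ m) ^ (k / 2) * B := by
      intro n
      rw [norm_smul, norm_pow, norm_inv, norm_neg, norm_zpow, Padic.norm_p, inv_zpow, inv_inv]
      exact mul_le_mul_of_nonneg_left (hB n) (pow_nonneg (zpow_nonneg p_pos.le _) _)
    refine (coneInt_norm_le hc (homog_ext f) h1 ?_ hn).trans (le_of_eq (by ring))
    exact mul_nonneg (pow_nonneg (zpow_nonneg p_pos.le _) _) hB0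
  · intro z hz
    simp only [iaff, mat_10, mat_11, mat_00, mat_01, one_mul, zero_mul, zero_add, add_zero]
    rw [ext_of_ne _ _ hp0, hf, smul_zero]
    rw [finBall_iaff, Set.mem_ofPred_eq, not_le, norm_div, Padic.norm_p_zpow, zpow_neg, div_inv_eq_mul]
    exact mul_lt_of_lt_one_left (zpow_pos p_pos _) (norm_p_mul_lt one_pos hz)

omit [CompleteSpace E] [IsUltrametricDist E] in
lemma hasExp_monomial (n : ℕ) (t : E) :
    HasExp (fun z : ℚ_[p] => z ^ n • t) (fun i => if i = n then t else 0) := by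
  intro z _
  have := hasSum_ite_eq n (z ^ n • t)
  refine (congrArg (fun f => HasSum f _) (funext fun i => ?_)).mp this
  by_cases h : i = n
  · subst h; simp
  · simp [h]

/-- The homogenization of a polynomial. -/
def homogenize (P : Pk p k) (x y : ℚ_[p]) : ℚ_[p] :=
  ∑ i ∈ Finset.range (k + 1), P.1.coeff i * x ^ i * y ^ (k - i)

lemma homogenize_of_ne (P : Pk p k) (x : ℚ_[p]) {y : ℚ_[p]} (hy : y ≠ 0) :
    homogenize P x y = y ^ k * P.1.eval (x / y) := by
  rw [homogenize, Polynomial.eval_eq_sum_range' (Nat.lt_succ_of_le (natDegree_le k P)),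
    Finset.mul_sum]
  refine Finset.sum_congr rfl fun i hi => ?_
  have hi' : i ≤ k := Nat.lt_succ_iff.1 (Finset.mem_range.1 hi)
  have : y ^ k = y ^ (k - i) * y ^ i := by rw [← pow_add, Nat.sub_add_cancel hi']
  have hyi : y ^ i ≠ 0 := pow_ne_zero _ hy
  rw [this, div_pow]
  field_simp

lemma eval_polyAct (P : Pk p k) (g : GL (Fin 2) ℚ_[p]) (z : ℚ_[p]) :
    (polyAct k g P).1.eval z =
      (gdet g)⁻¹ ^ (k / 2) * homogenize P (g 0 0 * z + g 0 1) (g 1 0 * z + g 1 1) := by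
  change (polyActAux k g P.1).eval z = _
  rw [polyActAux, homogenize, Polynomial.eval_mul, Polynomial.eval_C, Units.val_inv_eq_inv_val,
    gdet_eq, Polynomial.eval_finsetSum]
  congr 1
  refine Finset.sum_congr rfl fun i _ => ?_
  simp

lemma continuous_homogenize (P : Pk p k) : Continuous fun y => homogenize P 1 y := by
  unfold homogenize; fun_prop

lemma homogenize_smul (P : Pk p k) (s x y : ℚ_[p]) :
    homogenize P (s * x) (s * y) = s ^ k * homogenize P x y := by
  rw [homogenize, homogenize, Finset.mul_sum]
  refine Finset.sum_congr rfl fun i hi => ?_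
  have hi' : i ≤ k := Nat.lt_succ_iff.1 (Finset.mem_range.1 hi)
  have : s ^ k = s ^ (k - i) * s ^ i := by rw [← pow_add, Nat.sub_add_cancel hi']
  rw [this, mul_pow, mul_pow]
  ring

lemma InCone_smul (g : GL (Fin 2) ℚ_[p]) {s : ℚ_[p]} (hs : s ≠ 0) (x y : ℚ_[p]) :
    InCone g (s * x) (s * y) ↔ InCone g x y := by
  have e1 : g 1 1 * (s * x) - g 0 1 * (s * y) = s * (g 1 1 * x - g 0 1 * y) := by ring
  have e2 : g 0 0 * (s * y) - g 1 0 * (s * x) = s * (g 0 0 * y - g 1 0 * x) := by ring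
  rw [InCone, InCone, e1, e2, norm_mul, norm_mul, mul_le_mul_iff_right₀ (norm_pos_iff.2 hs)]

lemma InCone_infty (g : GL (Fin 2) ℚ_[p]) :
    ∃ r : ℝ, ∀ x : ℚ_[p], r < ‖x‖ → (InCone g x 1 ↔ InCone g 1 0) := by
  have key : ∀ᶠ w : ℚ_[p] in 𝓝 0, (InCone g 1 w ↔ InCone g 1 0) := by
    have c1 : Tendsto (fun w : ℚ_[p] => ‖g 0 1 * w‖) (𝓝 0) (𝓝 0) := by
      have : Continuous fun w : ℚ_[p] => ‖g 0 1 * w‖ := by fun_prop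
      simpa using this.tendsto 0
    have c2 : Tendsto (fun w : ℚ_[p] => ‖g 0 0 * w‖) (𝓝 0) (𝓝 0) := by
      have : Continuous fun w : ℚ_[p] => ‖g 0 0 * w‖ := by fun_prop
      simpa using this.tendsto 0
    by_cases h : ‖g 1 1‖ ≤ ‖g 1 0‖
    · have h0 : 0 < ‖g 1 0‖ := by
        rw [norm_pos_iff]
        intro h0
        rw [h0, norm_zero, norm_le_zero_iff] at h
        exact gdet_ne_zero g (by rw [gdet, h, h0]; ring)
      filter_upwards [c1.eventually (gt_mem_nhds h0), c2.eventually (gt_mem_nhds h0)] with w h1 h2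
      rw [InCone, InCone, mul_one, mul_one, mul_zero, mul_zero, sub_zero, zero_sub, norm_neg,
        norm_sub_rev (g 0 0 * w), norm_sub_eq_left h2]
      exact iff_of_true (norm_sub_le_of h h1.le) h
    · have h' := not_le.1 h
      have h0 : 0 < ‖g 1 1‖ := (norm_nonneg _).trans_lt h'
      filter_upwards [c1.eventually (gt_mem_nhds h0), c2.eventually (gt_mem_nhds h0)] with w h1 h2
      rw [InCone, InCone, mul_one, mul_one, mul_zero, mul_zero, sub_zero, zero_sub, norm_neg,
        norm_sub_eq_left h1]
      exact iff_of_false (not_le.2 (norm_sub_lt_of h2 h')) h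
  rw [Metric.eventually_nhds_iff] at key
  obtain ⟨ε, hε, key⟩ := key
  refine ⟨ε⁻¹, fun x hx => ?_⟩
  have hx0 : x ≠ 0 := norm_pos_iff.1 ((inv_pos.2 hε).trans hx)
  have := @key x⁻¹ (by rw [dist_zero_right, norm_inv]; exact inv_lt_of_inv_lt₀ hε hx)
  rw [← this, ← InCone_smul g hx0 1, mul_one, mul_inv_cancel₀ hx0]

open scoped Classical in
omit [CompleteSpace E] [IsUltrametricDist E] in
lemma ext_indicator {g : GL (Fin 2) ℚ_[p]} {P : Pk p k} {f : locAn p k E}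
    (hf : f.1 = (finBall (g • e0 p)).indicator (fun x => algebraMap ℚ_[p] E (P.1.eval x)))
    {x y : ℚ_[p]} (hxy : x ≠ 0 ∨ y ≠ 0) :
    ext f x y = if InCone g x y then algebraMap ℚ_[p] E (homogenize P x y) else 0 := by
  have hval : ∀ x : ℚ_[p], f.1 x =
      if InCone g x 1 then algebraMap ℚ_[p] E (P.1.eval x) else 0 := fun x => by
    rw [hf, Set.indicator_apply]
    exact if_congr (coe_mem_ball g x) rfl rfl
  by_cases hy : y = 0
  · subst hy
    have hx : x ≠ 0 := hxy.resolve_right (by simp)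
    obtain ⟨r, hr⟩ := InCone_infty g
    rw [ext_zero, leading_eq (g := fun w => if InCone g 1 0 then
      algebraMap ℚ_[p] E (homogenize P 1 w) else 0) (r := max r 0)]
    · have h1 := InCone_smul g hx 1 0
      rw [mul_one, mul_zero] at h1
      have h2 := homogenize_smul P x 1 0
      rw [mul_one, mul_zero] at h2
      rw [h2, map_mul]
      simp only [h1]
      split_ifs
      · rw [Algebra.smul_def]
      · rw [smul_zero]
    · split_ifs
      · exact ((algebraMapCLM ℚ_[p] E).continuous.comp (continuous_homogenize P)).continuousAt
      · exact continuousAt_const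
    · intro w hw
      rw [max_lt_iff] at hw
      have hw0 : w ≠ 0 := norm_pos_iff.1 hw.2
      rw [hval]
      simp only [hr w hw.1]
      split_ifs
      · rw [homogenize_of_ne P 1 (inv_ne_zero hw0), Algebra.smul_def, ← map_mul, ← mul_assoc,
          ← mul_pow, mul_inv_cancel₀ hw0, one_pow, one_mul, one_div, inv_inv]
      · rw [smul_zero]
  · rw [ext_of_ne _ _ hy, hval]
    have h1 := InCone_smul g hy (x / y) 1
    rw [mul_one, mul_div_cancel₀ _ hy] at h1
    simp only [h1]
    split_ifs
    · rw [homogenize_of_ne P x hy, Algebra.smul_def, ← map_mul]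
    · rw [smul_zero]

lemma theMeasure_poly (hk : Even k) (hc : IsBdd c C) (e : Edge p) (P : Pk p k) (f : locAn p k E)
    (hf : f.1 = (finBall e).indicator (fun x => algebraMap ℚ_[p] E (P.1.eval x))) :
    theMeasure hc f = c e P := by
  classical
  obtain ⟨g, rfl⟩ := exists_smul_e0 e
  rw [theMeasure_apply, totalInt_of_support hk hc (isLA_ext f) (g := g)]
  · have h1 : HasExp (res k (ext f) g) (fun n => algebraMap ℚ_[p] E ((polyAct k g P).1.coeff n)) := by
      intro z hz
      have e1 : res k (ext f) g z = algebraMap ℚ_[p] E ((polyAct k g P).1.eval z) := by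
        rw [res, ext_indicator hf, if_pos, eval_polyAct, map_mul, Algebra.smul_def]
        · have a1 : g 1 1 * (g 0 0 * z + g 0 1) - g 0 1 * (g 1 0 * z + g 1 1) = gdet g * z := by
            rw [gdet]; ring
          have a2 : g 0 0 * (g 1 0 * z + g 1 1) - g 1 0 * (g 0 0 * z + g 0 1) = gdet g := by
            rw [gdet]; ring
          rw [InCone, a1, a2, norm_mul]
          exact mul_le_of_le_one_right (norm_nonneg _) hz
        · by_cases h0 : g 1 0 * z + g 1 1 = 0
          · exact Or.inl (gl_vec_ne_zero g z h0)
          · exact Or.inr h0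
      rw [e1]
      have := (hasExp_eval (polyAct k g P).1 z hz).mapL (algebraMapCLM ℚ_[p] E)
      simpa [Algebra.smul_def] using this
    have h2 := coneInt_of_hasExp hc (homog_ext f) h1 le_rfl (fun n hn => by
      rw [Polynomial.coeff_eq_zero_of_natDegree_lt ((natDegree_le k _).trans_lt hn)]; simp)
    rw [zero_mul, mul_zero, norm_le_zero_iff, sub_eq_zero] at h2
    have e2 : P = polyAct k g⁻¹ (polyAct k g P) := by
      rw [← LinearMap.comp_apply, ← polyAct_mul, mul_inv_cancel, polyAct_one, LinearMap.id_apply]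
    rw [h2]
    conv_rhs => rw [e2, eq_sum_mono (polyAct k g P), map_sum, map_sum]
    refine Finset.sum_congr rfl fun i _ => ?_
    rw [map_smul, map_smul, mom, Algebra.smul_def]
  · intro z hz
    have hne : g 0 0 + g 0 1 * (p * z) ≠ 0 ∨ g 1 0 + g 1 1 * (p * z) ≠ 0 := by
      by_contra! h
      refine gdet_ne_zero g ?_
      rw [gdet]
      linear_combination g 1 1 * h.1 - g 0 1 * h.2
    rw [ext_indicator hf hne, if_neg]
    have a1 : g 1 1 * (g 0 0 + g 0 1 * (p * z)) - g 0 1 * (g 1 0 + g 1 1 * (p * z)) = gdet g := by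
      rw [gdet]; ring
    have a2 : g 0 0 * (g 1 0 + g 1 1 * (p * z)) - g 1 0 * (g 0 0 + g 0 1 * (p * z)) =
        gdet g * (p * z) := by
      rw [gdet]; ring
    rw [InCone, a1, a2, norm_mul, not_le]
    exact mul_lt_of_lt_one_right (norm_pos_iff.2 (gdet_ne_zero g)) (norm_p_mul_lt one_pos hz)

lemma isMeasureOf_theMeasure (hk : Even k) (hc : IsBdd c C) : IsMeasureOf c (theMeasure hc) := by
  have hC1 : 0 ≤ (p : ℝ) ^ (k / 2) * C := mul_nonneg (pow_nonneg p_pos.le _) hc.nonneg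
  refine ⟨⟨fun e he a ha => ?_, fun e he h0 => ?_⟩, theMeasure_poly hk hc,
    (p : ℝ) ^ (k / 2) * C, hC1, fun e he h0 n hn f hf => ?_, fun e he a ha n f hf => ?_⟩
  · obtain ⟨m, rfl⟩ := exists_aff he ha
    refine ⟨(p : ℝ) ^ (k / 2) * C * ((p : ℝ) ^ m) ^ (k / 2), fun f b M h1 h2 h3 => ?_⟩
    have hM0 : 0 ≤ M := by have := h3 0; rw [pow_zero, mul_one] at this; exact (norm_nonneg _).trans this
    have hb : HasExp (fun z => f.1 (a + (p : ℚ_[p]) ^ m * z)) (fun i => ((p : ℚ_[p]) ^ m) ^ i • b i) := by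
      intro z hz
      have := h1 (a + (p : ℚ_[p]) ^ m * z) (by
        rw [finBall_aff, Metric.mem_closedBall, dist_eq_norm, add_sub_cancel_left, norm_mul,
          Padic.norm_p_zpow]
        exact mul_le_of_le_one_right (zpow_nonneg p_pos.le _) hz)
      rw [add_sub_cancel_left] at this
      refine (congrArg (fun f => HasSum f _) (funext fun i => ?_)).mp this
      rw [smul_smul, mul_pow, mul_comm]
    refine (theMeasure_aff hk hc h2 hb hM0 fun n => ?_).trans (le_of_eq (by ring))
    have := h3 n
    rwa [norm_smul, norm_pow, Padic.norm_p_zpow, mul_comm, ← radius_aff m a]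
  · obtain ⟨m, rfl⟩ := exists_iaff he h0
    refine ⟨(p : ℝ) ^ (k / 2) * C * ((p : ℝ) ^ m) ^ (k / 2), fun f b M h1 h2 h3 => ?_⟩
    have hM0 : 0 ≤ M := by have := h3 0; rw [pow_zero, mul_one] at this; exact (norm_nonneg _).trans this
    have hp0 : (p : ℚ_[p]) ^ m ≠ 0 := zpow_ne_zero _ p_ne_zero
    have hB : ∀ n, ‖((p : ℚ_[p]) ^ m) ^ n • b n‖ ≤ M := fun n => by
      have := h3 n
      rwa [norm_smul, norm_pow, Padic.norm_p_zpow, mul_comm, ← radius_iaff m]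
    have hsum : ∀ z, z ≠ 0 → ‖z‖ ≤ 1 → HasSum (fun i => z ^ i • ((p : ℚ_[p]) ^ m) ^ i • b i)
        (((p : ℚ_[p]) ^ m * z) ^ k • f.1 ((p : ℚ_[p]) ^ m * z)⁻¹) := by
      intro z hz0 hz
      have hq := mul_ne_zero hp0 hz0
      have := h1 ((p : ℚ_[p]) ^ m * z)⁻¹ (by
        rw [finBall_iaff, Set.mem_ofPred_eq, norm_inv, norm_mul, Padic.norm_p_zpow, mul_inv,
          zpow_neg, inv_inv]
        exact le_mul_of_one_le_right (zpow_nonneg p_pos.le _)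
          ((one_le_inv₀ (norm_pos_iff.2 hz0)).2 hz))
      have := this.const_smul (((p : ℚ_[p]) ^ m * z) ^ k)
      refine (congrArg (fun f => HasSum f _) (funext fun i => ?_)).mp this
      rw [smul_smul, smul_smul]
      congr 1
      rw [inv_zpow', neg_sub, zpow_sub₀ hq, zpow_natCast, zpow_natCast,
        mul_div_cancel₀ _ (pow_ne_zero k hq), mul_pow, mul_comm]
    have htend : Tendsto (fun i => ((p : ℚ_[p]) ^ m) ^ i • b i) atTop (𝓝 0) := by
      have := (hsum 1 one_ne_zero (by simp)).summable.tendsto_atTop_zero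
      simpa using this
    refine (theMeasure_iaff hk hc h2 (hasExp_tsum htend) (fun z hz0 hz => (hsum z hz0 hz).tsum_eq)
      hM0 hB).trans (le_of_eq (by ring))
  · obtain ⟨m, rfl⟩ := exists_iaff he h0
    have hp0 : (p : ℚ_[p]) ^ m ≠ 0 := zpow_ne_zero _ p_ne_zero
    obtain ⟨i, hi⟩ : ∃ i : ℕ, n = k - i := ⟨(k - n).toNat, by omega⟩
    have hB : ∀ j, ‖(if j = i then algebraMap ℚ_[p] E (((p : ℚ_[p]) ^ m) ^ i) else 0)‖ ≤
        ((p : ℝ) ^ (-m)) ^ i := fun j => by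
      split_ifs
      · rw [norm_algebraMap', norm_pow, Padic.norm_p_zpow]
      · rw [norm_zero]; exact pow_nonneg (zpow_nonneg p_pos.le _) _
    refine (theMeasure_iaff hk hc (fun x hx => by rw [hf, Set.indicator_of_notMem hx])
      (hasExp_monomial i (algebraMap ℚ_[p] E (((p : ℚ_[p]) ^ m) ^ i))) (fun z hz0 hz => ?_)
      (pow_nonneg (zpow_nonneg p_pos.le _) _) hB).trans (le_of_eq ?_)
    · have hq := mul_ne_zero hp0 hz0
      rw [hf, Set.indicator_of_mem, Algebra.smul_def, Algebra.smul_def, ← map_mul, ← map_mul, hi]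
      · congr 1
        rw [inv_zpow', neg_sub, zpow_sub₀ hq, zpow_natCast, zpow_natCast,
          mul_div_cancel₀ _ (pow_ne_zero k hq), mul_pow, mul_comm]
      · rw [finBall_iaff, Set.mem_ofPred_eq, norm_inv, norm_mul, Padic.norm_p_zpow, mul_inv,
          zpow_neg, inv_inv]
        exact le_mul_of_one_le_right (zpow_nonneg p_pos.le _)
          ((one_le_inv₀ (norm_pos_iff.2 hz0)).2 hz)
    · rw [radius_iaff, hi]
      congr 1
      obtain ⟨r, rfl⟩ := hk
      rw [show (r + r) / 2 = r by omega, ← zpow_natCast, ← zpow_natCast, ← zpow_mul, ← zpow_mul,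
        ← zpow_mul, ← zpow_add₀ p_pos.ne']
      congr 1
      push_cast
      ring
  · obtain ⟨m, rfl⟩ := exists_aff he ha
    have hB : ∀ j, ‖(if j = n then algebraMap ℚ_[p] E (((p : ℚ_[p]) ^ m) ^ n) else 0)‖ ≤
        ((p : ℝ) ^ (-m)) ^ n := fun j => by
      split_ifs
      · rw [norm_algebraMap', norm_pow, Padic.norm_p_zpow]
      · rw [norm_zero]; exact pow_nonneg (zpow_nonneg p_pos.le _) _
    refine (theMeasure_aff hk hc (fun x hx => by rw [hf, Set.indicator_of_notMem hx])
      ((hasExp_monomial n (algebraMap ℚ_[p] E (((p : ℚ_[p]) ^ m) ^ n))).congr fun z hz => ?_)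
      (pow_nonneg (zpow_nonneg p_pos.le _) _) hB).trans (le_of_eq ?_)
    · rw [hf, Set.indicator_of_mem, Algebra.smul_def, ← map_mul, add_sub_cancel_left, mul_pow, mul_comm]
      rw [finBall_aff, Metric.mem_closedBall, dist_eq_norm, add_sub_cancel_left, norm_mul,
          Padic.norm_p_zpow]
      exact mul_le_of_le_one_right (zpow_nonneg p_pos.le _) hz
    · rw [radius_aff]
      congr 1
      rw [← zpow_natCast, ← zpow_natCast, ← zpow_mul, ← zpow_mul,
        ← zpow_mul, ← zpow_add₀ p_pos.ne']
      congr 1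
      ring

end Ext

/-! ### Uniqueness of the measure -/

section Unique
variable {E : Type} [NormedField E] [NormedAlgebra ℚ_[p] E] {k : ℕ}

lemma IsMeasureOf.lin {c c' : Edge p → Vk p k E} {μ μ' : locAn p k E →ₗ[E] E}
    (h : IsMeasureOf c μ) (h' : IsMeasureOf c' μ') (t : E) :
    IsMeasureOf (t • c + c') (t • μ + μ') := by
  obtain ⟨C, hC0, h1, h2⟩ := h.growth
  obtain ⟨C', hC0', h1', h2'⟩ := h'.growth
  have key : ∀ (f : locAn p k E) {a b : ℝ}, ‖μ f‖ ≤ a → ‖μ' f‖ ≤ b →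
      ‖(t • μ + μ') f‖ ≤ ‖t‖ * a + b := by
    intro f a b ha hb
    rw [LinearMap.add_apply, LinearMap.smul_apply, smul_eq_mul]
    refine (norm_add_le _ _).trans (add_le_add ?_ hb)
    rw [norm_mul]
    exact mul_le_mul_of_nonneg_left ha (norm_nonneg _)
  refine ⟨⟨fun e he a ha => ?_, fun e he h0 => ?_⟩, fun e P f hf => ?_,
    ‖t‖ * C + C', by positivity, fun e he h0 n hn f hf => ?_, fun e he a ha n f hf => ?_⟩
  · obtain ⟨A, hA⟩ := h.cont.1 e he a ha
    obtain ⟨A', hA'⟩ := h'.cont.1 e he a ha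
    refine ⟨‖t‖ * A + A', fun f b M h1 h2 h3 => ?_⟩
    refine (key f (hA f b M h1 h2 h3) (hA' f b M h1 h2 h3)).trans (le_of_eq (by ring))
  · obtain ⟨A, hA⟩ := h.cont.2 e he h0
    obtain ⟨A', hA'⟩ := h'.cont.2 e he h0
    refine ⟨‖t‖ * A + A', fun f b M h1 h2 h3 => ?_⟩
    refine (key f (hA f b M h1 h2 h3) (hA' f b M h1 h2 h3)).trans (le_of_eq (by ring))
  · rw [LinearMap.add_apply, LinearMap.smul_apply, h.integral_poly e P f hf,
      h'.integral_poly e P f hf]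
    rfl
  · exact (key f (h1 e he h0 n hn f hf) (h1' e he h0 n hn f hf)).trans (le_of_eq (by ring))
  · exact (key f (h2 e he a ha n f hf) (h2' e he a ha n f hf)).trans (le_of_eq (by ring))

lemma isClopen_finBall_aff (m : ℤ) (a : ℚ_[p]) : IsClopen (finBall (aff m a • e0 p)) := by
  rw [finBall_aff]
  exact IsUltrametricDist.isClopen_closedBall a (zpow_pos p_pos _).ne'

lemma analyticAt_indicator {S : Set ℚ_[p]} (hS : IsClopen S) {f : ℚ_[p] → E} {x : ℚ_[p]}
    (hf : x ∈ S → AnalyticAt ℚ_[p] f x) : AnalyticAt ℚ_[p] (S.indicator f) x := by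
  by_cases hx : x ∈ S
  · refine (hf hx).congr ?_
    filter_upwards [hS.isOpen.mem_nhds hx] with y hy
    rw [Set.indicator_of_mem hy]
  · refine (analyticAt_const (v := (0 : E))).congr ?_
    filter_upwards [hS.compl.isOpen.mem_nhds hx] with y hy
    rw [Set.indicator_of_notMem hy]

lemma indicator_aff_mem (m : ℤ) (a : ℚ_[p]) {f : ℚ_[p] → E}
    (hf : ∀ x ∈ finBall (aff m a • e0 p), AnalyticAt ℚ_[p] f x) :
    (finBall (aff m a • e0 p)).indicator f ∈ locAn p k E := by
  refine ⟨fun x => analyticAt_indicator (isClopen_finBall_aff m a) (hf x), 0, analyticAt_const,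
    (p : ℝ) ^ (-m) + ‖a‖, fun x hx => ?_⟩
  rw [Set.indicator_of_notMem]
  · simp
  · rw [finBall_aff, Metric.mem_closedBall, dist_eq_norm, not_le]
    have := norm_sub_norm_le x a
    linarith

/-- The restriction of `f` to a ball. -/
def cut (m : ℤ) (a : ℚ_[p]) (f : locAn p k E) : locAn p k E :=
  ⟨_, indicator_aff_mem m a fun x _ => f.2.1 x⟩

variable (k) (E) in
/-- The function `(x - a) ^ n` on a ball with center `a`. -/
def ballMon (m : ℤ) (a : ℚ_[p]) (n : ℕ) : locAn p k E :=
  ⟨(finBall (aff m a • e0 p)).indicator (fun x => algebraMap ℚ_[p] E ((x - a) ^ n)),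
    indicator_aff_mem m a fun x _ => by
      have : AnalyticAt ℚ_[p] (fun x : ℚ_[p] => (x - a) ^ n) x :=
        (analyticAt_id.sub analyticAt_const).pow n
      exact ((algebraMapCLM ℚ_[p] E).analyticAt _).comp this⟩

lemma mem_iaff_iff (m : ℤ) (x : ℚ_[p]) :
    x ∈ finBall (iaff p m • e0 p) ↔ x ∉ finBall (aff (1 - m) (0 : ℚ_[p]) • e0 p) := by
  rw [finBall_iaff, finBall_aff, Metric.mem_closedBall, dist_zero_right, Set.mem_ofPred_eq, neg_sub,
    Padic.norm_le_pow_iff_norm_lt_pow_add_one, sub_add_cancel, not_lt]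

lemma isClopen_finBall_iaff (m : ℤ) : IsClopen (finBall (iaff p m • e0 p)) := by
  have : finBall (iaff p m • e0 p) = (finBall (aff (1 - m) (0 : ℚ_[p]) • e0 p))ᶜ := by
    ext x; exact mem_iaff_iff m x
  rw [this]
  exact (isClopen_finBall_aff _ _).compl

variable (E) in
/-- The function `x ^ n` on a neighbourhood of infinity. -/
def inftyMon (m : ℤ) {n : ℤ} (hn : n ≤ k) : locAn p k E :=
  ⟨(finBall (iaff p m • e0 p)).indicator (fun x => algebraMap ℚ_[p] E (x ^ n)), by
    refine ⟨fun x => analyticAt_indicator (isClopen_finBall_iaff m) fun hx => ?_,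
      fun w => algebraMap ℚ_[p] E (w ^ ((k : ℤ) - n).toNat), ?_, (p : ℝ) ^ m, fun x hx => ?_⟩
    · have hx0 : x ≠ 0 := by
        rintro rfl
        exact zero_notMem_iaff m hx
      have : AnalyticAt ℚ_[p] (fun x : ℚ_[p] => x ^ n) x := analyticAt_id.zpow hx0
      exact ((algebraMapCLM ℚ_[p] E).analyticAt _).comp this
    · have : AnalyticAt ℚ_[p] (fun x : ℚ_[p] => x ^ ((k : ℤ) - n).toNat) 0 := analyticAt_id.pow _
      exact ((algebraMapCLM ℚ_[p] E).analyticAt _).comp this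
    · have hx0 : x ≠ 0 := norm_pos_iff.1 ((zpow_pos p_pos m).trans hx)
      rw [Set.indicator_of_mem (by rw [finBall_iaff]; exact hx.le), Algebra.smul_def, ← map_mul]
      congr 1
      rw [← zpow_natCast, ← zpow_natCast, Int.toNat_of_nonneg (by omega), inv_zpow', ← zpow_add₀ hx0]
      congr 1
      ring⟩

variable (E) in
lemma inftyMon_val (m : ℤ) {n : ℤ} (hn : n ≤ k) : (inftyMon E m hn : locAn p k E).1 =
    (finBall (iaff p m • e0 p)).indicator (fun x : ℚ_[p] => algebraMap ℚ_[p] E (x ^ n)) := rfl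

lemma indicator_split (m : ℤ) (a : ℚ_[p]) (f : ℚ_[p] → E) :
    (finBall (aff m a • e0 p)).indicator f =
      ∑ j : Fin p, (finBall (aff (m + 1) ((p : ℚ_[p]) ^ m * ((j : ℕ) : ℚ_[p]) + a) • e0 p)).indicator f := by
  classical
  have hp0 : (p : ℚ_[p]) ^ m ≠ 0 := zpow_ne_zero _ p_ne_zero
  have hmem : ∀ (x : ℚ_[p]) (j : Fin p),
      x ∈ finBall (aff (m + 1) ((p : ℚ_[p]) ^ m * ((j : ℕ) : ℚ_[p]) + a) • e0 p) ↔
        ‖(x - a) / (p : ℚ_[p]) ^ m - ((j : ℕ) : ℚ_[p])‖ < 1 := by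
    intro x j
    have e : x - ((p : ℚ_[p]) ^ m * ((j : ℕ) : ℚ_[p]) + a) =
        (p : ℚ_[p]) ^ m * ((x - a) / (p : ℚ_[p]) ^ m - ((j : ℕ) : ℚ_[p])) := by
      rw [mul_sub, mul_div_cancel₀ _ hp0]; ring
    rw [finBall_aff, Metric.mem_closedBall, dist_eq_norm, e, norm_mul, Padic.norm_p_zpow, neg_add,
      zpow_add₀ p_pos.ne', mul_le_mul_iff_right₀ (zpow_pos p_pos _), zpow_neg_one, norm_lt_one_iff']
  funext x
  rw [Finset.sum_apply]
  by_cases hx : x ∈ finBall (aff m a • e0 p)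
  · have hx1 : ‖(x - a) / (p : ℚ_[p]) ^ m‖ ≤ 1 := by
      rw [finBall_aff, Metric.mem_closedBall, dist_eq_norm] at hx
      rwa [norm_div, Padic.norm_p_zpow, div_le_one (zpow_pos p_pos _)]
    obtain ⟨j, hj⟩ := exists_digit hx1
    rw [Set.indicator_of_mem hx, Finset.sum_eq_single j, Set.indicator_of_mem ((hmem x j).2 hj)]
    · intro i _ hij
      rw [Set.indicator_of_notMem]
      intro hi
      refine hij (digit_unique ?_)
      have h1 := (hmem x i).1 hi
      have := norm_sub_lt_of hj h1
      rwa [sub_sub_sub_cancel_left] at this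
    · simp
  · rw [Set.indicator_of_notMem hx, Finset.sum_eq_zero]
    intro j _
    rw [Set.indicator_of_notMem]
    intro hj
    refine hx ?_
    rw [finBall_aff, Metric.mem_closedBall, dist_eq_norm]
    have h1 := norm_add_le_of ((hmem x j).1 hj).le (norm_natCast_le (p := p) j)
    rw [sub_add_cancel, norm_div, Padic.norm_p_zpow, div_le_one (zpow_pos p_pos _)] at h1
    exact h1

lemma cut_split (m : ℤ) (a : ℚ_[p]) (f : locAn p k E) :
    cut m a f = ∑ j : Fin p, cut (m + 1) ((p : ℚ_[p]) ^ m * ((j : ℕ) : ℚ_[p]) + a) f := by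
  refine Subtype.ext ?_
  rw [Submodule.coe_sum]
  exact indicator_split m a f.1

lemma smul_ballMon_apply (t : E) (m : ℤ) (a : ℚ_[p]) (n : ℕ) (x : ℚ_[p]) :
    (t • ballMon E k m a n).1 x = t * (finBall (aff m a • e0 p)).indicator
      (fun x => algebraMap ℚ_[p] E ((x - a) ^ n)) x := rfl

lemma ballMon_split (m : ℤ) (a : ℚ_[p]) (n : ℕ) :
    ballMon E k m a n = ∑ j : Fin p, ∑ i ∈ Finset.range (n + 1),
      algebraMap ℚ_[p] E (((p : ℚ_[p]) ^ m * ((j : ℕ) : ℚ_[p])) ^ (n - i) * (n.choose i)) •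
        ballMon E k (m + 1) ((p : ℚ_[p]) ^ m * ((j : ℕ) : ℚ_[p]) + a) i := by
  refine Subtype.ext ?_
  rw [Submodule.coe_sum]
  refine (indicator_split m a _).trans (Finset.sum_congr rfl fun j _ => ?_)
  funext x
  rw [Submodule.coe_sum, Finset.sum_apply]
  by_cases hx : x ∈ finBall (aff (m + 1) ((p : ℚ_[p]) ^ m * ((j : ℕ) : ℚ_[p]) + a) • e0 p)
  · rw [Set.indicator_of_mem hx]
    have e : x - a = (x - ((p : ℚ_[p]) ^ m * ((j : ℕ) : ℚ_[p]) + a)) + (p : ℚ_[p]) ^ m * ((j : ℕ) : ℚ_[p]) := by ring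
    rw [e, add_pow, map_sum]
    refine Finset.sum_congr rfl fun i _ => ?_
    rw [smul_ballMon_apply, Set.indicator_of_mem hx, ← map_mul]
    congr 1
    ring
  · rw [Set.indicator_of_notMem hx, Finset.sum_eq_zero]
    intro i _
    rw [smul_ballMon_apply, Set.indicator_of_notMem hx, mul_zero]

variable [CompleteSpace E] [IsUltrametricDist E] {ν : locAn p k E →ₗ[E] E}

omit [CompleteSpace E] [IsUltrametricDist E] in
lemma mem_finBall_aff_self (m : ℤ) (a : ℚ_[p]) : a ∈ finBall (aff m a • e0 p) := by
  rw [finBall_aff]; exact Metric.mem_closedBall_self (zpow_nonneg p_pos.le _)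

omit [CompleteSpace E] in
lemma ballMon_eq_zero (hν : IsMeasureOf 0 ν) (m : ℤ) (a : ℚ_[p]) (n : ℕ) :
    ν (ballMon E k m a n) = 0 := by
  obtain ⟨C, hC0, -, hg⟩ := hν.growth
  have hpoly : ∀ m a n, n ≤ k → ν (ballMon E k m a n) = 0 := by
    intro m a n hn
    refine hν.integral_poly (aff m a • e0 p) ⟨(Polynomial.X - Polynomial.C a) ^ n, ?_⟩ _ ?_
    · rw [Polynomial.mem_degreeLE]
      refine Polynomial.degree_le_of_natDegree_le ((Polynomial.natDegree_pow_le).trans ?_)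
      rw [Polynomial.natDegree_X_sub_C, mul_one]
      exact hn
    · simp [ballMon]
  have key : ∀ (s : ℕ) (m : ℤ) (a : ℚ_[p]) (n : ℕ), ‖ν (ballMon E k m a n)‖ ≤
      (p : ℝ)⁻¹ ^ s * (C * ((p : ℝ) ^ (-m)) ^ (n - (k / 2 : ℕ) : ℤ)) := by
    intro s
    induction s with
    | zero =>
      intro m a n
      rw [pow_zero, one_mul, ← radius_aff m a]
      exact hg _ (infty_notMem_ball_aff m a) a (mem_finBall_aff_self m a) n _ rfl
    | succ s ih =>
      intro m a n
      have hpp : (0 : ℝ) < (p : ℝ) ^ (-m) := zpow_pos p_pos _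
      have hp1 : (0 : ℝ) < (p : ℝ)⁻¹ := inv_pos.2 p_pos
      have h0 : 0 ≤ (p : ℝ)⁻¹ ^ (s + 1) * (C * ((p : ℝ) ^ (-m)) ^ (n - (k / 2 : ℕ) : ℤ)) := by
        positivity
      rw [ballMon_split, map_sum]
      refine IsUltrametricDist.norm_sum_le_of_forall_le_of_nonneg h0 fun j _ => ?_
      rw [map_sum]
      refine IsUltrametricDist.norm_sum_le_of_forall_le_of_nonneg h0 fun i hi => ?_
      have hin : i ≤ n := Nat.lt_succ_iff.1 (Finset.mem_range.1 hi)
      rw [map_smul, smul_eq_mul, norm_mul, norm_algebraMap']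
      by_cases hik : i ≤ k
      · rw [hpoly _ _ _ hik, norm_zero, mul_zero]; exact h0
      · have h1 : ‖((p : ℚ_[p]) ^ m * ((j : ℕ) : ℚ_[p])) ^ (n - i) * (n.choose i : ℚ_[p])‖ ≤
            ((p : ℝ) ^ (-m)) ^ (n - i) := by
          rw [norm_mul, norm_pow, norm_mul, Padic.norm_p_zpow]
          refine (mul_le_of_le_one_right (by positivity) (norm_natCast_le _)).trans ?_
          exact pow_le_pow_left₀ (by positivity)
            (mul_le_of_le_one_right hpp.le (norm_natCast_le _)) _
        refine (mul_le_mul h1 (ih _ _ i) (norm_nonneg _) (by positivity)).trans ?_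
        have e1 : ((p : ℝ) ^ (-(m + 1))) ^ (i - (k / 2 : ℕ) : ℤ) =
            ((p : ℝ) ^ (-m)) ^ (i - (k / 2 : ℕ) : ℤ) * (p : ℝ)⁻¹ ^ (i - (k / 2 : ℕ) : ℤ) := by
          rw [neg_add, zpow_add₀ p_pos.ne', mul_zpow, zpow_neg_one]
        have e2 : ((p : ℝ) ^ (-m)) ^ (n - (k / 2 : ℕ) : ℤ) =
            ((p : ℝ) ^ (-m)) ^ (n - i) * ((p : ℝ) ^ (-m)) ^ (i - (k / 2 : ℕ) : ℤ) := by
          rw [← zpow_natCast ((p : ℝ) ^ (-m)) (n - i), ← zpow_add₀ hpp.ne']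
          congr 1
          omega
        have e3 : (p : ℝ)⁻¹ ^ (i - (k / 2 : ℕ) : ℤ) ≤ (p : ℝ)⁻¹ := by
          have : (p : ℝ)⁻¹ ^ (i - (k / 2 : ℕ) : ℤ) ≤ (p : ℝ)⁻¹ ^ (1 : ℤ) :=
            zpow_le_zpow_right_of_le_one₀ hp1 (inv_le_one_of_one_le₀ one_lt_p.le) (by omega)
          rwa [zpow_one] at this
        rw [e1, e2, pow_succ]
        have h4 : 0 ≤ ((p : ℝ) ^ (-m)) ^ (n - i) * ((p : ℝ)⁻¹ ^ s *
            (C * ((p : ℝ) ^ (-m)) ^ (i - (k / 2 : ℕ) : ℤ))) := by positivity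
        calc _ = (((p : ℝ) ^ (-m)) ^ (n - i) * ((p : ℝ)⁻¹ ^ s *
            (C * ((p : ℝ) ^ (-m)) ^ (i - (k / 2 : ℕ) : ℤ)))) * (p : ℝ)⁻¹ ^ (i - (k / 2 : ℕ) : ℤ) := by
              ring
          _ ≤ _ := mul_le_mul_of_nonneg_left e3 h4
          _ = _ := by ring
  rw [← norm_le_zero_iff]
  refine ge_of_tendsto (x := atTop) (b := ‖ν (ballMon E k m a n)‖) ?_
    (Eventually.of_forall fun s => key s m a n)
  have := (tendsto_pow_atTop_nhds_zero_of_lt_one (inv_nonneg.2 p_pos.le)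
    (inv_lt_one_of_one_lt₀ (one_lt_p (p := p)))).mul_const
    (C * ((p : ℝ) ^ (-m)) ^ (n - (k / 2 : ℕ) : ℤ))
  rwa [zero_mul] at this

omit [CompleteSpace E] [IsUltrametricDist E] in
/-- A linear form that is bounded in terms of the coefficients of an expansion and kills the
terms of the expansion kills the sum. -/
lemma eq_zero_of_expansion {f : locAn p k E} {S : Set ℚ_[p]} {C : ℝ} {r : ℝ} {u : ℕ → locAn p k E}
    {b : ℕ → E} (w : ℕ → ℚ_[p] → ℚ_[p]) (hu : ∀ i, ν (u i) = 0)
    (huS : ∀ i, (u i).1 = S.indicator (fun x => algebraMap ℚ_[p] E (w i x)))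
    (hC : ∀ (f : locAn p k E) (b : ℕ → E) (M : ℝ), (∀ x ∈ S, HasSum (fun i => w i x • b i) (f.1 x)) →
      (∀ x ∉ S, f.1 x = 0) → (∀ i, ‖b i‖ * r ^ i ≤ M) → ‖ν f‖ ≤ C * M)
    (hf : ∀ x ∈ S, HasSum (fun i => w i x • b i) (f.1 x)) (hfS : ∀ x ∉ S, f.1 x = 0)
    (hb : Tendsto (fun i => ‖b i‖ * r ^ i) atTop (𝓝 0)) : ν f = 0 := by
  have key : ∀ ε > 0, ‖ν f‖ ≤ C * ε := by
    intro ε hε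
    obtain ⟨N, hN⟩ := eventually_atTop.1 (hb.eventually (gt_mem_nhds hε))
    have e : ν f = ν (f - ∑ i ∈ Finset.range N, b i • u i) := by
      rw [map_sub, map_sum, Finset.sum_eq_zero, sub_zero]
      intro i _
      rw [map_smul, hu, smul_zero]
    have hval : ∀ x, (f - ∑ i ∈ Finset.range N, b i • u i).1 x =
        f.1 x - ∑ i ∈ Finset.range N, b i * (u i).1 x := by
      intro x
      change f.1 x - (∑ i ∈ Finset.range N, b i • u i : locAn p k E).1 x = _
      rw [Submodule.coe_sum, Finset.sum_apply]
      rfl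
    rw [e]
    refine hC _ (fun i => if i < N then 0 else b i) ε (fun x hx => ?_) (fun x hx => ?_) fun i => ?_
    · rw [hval]
      have h1 : HasSum (fun i => w i x • (if i < N then b i else 0))
          (∑ i ∈ Finset.range N, b i * (u i).1 x) := by
        have e2 : ∑ i ∈ Finset.range N, b i * (u i).1 x =
            ∑ i ∈ Finset.range N, w i x • (if i < N then b i else 0) := by
          refine Finset.sum_congr rfl fun i hi => ?_
          rw [huS, Set.indicator_of_mem hx, if_pos (Finset.mem_range.1 hi), Algebra.smul_def, mul_comm]
        rw [e2]
        refine hasSum_sum_of_ne_finset_zero fun i hi => ?_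
        rw [if_neg (by simpa using hi), smul_zero]
      refine (congrArg (fun f => HasSum f _) (funext fun i => ?_)).mp ((hf x hx).sub h1)
      by_cases hi : i < N <;> simp [hi]
    · rw [hval, hfS x hx, Finset.sum_eq_zero, sub_zero]
      intro i _
      rw [huS, Set.indicator_of_notMem hx, mul_zero]
    · by_cases hi : i < N
      · simp [hi, hε.le]
      · simpa [hi] using (hN i (not_lt.1 hi)).le
  rw [← norm_le_zero_iff]
  have : Tendsto (fun ε : ℝ => C * ε) (𝓝[>] 0) (𝓝 (C * 0)) :=
    ((continuous_const.mul continuous_id).tendsto 0).mono_left nhdsWithin_le_nhds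
  rw [mul_zero] at this
  exact ge_of_tendsto this (eventually_mem_nhdsWithin.mono fun ε hε => key ε hε)

omit [CompleteSpace E] in
lemma measure_zero_of_hasExp (hν : IsMeasureOf 0 ν) {f : locAn p k E} {m : ℤ} {a : ℚ_[p]}
    {b : ℕ → E} (hb : HasExp (fun z => f.1 (a + (p : ℚ_[p]) ^ m * z)) b) : ν (cut m a f) = 0 := by
  have hp0 : (p : ℚ_[p]) ^ m ≠ 0 := zpow_ne_zero _ p_ne_zero
  obtain ⟨C, hC⟩ := hν.cont.1 _ (infty_notMem_ball_aff m a) a (mem_finBall_aff_self m a)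
  refine eq_zero_of_expansion (w := fun i x => (x - a) ^ i) (fun i => ballMon_eq_zero hν m a i)
    (fun i => rfl) hC (b := fun i => ((p : ℚ_[p]) ^ m)⁻¹ ^ i • b i) (fun x hx => ?_)
    (fun x hx => Set.indicator_of_notMem hx _) ?_
  · have e : (cut m a f).1 x = f.1 x := Set.indicator_of_mem hx _
    rw [e]
    rw [finBall_aff, Metric.mem_closedBall, dist_eq_norm] at hx
    have := hb ((x - a) / (p : ℚ_[p]) ^ m) (by
      rwa [norm_div, Padic.norm_p_zpow, div_le_one (zpow_pos p_pos _)])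
    dsimp only at this
    rw [mul_div_cancel₀ _ hp0, add_sub_cancel] at this
    refine (congrArg (fun f => HasSum f _) (funext fun i => ?_)).mp this
    rw [smul_smul, div_eq_mul_inv, mul_pow]
  · have := tendsto_norm_zero.comp hb.tendsto
    refine this.congr fun i => ?_
    rw [norm_smul, norm_pow, norm_inv, Padic.norm_p_zpow, radius_aff, mul_right_comm, ← mul_pow,
      inv_mul_cancel₀ (zpow_pos p_pos _).ne', one_pow, one_mul]
    rfl

lemma measure_zero_cut (hν : IsMeasureOf 0 ν) (f : locAn p k E) (m : ℤ) (a : ℚ_[p]) :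
    ν (cut m a f) = 0 := by
  have key : ∀ (N : ℕ) (m : ℤ) (a : ℚ_[p]) (t : ℝ), AnBd k (ext f) t N (aff m a) →
      ν (cut m a f) = 0 := by
    intro N
    induction N with
    | zero =>
      rintro m a t ⟨b, hb, -⟩
      have hp0 : ((p : ℚ_[p]) ^ m) ^ (k / 2) ≠ 0 := pow_ne_zero _ (zpow_ne_zero _ p_ne_zero)
      refine measure_zero_of_hasExp hν (b := fun n => ((p : ℚ_[p]) ^ m) ^ (k / 2) • b n) ?_
      intro z hz
      have e : f.1 (a + (p : ℚ_[p]) ^ m * z) =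
          ((p : ℚ_[p]) ^ m) ^ (k / 2) • res k (ext f) (aff m a) z := by
        rw [res, ext_of_ne _ _ (by simp [aff]), smul_smul]
        have : gdet (aff m a) = (p : ℚ_[p]) ^ m := by simp [aff, gdet]
        rw [this, inv_pow, mul_inv_cancel₀ hp0]
        simp [aff, add_comm]
      dsimp only
      rw [e]
      have := (hb z hz).const_smul (((p : ℚ_[p]) ^ m) ^ (k / 2))
      refine (congrArg (fun f => HasSum f _) (funext fun i => ?_)).mp this
      rw [smul_comm]
    | succ N ih =>
      intro m a t h
      rw [cut_split, map_sum]
      refine Finset.sum_eq_zero fun j _ => ih _ _ t ?_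
      have := h j
      rwa [hm_eq_aff, aff_mul_aff] at this
  obtain ⟨N, t, -, h⟩ := (isLA_ext f).an (aff m a)
  exact key N m a t h

lemma inftyMon_eq_zero (hν : IsMeasureOf 0 ν) (m : ℤ) {n : ℤ} (hn : n ≤ k) :
    ν (inftyMon E m hn : locAn p k E) = 0 := by
  by_cases h0 : 0 ≤ n
  · obtain ⟨i, rfl⟩ := Int.eq_ofNat_of_zero_le h0
    refine hν.integral_poly (iaff p m • e0 p) (mono k i) _ ?_
    have hi : i ≤ k := by exact_mod_cast hn
    rw [mono_val hi]
    simp [inftyMon]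
  · obtain ⟨C, hC0, hg, -⟩ := hν.growth
    have key : ∀ s : ℕ, ‖ν (inftyMon E m hn : locAn p k E)‖ ≤
        C * ((p : ℝ) ^ (-(m + s))) ^ (-n + (k / 2 : ℕ) : ℤ) := by
      intro s
      have hsub : ∀ x, x ∈ finBall (iaff p (m + s) • e0 p) → x ∈ finBall (iaff p m • e0 p) := by
        intro x hx
        rw [finBall_iaff, Set.mem_ofPred_eq] at *
        exact (zpow_le_zpow_right₀ one_lt_p.le (by omega)).trans hx
      have e : inftyMon E m hn = inftyMon E (m + s) hn +
          cut (1 - (m + s)) 0 (inftyMon E m hn : locAn p k E) := by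
        refine Subtype.ext (funext fun x => ?_)
        change _ = (inftyMon E (m + s) hn : locAn p k E).1 x + (finBall _).indicator _ x
        by_cases hx : x ∈ finBall (iaff p (m + s) • e0 p)
        · rw [Set.indicator_of_notMem ((mem_iaff_iff _ _).1 hx), add_zero]
          rw [inftyMon_val, inftyMon_val, Set.indicator_of_mem hx, Set.indicator_of_mem (hsub x hx)]
        · have hx' := not_not.1 (mt (mem_iaff_iff (m + s) x).2 hx)
          rw [Set.indicator_of_mem hx']
          rw [inftyMon_val E (m + s), Set.indicator_of_notMem hx, zero_add]
      rw [e, map_add, measure_zero_cut hν, add_zero, ← radius_iaff]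
      exact hg _ (infty_mem_ball_iaff _) (zero_notMem_iaff _) n hn _ rfl
    rw [← norm_le_zero_iff]
    refine ge_of_tendsto (x := atTop) ?_ (Eventually.of_forall key)
    obtain ⟨q, hq⟩ : ∃ q : ℕ, (-n + (k / 2 : ℕ) : ℤ) = (q + 1 : ℕ) :=
      ⟨(-n + (k / 2 : ℕ) - 1 : ℤ).toNat, by omega⟩
    have h1 : Tendsto (fun s : ℕ => (p : ℝ) ^ (-(m + s : ℤ))) atTop (𝓝 0) := by
      have := (tendsto_pow_atTop_nhds_zero_of_lt_one (inv_nonneg.2 p_pos.le)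
        (inv_lt_one_of_one_lt₀ (one_lt_p (p := p)))).const_mul ((p : ℝ) ^ (-m))
      rw [mul_zero] at this
      refine this.congr fun s => ?_
      rw [neg_add, zpow_add₀ p_pos.ne', zpow_neg _ (s : ℤ), zpow_natCast, inv_pow]
    have h2 := (h1.pow (q + 1)).const_mul C
    rw [zero_pow q.succ_ne_zero, mul_zero] at h2
    refine h2.congr fun s => ?_
    rw [hq, zpow_natCast]

lemma measure_zero (hν : IsMeasureOf 0 ν) : ν = 0 := by
  refine LinearMap.ext fun f => ?_
  obtain ⟨g, hg, -, r, hr⟩ := leading_spec f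
  obtain ⟨s, b, hb⟩ := exists_hasExp_of_analyticAt hg
  obtain ⟨i, hi⟩ := pow_unbounded_of_one_lt r (one_lt_p (p := p))
  have hb' := hb.comp_mul (s := (p : ℚ_[p]) ^ i) (by
    rw [norm_pow, Padic.norm_p]
    exact pow_le_one₀ (inv_nonneg.2 p_pos.le) (inv_le_one_of_one_le₀ one_lt_p.le))
  set b' := fun n => ((p : ℚ_[p]) ^ i) ^ n • b n
  clear_value b'
  set m : ℤ := (s : ℤ) + i with hm
  have hp0 : (p : ℚ_[p]) ^ m ≠ 0 := zpow_ne_zero _ p_ne_zero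
  have hb'' : ∀ z : ℚ_[p], ‖z‖ ≤ 1 → HasSum (fun n => z ^ n • b' n) (g ((p : ℚ_[p]) ^ m * z)) := by
    intro z hz
    have := hb' z hz
    dsimp only at this
    rwa [zero_add, ← mul_assoc, ← pow_add, ← zpow_natCast, Nat.cast_add] at this
  have hrm : ∀ x ∈ finBall (iaff p m • e0 p), r < ‖x‖ := by
    intro x hx
    rw [finBall_iaff, Set.mem_ofPred_eq] at hx
    refine hi.trans_le (le_trans ?_ hx)
    rw [← zpow_natCast]
    exact zpow_le_zpow_right₀ one_lt_p.le (by omega)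
  have e : f = (f - cut (1 - m) 0 f) + cut (1 - m) 0 f := (sub_add_cancel _ _).symm
  rw [e, map_add, measure_zero_cut hν, add_zero, LinearMap.zero_apply]
  obtain ⟨C, hC⟩ := hν.cont.2 _ (infty_mem_ball_iaff m) (zero_notMem_iaff m)
  refine eq_zero_of_expansion (w := fun i x => x ^ ((k : ℤ) - i)) (u := fun i =>
    inftyMon E m (n := (k : ℤ) - i) (by omega)) (fun i => inftyMon_eq_zero hν m _) (fun i => rfl) hC
    (b := fun i => ((p : ℚ_[p]) ^ m)⁻¹ ^ i • b' i) (fun x hx => ?_) (fun x hx => ?_) ?_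
  · have hx0 : x ≠ 0 := by
      rintro rfl
      exact zero_notMem_iaff m hx
    have e1 : (f - cut (1 - m) 0 f).1 x = f.1 x := by
      change f.1 x - (finBall _).indicator _ x = _
      rw [Set.indicator_of_notMem ((mem_iaff_iff _ _).1 hx), sub_zero]
    rw [e1, hr x (hrm x hx)]
    have := hb'' (((p : ℚ_[p]) ^ m)⁻¹ * x⁻¹) (by
      rw [finBall_iaff, Set.mem_ofPred_eq] at hx
      rw [norm_mul, norm_inv, norm_inv, Padic.norm_p_zpow, ← mul_inv, zpow_neg]
      refine inv_le_one_of_one_le₀ ?_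
      rw [← div_eq_inv_mul, one_le_div (zpow_pos p_pos m)]
      exact hx)
    rw [mul_inv_cancel_left₀ hp0] at this
    refine (congrArg (fun f => HasSum f _) (funext fun i => ?_)).mp (this.const_smul (x ^ k))
    rw [smul_smul, smul_smul, zpow_sub₀ hx0, zpow_natCast, zpow_natCast, mul_pow, inv_pow x]
    congr 1
    ring
  · have hx' := not_not.1 (mt (mem_iaff_iff m x).2 hx)
    change f.1 x - (finBall _).indicator _ x = _
    rw [Set.indicator_of_mem hx', sub_self]
  · have hb0 : Tendsto b' atTop (𝓝 0) := by
      have := (hb'' 1 (by simp)).summable.tendsto_atTop_zero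
      simpa using this
    have := tendsto_norm_zero.comp hb0
    refine this.congr fun i => ?_
    rw [norm_smul, norm_pow, norm_inv, Padic.norm_p_zpow, radius_iaff, mul_right_comm, ← mul_pow,
      inv_mul_cancel₀ (zpow_pos p_pos _).ne', one_pow, one_mul]
    rfl

lemma measure_unique {c : Edge p → Vk p k E} {μ μ' : locAn p k E →ₗ[E] E} (h : IsMeasureOf c μ)
    (h' : IsMeasureOf c μ') : μ = μ' := by
  have := h.lin h' (-1)
  have h0 : (-1 : E) • c + c = 0 := by
    funext e
    refine LinearMap.ext fun P => ?_
    change (-1 : E) * c e P + c e P = 0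
    ring
  rw [h0] at this
  refine LinearMap.ext fun f => ?_
  have h1 : (-1 : E) * μ f + μ' f = 0 := LinearMap.congr_fun (measure_zero this) f
  linear_combination -h1

lemma measureOf_eq {c : Edge p → Vk p k E} {μ : locAn p k E →ₗ[E] E} (h : IsMeasureOf c μ) :
    measureOf c = μ := by
  have hex : ∃ μ, IsMeasureOf c μ := ⟨μ, h⟩
  rw [measureOf, dif_pos hex]
  exact measure_unique hex.choose_spec h

end Unique

/-! ### Harmonic cocycles for cocompact groups -/

section Cocompact
variable {E : Type} [Field E] [Algebra ℚ_[p] E] {k : ℕ} {Γ : Subgroup (GL (Fin 2) ℚ_[p])}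

/-- There are finitely many edges up to `Γ`. -/
def Cocompact (Γ : Subgroup (GL (Fin 2) ℚ_[p])) : Prop :=
  ∃ S : Set (Edge p), S.Finite ∧ ∀ e, ∃ γ ∈ Γ, ∃ s ∈ S, e = γ • s

lemma harmonic_smul {c : Edge p → Vk p k E} (hc : c ∈ harmonic Γ k E) {γ : GL (Fin 2) ℚ_[p]}
    (hγ : γ ∈ Γ) (e : Edge p) : c (γ • e) = vkRep k E γ (c e) := by
  have := hc.2.2 γ hγ (γ • e)
  rwa [inv_smul_smul, eq_comm] at this

lemma harmonic_sum {c : Edge p → Vk p k E} (hc : c ∈ harmonic Γ k E) (g : GL (Fin 2) ℚ_[p]) :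
    c (g • e0 p) = ∑ j : Fin p, c ((g * hm ((j : ℕ) : ℚ_[p])) • e0 p) := by
  have := hc.2.1 (g • v0 p)
  rwa [finsum_edges, hc.1, neg_add_eq_zero] at this

end Cocompact

section LineIntegral
variable {E : Type} [NormedField E] [NormedAlgebra ℚ_[p] E] {k : ℕ}
  {Γ : Subgroup (GL (Fin 2) ℚ_[p])} {c : Edge p → Vk p k E}

lemma mom_smul (hc : c ∈ harmonic Γ k E) {γ : GL (Fin 2) ℚ_[p]} (hγ : γ ∈ Γ)
    (g : GL (Fin 2) ℚ_[p]) (i : ℕ) : mom c (γ * g) i = mom c g i := by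
  rw [mom, mul_smul, harmonic_smul hc hγ]
  change c (g • e0 p) (polyAct k γ (polyAct k (γ * g)⁻¹ (mono k i))) = _
  have e : polyAct k γ (polyAct k (γ * g)⁻¹ (mono k i)) = polyAct k g⁻¹ (mono k i) := by
    rw [← LinearMap.comp_apply, ← polyAct_mul, mul_inv_rev, inv_mul_cancel_right]
  rw [e]
  rfl

lemma mono_eq_zero {i : ℕ} (h : k < i) : (mono k i : Pk p k) = 0 :=
  Subtype.ext (if_neg (not_le.2 h))

lemma isBdd_of_harmonic [IsUltrametricDist E] (hk : Even k) (hΓ : Cocompact Γ)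
    (hc : c ∈ harmonic Γ k E) : ∃ C, IsBdd c C := by
  obtain ⟨S, hS, hcov⟩ := hΓ
  set r : Edge p → GL (Fin 2) ℚ_[p] := fun e => (exists_smul_e0 e).choose with hr
  have hr' : ∀ e, r e • e0 p = e := fun e => (exists_smul_e0 e).choose_spec
  have h0 : 0 ≤ ∑ s ∈ hS.toFinset, ∑ i ∈ Finset.range (k + 1), ‖mom c (r s) i‖ :=
    Finset.sum_nonneg fun _ _ => Finset.sum_nonneg fun _ _ => norm_nonneg _
  refine ⟨∑ s ∈ hS.toFinset, ∑ i ∈ Finset.range (k + 1), ‖mom c (r s) i‖, h0, hc.1,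
    harmonic_sum hc, fun g m => ?_⟩
  by_cases hm : m ≤ k
  · obtain ⟨γ, hγ, s, hs, e⟩ := hcov (g • e0 p)
    rw [← hr' s, ← mul_smul, eq_comm, smul_e0_eq_smul_iff] at e
    set u := g⁻¹ * (γ * r s) with hu
    have hgu : g * u = γ * r s := by rw [hu, mul_inv_cancel_left]
    have h1 := mom_mul c (g := g) e.sig hm
    rw [mul_smul, (smul_e0_eq_iff u).2 e] at h1
    change mom c g m = _ at h1
    rw [h1]
    refine IsUltrametricDist.norm_sum_le_of_forall_le_of_nonneg h0 fun i hi => ?_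
    rw [hgu, mom_smul hc hγ, norm_smul, norm_mul, e.norm_wt hk, one_mul]
    refine (mul_le_of_le_one_left (norm_nonneg _) (e.sig.coef_norm k m i)).trans ?_
    refine (Finset.single_le_sum (f := fun i => ‖mom c (r s) i‖) (fun _ _ => norm_nonneg _) hi).trans ?_
    exact Finset.single_le_sum (f := fun s => ∑ i ∈ Finset.range (k + 1), ‖mom c (r s) i‖)
      (fun _ _ => Finset.sum_nonneg fun _ _ => norm_nonneg _) (hS.mem_toFinset.2 hs)
  · rw [mom, mono_eq_zero (not_le.1 hm), map_zero, map_zero, norm_zero]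
    exact h0

variable [CompleteSpace E] [IsUltrametricDist E]

lemma exists_isMeasureOf (hk : Even k) (hΓ : Cocompact Γ) (hc : c ∈ harmonic Γ k E) :
    ∃ μ, IsMeasureOf c μ := by
  obtain ⟨C, hC⟩ := isBdd_of_harmonic hk hΓ hc
  exact ⟨_, isMeasureOf_theMeasure hk hC⟩

lemma integralsDefined (hk : Even k) (hΓ : Cocompact Γ) (hE : HasLog p E) :
    IntegralsDefined Γ k E := by
  refine ⟨fun c hc => ?_, fun τ₁ h1 τ₂ h2 P => logIntegrand_mem hE h1 h2 P⟩
  obtain ⟨μ, hμ⟩ := exists_isMeasureOf hk hΓ hc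
  exact ⟨μ, hμ, fun μ' h' => measure_unique h' hμ⟩

lemma integral_of_mem {f : ℚ_[p] → E} (h : f ∈ locAn p k E) :
    integral c f = measureOf c ⟨f, h⟩ := dif_pos h

lemma integral_lin_fun {f f' : ℚ_[p] → E} (h : f ∈ locAn p k E) (h' : f' ∈ locAn p k E) (t : E) :
    integral c (t • f + f') = t * integral c f + integral c f' := by
  rw [integral_of_mem h, integral_of_mem h',
    integral_of_mem ((locAn p k E).add_mem ((locAn p k E).smul_mem t h) h')]
  have : (⟨t • f + f', (locAn p k E).add_mem ((locAn p k E).smul_mem t h) h'⟩ : locAn p k E) =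
    t • ⟨f, h⟩ + ⟨f', h'⟩ := rfl
  rw [this, map_add, map_smul, smul_eq_mul]

lemma integral_lin (hk : Even k) (hΓ : Cocompact Γ) {c' : Edge p → Vk p k E}
    (hc : c ∈ harmonic Γ k E) (hc' : c' ∈ harmonic Γ k E) (t : E) {f : ℚ_[p] → E}
    (h : f ∈ locAn p k E) :
    integral (t • c + c') f = t * integral c f + integral c' f := by
  obtain ⟨μ, hμ⟩ := exists_isMeasureOf hk hΓ hc
  obtain ⟨μ', hμ'⟩ := exists_isMeasureOf hk hΓ hc'
  rw [integral_of_mem h, integral_of_mem h, integral_of_mem h, measureOf_eq hμ, measureOf_eq hμ',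
    measureOf_eq (hμ.lin hμ' t)]
  rfl

lemma integral_eq_totalInt (hk : Even k) {C : ℝ} (hc : IsBdd c C) (f : locAn p k E) :
    integral c f.1 = totalInt c (ext f) := by
  rw [integral_of_mem f.2, measureOf_eq (isMeasureOf_theMeasure hk hc), theMeasure_apply]

/-! ### Line integrals -/

/-- The integrand of the line integral as a homogeneous function. -/
def logSec (τ₁ τ₂ : E) (P : Pk p k) (x y : ℚ_[p]) : E :=
  algebraMap ℚ_[p] E (homogenize P x y) *
    logp p ((algebraMap ℚ_[p] E x - τ₂ * algebraMap ℚ_[p] E y) /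
      (algebraMap ℚ_[p] E x - τ₁ * algebraMap ℚ_[p] E y))

lemma ext_logIntegrand (hE : HasLog p E) {τ₁ τ₂ : E} (h1 : τ₁ ∈ Hp p E) (h2 : τ₂ ∈ Hp p E)
    (P : Pk p k) {x y : ℚ_[p]} (hxy : x ≠ 0 ∨ y ≠ 0) :
    ext ⟨_, logIntegrand_mem hE h1 h2 P⟩ x y = logSec τ₁ τ₂ P x y := by
  by_cases hy : y = 0
  · subst hy
    have hx : algebraMap ℚ_[p] E x ≠ 0 := by simpa using hxy
    rw [ext_zero, leading_eq (r := 0) (analyticAt_logPole hE τ₁ τ₂ P).continuousAt (fun x hx =>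
      logIntegrand_eq_logPole hE h1 h2 P (norm_pos_iff.1 hx)), logPole_zero, smul_zero, logSec]
    simp [div_self hx, logp_one]
  · have hy' : algebraMap ℚ_[p] E y ≠ 0 := by simpa using hy
    have e : ∀ τ : E, algebraMap ℚ_[p] E x - τ * algebraMap ℚ_[p] E y =
        (algebraMap ℚ_[p] E (x / y) - τ) * algebraMap ℚ_[p] E y := fun τ => by
      rw [map_div₀]; field_simp
    rw [ext_of_ne _ _ hy, logSec, e, e, mul_div_mul_right _ _ hy', homogenize_of_ne P x hy,
      Algebra.smul_def, map_mul, mul_assoc]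
    rfl

lemma lineIntegral_eq (hk : Even k) {C : ℝ} (hc : IsBdd c C) (hE : HasLog p E) {τ₁ τ₂ : E}
    (h1 : τ₁ ∈ Hp p E) (h2 : τ₂ ∈ Hp p E) (P : Pk p k) :
    lineIntegral c τ₁ τ₂ P = totalInt c (logSec τ₁ τ₂ P) := by
  rw [lineIntegral, integral_eq_totalInt hk hc ⟨_, logIntegrand_mem hE h1 h2 P⟩]
  exact totalInt_congr fun x y hxy => ext_logIntegrand hE h1 h2 P hxy

lemma lineIntegral_add (hE : HasLog p E) {τ₁ τ₂ τ₃ : E}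
    (h1 : τ₁ ∈ Hp p E) (h2 : τ₂ ∈ Hp p E) (h3 : τ₃ ∈ Hp p E) (P : Pk p k) :
    lineIntegral c τ₁ τ₃ P = lineIntegral c τ₁ τ₂ P + lineIntegral c τ₂ τ₃ P := by
  have := integral_lin_fun (c := c) (logIntegrand_mem hE h1 h2 P) (logIntegrand_mem hE h2 h3 P) 1
  rw [one_mul] at this
  rw [lineIntegral, lineIntegral, lineIntegral, ← this]
  congr 1
  funext x
  simp only [one_smul, Pi.add_apply, logIntegrand]
  rw [logp_div hE (hp_sub_ne h2 x) (hp_sub_ne h1 x), logp_div hE (hp_sub_ne h3 x) (hp_sub_ne h1 x),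
    logp_div hE (hp_sub_ne h3 x) (hp_sub_ne h2 x)]
  ring

/-- The line integral as an element of `V_k ⊗ E`. -/
def lineInt (hE : HasLog p E) (c : Edge p → Vk p k E) {τ₁ τ₂ : E} (h1 : τ₁ ∈ Hp p E)
    (h2 : τ₂ ∈ Hp p E) : Vk p k E where
  toFun P := lineIntegral c τ₁ τ₂ P
  map_add' P Q := by
    have := integral_lin_fun (c := c) (logIntegrand_mem hE h1 h2 P) (logIntegrand_mem hE h1 h2 Q) 1
    rw [one_mul] at this
    rw [lineIntegral, lineIntegral, lineIntegral, ← this]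
    congr 1
    funext x
    simp only [one_smul, Pi.add_apply, logIntegrand, Submodule.coe_add, Polynomial.eval_add, map_add]
    ring
  map_smul' t P := by
    have h0 : (0 : ℚ_[p] → E) ∈ locAn p k E := zero_mem _
    have hz : integral c (0 : ℚ_[p] → E) = 0 := by
      rw [integral_of_mem h0]; exact map_zero _
    have := integral_lin_fun (c := c) (logIntegrand_mem hE h1 h2 P) h0 (algebraMap ℚ_[p] E t)
    rw [hz, add_zero, add_zero] at this
    rw [lineIntegral, lineIntegral, RingHom.id_apply, Algebra.smul_def, ← this]
    congr 1
    funext x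
    simp only [Pi.smul_apply, smul_eq_mul, logIntegrand, Submodule.coe_smul, Polynomial.eval_smul,
      map_mul]
    ring

lemma homogenize_polyAct {γ : GL (Fin 2) ℚ_[p]} (hγ : gdet γ = 1) (P : Pk p k) {x y : ℚ_[p]}
    (hxy : x ≠ 0 ∨ y ≠ 0) : homogenize (polyAct k γ P) x y =
      homogenize P (γ 0 0 * x + γ 0 1 * y) (γ 1 0 * x + γ 1 1 * y) := by
  have key : ∀ x y : ℚ_[p], y ≠ 0 → homogenize (polyAct k γ P) x y =
      homogenize P (γ 0 0 * x + γ 0 1 * y) (γ 1 0 * x + γ 1 1 * y) := by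
    intro x y hy
    rw [homogenize_of_ne _ _ hy, eval_polyAct, hγ, inv_one, one_pow, one_mul, ← homogenize_smul]
    congr 1 <;> field_simp
  by_cases hy : y = 0
  · subst hy
    have c1 : Continuous fun y => homogenize (polyAct k γ P) x y := by
      unfold homogenize; fun_prop
    have c2 : Continuous fun y =>
        homogenize P (γ 0 0 * x + γ 0 1 * y) (γ 1 0 * x + γ 1 1 * y) := by
      unfold homogenize; fun_prop
    have h1 := (c1.tendsto 0).mono_left (nhdsWithin_le_nhds (s := ({0}ᶜ : Set ℚ_[p])))
    have h2 := (c2.tendsto 0).mono_left (nhdsWithin_le_nhds (s := ({0}ᶜ : Set ℚ_[p])))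
    exact tendsto_nhds_unique (h1.congr' (eventually_mem_nhdsWithin.mono fun y hy => key x y (by simpa using hy))) h2
  · exact key x y hy

variable (E) in
/-- The function on `ℚ_p` given by a polynomial. -/
def polyFun (P : Pk p k) : locAn p k E :=
  ⟨fun x => algebraMap ℚ_[p] E (P.1.eval x), fun a => analyticAt_polynomial P.1 a,
    fun w => algebraMap ℚ_[p] E (homogenize P 1 w), by
      have : AnalyticAt ℚ_[p] (fun w => homogenize P 1 w) 0 := by
        unfold homogenize
        refine Finset.analyticAt_fun_sum _ fun i _ => ?_
        exact analyticAt_const.mul (analyticAt_id.pow _)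
      exact ((algebraMapCLM ℚ_[p] E).analyticAt _).comp this, 0, fun x hx => by
      have hx0 : x ≠ 0 := norm_pos_iff.1 hx
      rw [Algebra.smul_def, ← map_mul, homogenize_of_ne P 1 (inv_ne_zero hx0), ← mul_assoc,
        ← mul_pow, mul_inv_cancel₀ hx0, one_pow, one_mul, one_div, inv_inv]⟩

omit [CompleteSpace E] [IsUltrametricDist E] in
lemma ext_polyFun (P : Pk p k) (x y : ℚ_[p]) :
    ext (polyFun E P) x y = algebraMap ℚ_[p] E (homogenize P x y) := by
  by_cases hy : y = 0
  · subst hy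
    have h2 := homogenize_smul P x 1 0
    rw [mul_one, mul_zero] at h2
    rw [ext_zero, h2, map_mul, Algebra.smul_def]
    congr 1
    refine leading_eq (g := fun w => algebraMap ℚ_[p] E (homogenize P 1 w)) (r := 0) ?_ fun x hx => ?_
    · exact ((algebraMapCLM ℚ_[p] E).continuous.comp (continuous_homogenize P)).continuousAt
    · have hx0 : x ≠ 0 := norm_pos_iff.1 hx
      rw [Algebra.smul_def, ← map_mul, homogenize_of_ne P 1 (inv_ne_zero hx0), ← mul_assoc,
        ← mul_pow, mul_inv_cancel₀ hx0, one_pow, one_mul, one_div, inv_inv]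
      rfl
  · rw [ext_of_ne _ _ hy, homogenize_of_ne P x hy, Algebra.smul_def, map_mul]
    rfl

lemma totalInt_polyFun (hk : Even k) {C : ℝ} (hc : IsBdd c C) (P : Pk p k) :
    totalInt c (ext (polyFun E P)) = 0 := by
  rw [← theMeasure_apply hc]
  have e : polyFun E P = cut 0 0 (polyFun E P) + (polyFun E P - cut 0 0 (polyFun E P)) :=
    (add_sub_cancel _ _).symm
  rw [e, map_add, theMeasure_poly hk hc (aff 0 0 • e0 p) P _ rfl,
    theMeasure_poly hk hc (iaff p 1 • e0 p) P]
  · have e1 : iaff p 1 = w0 p := by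
      apply gl_ext <;> simp [iaff, w0_eq]
    rw [aff_zero_zero, one_smul, e1, w0_smul_e0, hc.symm, LinearMap.neg_apply, add_neg_cancel]
  · funext x
    change (polyFun E P).1 x - (finBall _).indicator _ x = _
    by_cases hx : x ∈ finBall (iaff p 1 • e0 p)
    · have hx' := (mem_iaff_iff 1 x).1 hx
      rw [sub_self] at hx'
      rw [Set.indicator_of_mem hx, Set.indicator_of_notMem hx', sub_zero]
      rfl
    · have hx' := not_not.1 (mt (mem_iaff_iff 1 x).2 hx)
      rw [sub_self] at hx'
      rw [Set.indicator_of_notMem hx, Set.indicator_of_mem hx', sub_self]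

omit [CompleteSpace E] [IsUltrametricDist E] in
lemma hp_lin_ne {τ : E} (hτ : τ ∈ Hp p E) {x y : ℚ_[p]} (hxy : x ≠ 0 ∨ y ≠ 0) :
    algebraMap ℚ_[p] E x * τ + algebraMap ℚ_[p] E y ≠ 0 := by
  intro h
  by_cases hx : x = 0
  · subst hx
    simp at h hxy
    exact hxy h
  · have hx' : algebraMap ℚ_[p] E x ≠ 0 := by simpa using hx
    refine hτ ⟨-y / x, ?_⟩
    rw [map_div₀, map_neg, div_eq_iff hx']
    linear_combination -h

omit [CompleteSpace E] [IsUltrametricDist E] in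
lemma gl_row_ne (g : GL (Fin 2) ℚ_[p]) : g 1 0 ≠ 0 ∨ g 1 1 ≠ 0 := by
  by_contra! h
  exact gdet_ne_zero g (by rw [gdet, h.1, h.2]; ring)

omit [CompleteSpace E] [IsUltrametricDist E] in
lemma moebius_mem (g : GL (Fin 2) ℚ_[p]) {τ : E} (hτ : τ ∈ Hp p E) : moebius g τ ∈ Hp p E := by
  have hd := hp_lin_ne hτ (gl_row_ne g)
  rintro ⟨x, hx⟩
  rw [moebius, eq_div_iff hd] at hx
  have h : algebraMap ℚ_[p] E (x * g 1 0 - g 0 0) * τ + algebraMap ℚ_[p] E (x * g 1 1 - g 0 1) = 0 := by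
    simp only [map_sub, map_mul]
    linear_combination hx
  refine hp_lin_ne hτ ?_ h
  by_contra! h2
  refine gdet_ne_zero g ?_
  rw [gdet]
  linear_combination -g 1 1 * h2.1 + g 1 0 * h2.2

omit [CompleteSpace E] [IsUltrametricDist E] in
lemma moebius_mul (g h : GL (Fin 2) ℚ_[p]) {τ : E} (hτ : τ ∈ Hp p E) :
    moebius (g * h) τ = moebius g (moebius h τ) := by
  have hd := hp_lin_ne hτ (gl_row_ne h)
  have hd2 := hp_lin_ne (moebius_mem h hτ) (gl_row_ne g)
  have hd3 := hp_lin_ne hτ (gl_row_ne (g * h))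
  rw [moebius] at hd2
  rw [moebius, moebius, moebius, div_eq_div_iff hd3 hd2]
  rw [mul_00, mul_01, mul_10, mul_11]
  simp only [map_add, map_mul]
  field_simp
  ring

lemma lineIntegral_smul (hk : Even k) (hΓ : Cocompact Γ) (hE : HasLog p E)
    (hc : c ∈ harmonic Γ k E) {γ : GL (Fin 2) ℚ_[p]} (hγ : γ ∈ Γ) (hdet : gdet γ = 1) {τ₁ τ₂ : E}
    (h1 : τ₁ ∈ Hp p E) (h2 : τ₂ ∈ Hp p E) (P : Pk p k) :
    lineIntegral c (moebius γ τ₁) (moebius γ τ₂) P = lineIntegral c τ₁ τ₂ (polyAct k γ P) := by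
  obtain ⟨C, hC⟩ := isBdd_of_harmonic hk hΓ hc
  have hm1 := moebius_mem γ h1
  have hm2 := moebius_mem γ h2
  have hd1 := hp_lin_ne h1 (gl_row_ne γ)
  have hd2 := hp_lin_ne h2 (gl_row_ne γ)
  set t : E := logp p ((algebraMap ℚ_[p] E (γ 1 0) * τ₁ + algebraMap ℚ_[p] E (γ 1 1)) /
    (algebraMap ℚ_[p] E (γ 1 0) * τ₂ + algebraMap ℚ_[p] E (γ 1 1))) with ht
  have hL := isLA_ext (⟨_, logIntegrand_mem hE hm1 hm2 P⟩ : locAn p k E)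
  rw [lineIntegral_eq hk hC hE h1 h2, lineIntegral,
    integral_eq_totalInt hk hC ⟨_, logIntegrand_mem hE hm1 hm2 P⟩,
    ← totalInt_comp hk hC hL hdet (mom_smul hc hγ)]
  have h3 := totalInt_lin hC (isLA_ext (polyFun E (polyAct k γ P)))
    (isLA_ext (⟨_, logIntegrand_mem hE h1 h2 (polyAct k γ P)⟩ : locAn p k E)) t
  rw [totalInt_polyFun hk hC, mul_zero, zero_add,
    totalInt_congr (fun x y hxy => ext_logIntegrand hE h1 h2 (polyAct k γ P) hxy)] at h3
  rw [← h3]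
  refine totalInt_congr fun x y hxy => ?_
  have hne : γ 0 0 * x + γ 0 1 * y ≠ 0 ∨ γ 1 0 * x + γ 1 1 * y ≠ 0 := by
    by_contra! h
    rw [gdet] at hdet
    have hx : x = 0 := by linear_combination γ 1 1 * h.1 - γ 0 1 * h.2 - x * hdet
    have hy : y = 0 := by linear_combination γ 0 0 * h.2 - γ 1 0 * h.1 - y * hdet
    tauto
  rw [ext_logIntegrand hE hm1 hm2 P hne, ext_logIntegrand hE h1 h2 _ hxy, ext_polyFun,
    homogenize_polyAct hdet P hxy, logSec, logSec, homogenize_polyAct hdet P hxy]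
  have hn : ∀ τ ∈ Hp p E, algebraMap ℚ_[p] E x - τ * algebraMap ℚ_[p] E y ≠ 0 := by
    intro τ hτ h
    have hxy' : -y ≠ 0 ∨ x ≠ 0 := by rw [neg_ne_zero]; tauto
    refine hp_lin_ne hτ hxy' ?_
    rw [map_neg]
    linear_combination h
  have hdet' : algebraMap ℚ_[p] E (γ 0 0) * algebraMap ℚ_[p] E (γ 1 1) -
      algebraMap ℚ_[p] E (γ 0 1) * algebraMap ℚ_[p] E (γ 1 0) = 1 := by
    rw [← map_mul, ← map_mul, ← map_sub, ← map_one (algebraMap ℚ_[p] E), ← hdet, gdet]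
  have e : ∀ τ ∈ Hp p E, algebraMap ℚ_[p] E (γ 0 0 * x + γ 0 1 * y) -
      moebius γ τ * algebraMap ℚ_[p] E (γ 1 0 * x + γ 1 1 * y) =
      (algebraMap ℚ_[p] E x - τ * algebraMap ℚ_[p] E y) /
        (algebraMap ℚ_[p] E (γ 1 0) * τ + algebraMap ℚ_[p] E (γ 1 1)) := by
    intro τ hτ
    have hd := hp_lin_ne hτ (gl_row_ne γ)
    rw [moebius, eq_div_iff hd, sub_mul, mul_right_comm, div_mul_cancel₀ _ hd]
    simp only [map_add, map_mul]
    linear_combination (algebraMap ℚ_[p] E x - τ * algebraMap ℚ_[p] E y) * hdet'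
  rw [e τ₁ h1, e τ₂ h2, logp_div hE (div_ne_zero (hn _ h2) hd2) (div_ne_zero (hn _ h1) hd1),
    logp_div hE (hn _ h2) hd2, logp_div hE (hn _ h1) hd1, ht, logp_div hE hd1 hd2,
    logp_div hE (hn _ h2) (hn _ h1)]
  ring

end LineIntegral

/-! ### Classes of cocycles -/

section HasClass
variable {E : Type} [Field E] [Algebra ℚ_[p] E] {k : ℕ} {Γ : Subgroup (GL (Fin 2) ℚ_[p])}
  {f f' : Γ → Pk p k → E} {h h' : groupCohomology.H1 (vkRepOn Γ k E)}

lemma cocycle_mul (z : groupCohomology.cocycles₁ (vkRepOn Γ k E)) (g g' : Γ) :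
    (z.1 (g * g') : Vk p k E) = vkRep k E g.1 (z.1 g') + z.1 g :=
  (groupCohomology.mem_cocycles₁_iff _).1 z.2 g g'

/-- A cocycle with values in `V_k ⊗ E`. -/
def mkCocycle (z : Γ → Vk p k E) (hz : ∀ g g' : Γ, z (g * g') = vkRep k E g.1 (z g') + z g) :
    groupCohomology.cocycles₁ (vkRepOn Γ k E) :=
  ⟨z, (groupCohomology.mem_cocycles₁_iff (A := vkRepOn Γ k E) z).2 hz⟩

lemma hasClass_mkCocycle (z : Γ → Vk p k E)
    (hz : ∀ g g' : Γ, z (g * g') = vkRep k E g.1 (z g') + z g) (hf : ∀ γ P, z γ P = f γ P) :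
    HasClass Γ f (groupCohomology.H1π _ (mkCocycle z hz)) :=
  ⟨mkCocycle z hz, hf, rfl⟩

lemma HasClass.congr (hh : HasClass Γ f h) (e : ∀ γ P, f γ P = f' γ P) : HasClass Γ f' h := by
  obtain ⟨z, hz, rfl⟩ := hh
  exact ⟨z, fun γ P => (hz γ P).trans (e γ P), rfl⟩

lemma HasClass.unique (hh : HasClass Γ f h) (hh' : HasClass Γ f h') : h = h' := by
  obtain ⟨z, hz, rfl⟩ := hh
  obtain ⟨z', hz', rfl⟩ := hh'
  congr 1
  refine Subtype.ext (funext fun γ => LinearMap.ext fun P => ?_)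
  exact (hz γ P).trans (hz' γ P).symm

lemma HasClass.lin (hh : HasClass Γ f h) (hh' : HasClass Γ f' h') (t : E) :
    HasClass Γ (fun γ P => t * f γ P + f' γ P) (t • h + h') := by
  obtain ⟨z, hz, rfl⟩ := hh
  obtain ⟨z', hz', rfl⟩ := hh'
  refine ⟨t • z + z', fun γ P => ?_, by rw [map_add, map_smul]⟩
  dsimp only
  rw [← hz, ← hz']
  rfl

/-- Cocycles with the same class differ by a coboundary. -/
lemma HasClass.exists_sub (hh : HasClass Γ f h) (hh' : HasClass Γ f' h) :
    ∃ m : Vk p k E, ∀ γ P, f γ P - f' γ P = (vkRep k E γ.1 m - m) P := by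
  obtain ⟨z, hz, e⟩ := hh
  obtain ⟨z', hz', rfl⟩ := hh'
  obtain ⟨m, hm⟩ := (groupCohomology.H1π_eq_iff z z').1 e
  refine ⟨m, fun γ P => ?_⟩
  rw [← hz, ← hz']
  exact (LinearMap.congr_fun (congrFun hm γ) P).symm

lemma HasClass.of_sub (hh : HasClass Γ f h) (m : Vk p k E)
    (e : ∀ γ P, f' γ P = f γ P + (vkRep k E γ.1 m - m) P) : HasClass Γ f' h := by
  obtain ⟨z, hz, rfl⟩ := hh
  refine ⟨z + ⟨_, groupCohomology.d₀₁_apply_mem_cocycles₁ (A := vkRepOn Γ k E) m⟩,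
    fun γ P => ?_, ?_⟩
  · rw [e, ← hz]
    rfl
  · rw [groupCohomology.H1π_eq_iff]
    exact ⟨m, (add_sub_cancel_left _ _).symm⟩

/-- Classes of cocycles depending linearly on a parameter. -/
lemma exists_linearMap {M : Type} [AddCommGroup M] [Module E M] (F : M → Γ → Pk p k → E)
    (hF : ∀ (t : E) c c' γ P, F (t • c + c') γ P = t * F c γ P + F c' γ P)
    (hex : ∀ c, ∃ h, HasClass Γ (F c) h) :
    ∃ L : M →ₗ[E] groupCohomology.H1 (vkRepOn Γ k E), ∀ c, HasClass Γ (F c) (L c) := by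
  choose L hL using hex
  have key : ∀ (t : E) c c', L (t • c + c') = t • L c + L c' := fun t c c' =>
    (hL _).unique (((hL c).lin (hL c') t).congr fun γ P => (hF t c c' γ P).symm)
  have h0 : L 0 = 0 := by
    have := key 1 0 0
    simpa using this
  exact ⟨{ toFun := L
           map_add' := fun c c' => by simpa using key 1 c c'
           map_smul' := fun t c => by simpa [h0] using key t c 0 }, hL⟩

end HasClass

/-! ### Teitelbaum's cocycles -/

section Teitelbaum
variable {E : Type} [NormedField E] [NormedAlgebra ℚ_[p] E] {k : ℕ}
  {Γ : Subgroup (GL (Fin 2) ℚ_[p])} {c : Edge p → Vk p k E}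
  [CompleteSpace E] [IsUltrametricDist E]

lemma lineInt_smul (hk : Even k) (hΓ : Cocompact Γ) (hE : HasLog p E) (hc : c ∈ harmonic Γ k E)
    {γ : GL (Fin 2) ℚ_[p]} (hγ : γ ∈ Γ) (hdet : gdet γ = 1) {τ₁ τ₂ : E} (h1 : τ₁ ∈ Hp p E)
    (h2 : τ₂ ∈ Hp p E) :
    lineInt hE c (moebius_mem γ h1) (moebius_mem γ h2) = vkRep k E γ (lineInt hE c h1 h2) :=
  LinearMap.ext fun P => lineIntegral_smul hk hΓ hE hc hγ hdet h1 h2 P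

lemma lineInt_moebius_mul (hk : Even k) (hΓ : Cocompact Γ) (hE : HasLog p E)
    (hc : c ∈ harmonic Γ k E) (hdet : ∀ γ ∈ Γ, gdet γ = 1) {τ : E} (hτ : τ ∈ Hp p E) (g g' : Γ) :
    lineInt hE c hτ (moebius_mem (g * g').1 hτ) =
      vkRep k E g.1 (lineInt hE c hτ (moebius_mem g'.1 hτ)) +
        lineInt hE c hτ (moebius_mem g.1 hτ) := by
  rw [← lineInt_smul hk hΓ hE hc g.2 (hdet _ g.2)]
  refine LinearMap.ext fun P => ?_
  rw [add_comm]
  refine Eq.trans ?_ (lineIntegral_add hE hτ (moebius_mem g.1 hτ)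
    (moebius_mem g.1 (moebius_mem g'.1 hτ)) P)
  change lineIntegral c τ (moebius (g.1 * g'.1) τ) P = _
  rw [moebius_mul g.1 g'.1 hτ]

lemma lineInt_change (hk : Even k) (hΓ : Cocompact Γ) (hE : HasLog p E)
    (hc : c ∈ harmonic Γ k E) (hdet : ∀ γ ∈ Γ, gdet γ = 1) {τ τ' : E} (hτ : τ ∈ Hp p E)
    (hτ' : τ' ∈ Hp p E) (g : Γ) :
    lineInt hE c hτ' (moebius_mem g.1 hτ') = lineInt hE c hτ (moebius_mem g.1 hτ) +
      (vkRep k E g.1 (lineInt hE c hτ hτ') - lineInt hE c hτ hτ') := by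
  rw [← lineInt_smul hk hΓ hE hc g.2 (hdet _ g.2)]
  refine LinearMap.ext fun P => ?_
  have e1 := lineIntegral_add (c := c) hE hτ hτ' (moebius_mem g.1 hτ') P
  have e2 := lineIntegral_add (c := c) hE hτ (moebius_mem g.1 hτ) (moebius_mem g.1 hτ') P
  change lineIntegral c τ' (moebius g.1 τ') P = lineIntegral c τ (moebius g.1 τ) P +
    (lineIntegral c (moebius g.1 τ) (moebius g.1 τ') P - lineIntegral c τ τ' P)
  linear_combination e2 - e1

/-- Teitelbaum's cocycles have a class which does not depend on the base point. -/
lemma exists_class_teitelbaum (hk : Even k) (hΓ : Cocompact Γ) (hE : HasLog p E)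
    (hc : c ∈ harmonic Γ k E) (hdet : ∀ γ ∈ Γ, gdet γ = 1) :
    ∃ h, ∀ τ ∈ Hp p E, HasClass Γ (teitelbaumCocycle c τ) h := by
  by_cases hne : ∃ τ, τ ∈ Hp p E
  · obtain ⟨τ, hτ⟩ := hne
    have h0 := hasClass_mkCocycle (f := teitelbaumCocycle c τ)
      (fun g => lineInt hE c hτ (moebius_mem g.1 hτ))
      (lineInt_moebius_mul hk hΓ hE hc hdet hτ) fun _ _ => rfl
    exact ⟨_, fun τ' hτ' => h0.of_sub (lineInt hE c hτ hτ') fun γ P =>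
      LinearMap.congr_fun (lineInt_change hk hΓ hE hc hdet hτ hτ' γ) P⟩
  · exact ⟨0, fun τ hτ => (hne ⟨τ, hτ⟩).elim⟩

lemma exists_isTeitelbaumLambda (hk : Even k) (hΓ : Cocompact Γ) (hE : HasLog p E)
    (hdet : ∀ γ ∈ Γ, gdet γ = 1) :
    ∃ lam : harmonic Γ k E →ₗ[E] groupCohomology.H1 (vkRepOn Γ k E),
      IsTeitelbaumLambda Γ lam := by
  by_cases hne : ∃ τ, τ ∈ Hp p E
  · obtain ⟨τ, hτ⟩ := hne
    have hex := fun c : harmonic Γ k E => exists_class_teitelbaum hk hΓ hE c.2 hdet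
    obtain ⟨L, hL⟩ := exists_linearMap (fun (c : harmonic Γ k E) => teitelbaumCocycle (Γ := Γ) c.1 τ)
      (fun t c c' γ P => by
        have := integral_lin hk hΓ c.2 c'.2 t (logIntegrand_mem hE hτ (moebius_mem γ.1 hτ) P)
        exact this)
      fun c => (hex c).imp fun h hh => hh τ hτ
    refine ⟨L, fun τ' hτ' c => ?_⟩
    obtain ⟨h, hh⟩ := hex c
    rw [(hL c).unique (hh τ hτ)]
    exact hh τ' hτ'
  · exact ⟨0, fun τ hτ => (hne ⟨τ, hτ⟩).elim⟩

end Teitelbaum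

/-! ### Change of the field of coefficients -/

section Extend
variable {E E' : Type} [Field E] [Algebra ℚ_[p] E] [Field E'] [Algebra ℚ_[p] E'] {k : ℕ}
  {Γ : Subgroup (GL (Fin 2) ℚ_[p])}

lemma map_mem_harmonic (θ : E →ₗ[ℚ_[p]] E') {c : Edge p → Vk p k E} (hc : c ∈ harmonic Γ k E) :
    (fun e => θ ∘ₗ c e) ∈ harmonic Γ k E' := by
  refine ⟨fun e => ?_, fun v => ?_, fun γ hγ e => ?_⟩
  · dsimp only
    rw [hc.1, LinearMap.comp_neg]
  · let Φ : Vk p k E →+ Vk p k E' :=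
      { toFun := fun φ => θ ∘ₗ φ
        map_zero' := LinearMap.comp_zero _
        map_add' := fun _ _ => LinearMap.comp_add _ _ _ }
    have h := congrArg Φ (hc.2.1 v)
    rw [map_zero, AddMonoidHom.map_finsum_mem' _ ((finite_edges_from v).subset
      Set.inter_subset_left)] at h
    exact h
  · dsimp only
    rw [← hc.2.2 γ hγ e]
    rfl

lemma extend_mem {c : Edge p → Vk p k ℚ_[p]} (hc : c ∈ harmonic Γ k ℚ_[p]) :
    extend E c ∈ harmonic Γ k E :=
  map_mem_harmonic (Algebra.linearMap ℚ_[p] E) hc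

lemma map_extend (θ : E →ₐ[ℚ_[p]] E') (c : Edge p → Vk p k ℚ_[p]) :
    (fun e => θ.toLinearMap ∘ₗ extend E c e) = extend E' c :=
  funext fun e => LinearMap.ext fun P => θ.commutes (c e P)

end Extend

section Functoriality
variable {E E' : Type} [NormedField E] [NormedAlgebra ℚ_[p] E] [NormedField E']
  [NormedAlgebra ℚ_[p] E'] {k : ℕ} {Γ : Subgroup (GL (Fin 2) ℚ_[p])}
  (θ : E →ₐ[ℚ_[p]] E') (hθ : ∀ x, ‖θ x‖ = ‖x‖) {c : Edge p → Vk p k E}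
  {F : ℚ_[p] → ℚ_[p] → E}

include hθ in
lemma continuous_of_norm_eq : Continuous θ :=
  (AddMonoidHomClass.isometry_of_norm θ hθ).continuous

include hθ in
lemma map_hasExp {f : ℚ_[p] → E} {b : ℕ → E} (h : HasExp f b) :
    HasExp (fun x => θ (f x)) fun n => θ (b n) := by
  intro z hz
  have := (h z hz).map θ (continuous_of_norm_eq θ hθ)
  refine (congrArg (fun f => HasSum f _) (funext fun n => ?_)).mp this
  exact map_smul θ _ _

lemma map_res (g : GL (Fin 2) ℚ_[p]) :
    res k (fun x y => θ (F x y)) g = fun x => θ (res k F g x) := by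
  funext x
  rw [res, res, map_smul]

include hθ in
lemma map_riemann {t : ℝ} : ∀ {s : ℕ} {g}, AnBd k F t s g →
    riemann (fun e => θ.toLinearMap ∘ₗ c e) (fun x y => θ (F x y)) s g = θ (riemann c F s g)
  | 0, g, ⟨b, hb, _⟩ => by
    rw [riemann, riemann, taylorSum, taylorSum, map_sum, hb.coefs_eq, map_res,
      (map_hasExp θ hθ hb).coefs_eq]
    exact Finset.sum_congr rfl fun i _ => (map_mul θ _ _).symm
  | s + 1, g, h => by
    rw [riemann, riemann, map_sum]
    exact Finset.sum_congr rfl fun j _ => map_riemann (h j)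

variable [CompleteSpace E] [IsUltrametricDist E] [CompleteSpace E'] [IsUltrametricDist E']

include hθ in
lemma map_coneInt {C t : ℝ} (hc : IsBdd c C) (hF : Homog k F) (ht0 : 0 ≤ t) {m : ℕ}
    {g : GL (Fin 2) ℚ_[p]} (h : AnBd k F t m g) :
    coneInt (fun e => θ.toLinearMap ∘ₗ c e) (fun x y => θ (F x y)) g = θ (coneInt c F g) := by
  have h1 := ((continuous_of_norm_eq θ hθ).tendsto _).comp (coneInt_tendsto hc hF ht0 h)
  refine Tendsto.limUnder_eq (h1.congr' ?_)
  filter_upwards [eventually_ge_atTop m] with s hs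
  obtain ⟨s, rfl⟩ := Nat.exists_eq_add_of_le hs
  exact (map_riemann θ hθ (h.steps hF ht0 s)).symm

include hθ in
lemma map_totalInt {C : ℝ} (hc : IsBdd c C) (hF : IsLA k F) :
    totalInt (fun e => θ.toLinearMap ∘ₗ c e) (fun x y => θ (F x y)) = θ (totalInt c F) := by
  have key : ∀ g, coneInt (fun e => θ.toLinearMap ∘ₗ c e) (fun x y => θ (F x y)) g =
      θ (coneInt c F g) := fun g => by
    obtain ⟨m, t, ht0, h⟩ := hF.an g
    exact map_coneInt θ hθ hc hF.homog ht0 h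
  rw [totalInt, totalInt, key, key, map_add]

include hθ in
lemma map_logp (hE : HasLog p E) (z : E) : θ (logp p z) = logp p (θ z) := by
  by_cases hz : z = 0
  · subst hz
    have h0 : ∀ (E : Type) [NormedField E] [NormedAlgebra ℚ_[p] E], logp p (0 : E) = 0 := by
      intro E _ _
      rw [logp, dif_neg]
      rintro ⟨t, h1, h2, h3⟩
      rw [zero_pow h1.ne', eq_comm, mul_eq_zero] at h2
      have hp : (p : E) ≠ 0 := natCast_ne_zero' (p := p) (Fact.out : p.Prime).ne_zero
      have := h2.resolve_left (zpow_ne_zero _ hp)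
      rw [this] at h3
      simp at h3
    rw [map_zero, h0, h0, map_zero]
  obtain ⟨⟨n, m, u⟩, h1, h2, h3⟩ := hE z hz
  have h3' : ‖θ u - 1‖ < 1 := by rwa [← map_one θ, ← map_sub, hθ]
  rw [logp_eq (t := (n, m, u)) ⟨h1, h2, h3⟩, logp_eq (z := θ z) (t := (n, m, θ u)) ⟨h1, ?_, h3'⟩,
    map_mul, map_inv₀, map_natCast]
  · congr 1
    refine tendsto_nhds_unique (((continuous_of_norm_eq θ hθ).tendsto _).comp
      (tendsto_log1 (p := p) h3)) ((tendsto_log1 (p := p) h3').congr fun n => ?_)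
    simp
  · have := congrArg θ h2
    simpa using this

omit [CompleteSpace E] [IsUltrametricDist E] [CompleteSpace E'] [IsUltrametricDist E'] in
lemma map_mem_Hp {τ : E} (hτ : τ ∈ Hp p E) : θ τ ∈ Hp p E' := by
  rintro ⟨x, hx⟩
  rw [← θ.commutes] at hx
  exact hτ ⟨x, θ.toRingHom.injective hx⟩

omit [CompleteSpace E] [IsUltrametricDist E] [CompleteSpace E'] [IsUltrametricDist E'] in
lemma map_moebius (g : GL (Fin 2) ℚ_[p]) (τ : E) : θ (moebius g τ) = moebius g (θ τ) := by
  simp [moebius]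

include hθ in
lemma map_lineIntegral (hk : Even k) (hΓ : Cocompact Γ) (hE : HasLog p E) (hE' : HasLog p E')
    (hc : c ∈ harmonic Γ k E) {τ₁ τ₂ : E} (h1 : τ₁ ∈ Hp p E) (h2 : τ₂ ∈ Hp p E) (P : Pk p k) :
    θ (lineIntegral c τ₁ τ₂ P) =
      lineIntegral (fun e => θ.toLinearMap ∘ₗ c e) (θ τ₁) (θ τ₂) P := by
  obtain ⟨C, hC⟩ := isBdd_of_harmonic hk hΓ hc
  obtain ⟨C', hC'⟩ := isBdd_of_harmonic hk hΓ (map_mem_harmonic θ.toLinearMap hc)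
  rw [lineIntegral_eq hk hC' hE' (map_mem_Hp θ h1) (map_mem_Hp θ h2), lineIntegral,
    integral_eq_totalInt hk hC ⟨_, logIntegrand_mem hE h1 h2 P⟩,
    ← map_totalInt θ hθ hC (isLA_ext _)]
  refine totalInt_congr fun x y hxy => ?_
  rw [ext_logIntegrand hE h1 h2 P hxy, logSec, logSec, map_mul, map_logp θ hθ hE]
  simp

include hθ in
lemma map_teitelbaumCocycle (hk : Even k) (hΓ : Cocompact Γ) (hE : HasLog p E) (hE' : HasLog p E')
    {c : Edge p → Vk p k ℚ_[p]} (hc : c ∈ harmonic Γ k ℚ_[p]) {τ : E} (hτ : τ ∈ Hp p E) (γ : Γ)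
    (P : Pk p k) : θ (teitelbaumCocycle (extend E c) τ γ P) =
      teitelbaumCocycle (extend E' c) (θ τ) γ P := by
  rw [teitelbaumCocycle, map_lineIntegral θ hθ hk hΓ hE hE' (extend_mem hc) hτ (moebius_mem _ hτ),
    map_extend, map_moebius]
  rfl

end Functoriality

/-! ### Quadratic extensions and the trace -/

section Trace
variable {K : Type} [NormedField K] [NormedAlgebra ℚ_[p] K]

lemma norm_algHom_eq [FiniteDimensional ℚ_[p] K] {K' : Type} [NormedField K']
    [NormedAlgebra ℚ_[p] K'] (θ : K →ₐ[ℚ_[p]] K') (x : K) : ‖θ x‖ = ‖x‖ := by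
  let T : K →L[ℚ_[p]] K' := ⟨θ.toLinearMap, LinearMap.continuous_of_finiteDimensional _⟩
  have h1 : ∀ x, ‖θ x‖ ≤ ‖x‖ := by
    intro x
    by_contra! h
    have hx : 0 < ‖x‖ := by
      rw [norm_pos_iff]
      rintro rfl
      simp at h
    obtain ⟨n, hn⟩ := pow_unbounded_of_one_lt ‖T‖ ((one_lt_div hx).2 h)
    have h2 := T.le_opNorm (x ^ n)
    change ‖θ (x ^ n)‖ ≤ _ at h2
    rw [map_pow, norm_pow, norm_pow] at h2
    rw [div_pow, lt_div_iff₀ (pow_pos hx n)] at hn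
    linarith
  by_cases hx : x = 0
  · simp [hx]
  refine le_antisymm (h1 x) ?_
  have h2 := h1 x⁻¹
  rw [map_inv₀, norm_inv, norm_inv] at h2
  exact (inv_le_inv₀ (norm_pos_iff.2 (by simpa using hx)) (norm_pos_iff.2 hx)).1 h2

lemma card_aut (hK : Module.finrank ℚ_[p] K = 2) : Nat.card (K ≃ₐ[ℚ_[p]] K) = 2 := by
  have : Algebra.IsQuadraticExtension ℚ_[p] K := ⟨hK⟩
  rw [IsGalois.card_aut_eq_finrank, hK]

lemma trace_eq_add (hK : Module.finrank ℚ_[p] K = 2) {σ : K ≃ₐ[ℚ_[p]] K} (hσ : σ ≠ 1) (x : K) :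
    algebraMap ℚ_[p] K (Algebra.trace ℚ_[p] K x) = x + σ x := by
  classical
  have : Algebra.IsQuadraticExtension ℚ_[p] K := ⟨hK⟩
  rw [trace_eq_sum_automorphisms]
  have h : (Finset.univ : Finset (K ≃ₐ[ℚ_[p]] K)) = {1, σ} := by
    symm
    rw [← Finset.card_eq_iff_eq_univ, Finset.card_pair hσ.symm, ← Nat.card_eq_fintype_card,
      card_aut hK]
  rw [h, Finset.sum_pair hσ.symm]
  rfl

lemma exists_aut (hK : Module.finrank ℚ_[p] K = 2) : ∃ σ : K ≃ₐ[ℚ_[p]] K, σ ≠ 1 := by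
  by_contra! h
  have := card_aut hK
  rw [Nat.card_eq_one_iff_unique.2 ⟨⟨fun a b => (h a).trans (h b).symm⟩, ⟨1⟩⟩] at this
  omega

lemma exists_mem_Hp (hK : Module.finrank ℚ_[p] K = 2) : ∃ τ, τ ∈ Hp p K := by
  by_contra! h
  obtain ⟨σ, hσ⟩ := exists_aut hK
  refine hσ (AlgEquiv.ext fun x => ?_)
  obtain ⟨y, rfl⟩ := not_not.1 (h x)
  simp

variable {k : ℕ} {Γ : Subgroup (GL (Fin 2) ℚ_[p])} [CompleteSpace K] [IsUltrametricDist K]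

lemma exists_class_trace (hk : Even k) (hΓ : Cocompact Γ) (hE : HasLog p K)
    {c : Edge p → Vk p k ℚ_[p]} (hc : c ∈ harmonic Γ k ℚ_[p]) (hdet : ∀ γ ∈ Γ, gdet γ = 1) :
    ∃ h, ∀ τ ∈ Hp p K, HasClass Γ (traceCocycle K c τ) h := by
  by_cases hne : ∃ τ, τ ∈ Hp p K
  · obtain ⟨τ, hτ⟩ := hne
    let T : Vk p k K → Vk p k ℚ_[p] := fun φ => (1 / 2 : ℚ_[p]) • (Algebra.trace ℚ_[p] K ∘ₗ φ)
    have hT : ∀ φ P, T φ P = (1 / 2 : ℚ_[p]) * Algebra.trace ℚ_[p] K (φ P) := fun _ _ => rfl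
    have h0 := hasClass_mkCocycle (f := traceCocycle K c τ)
      (fun g => T (lineInt hE (extend K c) hτ (moebius_mem g.1 hτ))) (fun g g' => by
        rw [lineInt_moebius_mul hk hΓ hE (extend_mem hc) hdet hτ]
        refine LinearMap.ext fun P => ?_
        rw [hT, LinearMap.add_apply, map_add, mul_add]
        rfl) fun _ _ => rfl
    refine ⟨_, fun τ' hτ' => h0.of_sub (T (lineInt hE (extend K c) hτ hτ')) fun γ P => ?_⟩
    have := LinearMap.congr_fun (lineInt_change hk hΓ hE (extend_mem hc) hdet hτ hτ' γ) P
    have h2 : traceCocycle K c τ' γ P = (1 / 2) * Algebra.trace ℚ_[p] K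
      (lineInt hE (extend K c) hτ' (moebius_mem γ.1 hτ') P) := rfl
    rw [h2, this, LinearMap.add_apply, map_add, LinearMap.sub_apply, map_sub, mul_add, mul_sub]
    rfl
  · exact ⟨0, fun τ hτ => (hne ⟨τ, hτ⟩).elim⟩

lemma extend_lin (t : ℚ_[p]) (c c' : Edge p → Vk p k ℚ_[p]) :
    extend K (t • c + c') = algebraMap ℚ_[p] K t • extend K c + extend K c' := by
  funext e
  refine LinearMap.ext fun P => ?_
  change algebraMap ℚ_[p] K (t * c e P + c' e P) = _
  rw [map_add, map_mul]
  rfl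

lemma exists_isTraceLambda (hk : Even k) (hΓ : Cocompact Γ) (hE : HasLog p K)
    (hdet : ∀ γ ∈ Γ, gdet γ = 1) :
    ∃ lam : harmonic Γ k ℚ_[p] →ₗ[ℚ_[p]] groupCohomology.H1 (vkRepOn Γ k ℚ_[p]),
      IsTraceLambda Γ K lam := by
  by_cases hne : ∃ τ, τ ∈ Hp p K
  · obtain ⟨τ, hτ⟩ := hne
    have hex := fun c : harmonic Γ k ℚ_[p] => exists_class_trace (K := K) hk hΓ hE c.2 hdet
    obtain ⟨L, hL⟩ := exists_linearMap
      (fun (c : harmonic Γ k ℚ_[p]) => traceCocycle (Γ := Γ) K c.1 τ)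
      (fun t c c' γ P => by
        have := integral_lin hk hΓ (extend_mem (E := K) c.2) (extend_mem c'.2)
          (algebraMap ℚ_[p] K t) (logIntegrand_mem hE hτ (moebius_mem γ.1 hτ) P)
        rw [← extend_lin] at this
        have h2 : traceCocycle (Γ := Γ) K (t • c + c').1 τ γ P = 1 / 2 * Algebra.trace ℚ_[p] K
          (integral (extend K (t • c.1 + c'.1)) (logIntegrand τ (moebius γ.1 τ) P)) := rfl
        rw [h2, this, map_add, ← Algebra.smul_def, map_smul, smul_eq_mul, mul_add, mul_left_comm]
        rfl)
      fun c => (hex c).imp fun h hh => hh τ hτ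
    refine ⟨L, fun τ' hτ' c => ?_⟩
    obtain ⟨h, hh⟩ := hex c
    rw [(hL c).unique (hh τ hτ)]
    exact hh τ' hτ'
  · exact ⟨0, fun τ hτ => (hne ⟨τ, hτ⟩).elim⟩

lemma two_mul_traceCocycle (hk : Even k) (hΓ : Cocompact Γ) (hE : HasLog p K)
    (hK : Module.finrank ℚ_[p] K = 2) {σ : K ≃ₐ[ℚ_[p]] K} (hσ : σ ≠ 1)
    {c : Edge p → Vk p k ℚ_[p]} (hc : c ∈ harmonic Γ k ℚ_[p]) {τ : K} (hτ : τ ∈ Hp p K) (γ : Γ)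
    (P : Pk p k) : algebraMap ℚ_[p] K (traceCocycle K c τ γ P) =
      (1 / 2) * (teitelbaumCocycle (extend K c) τ γ P +
        teitelbaumCocycle (extend K c) (σ τ) γ P) := by
  have : FiniteDimensional ℚ_[p] K := Module.finite_of_finrank_pos (by omega)
  have h := map_teitelbaumCocycle (σ : K →ₐ[ℚ_[p]] K) (norm_algHom_eq _) hk hΓ hE hE hc hτ γ P
  rw [traceCocycle, map_mul, trace_eq_add hK hσ, map_div₀, map_one, map_ofNat]
  exact congrArg (fun y => 1 / 2 * (teitelbaumCocycle (extend K c) τ γ P + y)) h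

/-- Over a larger field, the averaged cocycle has the class of Teitelbaum's cocycle. -/
lemma hasClass_traceCocycle {C : Type} [NormedField C] [NormedAlgebra ℚ_[p] C] [CompleteSpace C]
    [IsUltrametricDist C] (hC : HasLog p C) (θ : K →ₐ[ℚ_[p]] C) (hk : Even k) (hΓ : Cocompact Γ)
    (hE : HasLog p K) (hK : Module.finrank ℚ_[p] K = 2)
    {c : Edge p → Vk p k ℚ_[p]} (hc : c ∈ harmonic Γ k ℚ_[p]) {τ : K} (hτ : τ ∈ Hp p K)
    {h : groupCohomology.H1 (vkRepOn Γ k C)}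
    (hh : ∀ τ ∈ Hp p C, HasClass Γ (teitelbaumCocycle (extend C c) τ) h) :
    HasClass Γ (fun γ P => algebraMap ℚ_[p] C (traceCocycle K c τ γ P)) h := by
  have : FiniteDimensional ℚ_[p] K := Module.finite_of_finrank_pos (by omega)
  obtain ⟨σ, hσ⟩ := exists_aut hK
  have hστ : σ τ ∈ Hp p K := map_mem_Hp (σ : K →ₐ[ℚ_[p]] K) hτ
  have h1 := hh _ (map_mem_Hp θ hτ)
  have h2 := hh _ (map_mem_Hp θ hστ)
  have h20 : (2 : C) ≠ 0 := by exact_mod_cast natCast_ne_zero' (p := p) (E := C) two_ne_zero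
  have h3 := (h1.lin h2 1).lin (((h1.lin h1 (-1)))) (1 / 2)
  have e : (1 / 2 : C) • ((1 : C) • h + h) + ((-1 : C) • h + h) = h := by
    rw [one_smul, ← two_smul C h, smul_smul, neg_one_smul, neg_add_cancel, add_zero,
      one_div_mul_cancel h20, one_smul]
  rw [e] at h3
  refine h3.congr fun γ P => ?_
  rw [← θ.commutes, two_mul_traceCocycle hk hΓ hE hK hσ hc hτ, map_mul, map_add,
    map_teitelbaumCocycle θ (norm_algHom_eq θ) hk hΓ hE hC hc hτ,
    map_teitelbaumCocycle θ (norm_algHom_eq θ) hk hΓ hE hC hc hστ, map_div₀, map_one, map_ofNat]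
  ring

end Trace

/-! ### Definite quaternion algebras -/

open scoped Quaternion

section Quat
variable {a b : ℚ}

/-- The reduced norm. -/
def nrd (x : ℍ[ℚ, a, b]) : ℚ := x.re ^ 2 - a * x.imI ^ 2 - b * x.imJ ^ 2 + a * b * x.imK ^ 2

lemma mul_star_eq (x : ℍ[ℚ, a, b]) : x * star x = ((nrd x : ℚ) : ℍ[ℚ, a, b]) := by
  generalize h : nrd x = n
  ext <;> simp <;> first | (rw [← h, nrd]; ring) | ring

lemma star_mul_eq (x : ℍ[ℚ, a, b]) : star x * x = ((nrd x : ℚ) : ℍ[ℚ, a, b]) := by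
  generalize h : nrd x = n
  ext <;> simp <;> first | (rw [← h, nrd]; ring) | ring

lemma nrd_mul (x y : ℍ[ℚ, a, b]) : nrd (x * y) = nrd x * nrd y := by
  simp [nrd]; ring

lemma nrd_coe (q : ℚ) : nrd (q : ℍ[ℚ, a, b]) = q ^ 2 := by
  simp [nrd]

lemma nrd_terms_nonneg (ha : a < 0) (hb : b < 0) (x : ℍ[ℚ, a, b]) :
    0 ≤ x.re ^ 2 ∧ 0 ≤ -a * x.imI ^ 2 ∧ 0 ≤ -b * x.imJ ^ 2 ∧ 0 ≤ a * b * x.imK ^ 2 :=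
  ⟨sq_nonneg _, mul_nonneg (by linarith) (sq_nonneg _), mul_nonneg (by linarith) (sq_nonneg _),
    mul_nonneg (mul_pos_of_neg_of_neg ha hb).le (sq_nonneg _)⟩

lemma nrd_pos (ha : a < 0) (hb : b < 0) {x : ℍ[ℚ, a, b]} (hx : x ≠ 0) : 0 < nrd x := by
  obtain ⟨h1, h2, h3, h4⟩ := nrd_terms_nonneg ha hb x
  have hab := mul_pos_of_neg_of_neg ha hb
  refine lt_of_le_of_ne (by rw [nrd]; linarith) fun h => hx ?_
  rw [nrd] at h
  have e1 : x.re ^ 2 = 0 := by linarith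
  have e2 : -a * x.imI ^ 2 = 0 := by linarith
  have e3 : -b * x.imJ ^ 2 = 0 := by linarith
  have e4 : a * b * x.imK ^ 2 = 0 := by linarith
  ext
  · simpa using e1
  · simpa [ha.ne] using e2
  · simpa [hb.ne] using e3
  · simpa [ha.ne, hb.ne] using e4

/-- Nonzero elements are units. -/
def toUnit (ha : a < 0) (hb : b < 0) {x : ℍ[ℚ, a, b]} (hx : x ≠ 0) : ℍ[ℚ, a, b]ˣ :=
  ⟨x, (nrd x)⁻¹ • star x,
    by rw [mul_smul_comm, mul_star_eq, QuaternionAlgebra.smul_coe,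
      inv_mul_cancel₀ (nrd_pos ha hb hx).ne', QuaternionAlgebra.coe_one],
    by rw [smul_mul_assoc, star_mul_eq, QuaternionAlgebra.smul_coe,
      inv_mul_cancel₀ (nrd_pos ha hb hx).ne', QuaternionAlgebra.coe_one]⟩

variable (ι : ℍ[ℚ, a, b] →ₐ[ℚ] Matrix (Fin 2) (Fin 2) ℚ_[p])

lemma map_coe_quat (q : ℚ) : ι (q : ℍ[ℚ, a, b]) = (q : ℚ_[p]) • 1 := by
  have := ι.commutes q
  rw [QuaternionAlgebra.coe_algebraMap] at this
  rw [this, Matrix.algebraMap_eq_diagonal, Matrix.smul_one_eq_diagonal]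
  rfl

lemma trace_map (ha : a ≠ 0) (hb : b ≠ 0) (x : ℍ[ℚ, a, b]) :
    (ι x).trace = ((2 * x.re : ℚ) : ℚ_[p]) := by
  have hcomm : ∀ x y : ℍ[ℚ, a, b], (ι (x * y - y * x)).trace = 0 := by
    intro x y
    rw [map_sub, map_mul, map_mul, Matrix.trace_sub, Matrix.trace_mul_comm, sub_self]
  have h : x = (x.re : ℍ[ℚ, a, b]) +
      ((⟨0, 0, 1, 0⟩ : ℍ[ℚ, a, b]) * ⟨0, 0, 0, -x.imI / (2 * b)⟩ -
        (⟨0, 0, 0, -x.imI / (2 * b)⟩ : ℍ[ℚ, a, b]) * ⟨0, 0, 1, 0⟩) +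
      ((⟨0, 1, 0, 0⟩ : ℍ[ℚ, a, b]) * ⟨0, 0, 0, x.imJ / (2 * a)⟩ -
        (⟨0, 0, 0, x.imJ / (2 * a)⟩ : ℍ[ℚ, a, b]) * ⟨0, 1, 0, 0⟩) +
      ((⟨0, 1, 0, 0⟩ : ℍ[ℚ, a, b]) * ⟨0, 0, x.imK / 2, 0⟩ -
        (⟨0, 0, x.imK / 2, 0⟩ : ℍ[ℚ, a, b]) * ⟨0, 1, 0, 0⟩) := by
    ext <;> simp <;> field_simp <;> ring
  rw [h, map_add, map_add, map_add, Matrix.trace_add, Matrix.trace_add, Matrix.trace_add, hcomm,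
    hcomm, hcomm, map_coe_quat, Matrix.trace_smul, Matrix.trace_one]
  simp
  ring

/-- A splitting carries the reduced norm to the determinant. -/
lemma det_map (ha : a ≠ 0) (hb : b ≠ 0) (x : ℍ[ℚ, a, b]) : (ι x).det = (nrd x : ℚ_[p]) := by
  have h1 : star x = ((2 * x.re : ℚ) : ℍ[ℚ, a, b]) - x := by
    rw [QuaternionAlgebra.star_eq_two_re_sub]; simp
  have h2 : ι x * ι (star x) = (nrd x : ℚ_[p]) • 1 := by
    rw [← map_mul, mul_star_eq, map_coe_quat]
  rw [h1, map_sub, map_coe_quat, ← trace_map ι ha hb x] at h2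
  have h00 := congrFun (congrFun h2 0) 0
  simp [Matrix.mul_apply, Fin.sum_univ_two, Matrix.trace] at h00
  rw [Matrix.det_fin_two, ← h00]
  ring

/-- The image of a unit in `GL₂(ℚ_p)`. -/
def unitMap (u : ℍ[ℚ, a, b]ˣ) : GL (Fin 2) ℚ_[p] :=
  Units.map (ι : ℍ[ℚ, a, b] →* Matrix (Fin 2) (Fin 2) ℚ_[p]) u

lemma unitMap_apply (u : ℍ[ℚ, a, b]ˣ) (i j : Fin 2) : unitMap ι u i j = ι u i j := rfl

lemma unitMap_mul (u v : ℍ[ℚ, a, b]ˣ) : unitMap ι (u * v) = unitMap ι u * unitMap ι v :=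
  map_mul _ _ _

lemma gdet_unitMap (ha : a ≠ 0) (hb : b ≠ 0) (u : ℍ[ℚ, a, b]ˣ) :
    gdet (unitMap ι u) = (nrd (u : ℍ[ℚ, a, b]) : ℚ_[p]) := by
  rw [← det_map ι ha hb, Matrix.det_fin_two, gdet]
  rfl

variable {R : Subring ℍ[ℚ, a, b]}

lemma nrd_of_mem {u : ℍ[ℚ, a, b]ˣ} (hu : u ∈ normOneUnits p R) : nrd (u : ℍ[ℚ, a, b]) = 1 := by
  have := hu.2.2
  rw [mul_star_eq] at this
  exact QuaternionAlgebra.coe_injective this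

lemma gdet_of_mem_arithGroup (ha : a ≠ 0) (hb : b ≠ 0) {γ : GL (Fin 2) ℚ_[p]}
    (hγ : γ ∈ arithGroup R ι) : gdet γ = 1 := by
  obtain ⟨u, hu, rfl⟩ := hγ
  refine (gdet_unitMap ι ha hb u).trans ?_
  rw [nrd_of_mem hu, Rat.cast_one]

/-- `e` is a `ℤ`-basis of `R` whose image is a `ℤ_p`-basis of `M₂(ℤ_p)`. -/
structure IsOrderBasis (R : Subring ℍ[ℚ, a, b]) (e : Fin 4 → ℍ[ℚ, a, b]) : Prop where
  mem_iff : ∀ x, x ∈ R ↔ ∃ m : Fin 4 → ℤ, x = ∑ i, m i • e i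
  li : LinearIndependent ℚ_[p] fun i => ι (e i)
  exists_eq : ∀ M : Matrix (Fin 2) (Fin 2) ℚ_[p], (∀ i j, ‖M i j‖ ≤ 1) →
    ∃ z : Fin 4 → ℤ_[p], M = ∑ i, (z i : ℚ_[p]) • ι (e i)
  norm_le : ∀ x ∈ R, ∀ i j, ‖ι x i j‖ ≤ 1

lemma exists_isOrderBasis (hRfg : R.toAddSubgroup.FG)
    (hRspan : Submodule.span ℚ (R : Set ℍ[ℚ, a, b]) = ⊤)
    (hι : ∀ M : Matrix (Fin 2) (Fin 2) ℚ_[p],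
      M ∈ Submodule.span ℤ_[p] (ι '' (R : Set ℍ[ℚ, a, b])) ↔ ∀ i j, ‖M i j‖ ≤ 1) :
    ∃ e, IsOrderBasis ι R e := by
  set N : Submodule ℤ ℍ[ℚ, a, b] := AddSubgroup.toIntSubmodule R.toAddSubgroup with hN
  have hmemN : ∀ x, x ∈ N ↔ x ∈ R := fun x => Iff.rfl
  have hfin : Module.Finite ℤ N := by
    rw [Module.Finite.iff_fg, Submodule.fg_iff_addSubgroup_fg]
    exact hRfg
  have htf : Module.IsTorsionFree ℤ ℍ[ℚ, a, b] := Module.IsTorsionFree.trans_faithfulSMul ℤ ℚ _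
  have hfree : Module.Free ℤ N := inferInstance
  have key : ∀ {n : ℕ} (B : Module.Basis (Fin n) ℤ N),
      LinearIndependent ℚ (fun i => (B i : ℍ[ℚ, a, b])) ∧
      ⊤ ≤ Submodule.span ℚ (Set.range fun i => (B i : ℍ[ℚ, a, b])) ∧
      ∀ x, x ∈ R ↔ ∃ m : Fin n → ℤ, x = ∑ i, m i • (B i : ℍ[ℚ, a, b]) := by
    intro n B
    have h3 : ∀ x, x ∈ R ↔ ∃ m : Fin n → ℤ, x = ∑ i, m i • (B i : ℍ[ℚ, a, b]) := by
      intro x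
      constructor
      · intro hx
        refine ⟨fun i => B.repr ⟨x, hx⟩ i, ?_⟩
        have := congrArg (Subtype.val) (B.sum_repr ⟨x, (hmemN x).2 hx⟩)
        refine this.symm.trans ?_
        simp only [Submodule.coe_sum, Submodule.coe_smul]
      · rintro ⟨m, rfl⟩
        exact sum_mem fun i _ => zsmul_mem ((hmemN _).1 (B i).2) _
    refine ⟨?_, ?_, h3⟩
    · have := B.linearIndependent.map' N.subtype N.ker_subtype
      exact (LinearIndependent.iff_fractionRing ℤ ℚ).1 this
    · rw [← hRspan, Submodule.span_le]
      intro x hx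
      obtain ⟨m, rfl⟩ := (h3 x).1 hx
      refine sum_mem fun i _ => zsmul_mem (Submodule.subset_span (Set.mem_range_self i)) _
  have hrank : Module.finrank ℤ N = 4 := by
    obtain ⟨h1, h2, -⟩ := key (Module.finBasis ℤ N)
    have := Module.finrank_eq_card_basis (Module.Basis.mk h1 h2)
    rw [QuaternionAlgebra.finrank_eq_four, Fintype.card_fin] at this
    exact this.symm
  set B := Module.finBasisOfFinrankEq ℤ N hrank with hB
  obtain ⟨h1, h2, h3⟩ := key B
  have hnorm : ∀ x ∈ R, ∀ i j, ‖ι x i j‖ ≤ 1 := fun x hx =>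
    (hι _).1 (Submodule.subset_span ⟨x, hx, rfl⟩)
  have hint : ∀ M : Matrix (Fin 2) (Fin 2) ℚ_[p], (∀ i j, ‖M i j‖ ≤ 1) →
      ∃ z : Fin 4 → ℤ_[p], M = ∑ i, (z i : ℚ_[p]) • ι (B i) := by
    intro M hM
    have hle : Submodule.span ℤ_[p] (ι '' (R : Set ℍ[ℚ, a, b])) ≤
        Submodule.span ℤ_[p] (Set.range fun i => ι (B i)) := by
      rw [Submodule.span_le]
      rintro _ ⟨x, hx, rfl⟩
      obtain ⟨m, rfl⟩ := (h3 x).1 hx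
      rw [map_sum]
      refine sum_mem fun i _ => ?_
      rw [map_zsmul]
      exact zsmul_mem (Submodule.subset_span (Set.mem_range_self i)) _
    obtain ⟨z, hz⟩ := (Submodule.mem_span_range_iff_exists_fun ℤ_[p]).1 (hle ((hι M).2 hM))
    refine ⟨z, hz.symm.trans (Finset.sum_congr rfl fun i _ => ?_)⟩
    ext s t
    simp [Algebra.smul_def]
  refine ⟨fun i => B i, h3, ?_, hint, hnorm⟩
  refine linearIndependent_of_top_le_span_of_card_eq_finrank ?_ ?_
  · intro M _
    obtain ⟨m, hm⟩ : ∃ m : ℕ, ∀ i j, ‖((p : ℚ_[p]) ^ m • M) i j‖ ≤ 1 := by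
      obtain ⟨m, hm⟩ := pow_unbounded_of_one_lt (∑ i, ∑ j, ‖M i j‖) (one_lt_p (p := p))
      refine ⟨m, fun i j => ?_⟩
      have h1 : ‖M i j‖ ≤ ∑ i, ∑ j, ‖M i j‖ :=
        (Finset.single_le_sum (fun _ _ => norm_nonneg _) (Finset.mem_univ j)).trans
          (Finset.single_le_sum (f := fun i => ∑ j, ‖M i j‖)
            (fun _ _ => Finset.sum_nonneg fun _ _ => norm_nonneg _) (Finset.mem_univ i))
      rw [Matrix.smul_apply, smul_eq_mul, norm_mul, norm_pow, Padic.norm_p, inv_pow,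
        inv_mul_le_one₀ (pow_pos p_pos m)]
      exact h1.trans hm.le
    obtain ⟨z, hz⟩ := hint _ hm
    have e : M = ((p : ℚ_[p]) ^ m)⁻¹ • ∑ i, (z i : ℚ_[p]) • ι (B i) := by
      rw [← hz, inv_smul_smul₀ (pow_ne_zero m p_ne_zero)]
    rw [e]
    exact Submodule.smul_mem _ _ (sum_mem fun i _ =>
      Submodule.smul_mem _ _ (Submodule.subset_span ⟨i, rfl⟩))
  · simp [Module.finrank_matrix]

variable {ι} {e : Fin 4 → ℍ[ℚ, a, b]}

lemma IsOrderBasis.eq_zero (he : IsOrderBasis ι R e) {m : Fin 4 → ℤ} (h : ∑ i, m i • e i = 0) :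
    m = 0 := by
  have h2 := congrArg ι h
  rw [map_sum, map_zero] at h2
  have h3 := Fintype.linearIndependent_iff.1 he.li (fun i => (m i : ℚ_[p])) (by
    rw [← h2]
    refine Finset.sum_congr rfl fun i _ => ?_
    rw [map_zsmul]
    exact Int.cast_smul_eq_zsmul _ _ _)
  funext i
  exact_mod_cast h3 i

/-- An element of `R[1/p]` which is integral at `p` is in `R`. -/
lemma IsOrderBasis.mem_of_norm_le (he : IsOrderBasis ι R e) {x : ℍ[ℚ, a, b]} {N : ℕ}
    (hx : (p : ℍ[ℚ, a, b]) ^ N * x ∈ R) (h : ∀ i j, ‖ι x i j‖ ≤ 1) : x ∈ R := by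
  obtain ⟨m, hm⟩ := (he.mem_iff _).1 hx
  obtain ⟨z, hz⟩ := he.exists_eq _ h
  have hpx : (p : ℍ[ℚ, a, b]) ^ N * x = ((p : ℤ) ^ N) • x := by
    rw [zsmul_eq_mul]; simp
  rw [hpx] at hm
  have h2 := congrArg ι hm
  rw [map_zsmul, hz, map_sum, Finset.smul_sum, ← sub_eq_zero, ← Finset.sum_sub_distrib] at h2
  have h3 := Fintype.linearIndependent_iff.1 he.li
    (fun i => (p : ℚ_[p]) ^ N * (z i : ℚ_[p]) - (m i : ℚ_[p])) (by
      rw [← h2]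
      refine Finset.sum_congr rfl fun i _ => ?_
      rw [map_zsmul, sub_smul, mul_smul, Int.cast_smul_eq_zsmul]
      congr 1
      rw [← Int.cast_smul_eq_zsmul ℚ_[p] ((p : ℤ) ^ N)]
      simp)
  have h4 : ∀ i, ((p : ℤ) ^ N) ∣ m i := by
    intro i
    have h5 := sub_eq_zero.1 (h3 i)
    have := (Padic.norm_int_le_pow_iff_dvd (p := p) (m i) N).1 (by
      rw [← h5, norm_mul, norm_pow, Padic.norm_p, zpow_neg, zpow_natCast, inv_pow]
      exact mul_le_of_le_one_right (inv_nonneg.2 (pow_nonneg p_pos.le _)) (z i).2)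
    exact_mod_cast this
  choose m' hm' using h4
  refine (he.mem_iff x).2 ⟨m', ?_⟩
  have hp0 : ((p : ℤ) ^ N) ≠ 0 := pow_ne_zero _ (by exact_mod_cast (Fact.out : p.Prime).ne_zero)
  have htf : Module.IsTorsionFree ℤ ℍ[ℚ, a, b] := Module.IsTorsionFree.trans_faithfulSMul ℤ ℚ _
  refine smul_right_injective _ hp0 ?_
  dsimp only
  rw [hm, Finset.smul_sum]
  exact Finset.sum_congr rfl fun i _ => by rw [hm' i, mul_smul]

/-- The coordinates of the elements of `R` have bounded denominators. -/
lemma IsOrderBasis.exists_denom (he : IsOrderBasis ι R e) : ∃ D : ℕ, 0 < D ∧ ∀ x ∈ R,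
    (∃ z : ℤ, D * x.re = z) ∧ (∃ z : ℤ, D * x.imI = z) ∧ (∃ z : ℤ, D * x.imJ = z) ∧
    (∃ z : ℤ, D * x.imK = z) ∧ (D : ℍ[ℚ, a, b]) * star x ∈ R ∧ ∃ z : ℤ, D * nrd x = z := by
  set Z : Subring ℚ := (Int.castRingHom ℚ).range with hZ
  have hmem : ∀ q, q ∈ Z ↔ ∃ z : ℤ, q = z := fun q =>
    ⟨fun ⟨z, hz⟩ => ⟨z, hz.symm⟩, fun ⟨z, hz⟩ => ⟨z, hz.symm⟩⟩
  have hden : ∀ q : ℚ, (q.den : ℚ) * q ∈ Z := fun q => ⟨q.num, (Rat.den_mul_eq_num q).symm⟩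
  have hnat : ∀ n : ℕ, (n : ℚ) ∈ Z := fun n => natCast_mem _ n
  have hpd : ∀ f : Fin 4 → ℚ, ∀ i, ((∏ i, (f i).den : ℕ) : ℚ) * f i ∈ Z := by
    intro f i
    rw [← Finset.mul_prod_erase _ _ (Finset.mem_univ i), Nat.cast_mul, mul_right_comm]
    exact mul_mem (hden _) (hnat _)
  set d1 := ∏ i, (e i).re.den
  set d2 := ∏ i, (e i).imI.den
  set d3 := ∏ i, (e i).imJ.den
  set d4 := ∏ i, (e i).imK.den
  have hpos : ∀ f : Fin 4 → ℚ, 0 < ∏ i, (f i).den := fun f => Finset.prod_pos fun i _ => (f i).den_pos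
  set D := d1 * d2 * d3 * d4 * (a.den * b.den) with hD
  have hD0 : 0 < D := Nat.mul_pos (Nat.mul_pos (Nat.mul_pos (Nat.mul_pos (hpos _) (hpos _)) (hpos _))
    (hpos _)) (Nat.mul_pos a.den_pos b.den_pos)
  have hsum : ∀ (f : ℍ[ℚ, a, b] →ₗ[ℚ] ℚ), (∀ i, (D : ℚ) * f (e i) ∈ Z) → ∀ x ∈ R,
      (D : ℚ) * f x ∈ Z := by
    intro f hf x hx
    obtain ⟨m, rfl⟩ := (he.mem_iff x).1 hx
    rw [map_sum, Finset.mul_sum]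
    refine sum_mem fun i _ => ?_
    rw [map_zsmul, mul_smul_comm]
    exact zsmul_mem (hf i) _
  have H1 : ∀ x ∈ R, (D : ℚ) * x.re ∈ Z := hsum (QuaternionAlgebra.reₗ a 0 b) fun i => by
    have h : ((d1 : ℕ) : ℚ) * (e i).re ∈ Z := hpd (fun i => (e i).re) i
    have := mul_mem h (hnat (d2 * d3 * d4 * (a.den * b.den)))
    convert this using 1
    change _ * (e i).re = _
    simp only [hD, Nat.cast_mul]; ring
  have H2 : ∀ x ∈ R, (D : ℚ) * x.imI ∈ Z := hsum (QuaternionAlgebra.imIₗ a 0 b) fun i => by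
    have h : ((d2 : ℕ) : ℚ) * (e i).imI ∈ Z := hpd (fun i => (e i).imI) i
    have := mul_mem h (hnat (d1 * d3 * d4 * (a.den * b.den)))
    convert this using 1
    change _ * (e i).imI = _
    simp only [hD, Nat.cast_mul]; ring
  have H3 : ∀ x ∈ R, (D : ℚ) * x.imJ ∈ Z := hsum (QuaternionAlgebra.imJₗ a 0 b) fun i => by
    have h : ((d3 : ℕ) : ℚ) * (e i).imJ ∈ Z := hpd (fun i => (e i).imJ) i
    have := mul_mem h (hnat (d1 * d2 * d4 * (a.den * b.den)))
    convert this using 1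
    change _ * (e i).imJ = _
    simp only [hD, Nat.cast_mul]; ring
  have H4 : ∀ x ∈ R, (D : ℚ) * x.imK ∈ Z := hsum (QuaternionAlgebra.imKₗ a 0 b) fun i => by
    have h : ((d4 : ℕ) : ℚ) * (e i).imK ∈ Z := hpd (fun i => (e i).imK) i
    have := mul_mem h (hnat (d1 * d2 * d3 * (a.den * b.den)))
    convert this using 1
    change _ * (e i).imK = _
    simp only [hD, Nat.cast_mul]; ring
  have Ha : (D : ℚ) * a ∈ Z := by
    have := mul_mem (hden a) (hnat (d1 * d2 * d3 * d4 * b.den))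
    convert this using 1
    simp only [hD, Nat.cast_mul]; ring
  have Hb : (D : ℚ) * b ∈ Z := by
    have := mul_mem (hden b) (hnat (d1 * d2 * d3 * d4 * a.den))
    convert this using 1
    simp only [hD, Nat.cast_mul]; ring
  have hup : ∀ q : ℚ, (D : ℚ) * q ∈ Z → ((D ^ 4 : ℕ) : ℚ) * q ∈ Z := fun q hq => by
    have := mul_mem (hnat (D ^ 3)) hq
    convert this using 1
    push_cast; ring
  refine ⟨D ^ 4, pow_pos hD0 4, fun x hx => ⟨(hmem _).1 (hup _ (H1 x hx)),
    (hmem _).1 (hup _ (H2 x hx)), (hmem _).1 (hup _ (H3 x hx)), (hmem _).1 (hup _ (H4 x hx)), ?_,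
    (hmem _).1 ?_⟩⟩
  · obtain ⟨z, hz⟩ := (hmem _).1 (hup _ (H1 x hx))
    have : ((D ^ 4 : ℕ) : ℍ[ℚ, a, b]) * star x = ((2 * z : ℤ) : ℍ[ℚ, a, b]) - ((D ^ 4 : ℕ) : ℍ[ℚ, a, b]) * x := by
      have e1 : star x = ((2 * x.re : ℚ) : ℍ[ℚ, a, b]) - x := by
        rw [QuaternionAlgebra.star_eq_two_re_sub]; simp
      rw [e1, mul_sub, ← QuaternionAlgebra.coe_natCast, ← QuaternionAlgebra.coe_mul,
        ← QuaternionAlgebra.coe_intCast]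
      congr 2
      push_cast at hz ⊢
      rw [← hz]; ring
    rw [this]
    exact sub_mem (intCast_mem _ _) (mul_mem (natCast_mem _ _) hx)
  · have h1 := mul_mem (hnat (D ^ 2)) (pow_mem (H1 x hx) 2)
    have h2 := mul_mem (mul_mem (hnat D) Ha) (pow_mem (H2 x hx) 2)
    have h3 := mul_mem (mul_mem (hnat D) Hb) (pow_mem (H3 x hx) 2)
    have h4 := mul_mem (mul_mem Ha Hb) (pow_mem (H4 x hx) 2)
    have := add_mem (sub_mem (sub_mem h1 h2) h3) h4
    convert this using 1
    rw [nrd]; push_cast; ring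

/-- There are finitely many elements of bounded norm in `R`. -/
lemma IsOrderBasis.finite_nrd_le (he : IsOrderBasis ι R e) (ha : a < 0) (hb : b < 0) (C : ℚ) :
    {x : ℍ[ℚ, a, b] | x ∈ R ∧ nrd x ≤ C}.Finite := by
  obtain ⟨D, hD0, hD⟩ := he.exists_denom
  have hD1 : (0 : ℚ) < D := by exact_mod_cast hD0
  have fin : ∀ q : ℚ, 0 < q → {r : ℚ | (∃ z : ℤ, D * r = z) ∧ q * r ^ 2 ≤ C}.Finite := by
    intro q hq
    obtain ⟨n, hn⟩ := exists_nat_gt (D ^ 2 * C / q)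
    refine ((Set.finite_Icc (-(n : ℤ)) n).image fun z : ℤ => (z : ℚ) / D).subset ?_
    rintro r ⟨⟨z, hz⟩, hr⟩
    refine ⟨z, ?_, by dsimp only; rw [← hz]; field_simp⟩
    have h1 : (z : ℚ) ^ 2 < n := by
      rw [← hz]
      refine lt_of_le_of_lt ?_ hn
      rw [le_div_iff₀ hq]
      have := mul_le_mul_of_nonneg_left hr (sq_nonneg (D : ℚ))
      linarith
    have h2 : z ^ 2 < n := by exact_mod_cast h1
    constructor <;> nlinarith
  have f1 := fin 1 one_pos
  have f2 := fin (-a) (by linarith)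
  have f3 := fin (-b) (by linarith)
  have f4 := fin (a * b) (mul_pos_of_neg_of_neg ha hb)
  refine ((((f1.prod f2).prod f3).prod f4).image
    fun t => (⟨t.1.1.1, t.1.1.2, t.1.2, t.2⟩ : ℍ[ℚ, a, b])).subset ?_
  rintro x ⟨hx, hC⟩
  obtain ⟨z1, z2, z3, z4, -, -⟩ := hD x hx
  obtain ⟨h1, h2, h3, h4⟩ := nrd_terms_nonneg ha hb x
  rw [nrd] at hC
  exact ⟨(((x.re, x.imI), x.imJ), x.imK), ⟨⟨⟨⟨z1, by linarith⟩, ⟨z2, by linarith⟩⟩,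
    ⟨z3, by linarith⟩⟩, ⟨z4, by linarith⟩⟩, rfl⟩

/-- There are finitely many elements of `Γ` with bounded entries. -/
lemma IsOrderBasis.finite_arithGroup (he : IsOrderBasis ι R e) (ha : a < 0) (hb : b < 0) (m : ℕ) :
    {γ : GL (Fin 2) ℚ_[p] | γ ∈ arithGroup R ι ∧ ∀ i j, ‖γ i j‖ ≤ (p : ℝ) ^ m}.Finite := by
  have hp : (p : ℚ) ≠ 0 := by exact_mod_cast (Fact.out : p.Prime).ne_zero
  refine Set.Finite.of_finite_image (f := fun γ => γ.1) (((he.finite_nrd_le ha hb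
    (((p : ℚ) ^ m) ^ 2)).image fun x => ι ((((p : ℚ) ^ m)⁻¹ : ℚ) • x)).subset ?_) fun _ _ _ _ h =>
    Units.ext h
  rintro _ ⟨_, ⟨⟨u, hu, rfl⟩, hγ⟩, rfl⟩
  refine ⟨((p : ℚ) ^ m) • (u : ℍ[ℚ, a, b]), ⟨?_, ?_⟩, ?_⟩
  · obtain ⟨N, hN⟩ := hu.1
    refine he.mem_of_norm_le (N := N) ?_ fun i j => ?_
    · have e1 : (p : ℍ[ℚ, a, b]) ^ N * ((p : ℚ) ^ m • (u : ℍ[ℚ, a, b])) =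
          (p : ℍ[ℚ, a, b]) ^ m * ((p : ℍ[ℚ, a, b]) ^ N * u) := by
        rw [mul_smul_comm, ← QuaternionAlgebra.coe_mul_eq_smul, QuaternionAlgebra.coe_pow,
          QuaternionAlgebra.coe_natCast]
      rw [e1]
      exact mul_mem (pow_mem (natCast_mem _ _) _) hN
    · rw [map_smul]
      have e2 : (((p : ℚ) ^ m) • ι (u : ℍ[ℚ, a, b])) i j = (p : ℚ_[p]) ^ m * ι u i j := by
        rw [Matrix.smul_apply, Algebra.smul_def]
        simp
      rw [e2, norm_mul, norm_pow, Padic.norm_p, inv_pow, inv_mul_le_one₀ (pow_pos p_pos m)]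
      exact hγ i j
  · rw [← QuaternionAlgebra.coe_mul_eq_smul, nrd_mul, nrd_coe, nrd_of_mem hu, mul_one]
  · dsimp only
    rw [inv_smul_smul₀ (pow_ne_zero _ hp)]
    rfl

end Quat

/-! ### Finiteness of the orbits of vertices and edges -/

lemma Maxl.scale {u : GL (Fin 2) ℚ_[p]} (hu : Maxl u) {a : ℚ_[p]} (ha : a ≠ 0) :
    Maxl (scal a ha * u) := by
  obtain ⟨c, h1, h2⟩ := hu
  refine ⟨Units.mk0 a ha * c, fun i j => ?_, ?_⟩
  · have : (scal a ha * u) i j = a * u i j := by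
      fin_cases i <;> fin_cases j <;> simp [scal, Matrix.mul_apply, Fin.sum_univ_two, mat]
    rw [this, Units.val_mul, norm_mul, norm_mul, Units.val_mk0]
    exact mul_le_mul_of_nonneg_left (h1 i j) (norm_nonneg _)
  · rw [gdet_mul, norm_mul, h2, Units.val_mul, norm_mul, Units.val_mk0, mul_pow]
    simp [gdet, scal]
    ring

lemma scal_comm {a : ℚ_[p]} (ha : a ≠ 0) (g : GL (Fin 2) ℚ_[p]) :
    scal a ha * g = g * scal a ha := by
  apply gl_ext <;> simp only [mul_00, mul_01, mul_10, mul_11] <;> simp [scal] <;> ring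

lemma scal_smul_vertex {a : ℚ_[p]} (ha : a ≠ 0) (v : Vertex p) : scal a ha • v = v := by
  obtain ⟨g, rfl⟩ := exists_smul_v0 v
  have h := Maxl_one.scale ha
  rw [mul_one, ← smul_v0_eq_iff] at h
  rw [← mul_smul, scal_comm, mul_smul, h]

/-- Up to homothety, an element fixing `v₀` is in `GL₂(ℤ_p)`. -/
lemma Maxl.exists_scal {u : GL (Fin 2) ℚ_[p]} (hu : Maxl u) : ∃ (a : ℚ_[p]) (ha : a ≠ 0),
    (∀ i j, ‖(scal a ha * u) i j‖ ≤ 1) ∧ ‖gdet (scal a ha * u)‖ = 1 := by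
  obtain ⟨c, h1, h2⟩ := hu
  have hc : 0 < ‖(c : ℚ_[p])‖ := norm_pos_iff.2 c.ne_zero
  refine ⟨(c : ℚ_[p])⁻¹, inv_ne_zero c.ne_zero, fun i j => ?_, ?_⟩
  · have : (scal (c : ℚ_[p])⁻¹ (inv_ne_zero c.ne_zero) * u) i j = (c : ℚ_[p])⁻¹ * u i j := by
      fin_cases i <;> fin_cases j <;> simp [scal, Matrix.mul_apply, Fin.sum_univ_two, mat]
    rw [this, norm_mul, norm_inv, inv_mul_le_one₀ hc]
    exact h1 i j
  · have : gdet (scal (c : ℚ_[p])⁻¹ (inv_ne_zero c.ne_zero)) = ((c : ℚ_[p])⁻¹) ^ 2 := by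
      simp [gdet, scal]; ring
    rw [gdet_mul, norm_mul, h2, this, norm_pow, norm_inv]
    field_simp

lemma norm_mul_apply_le {A B : Matrix (Fin 2) (Fin 2) ℚ_[p]} {s t : ℝ} (hA : ∀ i j, ‖A i j‖ ≤ s)
    (hB : ∀ i j, ‖B i j‖ ≤ t) (i j : Fin 2) : ‖(A * B) i j‖ ≤ s * t := by
  have hs : 0 ≤ s := (norm_nonneg _).trans (hA 0 0)
  rw [Matrix.mul_apply, Fin.sum_univ_two]
  refine norm_add_le_of ?_ ?_ <;>
  · rw [norm_mul]
    exact mul_le_mul (hA _ _) (hB _ _) (norm_nonneg _) hs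

lemma norm_inv_apply_le {u : GL (Fin 2) ℚ_[p]} (hu : ∀ i j, ‖u i j‖ ≤ 1) (hd : ‖gdet u‖ = 1)
    (i j : Fin 2) : ‖(u⁻¹ : GL (Fin 2) ℚ_[p]) i j‖ ≤ 1 := by
  rw [gl_inv]
  fin_cases i <;> fin_cases j <;> simp [mat, hd, hu]

/-- The vertices at distance `n` from `v₀`. -/
lemma finite_sphere (n : ℕ) : {v : Vertex p | ∃ k : GL (Fin 2) ℚ_[p], Maxl k ∧ v = (k * dg n) • v0 p}.Finite := by
  induction n with
  | zero =>
    refine (Set.finite_singleton (v0 p)).subset ?_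
    rintro _ ⟨k, hk, rfl⟩
    have : (dg 0 : GL (Fin 2) ℚ_[p]) = 1 := by apply gl_ext <;> simp [dg]
    rw [this, mul_one]
    exact (smul_v0_eq_iff k).2 hk
  | succ n ih =>
    have hs : ∀ v : Vertex p, ((fun e : Edge p => e.snd) '' {e | e.fst = v}).Finite := fun v =>
      (finite_edges_from v).image _
    refine (ih.biUnion fun v _ => hs v).subset ?_
    rintro _ ⟨k, hk, rfl⟩
    refine Set.mem_biUnion (x := (k * dg n) • v0 p) ⟨k, hk, rfl⟩
      ⟨(k * dg n) • (e0 p).symm, rfl, ?_⟩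
    change (k * dg n) • w0 p • v0 p = _
    rw [dg_succ, ← mul_assoc, ← mul_assoc, mul_smul _ sw, (smul_v0_eq_iff sw).2 Maxl_sw,
      ← mul_smul]

lemma finite_inv_smul (N : ℕ) : {v : Vertex p | ∃ h : GL (Fin 2) ℚ_[p], (∀ i j, ‖h i j‖ ≤ 1) ∧
    ((p : ℝ) ^ N)⁻¹ ≤ ‖gdet h‖ ∧ v = h⁻¹ • v0 p}.Finite := by
  refine ((Set.finite_Iic N).biUnion fun n _ => finite_sphere (p := p) n).subset ?_
  rintro _ ⟨h, h1, h2, rfl⟩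
  obtain ⟨k, k', n, hk, hk', rfl⟩ := cartan h
  obtain ⟨c, hc, k1, k2⟩ := hk.exists_scal
  obtain ⟨c', hc', k1', k2'⟩ := hk'.exists_scal
  have hpn : ((p : ℚ_[p]) ^ n) ≠ 0 := pow_ne_zero n p_ne_zero
  refine Set.mem_biUnion (x := n) ?_ ?_
  · set u := scal c hc * k
    set u' := scal c' hc' * k'
    have hn : ∀ g : GL (Fin 2) ℚ_[p], ∀ i j, (scal c hc * g) i j = c * g i j := fun g i j => by
      fin_cases i <;> fin_cases j <;> simp [scal, Matrix.mul_apply, Fin.sum_univ_two, mat]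
    have e1 : scal (c * c') (mul_ne_zero hc hc') * (k * dg n * k') = u * dg n * u' := by
      have : scal (c * c') (mul_ne_zero hc hc') = scal c hc * scal c' hc' := by
        apply gl_ext <;> simp only [mul_00, mul_01, mul_10, mul_11] <;> simp [scal]
      rw [this]
      simp only [u, u', mul_assoc]
      rw [← mul_assoc (scal c' hc') k, scal_comm hc' k, mul_assoc, ← mul_assoc (scal c' hc') (dg n),
        scal_comm hc' (dg n), mul_assoc]
    have e2 : scal (c * c') (mul_ne_zero hc hc') * (u⁻¹ * (k * dg n * k') * u'⁻¹) = dg n := by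
      rw [← mul_assoc, ← mul_assoc, scal_comm, mul_assoc u⁻¹, e1]
      group
    have e3 : (c * c') * (u⁻¹ * (k * dg n * k') * u'⁻¹ : GL (Fin 2) ℚ_[p]) 0 0 = 1 := by
      have := congrArg (fun g : GL (Fin 2) ℚ_[p] => g 0 0) e2
      rw [mul_00] at this
      simpa [scal, dg] using this
    have e4 : ‖(u⁻¹ * (k * dg n * k') * u'⁻¹ : GL (Fin 2) ℚ_[p]) 0 0‖ ≤ 1 := by
      have := norm_mul_apply_le (norm_mul_apply_le (norm_inv_apply_le k1 k2) h1)
        (norm_inv_apply_le k1' k2') 0 0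
      rwa [mul_one, mul_one] at this
    have e5 : 1 ≤ ‖c * c'‖ := by
      have := congrArg norm e3
      rw [norm_mul, norm_one] at this
      rw [← this]
      exact mul_le_of_le_one_right (norm_nonneg _) e4
    have e6 := congrArg (fun g => ‖gdet g‖) e1
    have hs : gdet (scal (c * c') (mul_ne_zero hc hc')) = (c * c') ^ 2 := by
      simp [gdet, scal]; ring
    have hdg : gdet (dg n : GL (Fin 2) ℚ_[p]) = (p : ℚ_[p]) ^ n := by simp [gdet, dg]
    rw [gdet_mul, gdet_mul (u * dg n), gdet_mul u, norm_mul, norm_mul,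
      norm_mul, k2, k2', hs, hdg, one_mul, mul_one, norm_pow, norm_pow, Padic.norm_p, inv_pow] at e6
    have e7 : ((p : ℝ) ^ N)⁻¹ ≤ ((p : ℝ) ^ n)⁻¹ := by
      rw [← e6]
      refine h2.trans (le_mul_of_one_le_left (norm_nonneg _) (one_le_pow₀ e5))
    rw [inv_le_inv₀ (pow_pos p_pos _) (pow_pos p_pos _)] at e7
    exact (pow_le_pow_iff_right₀ one_lt_p).1 e7
  · refine ⟨k'⁻¹ * scal ((p : ℚ_[p]) ^ n)⁻¹ (inv_ne_zero hpn) * sw, ?_, ?_⟩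
    · rw [← scal_comm]
      exact (hk'.inv.scale _).mul Maxl_sw
    · have e : (dg n : GL (Fin 2) ℚ_[p])⁻¹ =
          scal ((p : ℚ_[p]) ^ n)⁻¹ (inv_ne_zero hpn) * sw * dg n * sw := by
        rw [inv_eq_iff_mul_eq_one]
        apply gl_ext <;> simp only [mul_00, mul_01, mul_10, mul_11] <;> simp [scal, dg, sw, hpn]
      rw [mul_inv_rev, mul_inv_rev, mul_smul, mul_smul, (smul_v0_eq_iff _).2 hk.inv, e]
      conv_lhs => rw [mul_smul _ sw, (smul_v0_eq_iff sw).2 Maxl_sw]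
      rw [← mul_smul]
      simp only [mul_assoc]

section Orbits
variable {a b : ℚ} {R : Subring ℍ[ℚ, a, b]} {ι : ℍ[ℚ, a, b] →ₐ[ℚ] Matrix (Fin 2) (Fin 2) ℚ_[p]}
  {e : Fin 4 → ℍ[ℚ, a, b]}

/-- Elements of `Γ` moving a vertex to another one form a finite set. -/
lemma IsOrderBasis.finite_stab (he : IsOrderBasis ι R e) (ha : a < 0) (hb : b < 0)
    (v w : Vertex p) : {γ : GL (Fin 2) ℚ_[p] | γ ∈ arithGroup R ι ∧ γ • v = w}.Finite := by
  obtain ⟨g, rfl⟩ := exists_smul_v0 v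
  obtain ⟨h, rfl⟩ := exists_smul_v0 w
  have bd : ∀ g : GL (Fin 2) ℚ_[p], ∃ s, ∀ i j, ‖g i j‖ ≤ s := fun g =>
    ⟨∑ i, ∑ j, ‖g i j‖, fun i j => (Finset.single_le_sum (f := fun j => ‖g i j‖)
      (fun _ _ => norm_nonneg _) (Finset.mem_univ j)).trans
        (Finset.single_le_sum (f := fun i => ∑ j, ‖g i j‖)
          (fun _ _ => Finset.sum_nonneg fun _ _ => norm_nonneg _) (Finset.mem_univ i))⟩
  obtain ⟨s, hs⟩ := bd h
  obtain ⟨t, ht⟩ := bd g⁻¹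
  set r : ℝ := ‖gdet (h⁻¹ * g)‖ + 1
  obtain ⟨m, hm⟩ := pow_unbounded_of_one_lt (s * r * t) (one_lt_p (p := p))
  refine (he.finite_arithGroup ha hb m).subset ?_
  rintro γ ⟨hγ, hv⟩
  refine ⟨hγ, fun i j => ?_⟩
  have hM : Maxl (h⁻¹ * γ * g) := by
    rw [← smul_v0_eq_iff, mul_assoc, mul_smul, mul_smul, hv, inv_smul_smul]
  obtain ⟨c, h1, h2⟩ := hM
  have hc : ‖(c : ℚ_[p])‖ ≤ r := by
    rw [mul_assoc, gdet_mul, gdet_mul, gdet_of_mem_arithGroup ι ha.ne hb.ne hγ, one_mul,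
      ← gdet_mul] at h2
    have := norm_nonneg (gdet (h⁻¹ * g))
    change _ ≤ ‖gdet (h⁻¹ * g)‖ + 1
    rw [h2]
    nlinarith [norm_nonneg (c : ℚ_[p])]
  have h3 := norm_mul_apply_le (norm_mul_apply_le hs fun i j => (h1 i j).trans hc) ht i j
  have h4 : (h.1 * (h⁻¹ * γ * g : GL (Fin 2) ℚ_[p]).1 * (g⁻¹ : GL (Fin 2) ℚ_[p]).1) = γ.1 := by
    rw [← Units.val_mul, ← Units.val_mul]
    congr 1
    group
  rw [h4] at h3
  exact h3.trans hm.le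

/-- A short nonzero vector of `R` in the lattice attached to `k · diag(1, pⁿ)`. -/
lemma IsOrderBasis.exists_short (he : IsOrderBasis ι R e) (ha : a < 0) (hb : b < 0) :
    ∃ C : ℕ, ∀ (n : ℕ) (u : GL (Fin 2) ℚ_[p]), (∀ i j, ‖u i j‖ ≤ 1) →
      ∃ x ∈ R, x ≠ 0 ∧ nrd x ≤ C * (p : ℚ) ^ n ∧
        ∀ j, ‖(u.1 * ι x) 1 j‖ ≤ ((p : ℝ) ^ n)⁻¹ := by
  set c : ℚ := ∑ i, (|(e i).re| + |(e i).imI| + |(e i).imJ| + |(e i).imK|) with hc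
  obtain ⟨C, hC⟩ := exists_nat_ge (c ^ 2 * (1 - a - b + a * b))
  refine ⟨C, fun n u hu => ?_⟩
  have heR : ∀ i, e i ∈ R := fun i => (he.mem_iff _).2 ⟨Pi.single i 1, by
    simp [Pi.single_apply]⟩
  have hint : ∀ i j, ‖(u.1 * ι (e i)) 1 j‖ ≤ 1 := fun i j => by
    have := norm_mul_apply_le hu (he.norm_le _ (heR i)) 1 j
    rwa [mul_one] at this
  set r : Fin 4 → Fin 2 → ℤ_[p] := fun i j => ⟨_, hint i j⟩ with hr
  set B := Nat.sqrt (p ^ n) with hB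
  have hp0 : p ^ n ≠ 0 := pow_ne_zero _ (Fact.out : p.Prime).ne_zero
  have : NeZero (p ^ n) := ⟨hp0⟩
  obtain ⟨m, m', hne, hmm⟩ := Fintype.exists_ne_map_eq_of_card_lt
    (fun (m : Fin 4 → Fin (B + 1)) (j : Fin 2) =>
      PadicInt.toZModPow n (∑ i, ((m i : ℕ) : ℤ_[p]) * r i j)) (by
      rw [Fintype.card_fun, Fintype.card_fun, ZMod.card, Fintype.card_fin, Fintype.card_fin,
        Fintype.card_fin]
      have := Nat.lt_succ_sqrt' (p ^ n)
      calc (p ^ n) ^ 2 < ((B + 1) ^ 2) ^ 2 := Nat.pow_lt_pow_left this two_ne_zero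
        _ = _ := by ring)
  set d : Fin 4 → ℤ := fun i => (m i : ℕ) - (m' i : ℕ) with hd
  have hdB : ∀ i, |(d i : ℚ)| ≤ B := by
    intro i
    have h1 := (m i).2
    have h2 := (m' i).2
    have : |d i| ≤ B := by rw [abs_le, hd]; dsimp only; constructor <;> omega
    exact_mod_cast this
  have hd0 : d ≠ 0 := by
    intro h
    refine hne (funext fun i => Fin.ext ?_)
    have := congrFun h i
    simp only [hd, Pi.zero_apply] at this
    omega
  refine ⟨∑ i, d i • e i, (he.mem_iff _).2 ⟨d, rfl⟩, fun h => hd0 (he.eq_zero h), ?_, fun j => ?_⟩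
  · have hco : ∀ f : ℍ[ℚ, a, b] →ₗ[ℚ] ℚ, (∀ i, |f (e i)| ≤ |(e i).re| + |(e i).imI| + |(e i).imJ| +
        |(e i).imK|) → (f (∑ i, d i • e i)) ^ 2 ≤ (B * c) ^ 2 := by
      intro f hf
      rw [← sq_abs]
      refine pow_le_pow_left₀ (abs_nonneg _) ?_ 2
      rw [map_sum, hc, Finset.mul_sum]
      refine (Finset.abs_sum_le_sum_abs _ _).trans (Finset.sum_le_sum fun i _ => ?_)
      rw [map_zsmul, zsmul_eq_mul, abs_mul]
      exact mul_le_mul (hdB i) (hf i) (abs_nonneg _) (Nat.cast_nonneg _)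
    have q := fun i => And.intro (abs_nonneg (e i).re) (And.intro (abs_nonneg (e i).imI)
      (And.intro (abs_nonneg (e i).imJ) (abs_nonneg (e i).imK)))
    set x := ∑ i, d i • e i with hx
    have h1 : x.re ^ 2 ≤ (B * c) ^ 2 := hco (QuaternionAlgebra.reₗ a 0 b) fun i => by
      change |(e i).re| ≤ _; linarith [q i]
    have h2 : x.imI ^ 2 ≤ (B * c) ^ 2 := hco (QuaternionAlgebra.imIₗ a 0 b) fun i => by
      change |(e i).imI| ≤ _; linarith [q i]
    have h3 : x.imJ ^ 2 ≤ (B * c) ^ 2 := hco (QuaternionAlgebra.imJₗ a 0 b) fun i => by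
      change |(e i).imJ| ≤ _; linarith [q i]
    have h4 : x.imK ^ 2 ≤ (B * c) ^ 2 := hco (QuaternionAlgebra.imKₗ a 0 b) fun i => by
      change |(e i).imK| ≤ _; linarith [q i]
    have h2' := mul_le_mul_of_nonneg_left h2 (by linarith : 0 ≤ -a)
    have h3' := mul_le_mul_of_nonneg_left h3 (by linarith : 0 ≤ -b)
    have h4' := mul_le_mul_of_nonneg_left h4 (mul_pos_of_neg_of_neg ha hb).le
    have hBn : (B : ℚ) ^ 2 ≤ (p : ℚ) ^ n := by exact_mod_cast Nat.sqrt_le' (p ^ n)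
    calc nrd x ≤ (B : ℚ) ^ 2 * (c ^ 2 * (1 - a - b + a * b)) := by rw [nrd]; linarith
      _ ≤ (p : ℚ) ^ n * C := mul_le_mul hBn hC (mul_nonneg (sq_nonneg _) (by
          linarith [mul_pos_of_neg_of_neg ha hb])) (by positivity)
      _ = _ := mul_comm _ _
  · have h1 := congrFun hmm j
    rw [← sub_eq_zero, ← map_sub, ← RingHom.mem_ker, PadicInt.ker_toZModPow,
      ← PadicInt.norm_le_pow_iff_mem_span_pow, ← Finset.sum_sub_distrib, zpow_neg,
      zpow_natCast] at h1
    refine le_trans (le_of_eq ?_) h1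
    rw [PadicInt.norm_def]
    congr 1
    rw [map_sum, Finset.mul_sum, Matrix.sum_apply, PadicInt.coe_sum]
    refine Finset.sum_congr rfl fun i _ => ?_
    rw [map_zsmul, mul_smul_comm, Matrix.smul_apply, zsmul_eq_mul]
    have hrc : ((r i j : ℤ_[p]) : ℚ_[p]) = (u.1 * ι (e i)) 1 j := rfl
    rw [PadicInt.coe_sub, PadicInt.coe_mul, PadicInt.coe_mul, PadicInt.coe_natCast,
      PadicInt.coe_natCast, hrc, hd]
    push_cast
    ring

/-- The subring `R[1/p]`. -/
def awayP (p : ℕ) (R : Subring ℍ[ℚ, a, b]) : Subring ℍ[ℚ, a, b] where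
  carrier := {x | ∃ n : ℕ, (p : ℍ[ℚ, a, b]) ^ n * x ∈ R}
  one_mem' := ⟨0, by simp⟩
  zero_mem' := ⟨0, by simp⟩
  neg_mem' := by
    rintro x ⟨n, hn⟩
    exact ⟨n, by rw [mul_neg]; exact neg_mem hn⟩
  add_mem' := by
    rintro x y ⟨n, hn⟩ ⟨m, hm⟩
    refine ⟨n + m, ?_⟩
    rw [mul_add]
    nth_rw 1 [add_comm n m]
    rw [pow_add, mul_assoc, pow_add, mul_assoc _ _ y]
    exact add_mem (mul_mem (pow_mem (natCast_mem _ _) _) hn)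
      (mul_mem (pow_mem (natCast_mem _ _) _) hm)
  mul_mem' := by
    rintro x y ⟨n, hn⟩ ⟨m, hm⟩
    refine ⟨n + m, ?_⟩
    have hc : (p : ℍ[ℚ, a, b]) ^ m * x = x * (p : ℍ[ℚ, a, b]) ^ m :=
      ((Nat.cast_commute p x).pow_left m).eq
    have h : (p : ℍ[ℚ, a, b]) ^ (n + m) * (x * y) =
        ((p : ℍ[ℚ, a, b]) ^ n * x) * ((p : ℍ[ℚ, a, b]) ^ m * y) := by
      rw [pow_add, mul_assoc, mul_assoc, ← mul_assoc _ x y, hc, mul_assoc x]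
    rw [h]
    exact mul_mem hn hm

lemma coe_zpow_mem (z : ℤ) : (((p : ℚ) ^ z : ℚ) : ℍ[ℚ, a, b]) ∈ awayP p R := by
  have hp : (p : ℚ) ≠ 0 := by exact_mod_cast (Fact.out : p.Prime).ne_zero
  obtain ⟨m, hm⟩ := Int.eq_ofNat_of_zero_le (a := z.natAbs + z) (by omega)
  refine ⟨z.natAbs, ?_⟩
  have : (p : ℍ[ℚ, a, b]) ^ z.natAbs * (((p : ℚ) ^ z : ℚ) : ℍ[ℚ, a, b]) =
      ((p ^ m : ℕ) : ℍ[ℚ, a, b]) := by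
    rw [← QuaternionAlgebra.coe_natCast, ← QuaternionAlgebra.coe_natCast,
      ← QuaternionAlgebra.coe_pow, ← QuaternionAlgebra.coe_mul]
    congr 1
    rw [← zpow_natCast, ← zpow_add₀ hp, hm, Nat.cast_pow]
    exact zpow_natCast _ _
  rw [this]
  exact natCast_mem _ _

/-- Every vertex is the image of a vertex of a finite set under an element of `R`. -/
lemma IsOrderBasis.exists_rep (he : IsOrderBasis ι R e) (ha : a < 0) (hb : b < 0) :
    ∃ (S : Set (Vertex p)) (D T : ℕ), S.Finite ∧ 0 < D ∧
      (∀ x ∈ R, (D : ℍ[ℚ, a, b]) * star x ∈ R) ∧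
      ∀ v : Vertex p, ∃ s ∈ S, ∃ x : ℍ[ℚ, a, b]ˣ, (x : ℍ[ℚ, a, b]) ∈ R ∧ v = unitMap ι x • s ∧
        ∃ t n : ℕ, 0 < t ∧ t ≤ T ∧ D * nrd (x : ℍ[ℚ, a, b]) = p ^ n * t := by
  obtain ⟨D, hD0, hD⟩ := he.exists_denom
  obtain ⟨C, hC⟩ := he.exists_short ha hb
  refine ⟨_, D, D * C, finite_inv_smul (D * C), hD0, fun x hx => (hD x hx).2.2.2.2.1, fun v => ?_⟩
  obtain ⟨g, rfl⟩ := exists_smul_v0 v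
  obtain ⟨k, k', n, hk, hk', rfl⟩ := cartan g
  obtain ⟨c, hc, k1, k2⟩ := hk.exists_scal
  set u := scal c hc * k with hu
  obtain ⟨x, hxR, hx0, hxn, hx1⟩ := hC n u⁻¹ (norm_inv_apply_le k1 k2)
  obtain ⟨z, hz⟩ := (hD x hxR).2.2.2.2.2
  set X := toUnit ha hb hx0 with hX
  have hpn : (p : ℚ_[p]) ^ n ≠ 0 := pow_ne_zero n p_ne_zero
  have hp0 : (0 : ℚ) < (p : ℚ) ^ n := pow_pos (by exact_mod_cast (Fact.out : p.Prime).pos) n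
  have hN := nrd_pos ha hb hx0
  set h := (u * dg n)⁻¹ * unitMap ι X with hh
  have hdg : gdet (dg n : GL (Fin 2) ℚ_[p]) = (p : ℚ_[p]) ^ n := by simp [gdet, dg]
  have hux : ∀ i j, ‖(u⁻¹ * unitMap ι X : GL (Fin 2) ℚ_[p]) i j‖ ≤ 1 := fun i j => by
    have := norm_mul_apply_le (norm_inv_apply_le k1 k2) (he.norm_le x hxR) i j
    rwa [mul_one] at this
  have hdi : (dg n : GL (Fin 2) ℚ_[p])⁻¹ = mat 1 0 0 ((p : ℚ_[p]) ^ n)⁻¹ (by simpa using hpn) := by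
    rw [inv_eq_iff_mul_eq_one]
    apply gl_ext <;> simp only [mul_00, mul_01, mul_10, mul_11] <;> simp [dg, hpn]
  have hent : ∀ i j, ‖h i j‖ ≤ 1 := by
    intro i j
    rw [hh, mul_inv_rev, mul_assoc, hdi]
    fin_cases i
    · have : (mat 1 0 0 ((p : ℚ_[p]) ^ n)⁻¹ (by simpa using hpn) *
          (u⁻¹ * unitMap ι X) : GL (Fin 2) ℚ_[p]) 0 j =
          (u⁻¹ * unitMap ι X : GL (Fin 2) ℚ_[p]) 0 j := by
        fin_cases j
        · refine (mul_00 _ _).trans ?_; simp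
        · refine (mul_01 _ _).trans ?_; simp
      exact (congrArg norm this).trans_le (hux 0 j)
    · have : (mat 1 0 0 ((p : ℚ_[p]) ^ n)⁻¹ (by simpa using hpn) *
          (u⁻¹ * unitMap ι X) : GL (Fin 2) ℚ_[p]) 1 j =
          ((p : ℚ_[p]) ^ n)⁻¹ * (u⁻¹ * unitMap ι X : GL (Fin 2) ℚ_[p]) 1 j := by
        fin_cases j
        · refine (mul_10 _ _).trans ?_; simp
        · refine (mul_11 _ _).trans ?_; simp
      refine (congrArg norm this).trans_le ?_
      rw [norm_mul, norm_inv, norm_pow, Padic.norm_p, inv_pow, inv_inv]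
      have h2 := hx1 j
      refine (mul_le_mul_of_nonneg_left h2 (pow_nonneg p_pos.le n)).trans (le_of_eq ?_)
      exact mul_inv_cancel₀ (pow_pos p_pos n).ne'
  have hdet : ‖gdet h‖ = (p : ℝ) ^ n * ‖((nrd x : ℚ) : ℚ_[p])‖ := by
    have h1 : gdet (u * dg n) * gdet h = (nrd x : ℚ_[p]) := by
      rw [← gdet_mul, hh, mul_inv_cancel_left, gdet_unitMap ι ha.ne hb.ne]
      rfl
    have h2 := congrArg norm h1
    rw [gdet_mul, norm_mul, norm_mul, k2, hdg, one_mul, norm_pow, Padic.norm_p, inv_pow] at h2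
    rw [← h2, mul_inv_cancel_left₀ (pow_pos p_pos n).ne']
  have hdet1 : ‖gdet h‖ ≤ 1 := by
    rw [gdet]
    refine norm_sub_le_of ?_ ?_ <;>
    · rw [norm_mul]
      exact mul_le_one₀ (hent _ _) (norm_nonneg _) (hent _ _)
  have hzn : ‖((z : ℤ) : ℚ_[p])‖ = ‖((D : ℕ) : ℚ_[p])‖ * ‖((nrd x : ℚ) : ℚ_[p])‖ := by
    rw [← norm_mul]
    congr 1
    exact_mod_cast congrArg (fun q : ℚ => (q : ℚ_[p])) hz.symm
  have hD1 : ‖((D : ℕ) : ℚ_[p])‖ ≤ 1 := by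
    have := Padic.norm_int_le_one (p := p) D
    simpa using this
  have hdvd : ((p : ℤ) ^ n) ∣ z := by
    have := (Padic.norm_int_le_pow_iff_dvd (p := p) z n).1 (by
      rw [hzn, zpow_neg, zpow_natCast]
      have h3 : ‖((nrd x : ℚ) : ℚ_[p])‖ ≤ ((p : ℝ) ^ n)⁻¹ := by
        rw [← one_div, le_div_iff₀' (pow_pos p_pos n), ← hdet]
        exact hdet1
      exact (mul_le_of_le_one_left (norm_nonneg _) hD1).trans h3)
    exact_mod_cast this
  obtain ⟨t, rfl⟩ := hdvd
  have ht0 : 0 < t := by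
    have h1 : (0 : ℚ) < D * nrd x := mul_pos (by exact_mod_cast hD0) hN
    rw [hz] at h1
    push_cast at h1
    have := pos_of_mul_pos_right h1 hp0.le
    exact_mod_cast this
  obtain ⟨t, rfl⟩ := Int.eq_ofNat_of_zero_le ht0.le
  have htT : t ≤ D * C := by
    have h1 : (p : ℚ) ^ n * t ≤ D * (C * p ^ n) := by
      have := mul_le_mul_of_nonneg_left hxn (Nat.cast_nonneg (α := ℚ) D)
      rw [hz] at this
      simpa using this
    have h2 : (t : ℚ) ≤ D * C := by
      refine le_of_mul_le_mul_left ?_ hp0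
      linarith
    exact_mod_cast h2
  have ht0' : t ≠ 0 := by rintro rfl; simp at ht0
  refine ⟨h⁻¹ • v0 p, ⟨h, hent, ?_, rfl⟩, X, hxR, ?_, t, n, Nat.pos_of_ne_zero ht0', htT, ?_⟩
  · have h3 : ‖((t : ℕ) : ℚ_[p])‖ ≤ ‖gdet h‖ := by
      rw [hdet]
      have h4 : ‖(((p : ℤ) ^ n * (t : ℤ) : ℤ) : ℚ_[p])‖ ≤ ‖((nrd x : ℚ) : ℚ_[p])‖ := by
        rw [hzn]
        exact mul_le_of_le_one_left (norm_nonneg _) hD1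
      push_cast at h4
      rw [norm_mul, norm_pow, Padic.norm_p, inv_pow, inv_mul_le_iff₀ (pow_pos p_pos n)] at h4
      exact h4
    refine le_trans ?_ h3
    have h5 := norm_natCast_inv_le (p := p) ht0'
    rw [norm_inv] at h5
    have h6 : (t : ℝ) ≤ (p : ℝ) ^ (D * C) := by
      have := (Nat.lt_pow_self (Fact.out : p.Prime).one_lt (n := D * C)).le
      exact_mod_cast htT.trans this
    exact inv_le_of_inv_le₀ (norm_pos_iff.2 (by exact_mod_cast ht0')) (h5.trans h6)
  · rw [← mul_smul]
    have h7 : unitMap ι X * h⁻¹ = u * dg n := by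
      rw [hh, mul_inv_rev, inv_inv, mul_inv_cancel_left]
    rw [h7, hu, mul_smul _ k', (smul_v0_eq_iff k').2 hk', mul_assoc (scal c hc), mul_smul (scal c hc),
      scal_smul_vertex]
  · change (D : ℚ) * nrd x = _
    rw [hz]
    push_cast
    rfl

lemma mem_normOneUnits {x x' : ℍ[ℚ, a, b]ˣ} {D t q n : ℕ} {j : ℤ} {r : ℍ[ℚ, a, b]}
    (hD : (D : ℍ[ℚ, a, b]) * star (x : ℍ[ℚ, a, b]) ∈ R) (ht : 0 < t)
    (hx : D * nrd (x : ℍ[ℚ, a, b]) = p ^ n * t) (hr : r ∈ R)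
    (hxx : (x' : ℍ[ℚ, a, b]) = x + ((q * t : ℕ) : ℍ[ℚ, a, b]) * r) :
    (((p : ℚ) ^ j : ℚ) : ℍ[ℚ, a, b]) * (x' * (x⁻¹ : ℍ[ℚ, a, b]ˣ)) ∈ awayP p R := by
  have hp0 : (p : ℚ) ≠ 0 := by exact_mod_cast (Fact.out : p.Prime).ne_zero
  have hnx : nrd (x : ℍ[ℚ, a, b]) ≠ 0 := by
    intro h
    rw [h, mul_zero] at hx
    have : (0 : ℚ) < p ^ n * t := by
      have h1 : (0 : ℚ) < p := by exact_mod_cast (Fact.out : p.Prime).pos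
      have h2 : (0 : ℚ) < t := by exact_mod_cast ht
      positivity
    linarith
  have hinv : ((x⁻¹ : ℍ[ℚ, a, b]ˣ) : ℍ[ℚ, a, b]) = (nrd (x : ℍ[ℚ, a, b]))⁻¹ • star (x : ℍ[ℚ, a, b]) := by
    refine Units.inv_eq_of_mul_eq_one_right ?_
    rw [mul_smul_comm, mul_star_eq, QuaternionAlgebra.smul_coe, inv_mul_cancel₀ hnx,
      QuaternionAlgebra.coe_one]
  have e1 : (x' : ℍ[ℚ, a, b]) * (x⁻¹ : ℍ[ℚ, a, b]ˣ) = 1 + (((p : ℚ) ^ (-n : ℤ) : ℚ) : ℍ[ℚ, a, b]) *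
      ((q : ℍ[ℚ, a, b]) * (r * (D * star (x : ℍ[ℚ, a, b])))) := by
    rw [hxx, add_mul, Units.mul_inv, hinv]
    congr 1
    have e2 : (nrd (x : ℍ[ℚ, a, b]))⁻¹ * (q * t) = (p : ℚ) ^ (-n : ℤ) * (q * D) := by
      rw [zpow_neg, zpow_natCast]
      field_simp
      linear_combination -(q : ℚ) * hx
    have e3 : ∀ (s : ℕ) (y : ℍ[ℚ, a, b]), (s : ℍ[ℚ, a, b]) * y = (s : ℚ) • y := fun s y => by
      rw [← QuaternionAlgebra.coe_natCast, QuaternionAlgebra.coe_mul_eq_smul]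
    rw [QuaternionAlgebra.coe_mul_eq_smul, e3, e3, e3]
    simp only [smul_mul_assoc, mul_smul_comm, smul_smul]
    rw [Nat.cast_mul, e2]
  rw [e1]
  have h2 : ∀ y ∈ R, y ∈ awayP p R := fun y hy => ⟨0, by simpa using hy⟩
  exact mul_mem (coe_zpow_mem j) (add_mem (one_mem _) (mul_mem (coe_zpow_mem _)
    (h2 _ (mul_mem (natCast_mem _ _) (mul_mem hr hD)))))

/-- There are finitely many edges modulo `Γ`. -/
theorem IsOrderBasis.cocompact (he : IsOrderBasis ι R e) (ha : a < 0) (hb : b < 0) :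
    Cocompact (arithGroup R ι) := by
  have hp0 : (p : ℚ) ≠ 0 := by exact_mod_cast (Fact.out : p.Prime).ne_zero
  obtain ⟨S, D, T, hS, hD0, hD, hrep⟩ := he.exists_rep ha hb
  choose s hs x hxR hv t n ht htT hn using hrep
  choose m hm using fun v => (he.mem_iff _).1 (hxR v)
  set M := T.factorial with hM
  have : NeZero M := ⟨T.factorial_ne_zero⟩
  have : Finite S := hS
  have key : ∀ v w, s v = s w → t v = t w → ((n v : ZMod 2) = n w) →
      (∀ i, (m v i : ZMod M) = m w i) → ∃ γ ∈ arithGroup R ι, w = γ • v := by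
    intro v w h1 h2 h3 h4
    obtain ⟨q, hq⟩ : t v ∣ M := Nat.dvd_factorial (ht v) (htT v)
    have h5 : ∀ i, ∃ r : ℤ, m w i = m v i + M * r := fun i => by
      obtain ⟨r, hr⟩ := (ZMod.intCast_eq_intCast_iff_dvd_sub _ _ _).1 (h4 i)
      exact ⟨r, by linarith⟩
    choose r hr using h5
    set y := ∑ i, r i • e i with hy
    have hyR : y ∈ R := (he.mem_iff _).2 ⟨r, rfl⟩
    have hxx : (x w : ℍ[ℚ, a, b]) = x v + ((q * t v : ℕ) : ℍ[ℚ, a, b]) * y := by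
      rw [hm w, hm v, mul_comm q, ← hq, hy, Finset.mul_sum, ← Finset.sum_add_distrib]
      refine Finset.sum_congr rfl fun i _ => ?_
      rw [hr i, add_smul, mul_smul, ← nsmul_eq_mul, ← natCast_zsmul]
    have hxx' : (x v : ℍ[ℚ, a, b]) = x w + ((q * t w : ℕ) : ℍ[ℚ, a, b]) * (-y) := by
      rw [hxx, h2]; noncomm_ring
    obtain ⟨j, hj⟩ : ∃ j : ℤ, (n v : ℤ) - n w = 2 * j := by
      have := (ZMod.intCast_eq_intCast_iff_dvd_sub (n w) (n v) 2).1 (by exact_mod_cast h3.symm)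
      exact this
    set c : ℍ[ℚ, a, b]ˣ := Units.map (algebraMap ℚ ℍ[ℚ, a, b]).toMonoidHom
      (Units.mk0 ((p : ℚ) ^ j) (zpow_ne_zero j hp0)) with hc
    have hc1 : (c : ℍ[ℚ, a, b]) = (((p : ℚ) ^ j : ℚ) : ℍ[ℚ, a, b]) := rfl
    have hc2 : ((c⁻¹ : ℍ[ℚ, a, b]ˣ) : ℍ[ℚ, a, b]) = (((p : ℚ) ^ (-j) : ℚ) : ℍ[ℚ, a, b]) := by
      rw [hc, ← map_inv, zpow_neg]
      rfl
    have hcc : ∀ z : ℍ[ℚ, a, b]ˣ, c * z = z * c := fun z => Units.ext (by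
      rw [Units.val_mul, Units.val_mul, hc1, QuaternionAlgebra.coe_commutes])
    set u := c * (x w * (x v)⁻¹) with hu
    have hnx : ∀ v, nrd (x v : ℍ[ℚ, a, b]) ≠ 0 := fun v => (nrd_pos ha hb (x v).ne_zero).ne'
    have hnu : nrd (u : ℍ[ℚ, a, b]) = 1 := by
      have e1 : nrd ((x v)⁻¹ : ℍ[ℚ, a, b]ˣ).1 * nrd (x v : ℍ[ℚ, a, b]) = 1 := by
        rw [← nrd_mul, Units.inv_mul]; simp [nrd]
      have e2 : D * nrd (x w : ℍ[ℚ, a, b]) * ((p : ℚ) ^ j) ^ 2 = D * nrd (x v : ℍ[ℚ, a, b]) := by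
        rw [hn, hn, h2, mul_right_comm]
        congr 1
        rw [← zpow_natCast, ← zpow_natCast, ← zpow_natCast, ← zpow_mul, ← zpow_add₀ hp0]
        congr 1
        push_cast
        linarith
      have hDQ : (D : ℚ) ≠ 0 := by exact_mod_cast hD0.ne'
      have e3 : nrd (x w : ℍ[ℚ, a, b]) * ((p : ℚ) ^ j) ^ 2 = nrd (x v : ℍ[ℚ, a, b]) := by
        refine mul_left_cancel₀ hDQ ?_
        rw [← e2]; ring
      rw [hu, Units.val_mul, Units.val_mul, nrd_mul, nrd_mul, hc1, nrd_coe]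
      linear_combination nrd ((x v)⁻¹ : ℍ[ℚ, a, b]ˣ).1 * e3 + e1
    have huR : u ∈ normOneUnits p R := by
      refine ⟨?_, ?_, ?_⟩
      · exact mem_normOneUnits (j := j) (hD _ (hxR v)) (ht v) (hn v) hyR hxx
      · have h6 : u⁻¹ = c⁻¹ * (x v * (x w)⁻¹) := by
          rw [hu, hcc]; group
        rw [h6, Units.val_mul, Units.val_mul, hc2]
        exact mem_normOneUnits (j := -j) (hD _ (hxR w)) (ht w) (hn w) (neg_mem hyR) hxx'
      · rw [mul_star_eq, hnu, QuaternionAlgebra.coe_one]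
    refine ⟨unitMap ι u, ⟨u, huR, rfl⟩, ?_⟩
    have hcs : unitMap ι c = scal ((p : ℚ_[p]) ^ j) (zpow_ne_zero j p_ne_zero) := by
      have h7 : ι (c : ℍ[ℚ, a, b]) = ((p : ℚ_[p]) ^ j) • 1 := by
        rw [hc1, map_coe_quat]
        push_cast
        rfl
      apply gl_ext <;> rw [unitMap_apply, h7] <;> simp [scal]
    rw [hu, hcc, unitMap_mul, unitMap_mul, hcs, mul_smul _ (scal _ _), scal_smul_vertex]
    rw [← unitMap_mul]
    refine Eq.trans ?_ (congrArg (unitMap ι (x w * (x v)⁻¹) • ·) (hv v)).symm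
    rw [← mul_smul, ← unitMap_mul, inv_mul_cancel_right, h1]
    exact hv w
  set φ : Vertex p → S × Fin (T + 1) × ZMod 2 × (Fin 4 → ZMod M) := fun v =>
    (⟨s v, hs v⟩, ⟨t v, Nat.lt_succ_of_le (htT v)⟩, (n v : ZMod 2), fun i => (m v i : ZMod M)) with hφ
  have hfin : (Set.range fun y : Set.range φ => y.2.choose).Finite := Set.finite_range _
  refine ⟨_, hfin.biUnion fun (v : Vertex p) _ => finite_edges_from v, fun f => ?_⟩
  set y : Set.range φ := ⟨φ f.fst, Set.mem_range_self _⟩ with hy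
  have hyc : φ y.2.choose = φ f.fst := y.2.choose_spec
  set w := y.2.choose with hw
  obtain ⟨γ, hγ, h⟩ := key w f.fst (congrArg (fun z => z.1.1) hyc)
    (congrArg (fun z => z.2.1.1) hyc) (congrArg (fun z => z.2.2.1) hyc)
    (fun i => congrFun (congrArg (fun z => z.2.2.2) hyc) i)
  refine ⟨γ, hγ, γ⁻¹ • f, Set.mem_biUnion (x := w) ⟨y, rfl⟩ ?_, (smul_inv_smul γ f).symm⟩
  change (γ⁻¹ • f).fst = w
  rw [smul_fst, h, inv_smul_smul]

end Orbits

/-! ### Sums over orbits -/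

section Cutoff
variable {G X E : Type} [Group G] [MulAction G X] [Field E]

/-- A function of finite support whose translates add up to `1`. -/
structure IsCutoff (G : Type) [Group G] [MulAction G X] (w : X → E) : Prop where
  finite : (Function.support w).Finite
  proper : ∀ x, (Function.support fun γ : G => w (γ⁻¹ • x)).Finite
  sum : ∀ x, ∑ᶠ γ : G, w (γ⁻¹ • x) = 1

lemma IsCutoff.finsum_prod {w w' : X → E} (hw : IsCutoff G w) (hw' : IsCutoff G w') (F : X → E) :
    ∑ᶠ t : X × G, w t.1 * F t.1 * w' (t.2⁻¹ • t.1) = ∑ᶠ x, w x * F x := by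
  rw [finsum_curry]
  · refine finsum_congr fun x => ?_
    dsimp only
    simp_rw [← smul_eq_mul (w x * F x)]
    rw [← smul_finsum, hw'.sum, smul_eq_mul, mul_one]
  · refine Set.Finite.subset (hw.finite.biUnion fun x _ =>
      (hw'.proper x).image fun γ => (x, γ)) ?_
    rintro ⟨x, γ⟩ h
    rw [Function.mem_support] at h
    dsimp only at h
    exact Set.mem_biUnion (x := x) (left_ne_zero_of_mul (left_ne_zero_of_mul h))
      ⟨γ, right_ne_zero_of_mul h, rfl⟩

/-- Sums of invariant functions do not depend on the cutoff function. -/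
lemma IsCutoff.finsum_eq {w w' : X → E} (hw : IsCutoff G w) (hw' : IsCutoff G w') {F : X → E}
    (hF : ∀ (γ : G) x, F (γ • x) = F x) : ∑ᶠ x, w x * F x = ∑ᶠ x, w' x * F x := by
  rw [← hw.finsum_prod hw', ← hw'.finsum_prod hw]
  let ε : X × G ≃ X × G :=
    { toFun := fun t => (t.2⁻¹ • t.1, t.2⁻¹)
      invFun := fun t => (t.2⁻¹ • t.1, t.2⁻¹)
      left_inv := fun t => by simp
      right_inv := fun t => by simp }
  rw [← finsum_comp_equiv ε]
  refine finsum_congr fun t => ?_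
  change w (t.2⁻¹ • t.1) * F (t.2⁻¹ • t.1) * w' (t.2⁻¹⁻¹ • t.2⁻¹ • t.1) = _
  rw [hF, inv_inv, smul_inv_smul]
  ring

/-- Cutoff functions exist for proper cocompact actions. -/
lemma exists_isCutoff [CharZero E] {S : Set X} (hS : S.Finite) (hcov : ∀ x, ∃ γ : G, ∃ s ∈ S, x = γ • s)
    (hprop : ∀ x y : X, {γ : G | γ • x = y}.Finite) : ∃ w : X → E, IsCutoff G w := by
  classical
  have hfin : ∀ x, {γ : G | γ⁻¹ • x ∈ S}.Finite := fun x => by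
    refine (hS.biUnion fun s _ => hprop s x).subset fun γ hγ => ?_
    exact Set.mem_biUnion (x := γ⁻¹ • x) hγ (smul_inv_smul γ x)
  set N : X → ℕ := fun x => {γ : G | γ⁻¹ • x ∈ S}.ncard with hN
  have hNinv : ∀ (β : G) x, N (β • x) = N x := by
    intro β x
    have : {γ : G | γ⁻¹ • β • x ∈ S} = (fun γ => β * γ) '' {γ : G | γ⁻¹ • x ∈ S} := by
      ext γ
      constructor
      · intro h
        exact ⟨β⁻¹ * γ, by simpa [mul_smul] using h, by simp⟩
      · rintro ⟨γ, h, rfl⟩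
        simpa [mul_smul] using h
    rw [hN]
    dsimp only
    rw [this, Set.ncard_image_of_injective _ (mul_right_injective β)]
  have hN0 : ∀ x, (N x : E) ≠ 0 := by
    intro x
    obtain ⟨γ, s, hs, rfl⟩ := hcov x
    rw [Nat.cast_ne_zero, hN]
    exact (Set.ncard_pos (hfin _)).2 ⟨γ, by simpa using hs⟩ |>.ne'
  set w : X → E := fun x => if x ∈ S then (N x : E)⁻¹ else 0 with hw
  have hsupp : ∀ x, w x ≠ 0 → x ∈ S := fun x h => by
    by_contra hx
    exact h (if_neg hx)
  refine ⟨w, hS.subset hsupp, fun x => (hfin x).subset fun γ h => hsupp _ h, fun x => ?_⟩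
  rw [finsum_eq_sum_of_support_subset (s := (hfin x).toFinset) _ fun γ h => by
    simpa using hsupp _ h]
  rw [Finset.sum_congr rfl (g := fun _ => (N x : E)⁻¹), Finset.sum_const,
    ← Set.ncard_eq_toFinset_card _ (hfin x), nsmul_eq_mul]
  · exact mul_inv_cancel₀ (hN0 x)
  · intro γ h
    rw [hw]
    dsimp only
    rw [if_pos (by simpa using h), hNinv]

end Cutoff

/-! ### Equivariant functions on the tree -/

section Hodge
variable {Γ : Subgroup (GL (Fin 2) ℚ_[p])} {k : ℕ} {E : Type} [Field E] [Algebra ℚ_[p] E]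

lemma coe_smul_vertex (γ : Γ) (v : Vertex p) : γ • v = γ.1 • v := rfl

lemma coe_smul_edge (γ : Γ) (e : Edge p) : γ • e = γ.1 • e := rfl

variable (Γ k E) in
/-- The `Γ`-equivariant functions on the vertices. -/
def cochain0 : Submodule E (Vertex p → Vk p k E) where
  carrier := {f | ∀ γ ∈ Γ, ∀ v, f (γ • v) = vkRep k E γ (f v)}
  zero_mem' := fun γ _ v => (map_zero _).symm
  add_mem' := fun {f g} hf hg γ hγ v => by
    rw [Pi.add_apply, hf γ hγ, hg γ hγ, Pi.add_apply, map_add]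
  smul_mem' := fun t f hf γ hγ v => by
    rw [Pi.smul_apply, hf γ hγ, Pi.smul_apply, map_smul]

variable (p k E) in
/-- The divergence of a function on the edges. -/
def divg : (Edge p → Vk p k E) →ₗ[E] Vertex p → Vk p k E where
  toFun c v := ∑ e ∈ (finite_edges_from v).toFinset, c e
  map_add' c c' := funext fun v => Finset.sum_add_distrib
  map_smul' t c := by
    funext v
    exact (Finset.smul_sum (r := t) (f := c)).symm

variable (p k E) in
/-- The gradient of a function on the vertices. -/
def grad : (Vertex p → Vk p k E) →ₗ[E] Edge p → Vk p k E where
  toFun f e := f e.snd - f e.fst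
  map_add' f g := funext fun e => add_sub_add_comm _ _ _ _
  map_smul' t f := by
    funext e
    exact (smul_sub t (f e.snd) (f e.fst)).symm

lemma grad_apply (f : Vertex p → Vk p k E) (e : Edge p) : grad p k E f e = f e.snd - f e.fst := rfl

lemma divg_apply (c : Edge p → Vk p k E) (v : Vertex p) :
    divg p k E c v = ∑ᶠ e ∈ {e : Edge p | e.fst = v}, c e :=
  (finsum_mem_eq_finite_toFinset_sum _ _).symm

variable (Γ) in
/-- Alternating `Γ`-equivariant functions on the edges. -/
structure IsCochain1 (c : Edge p → Vk p k E) : Prop where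
  symm : ∀ e, c e.symm = -c e
  equiv : ∀ γ ∈ Γ, ∀ e, c (γ • e) = vkRep k E γ (c e)

lemma isCochain1_grad {f : Vertex p → Vk p k E} (hf : f ∈ cochain0 Γ k E) :
    IsCochain1 Γ (grad p k E f) := by
  refine ⟨fun e => (neg_sub _ _).symm, fun γ hγ e => ?_⟩
  rw [grad_apply, grad_apply, smul_fst, smul_snd, hf γ hγ, hf γ hγ, map_sub]

lemma mem_harmonic_iff {c : Edge p → Vk p k E} :
    c ∈ harmonic Γ k E ↔ IsCochain1 Γ c ∧ divg p k E c = 0 := by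
  constructor
  · intro h
    exact ⟨⟨h.1, fun γ hγ e => harmonic_smul h hγ e⟩, funext fun v => by
      rw [divg_apply]; exact h.2.1 v⟩
  · rintro ⟨h1, h2⟩
    refine ⟨h1.symm, fun v => ?_, fun γ hγ e => ?_⟩
    · rw [← divg_apply, h2]; rfl
    · rw [← h1.equiv γ hγ, smul_inv_smul]

lemma divg_mem {c : Edge p → Vk p k E} (hc : IsCochain1 Γ c) : divg p k E c ∈ cochain0 Γ k E := by
  intro γ hγ v
  have h : (finite_edges_from (γ • v)).toFinset =
      (finite_edges_from v).toFinset.map ⟨_, MulAction.injective γ⟩ := by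
    ext e
    simp only [Set.Finite.mem_toFinset, Finset.mem_map, Function.Embedding.coeFn_mk]
    constructor
    · intro h
      refine ⟨γ⁻¹ • e, ?_, smul_inv_smul γ e⟩
      change γ⁻¹ • e.fst = v
      rw [show e.fst = γ • v from h, inv_smul_smul]
    · rintro ⟨e, h, rfl⟩
      exact congrArg (γ • ·) h
  change ∑ e ∈ _, c e = vkRep k E γ (∑ e ∈ _, c e)
  rw [h, Finset.sum_map, map_sum]
  exact Finset.sum_congr rfl fun e _ => hc.equiv γ hγ e

lemma pathSum_grad (f : Vertex p → Vk p k E) (v w : Vertex p) :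
    pathSum (grad p k E f) v w = f w - f v :=
  pathSum_of_potential f (fun _ => rfl) v w

lemma pathSum_smul {c : Edge p → Vk p k E} (hc : IsCochain1 Γ c) {γ : GL (Fin 2) ℚ_[p]} (hγ : γ ∈ Γ)
    (v w : Vertex p) : pathSum c (γ • v) (γ • w) = vkRep k E γ (pathSum c v w) := by
  have h := pathSum_of_potential (c := c) (fun x => vkRep k E γ (pathSum c v (γ⁻¹ • x)))
    (fun e => by
      have h1 := pathSum_edge hc.symm v (γ⁻¹ • e)
      rw [smul_snd, smul_fst] at h1
      rw [h1, map_add, add_sub_cancel_left, ← hc.equiv γ hγ, smul_inv_smul]) (γ • v) (γ • w)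
  rw [h, inv_smul_smul, inv_smul_smul, pathSum_self, map_zero, sub_zero]

/-- Every class is given by path sums of the gradient of a function `g` with
`g (γ v) = γ g(v) + z(γ)`. -/
lemma exists_potential {w : Vertex p → E} (hw : IsCutoff Γ w)
    (z : groupCohomology.cocycles₁ (vkRepOn Γ k E)) :
    ∃ g : Vertex p → Vk p k E, ∀ (γ : Γ) v, g (γ • v) = vkRep k E γ.1 (g v) + z.1 γ := by
  refine ⟨fun v => ∑ᶠ γ : Γ, w (γ⁻¹ • v) • (z.1 γ : Vk p k E), fun β v => ?_⟩
  have hs : ∀ F : Γ → Vk p k E, (Function.support fun γ : Γ => w (γ⁻¹ • v) • F γ).Finite :=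
    fun F => (hw.proper v).subset fun γ h h0 => h (by
      dsimp only at h0 ⊢; rw [h0, zero_smul])
  dsimp only
  rw [← finsum_comp_equiv (Equiv.mulLeft β)]
  have h1 : ∀ γ : Γ, w ((Equiv.mulLeft β γ)⁻¹ • β • v) • (z.1 (Equiv.mulLeft β γ) : Vk p k E) =
      w (γ⁻¹ • v) • vkRep k E β.1 (z.1 γ) + w (γ⁻¹ • v) • (z.1 β : Vk p k E) := by
    intro γ
    rw [Equiv.coe_mulLeft, cocycle_mul, smul_add, mul_inv_rev, mul_smul, inv_smul_smul]
  rw [finsum_congr h1, finsum_add_distrib (hs _) (hs _)]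
  refine congrArg₂ (· + ·) ?_ ?_
  swap
  · have := finsum_smul (fun γ : Γ => w (γ⁻¹ • v)) (z.1 β : Vk p k E)
    rw [hw.sum, one_smul] at this
    exact this.symm
  have h2 := AddMonoidHom.map_finsum (vkRep k E β.1).toAddMonoidHom (hs fun γ => z.1 γ)
  refine Eq.trans (finsum_congr fun γ => ?_) h2.symm
  exact ((vkRep k E β.1).map_smul _ _).symm

/-- Invariant bilinear forms on the coefficients. -/
def InvForm (Γ : Subgroup (GL (Fin 2) ℚ_[p])) (b : Vk p k E →ₗ[E] Vk p k E →ₗ[E] E) : Prop :=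
  ∀ γ ∈ Γ, ∀ x y, b (vkRep k E γ x) (vkRep k E γ y) = b x y

lemma isCutoff_fst {w : Vertex p → E} (hw : IsCutoff Γ w) :
    IsCutoff Γ fun e : Edge p => w e.fst := by
  refine ⟨(hw.finite.biUnion fun v _ => finite_edges_from v).subset fun e he => ?_,
    fun e => hw.proper e.fst, fun e => hw.sum e.fst⟩
  exact Set.mem_biUnion (x := e.fst) he rfl

lemma isCutoff_snd {w : Vertex p → E} (hw : IsCutoff Γ w) :
    IsCutoff Γ fun e : Edge p => w e.snd := by
  refine ⟨?_, fun e => hw.proper e.snd, fun e => hw.sum e.snd⟩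
  have h := (isCutoff_fst hw).finite.image fun e : Edge p => e.symm
  exact h.subset fun e he => ⟨e.symm, he, e.symm_symm⟩

lemma finsum_vertex_edge {w : Vertex p → E} (hw : IsCutoff Γ w) (h : Edge p → E) :
    ∑ᶠ v, w v * ∑ e ∈ (finite_edges_from v).toFinset, h e = ∑ᶠ e : Edge p, w e.fst * h e := by
  classical
  have hT := (isCutoff_fst hw).finite
  rw [finsum_eq_sum_of_support_subset (s := hw.finite.toFinset) _ fun v hv => by
      simpa using left_ne_zero_of_mul hv,
    finsum_eq_sum_of_support_subset (s := hT.toFinset) _ fun v hv => by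
      simpa using left_ne_zero_of_mul hv,
    ← Finset.sum_fiberwise_of_maps_to (t := hw.finite.toFinset) (g := fun e : Edge p => e.fst)
      (by simp)]
  refine Finset.sum_congr rfl fun v hv => ?_
  rw [Finset.mul_sum]
  refine Finset.sum_congr ?_ fun e he => ?_
  · ext e
    simp only [Set.Finite.mem_toFinset, Finset.mem_filter, Function.mem_support, Set.mem_ofPred_eq]
    constructor
    · rintro rfl
      exact ⟨by simpa using hv, rfl⟩
    · exact fun h => h.2
  · rw [(Finset.mem_filter.1 he).2]

/-- The divergence is adjoint to the gradient. -/
lemma two_mul_finsum_divg {w : Vertex p → E} (hw : IsCutoff Γ w)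
    {b : Vk p k E →ₗ[E] Vk p k E →ₗ[E] E} (hb : InvForm Γ b) {f : Vertex p → Vk p k E}
    (hf : f ∈ cochain0 Γ k E) {c : Edge p → Vk p k E} (hc : IsCochain1 Γ c) :
    2 * ∑ᶠ v, w v * b (f v) (divg p k E c v) =
      -∑ᶠ e : Edge p, w e.fst * b (grad p k E f e) (c e) := by
  have h1 : ∑ᶠ v, w v * b (f v) (divg p k E c v) = ∑ᶠ e : Edge p, w e.fst * b (f e.fst) (c e) := by
    rw [← finsum_vertex_edge hw]
    refine finsum_congr fun v => ?_
    congr 1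
    change b (f v) (∑ e ∈ _, c e) = _
    rw [map_sum]
    refine Finset.sum_congr rfl fun e he => ?_
    have : e.fst = v := by simpa using he
    rw [this]
  have h2 : ∑ᶠ e : Edge p, w e.fst * b (f e.fst) (c e) =
      -∑ᶠ e : Edge p, w e.fst * b (f e.snd) (c e) := by
    rw [(isCutoff_fst hw).finsum_eq (isCutoff_snd hw) (F := fun e => b (f e.snd) (c e)),
      ← finsum_neg_distrib]
    · let ε : Edge p ≃ Edge p := ⟨fun e => e.symm, fun e => e.symm, fun e => e.symm_symm,
        fun e => e.symm_symm⟩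
      rw [← finsum_comp_equiv ε]
      refine finsum_congr fun e => ?_
      change w e.snd * b (f e.snd) (c e.symm) = _
      rw [hc.symm, map_neg, mul_neg]
    · intro γ e
      rw [coe_smul_edge, smul_snd, hf _ γ.2, hc.equiv _ γ.2, hb _ γ.2]
  have hfin : ∀ F : Edge p → E, (Function.support fun e => w e.fst * F e).Finite := fun F =>
    (isCutoff_fst hw).finite.subset fun e he => left_ne_zero_of_mul he
  have h3 : ∑ᶠ e : Edge p, w e.fst * b (grad p k E f e) (c e) =
      ∑ᶠ e : Edge p, w e.fst * b (f e.snd) (c e) - ∑ᶠ e : Edge p, w e.fst * b (f e.fst) (c e) := by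
    rw [← finsum_sub_distrib (hfin _) (hfin _)]
    refine finsum_congr fun e => ?_
    rw [grad_apply, map_sub, LinearMap.sub_apply, mul_sub]
  rw [two_mul, h1, h3]
  nth_rw 1 [h2]
  ring

/-- The equivariant function supported on the orbit of `v`. -/
lemma exists_orbit_fun (hprop : ∀ x y : Vertex p, {γ : Γ | γ • x = y}.Finite) {w : Vertex p → E}
    (hw : IsCutoff Γ w) {b : Vk p k E →ₗ[E] Vk p k E →ₗ[E] E} (hb : InvForm Γ b)
    (v : Vertex p) (u : Vk p k E) :
    ∃ g ∈ cochain0 Γ k E, ∀ f ∈ cochain0 Γ k E, ∑ᶠ x, w x * b (f x) (g x) = b (f v) u := by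
  classical
  have hs : ∀ x, ∀ F : Γ → Vk p k E,
      (Function.support fun γ : Γ => if γ • v = x then F γ else 0).Finite := fun x F =>
    (hprop v x).subset fun γ h => by
      by_contra h0
      exact h (if_neg h0)
  refine ⟨fun x => ∑ᶠ γ : Γ, if γ • v = x then vkRep k E γ.1 u else 0, fun β hβ x => ?_,
    fun f hf => ?_⟩
  · dsimp only
    rw [← finsum_comp_equiv (Equiv.mulLeft (⟨β, hβ⟩ : Γ))]
    have h2 := AddMonoidHom.map_finsum (vkRep k E β).toAddMonoidHom
      (hs x fun γ => vkRep k E γ.1 u)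
    refine Eq.trans (finsum_congr fun γ => ?_) h2.symm
    have hiff : Equiv.mulLeft (⟨β, hβ⟩ : Γ) γ • v = β • x ↔ γ • v = x := by
      rw [Equiv.coe_mulLeft, mul_smul]
      exact smul_left_cancel_iff β
    by_cases h : γ • v = x
    · rw [if_pos (hiff.2 h), if_pos h]
      exact LinearMap.congr_fun ((vkRep k E).map_mul β γ.1) u
    · rw [if_neg (mt hiff.1 h), if_neg h]
      exact (map_zero _).symm
  · have h1 : ∀ x, w x * b (f x) (∑ᶠ γ : Γ, if γ • v = x then vkRep k E γ.1 u else 0) =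
        ∑ᶠ γ : Γ, if γ • v = x then w (γ • v) * b (f v) u else 0 := by
      intro x
      have h2 := AddMonoidHom.map_finsum (b (f x)).toAddMonoidHom (hs x fun γ => vkRep k E γ.1 u)
      refine (congrArg (w x * ·) h2).trans ?_
      rw [← smul_eq_mul, smul_finsum]
      refine finsum_congr fun γ => ?_
      by_cases h : γ • v = x
      · rw [if_pos h, if_pos h, smul_eq_mul]
        subst h
        congr 1
        change b (f (γ • v)) _ = _
        rw [coe_smul_vertex, hf _ γ.2, hb _ γ.2]
      · rw [if_neg h, if_neg h]
        exact (congrArg (w x • ·) (map_zero _)).trans (smul_zero _)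
    have hp : (Function.support fun γ : Γ => w (γ • v)).Finite := by
      have := (hw.proper v).image fun γ : Γ => γ⁻¹
      exact this.subset fun γ h => ⟨γ⁻¹, by simpa using h, inv_inv γ⟩
    have hT : (Function.support fun t : Vertex p × Γ =>
        if t.2 • v = t.1 then w (t.2 • v) * b (f v) u else 0).Finite := by
      refine (hp.image fun γ => (γ • v, γ)).subset ?_
      rintro ⟨x, γ⟩ h
      rw [Function.mem_support] at h
      dsimp only at h
      by_cases hx : γ • v = x
      · rw [if_pos hx] at h
        exact ⟨γ, left_ne_zero_of_mul h, Prod.ext hx rfl⟩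
      · exact (h (if_neg hx)).elim
    rw [finsum_congr h1, ← finsum_curry (fun t : Vertex p × Γ =>
        if t.2 • v = t.1 then w (t.2 • v) * b (f v) u else 0) hT,
      ← finsum_comp_equiv (Equiv.prodComm Γ (Vertex p)), finsum_curry]
    · have h3 : ∀ γ : Γ, (∑ᶠ x : Vertex p, if γ • v = x then w (γ • v) * b (f v) u else 0) =
          w (γ • v) * b (f v) u := fun γ => by
        rw [finsum_eq_single _ (γ • v) fun x hx => if_neg hx.symm, if_pos rfl]
      refine (finsum_congr h3).trans ?_
      simp_rw [← smul_eq_mul]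
      rw [← finsum_smul, ← finsum_comp_equiv (Equiv.inv Γ)]
      change (∑ᶠ γ : Γ, w (γ⁻¹ • v)) • _ = _
      rw [hw.sum, one_smul]
    · exact Set.Finite.preimage (Equiv.injective _).injOn hT

/-- In a finite dimensional space with a left separating form, the range of a self-adjoint map
is the orthogonal of its kernel. -/
lemma mem_range_of_orthogonal {K C : Type} [Field K] [AddCommGroup C] [Module K C]
    [FiniteDimensional K C] (β : C →ₗ[K] C →ₗ[K] K) (hβ : ∀ f, (∀ g, β f g = 0) → f = 0)
    (Δ : C →ₗ[K] C) (hΔ : ∀ f g, β f (Δ g) = β (Δ f) g) {u : C}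
    (hu : ∀ f, Δ f = 0 → β f u = 0) : ∃ f, Δ f = u := by
  by_contra hne
  have hu' : u ∉ LinearMap.range Δ := fun ⟨f, hf⟩ => hne ⟨f, hf⟩
  obtain ⟨l, hl, hl'⟩ := Submodule.exists_le_ker_of_notMem hu'
  have hinj : Function.Injective β := by
    rw [← LinearMap.ker_eq_bot, LinearMap.ker_eq_bot']
    exact fun f hf => hβ f fun g => by rw [hf]; rfl
  have hsurj : Function.Surjective β :=
    (LinearMap.injective_iff_surjective_of_finrank_eq_finrank
      (Subspace.dual_finrank_eq (K := K) (V := C)).symm).1 hinj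
  obtain ⟨f, rfl⟩ := hsurj l
  refine hl (hu f (hβ _ fun g => ?_))
  rw [← hΔ]
  exact hl' ⟨g, rfl⟩

end Hodge

/-! ### The invariant form on the coefficients -/

section Form
variable {k : ℕ} {E : Type} [Field E] [Algebra ℚ_[p] E]

lemma vk_ext {φ ψ : Vk p k E} (h : ∀ i ≤ k, φ (mono k i) = ψ (mono k i)) : φ = ψ := by
  refine LinearMap.ext fun P => ?_
  rw [eq_sum_mono P, map_sum, map_sum]
  refine Finset.sum_congr rfl fun i hi => ?_
  rw [map_smul, map_smul, h i (Nat.lt_succ_iff.1 (Finset.mem_range.1 hi))]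

variable (p k E) in
/-- The pairing `⟨φ, ψ⟩ = ∑ (-1)^i (k choose i) φ(x^i) ψ(x^(k-i))`. -/
def vkForm : Vk p k E →ₗ[E] Vk p k E →ₗ[E] E :=
  LinearMap.mk₂ E (fun φ ψ => ∑ i ∈ Finset.range (k + 1),
      algebraMap ℚ_[p] E ((-1) ^ i * k.choose i) * (φ (mono k i) * ψ (mono k (k - i))))
    (fun φ φ' ψ => by
      rw [← Finset.sum_add_distrib]
      exact Finset.sum_congr rfl fun i _ => by rw [LinearMap.add_apply]; ring)
    (fun t φ ψ => by
      rw [smul_eq_mul, Finset.mul_sum]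
      exact Finset.sum_congr rfl fun i _ => by rw [LinearMap.smul_apply, smul_eq_mul]; ring)
    (fun φ ψ ψ' => by
      rw [← Finset.sum_add_distrib]
      exact Finset.sum_congr rfl fun i _ => by rw [LinearMap.add_apply]; ring)
    (fun t φ ψ => by
      rw [smul_eq_mul, Finset.mul_sum]
      exact Finset.sum_congr rfl fun i _ => by rw [LinearMap.smul_apply, smul_eq_mul]; ring)

lemma vkForm_apply (φ ψ : Vk p k E) : vkForm p k E φ ψ = ∑ i ∈ Finset.range (k + 1),
    algebraMap ℚ_[p] E ((-1) ^ i * k.choose i) * (φ (mono k i) * ψ (mono k (k - i))) := rfl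

lemma eq_zero_of_vkForm {φ : Vk p k E} (h : ∀ ψ, vkForm p k E φ ψ = 0) : φ = 0 := by
  refine vk_ext fun j hj => ?_
  let ψ : Vk p k E := Algebra.linearMap ℚ_[p] E ∘ₗ Polynomial.lcoeff ℚ_[p] (k - j) ∘ₗ
    (Polynomial.degreeLE ℚ_[p] (k : WithBot ℕ)).subtype
  have hψ : ∀ i ≤ k, ψ (mono k i) = if i = k - j then 1 else 0 := fun i hi => by
    change algebraMap ℚ_[p] E ((mono k i : Pk p k).1.coeff (k - j)) = _
    rw [mono_val hi, Polynomial.coeff_X_pow]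
    simp only [eq_comm]
    rw [apply_ite (algebraMap ℚ_[p] E), map_one, map_zero]
  have h1 := h ψ
  rw [vkForm_apply, Finset.sum_eq_single j] at h1
  · rw [hψ _ (Nat.sub_le _ _), if_pos rfl, mul_one] at h1
    refine (mul_eq_zero.1 h1).resolve_left ?_
    exact (map_ne_zero _).2 (mul_ne_zero (pow_ne_zero _ (by norm_num))
      (by exact_mod_cast (Nat.choose_pos hj).ne'))
  · intro i hi hij
    have := Nat.lt_succ_iff.1 (Finset.mem_range.1 hi)
    rw [hψ _ (Nat.sub_le _ _), if_neg (by omega), mul_zero, mul_zero]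
  · intro hj'
    exact (hj' (Finset.mem_range.2 (Nat.lt_succ_of_le hj))).elim

lemma homogenize_mono {i : ℕ} (hi : i ≤ k) (x y : ℚ_[p]) :
    homogenize (mono k i : Pk p k) x y = x ^ i * y ^ (k - i) := by
  rw [homogenize, Finset.sum_eq_single i]
  · rw [mono_val hi, Polynomial.coeff_X_pow_self, one_mul]
  · intro j _ hj
    rw [mono_val hi, Polynomial.coeff_X_pow, if_neg hj]; ring
  · intro h
    exact (h (Finset.mem_range.2 (Nat.lt_succ_of_le hi))).elim

lemma eq_zero_of_forall_sum {n : ℕ} {D : ℕ → ℕ → ℚ_[p]}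
    (h : ∀ x y, ∑ i ∈ Finset.range n, ∑ j ∈ Finset.range n, D i j * (x ^ i * y ^ j) = 0) :
    ∀ i < n, ∀ j < n, D i j = 0 := by
  have key : ∀ d : ℕ → ℚ_[p], (∀ x, ∑ i ∈ Finset.range n, d i * x ^ i = 0) → ∀ i < n, d i = 0 := by
    intro d hd i hi
    have h0 : (∑ i ∈ Finset.range n, Polynomial.C (d i) * Polynomial.X ^ i) = 0 :=
      Polynomial.funext fun x => by simpa [Polynomial.eval_finsetSum] using hd x
    have := congrArg (fun P => Polynomial.coeff P i) h0
    simpa [Polynomial.finsetSum_coeff, Polynomial.coeff_C_mul, Polynomial.coeff_X_pow, hi] using this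
  intro i hi
  refine key _ fun y => ?_
  refine key (fun i => ∑ j ∈ Finset.range n, D i j * y ^ j) (fun x => ?_) i hi
  rw [← h x y]
  refine Finset.sum_congr rfl fun i _ => ?_
  rw [Finset.sum_mul]
  exact Finset.sum_congr rfl fun j _ => by ring

lemma vkForm_smul {g : GL (Fin 2) ℚ_[p]} (hg : gdet g = 1) (φ ψ : Vk p k E) :
    vkForm p k E (vkRep k E g φ) (vkRep k E g ψ) = vkForm p k E φ ψ := by
  set A : ℕ → ℕ → ℚ_[p] := fun i m => (polyAct k g (mono k i)).1.coeff m with hA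
  set c : ℕ → ℚ_[p] := fun i => (-1) ^ i * k.choose i with hc
  have hA' : ∀ i ≤ k, ∀ z, ∑ m ∈ Finset.range (k + 1), A i m * z ^ m =
      (g 0 0 * z + g 0 1) ^ i * (g 1 0 * z + g 1 1) ^ (k - i) := by
    intro i hi z
    have h := eval_polyAct (mono k i) g z
    rw [hg, inv_one, one_pow, one_mul, homogenize_mono hi, Polynomial.eval_eq_sum_range'
      (Nat.lt_succ_of_le (natDegree_le k _))] at h
    exact h
  have hbin : ∀ x y : ℚ_[p], ∑ i ∈ Finset.range (k + 1), c i * (x ^ i * y ^ (k - i)) = (-x + y) ^ k :=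
    fun x y => by
      rw [add_pow]
      refine Finset.sum_congr rfl fun i _ => ?_
      rw [hc, neg_pow x]; ring
  have hD := eq_zero_of_forall_sum (n := k + 1) (D := fun m n =>
      (∑ i ∈ Finset.range (k + 1), c i * (A i m * A (k - i) n)) - if n = k - m then c m else 0)
    (fun x y => by
      have h1 : ∑ m ∈ Finset.range (k + 1), ∑ n ∈ Finset.range (k + 1),
          (∑ i ∈ Finset.range (k + 1), c i * (A i m * A (k - i) n)) * (x ^ m * y ^ n) =
          ∑ i ∈ Finset.range (k + 1), c i * ((∑ m ∈ Finset.range (k + 1), A i m * x ^ m) *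
            ∑ n ∈ Finset.range (k + 1), A (k - i) n * y ^ n) := by
        simp_rw [Finset.sum_mul_sum, Finset.mul_sum, Finset.sum_mul]
        rw [Finset.sum_comm' (t' := Finset.range (k + 1)) (s' := fun _ => Finset.range (k + 1))
          (by simp)]
        rw [Finset.sum_congr rfl fun n _ => Finset.sum_comm, Finset.sum_comm]
        refine Finset.sum_congr rfl fun i _ => ?_
        rw [Finset.sum_comm]
        refine Finset.sum_congr rfl fun m _ => Finset.sum_congr rfl fun n _ => ?_
        ring
      have h2 : ∑ i ∈ Finset.range (k + 1), c i * ((∑ m ∈ Finset.range (k + 1), A i m * x ^ m) *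
            ∑ n ∈ Finset.range (k + 1), A (k - i) n * y ^ n) = (-x + y) ^ k := by
        have : (-x + y) ^ k = (-((g 0 0 * x + g 0 1) * (g 1 0 * y + g 1 1)) +
            (g 1 0 * x + g 1 1) * (g 0 0 * y + g 0 1)) ^ k := by
          congr 1
          have := hg
          rw [gdet] at this
          linear_combination (x - y) * this
        rw [this, ← hbin]
        refine Finset.sum_congr rfl fun i hi => ?_
        have hi' := Nat.lt_succ_iff.1 (Finset.mem_range.1 hi)
        rw [hA' i hi', hA' _ (Nat.sub_le k i), Nat.sub_sub_self hi', mul_pow, mul_pow]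
        ring
      simp_rw [sub_mul, Finset.sum_sub_distrib]
      rw [h1, h2, ← hbin, sub_eq_zero]
      refine Finset.sum_congr rfl fun m hm => ?_
      rw [Finset.sum_eq_single (k - m)]
      · rw [if_pos rfl]
      · intro n _ hn
        rw [if_neg hn, zero_mul]
      · intro h
        exact (h (Finset.mem_range.2 (by omega))).elim)
  have hexp : ∀ (φ : Vk p k E) (i : ℕ), vkRep k E g φ (mono k i) =
      ∑ m ∈ Finset.range (k + 1), algebraMap ℚ_[p] E (A i m) * φ (mono k m) := by
    intro φ i
    change φ (polyAct k g (mono k i)) = _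
    conv_lhs => rw [eq_sum_mono (polyAct k g (mono k i)), map_sum]
    refine Finset.sum_congr rfl fun m _ => ?_
    rw [map_smul, Algebra.smul_def]
  rw [vkForm_apply, vkForm_apply]
  have h3 : ∀ i, algebraMap ℚ_[p] E (c i) * (vkRep k E g φ (mono k i) *
      vkRep k E g ψ (mono k (k - i))) = ∑ m ∈ Finset.range (k + 1), ∑ n ∈ Finset.range (k + 1),
        algebraMap ℚ_[p] E (c i * (A i m * A (k - i) n)) * (φ (mono k m) * ψ (mono k n)) := by
    intro i
    rw [hexp, hexp, Finset.sum_mul_sum, Finset.mul_sum]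
    refine Finset.sum_congr rfl fun m _ => ?_
    rw [Finset.mul_sum]
    refine Finset.sum_congr rfl fun n _ => ?_
    rw [map_mul _ (c i), map_mul _ (A i m)]
    ring
  rw [Finset.sum_congr rfl fun i _ => h3 i, Finset.sum_comm]
  refine Finset.sum_congr rfl fun m hm => ?_
  rw [Finset.sum_comm, Finset.sum_eq_single (k - m)]
  · rw [← Finset.sum_mul, ← map_sum]
    have := hD m (Finset.mem_range.1 hm) (k - m) (by omega)
    rw [if_pos rfl, sub_eq_zero] at this
    rw [this]
  · intro n hn hnm
    have := hD m (Finset.mem_range.1 hm) n (Finset.mem_range.1 hn)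
    rw [if_neg hnm, sub_zero] at this
    rw [← Finset.sum_mul, ← map_sum, this, map_zero, zero_mul]
  · intro h
    exact (h (Finset.mem_range.2 (by omega))).elim

end Form

/-! ### Harmonic functions on the vertices -/

/-- A maximum principle. -/
lemma eq_of_harmonic {J : Type} [Fintype J] {d : J → ℚ} (hd : ∀ i, 0 < d i) {F : Vertex p → J → ℚ}
    (hF : ∀ v i, ∑ e ∈ (finite_edges_from v).toFinset, (F e.snd i - F e.fst i) = 0)
    (hfin : (Set.range fun v => ∑ i, d i * F v i ^ 2).Finite) (v w : Vertex p) : F v = F w := by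
  set q : Vertex p → ℚ := fun v => ∑ i, d i * F v i ^ 2 with hq
  obtain ⟨_, ⟨u, rfl⟩, hu⟩ := Set.exists_max_image _ id hfin ⟨q (v0 p), v0 p, rfl⟩
  have hmax : ∀ v, q v ≤ q u := fun v => hu _ ⟨v, rfl⟩
  have step : ∀ e : Edge p, q e.fst = q u → F e.snd = F e.fst := by
    intro e he
    have h1 : ∑ e' ∈ (finite_edges_from e.fst).toFinset,
        ∑ i, d i * (F e'.snd i - F e'.fst i) ^ 2 =
        ∑ e' ∈ (finite_edges_from e.fst).toFinset, (q e'.snd - q e'.fst) := by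
      have h2 : ∑ e' ∈ (finite_edges_from e.fst).toFinset,
          ∑ i, 2 * d i * F e.fst i * (F e'.snd i - F e'.fst i) = 0 := by
        rw [Finset.sum_comm]
        refine Finset.sum_eq_zero fun i _ => ?_
        rw [← Finset.mul_sum, hF, mul_zero]
      rw [← sub_eq_zero, ← neg_eq_zero, ← h2, ← Finset.sum_sub_distrib, ← Finset.sum_neg_distrib]
      refine Finset.sum_congr rfl fun e' he' => ?_
      have : e'.fst = e.fst := by simpa using he'
      rw [hq, this]
      dsimp only
      rw [← Finset.sum_sub_distrib, ← Finset.sum_sub_distrib, ← Finset.sum_neg_distrib]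
      exact Finset.sum_congr rfl fun i _ => by ring
    have hnn : ∀ e' : Edge p, 0 ≤ ∑ i, d i * (F e'.snd i - F e'.fst i) ^ 2 := fun e' =>
      Finset.sum_nonneg fun i _ => mul_nonneg (hd i).le (sq_nonneg _)
    have h3 : ∑ e' ∈ (finite_edges_from e.fst).toFinset,
        ∑ i, d i * (F e'.snd i - F e'.fst i) ^ 2 = 0 := by
      refine le_antisymm ?_ (Finset.sum_nonneg fun e' _ => hnn e')
      rw [h1]
      refine Finset.sum_nonpos fun e' he' => ?_
      have : e'.fst = e.fst := by simpa using he'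
      rw [this, he]
      linarith [hmax e'.snd]
    have h4 := (Finset.sum_eq_zero_iff_of_nonneg fun e' _ => hnn e').1 h3 e (by simp)
    funext i
    have h5 := (Finset.sum_eq_zero_iff_of_nonneg fun i _ =>
      mul_nonneg (hd i).le (sq_nonneg (F e.snd i - F e.fst i))).1 h4 i (Finset.mem_univ i)
    exact sub_eq_zero.1 (pow_eq_zero_iff two_ne_zero |>.1 ((mul_eq_zero.1 h5).resolve_left (hd i).ne'))
  have hall : ∀ {x y : Vertex p}, (tree p).Walk x y → F x = F u → F y = F u := by
    intro x y w
    induction w with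
    | nil => exact id
    | cons h w ih =>
      intro hx
      refine ih ((step ⟨(_, _), h⟩ ?_).trans hx)
      rw [hq]
      dsimp only
      rw [hx]
  rw [hall (reachable u v).some rfl, hall (reachable u w).some rfl]

section Quat
variable {a b : ℚ}

variable (a b) in
/-- The standard basis `1, i, j, k`. -/
def qb : Fin 4 → ℍ[ℚ, a, b] := ![⟨1, 0, 0, 0⟩, ⟨0, 1, 0, 0⟩, ⟨0, 0, 1, 0⟩, ⟨0, 0, 0, 1⟩]

/-- The coordinates with respect to the standard basis. -/
def qc (x : ℍ[ℚ, a, b]) : Fin 4 → ℚ := ![x.re, x.imI, x.imJ, x.imK]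

variable (a b) in
/-- The inverses of the norms of the standard basis. -/
def qd : Fin 4 → ℚ := ![1, (-a)⁻¹, (-b)⁻¹, (a * b)⁻¹]

lemma qd_pos (ha : a < 0) (hb : b < 0) (i : Fin 4) : 0 < qd a b i := by
  fin_cases i
  · exact one_pos
  · exact inv_pos.2 (neg_pos.2 ha)
  · exact inv_pos.2 (neg_pos.2 hb)
  · exact inv_pos.2 (mul_pos_of_neg_of_neg ha hb)

lemma sum_qc (x : ℍ[ℚ, a, b]) : x = ∑ j, qc x j • qb a b j := by
  ext <;> simp [Fin.sum_univ_four, qc, qb]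

lemma sum_qd (ha : a ≠ 0) (hb : b ≠ 0) {u : ℍ[ℚ, a, b]} (hu : nrd u = 1) (j l : Fin 4) :
    ∑ i, qd a b i * (qc (qb a b i * u) j * qc (qb a b i * u) l) = if j = l then qd a b j else 0 := by
  rw [nrd] at hu
  have ea : a * a⁻¹ = 1 := mul_inv_cancel₀ ha
  have eb : b * b⁻¹ = 1 := mul_inv_cancel₀ hb
  fin_cases j <;> fin_cases l <;> simp [Fin.sum_univ_four, qc, qb, qd] <;> field_simp <;>
    first | ring1 | linear_combination hu | linear_combination -hu

lemma sum_tensor (ha : a ≠ 0) (hb : b ≠ 0) {u : ℍ[ℚ, a, b]} (hu : nrd u = 1) {k : ℕ}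
    (G : (Fin k → Fin 4) → ℚ) :
    ∑ I : Fin k → Fin 4, (∏ t, qd a b (I t)) *
        (∑ J : Fin k → Fin 4, (∏ t, qc (qb a b (I t) * u) (J t)) * G J) ^ 2 =
      ∑ I : Fin k → Fin 4, (∏ t, qd a b (I t)) * G I ^ 2 := by
  have h1 : ∀ J L : Fin k → Fin 4, ∑ I : Fin k → Fin 4, ∏ t, (qd a b (I t) *
      (qc (qb a b (I t) * u) (J t) * qc (qb a b (I t) * u) (L t))) =
      if J = L then ∏ t, qd a b (J t) else 0 := by
    intro J L
    have h2 := Finset.prod_univ_sum (fun _ : Fin k => (Finset.univ : Finset (Fin 4)))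
      (fun t i => qd a b i * (qc (qb a b i * u) (J t) * qc (qb a b i * u) (L t)))
    rw [Fintype.piFinset_univ] at h2
    rw [← h2]
    simp_rw [sum_qd ha hb hu]
    by_cases h : J = L
    · subst h
      simp
    · rw [if_neg h]
      obtain ⟨t, ht⟩ := Function.ne_iff.1 h
      exact Finset.prod_eq_zero (Finset.mem_univ t) (if_neg ht)
  have h3 : ∀ I : Fin k → Fin 4, (∏ t, qd a b (I t)) *
        (∑ J : Fin k → Fin 4, (∏ t, qc (qb a b (I t) * u) (J t)) * G J) ^ 2 =
      ∑ J : Fin k → Fin 4, ∑ L : Fin k → Fin 4, (∏ t, (qd a b (I t) *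
        (qc (qb a b (I t) * u) (J t) * qc (qb a b (I t) * u) (L t)))) * (G J * G L) := by
    intro I
    rw [sq, Finset.sum_mul_sum, Finset.mul_sum]
    refine Finset.sum_congr rfl fun J _ => ?_
    rw [Finset.mul_sum]
    refine Finset.sum_congr rfl fun L _ => ?_
    rw [Finset.prod_mul_distrib, Finset.prod_mul_distrib]
    ring
  rw [Finset.sum_congr rfl fun I _ => h3 I, Finset.sum_comm]
  refine Finset.sum_congr rfl fun J _ => ?_
  rw [Finset.sum_comm, Finset.sum_eq_single J]
  · rw [← Finset.sum_mul, h1, if_pos rfl, sq]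
  · intro L _ hL
    rw [← Finset.sum_mul, h1, if_neg hL.symm, zero_mul]
  · exact fun h => (h (Finset.mem_univ J)).elim

/-- The product of the linear forms given by the first rows. -/
def rowProd {k : ℕ} (M : Fin k → Matrix (Fin 2) (Fin 2) ℚ_[p]) : Pk p k :=
  ⟨∏ t, (Polynomial.C (M t 0 0) * Polynomial.X + Polynomial.C (M t 0 1)), by
    rw [Polynomial.mem_degreeLE]
    refine Polynomial.degree_le_of_natDegree_le ((Polynomial.natDegree_prod_le _ _).trans ?_)
    refine (Finset.sum_le_sum fun t _ => Polynomial.natDegree_linear_le).trans ?_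
    simp⟩

lemma eval_rowProd {k : ℕ} (M : Fin k → Matrix (Fin 2) (Fin 2) ℚ_[p]) (x : ℚ_[p]) :
    (rowProd M).1.eval x = ∏ t, (M t 0 0 * x + M t 0 1) := by
  simp [rowProd, Polynomial.eval_prod]

lemma rowProd_sum {k : ℕ} (s : Fin k → Fin 4 → ℚ_[p]) (N : Fin 4 → Matrix (Fin 2) (Fin 2) ℚ_[p]) :
    rowProd (fun t => ∑ j, s t j • N j) =
      ∑ J : Fin k → Fin 4, (∏ t, s t (J t)) • rowProd fun t => N (J t) := by
  refine Subtype.ext (Polynomial.funext fun x => ?_)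
  rw [eval_rowProd, Submodule.coe_sum, Polynomial.eval_finsetSum]
  have h2 := Finset.prod_univ_sum (fun _ : Fin k => (Finset.univ : Finset (Fin 4)))
      (fun t j => s t j * (N j 0 0 * x + N j 0 1))
  rw [Fintype.piFinset_univ] at h2
  refine Eq.trans ?_ (h2.trans ?_)
  · refine Finset.prod_congr rfl fun t _ => ?_
    simp only [Matrix.sum_apply, Matrix.smul_apply, smul_eq_mul, Finset.sum_mul,
      ← Finset.sum_add_distrib]
    exact Finset.sum_congr rfl fun j _ => by ring
  · refine Finset.sum_congr rfl fun J _ => ?_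
    rw [Submodule.coe_smul, Polynomial.eval_smul, eval_rowProd, smul_eq_mul,
      Finset.prod_mul_distrib]

lemma polyAct_rowProd {k : ℕ} {g : GL (Fin 2) ℚ_[p]} (hg : gdet g = 1)
    (M : Fin k → Matrix (Fin 2) (Fin 2) ℚ_[p]) :
    polyAct k g (rowProd M) = rowProd fun t => M t * g.1 := by
  refine Subtype.ext (Polynomial.eq_of_infinite_eval_eq _ _
    ((finite_denom_zero g).infinite_compl.mono fun x hx => ?_))
  refine (eval_polyActAux k g (rowProd M) x hx).trans ?_
  rw [Units.val_inv_eq_inv_val, gdet_eq, hg, inv_one, one_pow, one_mul, eval_rowProd, eval_rowProd]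
  have : (g 1 0 * x + g 1 1) ^ k = ∏ _t : Fin k, (g 1 0 * x + g 1 1) := by simp
  rw [this, ← Finset.prod_mul_distrib]
  refine Finset.prod_congr rfl fun t _ => ?_
  have hx' : g 1 0 * x + g 1 1 ≠ 0 := hx
  simp only [Matrix.mul_apply, Fin.sum_univ_two]
  field_simp
  ring

variable {ι : ℍ[ℚ, a, b] →ₐ[ℚ] Matrix (Fin 2) (Fin 2) ℚ_[p]} {R : Subring ℍ[ℚ, a, b]}
  {e : Fin 4 → ℍ[ℚ, a, b]}
  {k : ℕ} {E : Type} [Field E] [Algebra ℚ_[p] E]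

lemma map_qsmul (q : ℚ) (x : ℍ[ℚ, a, b]) : ι (q • x) = (q : ℚ_[p]) • ι x := by
  rw [map_smul, Rat.cast_smul_eq_qsmul]

lemma map_eq_sum_qc (x : ℍ[ℚ, a, b]) : ι x = ∑ j, (qc x j : ℚ_[p]) • ι (qb a b j) := by
  conv_lhs => rw [sum_qc x, map_sum]
  exact Finset.sum_congr rfl fun j _ => map_qsmul _ _

lemma IsOrderBasis.exists_eq_sum_qb (he : IsOrderBasis ι R e) {M : Matrix (Fin 2) (Fin 2) ℚ_[p]}
    (hM : ∀ i j, ‖M i j‖ ≤ 1) : ∃ s : Fin 4 → ℚ_[p], M = ∑ j, s j • ι (qb a b j) := by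
  obtain ⟨z, hz⟩ := he.exists_eq M hM
  refine ⟨fun j => ∑ i, (z i : ℚ_[p]) * qc (e i) j, ?_⟩
  rw [hz]
  simp_rw [Finset.sum_smul]
  rw [Finset.sum_comm]
  refine Finset.sum_congr rfl fun i _ => ?_
  rw [map_eq_sum_qc (e i), Finset.smul_sum]
  exact Finset.sum_congr rfl fun j _ => smul_smul _ _ _

lemma IsOrderBasis.vk_ext (he : IsOrderBasis ι R e) {φ ψ : Vk p k E}
    (h : ∀ I : Fin k → Fin 4, φ (rowProd fun t => ι (qb a b (I t))) =
      ψ (rowProd fun t => ι (qb a b (I t)))) : φ = ψ := by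
  refine LOperator.vk_ext fun i hi => ?_
  obtain ⟨s, hs⟩ := he.exists_eq_sum_qb (M := !![1, 0; 0, 0]) fun i j => by
    fin_cases i <;> fin_cases j <;> simp
  obtain ⟨s', hs'⟩ := he.exists_eq_sum_qb (M := !![0, 1; 0, 0]) fun i j => by
    fin_cases i <;> fin_cases j <;> simp
  have h1 : (mono k i : Pk p k) = rowProd fun t : Fin k =>
      ∑ j, (if (t : ℕ) < i then s else s') j • ι (qb a b j) := by
    refine Subtype.ext (Polynomial.funext fun x => ?_)
    rw [mono_val hi, eval_rowProd, Polynomial.eval_pow, Polynomial.eval_X]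
    have h2 : ∀ t : Fin k, (∑ j, (if (t : ℕ) < i then s else s') j • ι (qb a b j)) 0 0 * x +
        (∑ j, (if (t : ℕ) < i then s else s') j • ι (qb a b j)) 0 1 =
        if (t : ℕ) < i then x else 1 := by
      intro t
      split_ifs
      · rw [← hs]; simp
      · rw [← hs']; simp
    rw [Finset.prod_congr rfl fun t _ => h2 t, Fin.prod_univ_eq_prod_range
      (fun t => if t < i then x else 1) k, Finset.prod_ite, Finset.prod_const_one, mul_one,
      Finset.prod_const]
    have h3 : (Finset.range k).filter (· < i) = Finset.range i := by
      ext t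
      simp only [Finset.mem_filter, Finset.mem_range]
      omega
    rw [h3, Finset.card_range]
  rw [h1, rowProd_sum, map_sum, map_sum]
  exact Finset.sum_congr rfl fun J _ => by rw [map_smul, map_smul, h J]

/-- Harmonic equivariant functions on the vertices are constant. -/
lemma IsOrderBasis.grad_eq_zero [CharZero E] (he : IsOrderBasis ι R e) (ha : a < 0) (hb : b < 0)
    {S : Set (Vertex p)} (hS : S.Finite) (hcov : ∀ v, ∃ γ ∈ arithGroup R ι, ∃ s ∈ S, v = γ • s)
    {f : Vertex p → Vk p k E} (hf : f ∈ cochain0 (arithGroup R ι) k E)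
    (h : divg p k E (grad p k E f) = 0) : grad p k E f = 0 := by
  funext e
  rw [grad_apply, Pi.zero_apply, sub_eq_zero]
  refine he.vk_ext fun I => ?_
  rw [← sub_eq_zero, ← Module.forall_dual_apply_eq_zero_iff ℚ]
  intro ξ
  set F : Vertex p → (Fin k → Fin 4) → ℚ :=
    fun v I => ξ (f v (rowProd fun t => ι (qb a b (I t)))) with hF
  rw [map_sub, sub_eq_zero]
  refine congrFun (eq_of_harmonic (d := fun I : Fin k → Fin 4 => ∏ t, qd a b (I t))
    (fun I => Finset.prod_pos fun t _ => qd_pos ha hb _) (F := F) (fun v I => ?_) ?_ _ _) I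
  · have h1 := congrArg ξ (LinearMap.congr_fun (congrFun h v) (rowProd fun t => ι (qb a b (I t))))
    rw [Pi.zero_apply, LinearMap.zero_apply, map_zero] at h1
    rw [← h1]
    change _ = ξ ((∑ e ∈ _, grad p k E f e) _)
    rw [LinearMap.sum_apply, map_sum]
    refine Finset.sum_congr rfl fun e _ => ?_
    rw [grad_apply, LinearMap.sub_apply, map_sub]
  · refine (hS.image fun v => ∑ I : Fin k → Fin 4, (∏ t, qd a b (I t)) * F v I ^ 2).subset ?_
    rintro _ ⟨v, rfl⟩
    obtain ⟨γ, hγ, s, hs, rfl⟩ := hcov v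
    refine ⟨s, hs, ?_⟩
    have hdet := gdet_of_mem_arithGroup ι ha.ne hb.ne hγ
    obtain ⟨u, hu, rfl⟩ := id hγ
    dsimp only
    rw [← sum_tensor ha.ne hb.ne (nrd_of_mem hu)]
    refine Finset.sum_congr rfl fun I _ => ?_
    congr 2
    let η : Pk p k →+ ℚ := ξ.toAddMonoidHom.comp (f s).toAddMonoidHom
    have h2 : F (unitMap ι u • s) I = η (rowProd fun t => ι (qb a b (I t) * u)) := by
      rw [hF]
      dsimp only
      rw [hf (unitMap ι u) hγ]
      change ξ (f s (polyAct k _ _)) = _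
      rw [polyAct_rowProd (g := unitMap ι u) hdet]
      simp_rw [map_mul]
      rfl
    refine Eq.trans ?_ h2.symm
    have h3 : (rowProd fun t => ι (qb a b (I t) * u) : Pk p k) =
        ∑ J : Fin k → Fin 4, ((∏ t, qc (qb a b (I t) * (u : ℍ[ℚ, a, b])) (J t) : ℚ) : ℚ_[p]) •
          rowProd fun t => ι (qb a b (J t)) := by
      rw [funext fun t => map_eq_sum_qc (ι := ι) (qb a b (I t) * (u : ℍ[ℚ, a, b])), rowProd_sum]
      refine Finset.sum_congr rfl fun J _ => ?_
      rw [Rat.cast_prod]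
    rw [h3, map_sum]
    refine Finset.sum_congr rfl fun J _ => ?_
    rw [map_ratCast_smul η ℚ_[p] ℚ, Rat.cast_id, smul_eq_mul]
    rfl

end Quat

/-! ### The isomorphism between harmonic cocycles and cohomology -/

section Psi
variable {Γ : Subgroup (GL (Fin 2) ℚ_[p])} {k : ℕ} {E : Type} [Field E] [Algebra ℚ_[p] E]

lemma IsCochain1.of_harmonic {c : Edge p → Vk p k E} (hc : c ∈ harmonic Γ k E) : IsCochain1 Γ c :=
  (mem_harmonic_iff.1 hc).1

lemma IsCochain1.pathSum_mul {c : Edge p → Vk p k E} (hc : IsCochain1 Γ c) (v : Vertex p)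
    (g g' : Γ) : pathSum c v ((g * g' : Γ).1 • v) =
      vkRep k E g.1 (pathSum c v (g'.1 • v)) + pathSum c v (g.1 • v) := by
  rw [pathSum_trans hc.symm v (g.1 • v), ← pathSum_smul hc g.2, smul_smul, add_comm]
  rfl

lemma exists_isPsi_linear : ∃ ψ : harmonic Γ k E →ₗ[E] groupCohomology.H1 (vkRepOn Γ k E),
    IsPsi Γ ψ := by
  have hcl := fun c : harmonic Γ k E => hasClass_mkCocycle
    (f := fun (γ : Γ) P => pathSum c.1 (v0 p) (γ.1 • v0 p) P) _
    ((IsCochain1.of_harmonic c.2).pathSum_mul (v0 p)) fun _ _ => rfl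
  obtain ⟨ψ, hψ⟩ := exists_linearMap
    (fun (c : harmonic Γ k E) (γ : Γ) P => pathSum c.1 (v0 p) (γ.1 • v0 p) P)
    (fun t c c' γ P => by
      have := pathSum_of_potential (c := (t • c + c').1)
        (fun v => t • pathSum c.1 (v0 p) v + pathSum c'.1 (v0 p) v) (fun e => by
          rw [pathSum_edge c.2.1, pathSum_edge c'.2.1, smul_add, add_add_add_comm,
            add_sub_cancel_left]
          rfl) (v0 p) (γ.1 • v0 p)
      rw [this, pathSum_self, pathSum_self, smul_zero, add_zero, sub_zero]
      rfl)
    (fun c => ⟨_, hcl c⟩)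
  refine ⟨ψ, fun v c => (hψ c).of_sub (pathSum c.1 (v0 p) v) fun γ P => ?_⟩
  have hc := IsCochain1.of_harmonic c.2
  have h1 := pathSum_trans hc.symm v (v0 p) v
  rw [pathSum_self, eq_comm] at h1
  rw [← pathSum_smul hc γ.2, pathSum_trans hc.symm v (v0 p), pathSum_trans hc.symm (v0 p) (γ.1 • v0 p),
    eq_neg_of_add_eq_zero_left h1]
  simp only [LinearMap.add_apply, LinearMap.sub_apply, LinearMap.neg_apply]
  ring

variable [CharZero E] (hprop : ∀ v w : Vertex p, {γ : Γ | γ • v = w}.Finite) {S : Set (Vertex p)}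
  (hS : S.Finite) (hcov : ∀ v, ∃ γ : Γ, ∃ s ∈ S, v = γ • s) (hdet : ∀ γ ∈ Γ, gdet γ = 1)
  (hgrad : ∀ f ∈ cochain0 Γ k E, divg p k E (grad p k E f) = 0 → grad p k E f = 0)

omit [CharZero E] in
include hS hcov in
lemma finiteDimensional_cochain0 : FiniteDimensional E (cochain0 Γ k E) := by
  have := hS.to_subtype
  let l : cochain0 Γ k E →ₗ[E] (S × Fin (k + 1) → E) :=
    { toFun := fun f t => f.1 t.1.1 (mono k t.2)
      map_add' := fun _ _ => rfl
      map_smul' := fun _ _ => rfl }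
  refine FiniteDimensional.of_injective l fun f g h => Subtype.ext (funext fun v => ?_)
  obtain ⟨γ, s, hs, rfl⟩ := hcov v
  rw [coe_smul_vertex, f.2 _ γ.2, g.2 _ γ.2]
  congr 1
  exact vk_ext fun i hi => congrFun h (⟨s, hs⟩, ⟨i, Nat.lt_succ_of_le hi⟩)

include hprop hS hcov hdet hgrad in
lemma exists_grad_sub {c : Edge p → Vk p k E} (hc : IsCochain1 Γ c) :
    ∃ f ∈ cochain0 Γ k E, divg p k E (grad p k E f) = divg p k E c := by
  have : FiniteDimensional E (cochain0 Γ k E) := finiteDimensional_cochain0 hS hcov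
  obtain ⟨w, hw⟩ := exists_isCutoff (E := E) hS hcov hprop
  have hB : InvForm Γ (vkForm p k E) := fun γ hγ x y => vkForm_smul (hdet γ hγ) x y
  let l : Vertex p → cochain0 Γ k E →ₗ[E] Vk p k E := fun v =>
    LinearMap.proj v ∘ₗ (cochain0 Γ k E).subtype
  let β : cochain0 Γ k E →ₗ[E] cochain0 Γ k E →ₗ[E] E :=
    ∑ v ∈ hw.finite.toFinset, w v • (vkForm p k E).compl₁₂ (l v) (l v)
  have hβ : ∀ f g, β f g = ∑ᶠ v, w v * vkForm p k E (f.1 v) (g.1 v) := by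
    intro f g
    rw [finsum_eq_sum_of_support_subset (s := hw.finite.toFinset) _ fun v hv => by
      simpa using left_ne_zero_of_mul hv]
    simp only [β, LinearMap.sum_apply, LinearMap.smul_apply, LinearMap.compl₁₂_apply, smul_eq_mul]
    rfl
  let Δ : cochain0 Γ k E →ₗ[E] cochain0 Γ k E := (divg p k E ∘ₗ grad p k E).restrict
    fun f hf => divg_mem (isCochain1_grad hf)
  suffices h : ∃ f, Δ f = ⟨divg p k E c, divg_mem hc⟩ by
    obtain ⟨f, hf⟩ := h
    exact ⟨f.1, f.2, congrArg Subtype.val hf⟩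
  refine mem_range_of_orthogonal (K := E) (C := cochain0 Γ k E) β (fun f hf => ?_) Δ
    (fun f g => ?_) fun f hf => ?_
  · refine Subtype.ext (funext fun v => eq_zero_of_vkForm fun ψ => ?_)
    obtain ⟨g, hg, h⟩ := exists_orbit_fun hprop hw hB v ψ
    rw [← h f.1 f.2, ← hβ f ⟨g, hg⟩, hf]
  · refine mul_left_cancel₀ (two_ne_zero (α := E)) ?_
    have h1 := two_mul_finsum_divg hw hB f.2 (isCochain1_grad g.2)
    have h2 := two_mul_finsum_divg hw (b := (vkForm p k E).flip)
      (fun γ hγ x y => hB γ hγ y x) g.2 (isCochain1_grad f.2)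
    rw [hβ, hβ]
    exact h1.trans h2.symm
  · have h0 : grad p k E f.1 = 0 := hgrad f.1 f.2 (congrArg Subtype.val hf)
    have h1 := two_mul_finsum_divg hw hB f.2 hc
    rw [h0] at h1
    rw [hβ]
    refine (mul_eq_zero.1 (h1.trans ?_)).resolve_left two_ne_zero
    simp

include hprop hS hcov hdet hgrad in
/-- The map `ψ` is an isomorphism. -/
lemma exists_isPsi : ∃ ψ : harmonic Γ k E ≃ₗ[E] groupCohomology.H1 (vkRepOn Γ k E),
    IsPsi Γ ψ.toLinearMap := by
  obtain ⟨ψ, hψ⟩ := exists_isPsi_linear (Γ := Γ) (k := k) (E := E)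
  refine ⟨LinearEquiv.ofBijective ψ ⟨?_, fun h => ?_⟩, hψ⟩
  · suffices key : ∀ c, ψ c = 0 → c = 0 from fun c c' h =>
      sub_eq_zero.1 (key _ ((ψ.map_sub c c').trans (sub_eq_zero.2 h)))
    intro c hc
    have h0 : HasClass Γ (fun _ _ => 0) (0 : groupCohomology.H1 (vkRepOn Γ k E)) :=
      ⟨0, fun _ _ => rfl, map_zero _⟩
    have h1 := hψ (v0 p) c
    rw [hc] at h1
    obtain ⟨m, hm⟩ := h1.exists_sub h0
    have hc1 := IsCochain1.of_harmonic c.2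
    set f : Vertex p → Vk p k E := fun v => pathSum c.1 (v0 p) v + m with hf
    have hgr : grad p k E f = c.1 := funext fun e => by
      rw [grad_apply, hf]
      dsimp only
      rw [pathSum_edge hc1.symm, add_sub_add_right_eq_sub, add_sub_cancel_left]
    have hmem : f ∈ cochain0 Γ k E := fun γ hγ v => by
      have h2 : pathSum c.1 (v0 p) (γ • v0 p) = vkRep k E γ m - m := LinearMap.ext fun P => by
        have := hm ⟨γ, hγ⟩ P
        rwa [sub_zero] at this
      rw [hf]
      dsimp only
      rw [pathSum_trans hc1.symm (v0 p) (γ • v0 p), h2, pathSum_smul hc1 hγ, map_add]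
      abel
    refine Subtype.ext (hgr.symm.trans (hgrad f hmem ?_))
    rw [hgr]
    exact (mem_harmonic_iff.1 c.2).2
  · obtain ⟨w, hw⟩ := exists_isCutoff (E := E) hS hcov hprop
    obtain ⟨z, rfl⟩ := (ModuleCat.epi_iff_surjective (groupCohomology.H1π (vkRepOn Γ k E))).1
      inferInstance h
    obtain ⟨g, hg⟩ := exists_potential hw z
    have hgc : IsCochain1 Γ (grad p k E g) := by
      refine ⟨fun e => (neg_sub _ _).symm, fun γ hγ e => ?_⟩
      have h1 := hg ⟨γ, hγ⟩ e.snd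
      have h2 := hg ⟨γ, hγ⟩ e.fst
      rw [coe_smul_vertex] at h1 h2
      rw [grad_apply, grad_apply, smul_fst, smul_snd, h1, h2, map_sub, add_sub_add_right_eq_sub]
    obtain ⟨f, hf, hfg⟩ := exists_grad_sub hprop hS hcov hdet hgrad hgc
    have hfc := isCochain1_grad hf
    have hmem : grad p k E (g - f) ∈ harmonic Γ k E := by
      rw [mem_harmonic_iff, map_sub, map_sub, hfg, sub_self]
      refine ⟨⟨fun e => ?_, fun γ hγ e => ?_⟩, rfl⟩
      · rw [Pi.sub_apply, Pi.sub_apply, hgc.symm, hfc.symm, neg_sub_neg, neg_sub]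
      · rw [Pi.sub_apply, Pi.sub_apply, hgc.equiv γ hγ, hfc.equiv γ hγ, map_sub]
    have hz : HasClass Γ (fun γ P => (z.1 γ : Vk p k E) P) (groupCohomology.H1π _ z) :=
      ⟨z, fun _ _ => rfl, rfl⟩
    refine ⟨⟨_, hmem⟩, (hψ (v0 p) ⟨_, hmem⟩).unique
      (hz.of_sub (g (v0 p) - f (v0 p)) fun γ P => ?_)⟩
    have h1 := hg γ (v0 p)
    rw [coe_smul_vertex] at h1
    rw [pathSum_grad, Pi.sub_apply, Pi.sub_apply, h1, hf _ γ.2, map_sub]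
    simp only [LinearMap.add_apply, LinearMap.sub_apply]
    ring

end Psi

/-- The map `ψ` is an isomorphism for groups coming from definite quaternion algebras. -/
lemma IsOrderBasis.exists_isPsi {a b : ℚ} {ι : ℍ[ℚ, a, b] →ₐ[ℚ] Matrix (Fin 2) (Fin 2) ℚ_[p]}
    {R : Subring ℍ[ℚ, a, b]} {e : Fin 4 → ℍ[ℚ, a, b]} {k : ℕ} {E : Type} [Field E]
    [Algebra ℚ_[p] E] [CharZero E] (he : IsOrderBasis ι R e) (ha : a < 0) (hb : b < 0) :
    ∃ ψ : harmonic (arithGroup R ι) k E ≃ₗ[E]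
      groupCohomology.H1 (vkRepOn (arithGroup R ι) k E), IsPsi (arithGroup R ι) ψ.toLinearMap := by
  obtain ⟨S, hS, hcov⟩ := he.cocompact ha hb
  have hcov' : ∀ v : Vertex p, ∃ γ ∈ arithGroup R ι, ∃ s ∈ (fun e : Edge p => e.snd) '' S,
      v = γ • s := fun v => by
    obtain ⟨g, rfl⟩ := exists_smul_v0 v
    obtain ⟨γ, hγ, s, hs, h⟩ := hcov (g • e0 p)
    exact ⟨γ, hγ, _, ⟨s, hs, rfl⟩, congrArg (fun e : Edge p => e.snd) h⟩
  refine LOperator.exists_isPsi (fun v w => ?_) (hS.image fun e : Edge p => e.snd) (fun v => ?_)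
    (fun γ hγ => gdet_of_mem_arithGroup ι ha.ne hb.ne hγ)
    fun f hf h => he.grad_eq_zero ha hb (hS.image fun e : Edge p => e.snd) hcov' hf h
  · exact Set.Finite.of_finite_image ((he.finite_stab ha hb v w).subset (by
      rintro _ ⟨γ, h, rfl⟩
      exact ⟨γ.2, h⟩)) Subtype.val_injective.injOn
  · obtain ⟨γ, hγ, s, hs, h⟩ := hcov' v
    exact ⟨⟨γ, hγ⟩, s, hs, h⟩

/-! ### Extension of scalars -/

section BaseChange
variable {Γ : Subgroup (GL (Fin 2) ℚ_[p])} {k : ℕ} (E : Type) [Field E] [Algebra ℚ_[p] E]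

/-- Harmonic cocycles commute with extension of scalars. -/
lemma exists_harmonicEquiv (hΓ : Cocompact Γ) :
    ∃ β : TensorProduct ℚ_[p] E (harmonic Γ k ℚ_[p]) ≃ₗ[E] harmonic Γ k E,
      ∀ c, (β (TensorProduct.tmul ℚ_[p] 1 c)).1 = extend E c.1 := by
  classical
  let l : harmonic Γ k ℚ_[p] →ₗ[ℚ_[p]] harmonic Γ k E :=
    { toFun := fun c => ⟨extend E c.1, extend_mem c.2⟩
      map_add' := fun c c' => Subtype.ext (funext fun e => LinearMap.comp_add _ _ _)
      map_smul' := fun t c => Subtype.ext (funext fun e => LinearMap.comp_smul _ _ _) }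
  have hl : ∀ (t : E) c e P, ((l.liftBaseChange E (TensorProduct.tmul ℚ_[p] t c)).1 e) P =
      t * algebraMap ℚ_[p] E (c.1 e P) := fun t c e P => by
    rw [LinearMap.liftBaseChange_tmul]; rfl
  let ev : Edge p → Pk p k → harmonic Γ k E →ₗ[E] E := fun e P =>
    { toFun := fun c => c.1 e P
      map_add' := fun _ _ => rfl
      map_smul' := fun _ _ => rfl }
  let b := Module.Basis.ofVectorSpace ℚ_[p] E
  have hb : Function.Bijective (l.liftBaseChange E) := by
    refine ⟨?_, fun c => ?_⟩
    · refine (injective_iff_map_eq_zero _).2 fun x hx => ?_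
      obtain ⟨n, rfl⟩ := TensorProduct.eq_repr_basis_left b x
      suffices n = 0 by rw [this, Finsupp.sum_zero_index]
      refine Finsupp.ext fun i => Subtype.ext (funext fun e => LinearMap.ext fun P => ?_)
      have h1 := congrArg (ev e P) hx
      rw [map_zero, Finsupp.sum, map_sum, map_sum] at h1
      by_cases hi : i ∈ n.support
      · refine linearIndependent_iff'.1 b.linearIndependent n.support (fun i => (n i).1 e P) ?_ i hi
        rw [← h1]
        refine Finset.sum_congr rfl fun i _ => ?_
        rw [Algebra.smul_def, mul_comm]
        exact (hl _ _ _ _).symm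
      · rw [Finsupp.notMem_support_iff.1 hi]; rfl
    · obtain ⟨S, hS, hcov⟩ := hΓ
      let I : Finset _ := hS.toFinset.biUnion fun s => (Finset.range (k + 1)).biUnion fun m =>
        (b.repr (c.1 s (mono k m))).support
      refine ⟨∑ i ∈ I, TensorProduct.tmul ℚ_[p] (b i)
        (⟨_, map_mem_harmonic (b.coord i) c.2⟩ : harmonic Γ k ℚ_[p]), ?_⟩
      refine Subtype.ext (funext fun e => ?_)
      obtain ⟨γ, hγ, s, hs, rfl⟩ := hcov e
      rw [harmonic_smul (Subtype.prop _) hγ, harmonic_smul c.2 hγ]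
      congr 1
      refine vk_ext fun m hm => ?_
      change ev s (mono k m) _ = _
      rw [map_sum, map_sum]
      have hsub : (b.repr (c.1 s (mono k m))).support ⊆ I := fun i hi =>
        Finset.mem_biUnion.2 ⟨s, hS.mem_toFinset.2 hs, Finset.mem_biUnion.2
          ⟨m, Finset.mem_range.2 (Nat.lt_succ_of_le hm), hi⟩⟩
      conv_rhs => rw [← b.linearCombination_repr (c.1 s (mono k m)), Finsupp.linearCombination_apply,
        Finsupp.sum_of_support_subset _ hsub (fun i a => a • b i) fun i _ => zero_smul _ _]
      refine Finset.sum_congr rfl fun i _ => ?_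
      rw [Algebra.smul_def, mul_comm]
      exact hl _ _ _ _
  refine ⟨LinearEquiv.ofBijective _ hb, fun c => ?_⟩
  rw [LinearEquiv.ofBijective_apply, LinearMap.liftBaseChange_tmul, one_smul]
  rfl

variable {E}

/-- Cohomology commutes with extension of scalars. -/
lemma exists_isScalarExtension (hΓ : Cocompact Γ)
    {ψ : harmonic Γ k ℚ_[p] ≃ₗ[ℚ_[p]] groupCohomology.H1 (vkRepOn Γ k ℚ_[p])}
    (hψ : IsPsi Γ ψ.toLinearMap) {ψE : harmonic Γ k E ≃ₗ[E] groupCohomology.H1 (vkRepOn Γ k E)}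
    (hψE : IsPsi Γ ψE.toLinearMap) :
    ∃ j : TensorProduct ℚ_[p] E (groupCohomology.H1 (vkRepOn Γ k ℚ_[p])) ≃ₗ[E]
        groupCohomology.H1 (vkRepOn Γ k E), IsScalarExtension Γ j.toLinearMap ∧
      ∀ c, j (TensorProduct.tmul ℚ_[p] 1 (ψ c)) = ψE ⟨extend E c.1, extend_mem c.2⟩ := by
  obtain ⟨β, hβ⟩ := exists_harmonicEquiv (k := k) E hΓ
  let j := (ψ.symm.baseChange ℚ_[p] E _ _).trans (β.trans ψE)
  have hj : ∀ c, j (TensorProduct.tmul ℚ_[p] 1 (ψ c)) = ψE ⟨extend E c.1, extend_mem c.2⟩ := by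
    intro c
    have h : ψ.symm.baseChange ℚ_[p] E _ _ (TensorProduct.tmul ℚ_[p] 1 (ψ c)) =
        TensorProduct.tmul ℚ_[p] 1 c :=
      (LinearEquiv.baseChange_tmul _ _ _ _ 1 (ψ c)).trans (by rw [ψ.symm_apply_apply])
    exact congrArg ψE (Subtype.ext ((congrArg (fun x => (β x).1) h).trans (hβ c)))
  refine ⟨j, fun z => ?_, hj⟩
  obtain ⟨c, hc⟩ := ψ.surjective (groupCohomology.H1π _ z)
  have hz : HasClass Γ (fun γ P => (z.1 γ : Vk p k ℚ_[p]) P) (groupCohomology.H1π _ z) :=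
    ⟨z, fun _ _ => rfl, rfl⟩
  have h1 := hψ (v0 p) c
  rw [LinearEquiv.coe_coe, hc] at h1
  obtain ⟨m, hm⟩ := hz.exists_sub h1
  have h2 := hψE (v0 p) ⟨extend E c.1, extend_mem c.2⟩
  rw [LinearEquiv.coe_coe, ← hj, hc] at h2
  refine h2.of_sub (Algebra.linearMap ℚ_[p] E ∘ₗ m) fun γ P => ?_
  have h3 := pathSum_of_potential (c := extend E c.1)
    (fun v => Algebra.linearMap ℚ_[p] E ∘ₗ pathSum c.1 (v0 p) v) (fun e => by
      rw [pathSum_edge c.2.1, LinearMap.comp_add, add_sub_cancel_left]; rfl) (v0 p) (γ.1 • v0 p)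
  rw [pathSum_self, LinearMap.comp_zero, sub_zero] at h3
  dsimp only
  rw [h3, sub_eq_iff_eq_add'.1 (hm γ P), map_add]
  congr 1
  exact map_sub (algebraMap ℚ_[p] E) _ _

end BaseChange

end LOperator
end

open LOperator in
theorem mainTheorem7 (p : ℕ) [Fact p.Prime]
    -- a definite quaternion algebra over `ℚ`
    (a b : ℚ) (ha : a < 0) (hb : b < 0)
    -- a `ℤ`-order in it
    (R : Subring (QuaternionAlgebra ℚ a 0 b)) (hRfg : R.toAddSubgroup.FG)
    (hRspan : Submodule.span ℚ (R : Set (QuaternionAlgebra ℚ a 0 b)) = ⊤)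
    -- a splitting at `p` with `ι(R ⊗ ℤ_p) = M₂(ℤ_p)`
    (ι : QuaternionAlgebra ℚ a 0 b →ₐ[ℚ] Matrix (Fin 2) (Fin 2) ℚ_[p])
    (hι : ∀ M : Matrix (Fin 2) (Fin 2) ℚ_[p],
      M ∈ Submodule.span ℤ_[p] (ι '' (R : Set (QuaternionAlgebra ℚ a 0 b))) ↔
        ∀ i j, ‖M i j‖ ≤ 1)
    (k : ℕ) (hk : Even k)
    -- the unramified quadratic extension of `ℚ_p` in `ℂ_p`
    (K : IntermediateField ℚ_[p] ℂ_[p]) (hK : Module.finrank ℚ_[p] K = 2)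
    (hKunr : ∀ x : K, x ≠ 0 → ∃ n : ℤ, ‖x‖ = (p : ℝ) ^ n) :
    let Γ := arithGroup R ι
    -- the line integrals over `K` and `ℂ_p` are well defined
    IntegralsDefined Γ k K ∧ IntegralsDefined Γ k ℂ_[p] ∧
    -- the average over `Gal(K/ℚ_p)` of two cocycles which differ by a coboundary over `K`
    (∀ σ : K ≃ₐ[ℚ_[p]] K, σ ≠ 1 → ∀ c ∈ harmonic Γ k ℚ_[p], ∀ τ ∈ Hp p K,
      (∀ (γ : Γ) (P : Pk p k), algebraMap ℚ_[p] K (traceCocycle K c τ γ P) =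
        (1 / 2) * (teitelbaumCocycle (extend K c) τ γ P +
          teitelbaumCocycle (extend K c) (σ τ) γ P)) ∧
      ∃ h : groupCohomology.H1 (vkRepOn Γ k K),
        HasClass Γ (teitelbaumCocycle (extend K c) τ) h ∧
        HasClass Γ (teitelbaumCocycle (extend K c) (σ τ)) h) ∧
    -- `ψ`, `λ` over `ℚ_p`, Teitelbaum's maps over `ℂ_p`, and `ℂ_p ⊗ H¹(Γ, V_k) ≃ H¹(Γ, V_k ⊗ ℂ_p)`
    ∃ (ψ : harmonic Γ k ℚ_[p] ≃ₗ[ℚ_[p]] groupCohomology.H1 (vkRepOn Γ k ℚ_[p]))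
      (lam : harmonic Γ k ℚ_[p] →ₗ[ℚ_[p]] groupCohomology.H1 (vkRepOn Γ k ℚ_[p]))
      (ψC : harmonic Γ k ℂ_[p] ≃ₗ[ℂ_[p]] groupCohomology.H1 (vkRepOn Γ k ℂ_[p]))
      (lamC : harmonic Γ k ℂ_[p] →ₗ[ℂ_[p]] groupCohomology.H1 (vkRepOn Γ k ℂ_[p]))
      (j : TensorProduct ℚ_[p] ℂ_[p] (groupCohomology.H1 (vkRepOn Γ k ℚ_[p])) ≃ₗ[ℂ_[p]]
        groupCohomology.H1 (vkRepOn Γ k ℂ_[p])),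
      IsPsi Γ ψ.toLinearMap ∧ IsTraceLambda Γ K lam ∧
      IsPsi Γ ψC.toLinearMap ∧ IsTeitelbaumLambda Γ lamC ∧
      IsScalarExtension Γ j.toLinearMap ∧
      -- Teitelbaum's `L`-operator is the scalar extension of the `L`-operator over `ℚ_p`
      (lamC ∘ₗ ψC.symm.toLinearMap) ∘ₗ j.toLinearMap =
        j.toLinearMap ∘ₗ (lam ∘ₗ ψ.symm.toLinearMap).baseChange ℂ_[p] := by
  intro Γ
  obtain ⟨e, he⟩ := exists_isOrderBasis ι hRfg hRspan hι
  have hdet : ∀ γ ∈ Γ, gdet γ = 1 := fun γ hγ => gdet_of_mem_arithGroup ι ha.ne hb.ne hγ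
  have hΓ : Cocompact Γ := he.cocompact ha hb
  have hKfin : FiniteDimensional ℚ_[p] K := Module.finite_of_finrank_pos (by omega)
  have hKc : CompleteSpace K := FiniteDimensional.complete ℚ_[p] K
  have hKu : IsUltrametricDist K := IsUltrametricDist.of_normedAlgebra ℚ_[p]
  have hCu : IsUltrametricDist ℂ_[p] := PadicComplex.isUltrametricDist p
  have hK' : HasLog p K := hasLog_of_finiteDimensional
  have hC : HasLog p ℂ_[p] := hasLog_padicComplex
  have hC0 : CharZero ℂ_[p] := charZero_of_injective_algebraMap (algebraMap ℚ_[p] ℂ_[p]).injective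
  refine ⟨integralsDefined hk hΓ hK', integralsDefined hk hΓ hC, fun σ hσ c hc τ hτ =>
    ⟨two_mul_traceCocycle hk hΓ hK' hK hσ hc hτ, ?_⟩, ?_⟩
  · obtain ⟨h, hh⟩ := exists_class_teitelbaum hk hΓ hK' (extend_mem hc) hdet
    exact ⟨h, hh τ hτ, hh _ (map_mem_Hp (σ : K →ₐ[ℚ_[p]] K) hτ)⟩
  obtain ⟨ψ, hψ⟩ := he.exists_isPsi (k := k) (E := ℚ_[p]) ha hb
  obtain ⟨ψC, hψC⟩ := he.exists_isPsi (k := k) (E := ℂ_[p]) ha hb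
  obtain ⟨lam, hlam⟩ := exists_isTraceLambda (K := K) (k := k) hk hΓ hK' hdet
  obtain ⟨lamC, hlamC⟩ := exists_isTeitelbaumLambda (k := k) hk hΓ hC hdet
  obtain ⟨j, hj, hjψ⟩ := exists_isScalarExtension hΓ hψ hψC
  refine ⟨ψ, lam, ψC, lamC, j, hψ, hlam, hψC, hlamC, hj, ?_⟩
  obtain ⟨τ, hτ⟩ := exists_mem_Hp (K := K) hK
  refine LinearMap.ext fun x => ?_
  induction x using TensorProduct.induction_on with
  | zero => rw [LinearMap.map_zero, LinearMap.map_zero]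
  | add x y hx hy => rw [LinearMap.map_add, LinearMap.map_add, hx, hy]
  | tmul t h => ?_
  rw [← mul_one t, ← smul_eq_mul, ← TensorProduct.smul_tmul', LinearMap.map_smul, LinearMap.map_smul]
  congr 1
  obtain ⟨c, rfl⟩ := ψ.surjective h
  change lamC (ψC.symm (j (TensorProduct.tmul ℚ_[p] 1 (ψ c)))) =
    j (TensorProduct.tmul ℚ_[p] 1 (lam (ψ.symm (ψ c))))
  rw [hjψ, ψC.symm_apply_apply, ψ.symm_apply_apply]
  have h1 := hasClass_traceCocycle hC K.val hk hΓ hK' hK c.2 hτ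
    fun τ' hτ' => hlamC τ' hτ' ⟨extend ℂ_[p] c.1, extend_mem c.2⟩
  obtain ⟨z, hz, hzl⟩ := hlam τ hτ c
  have h2 := hj z
  rw [hzl] at h2
  exact h1.unique (h2.congr fun γ P => by rw [hz])
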